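/- Work with real-valued functions on $\mathbb{R}$. Let $X=H^1(\mathbb{R})\times L^2(\mathbb{R})$ with $\|(\eta,v)\|_X^2=\|\eta\|_{H^1}^2+\|v\|_{L^2}^2$, and let $\mathcal{NV}=\{(\eta,v)\in X:\ \max\eta<1\}$. The hydrodynamical Gross–Pitaevskii system (HGP) is $$\partial_t\eta=\partial_x(2v-2\eta v),\qquad \partial_t v=\partial_x\Big(\eta-v^2-\partial_x\Big(\frac{\partial_x\eta}{2(1-\eta)}\Big)+\frac{(\partial_x\eta)^2}{4(1-\eta)^2}\Big).$$ Put $E(\eta,v)=\frac18\int\frac{(\partial_x\eta)^2}{1-\eta}+\frac12\int(1-\eta)v^2+\frac14\int\eta^2$, $p(\eta,v)=\frac12\eta v$ and $P(\eta,v)=\int p(\eta,v)$. For $0<|c|<\sqrt2$ and $a\in\mathbb{R}$ let $$\eta_c(x)=\frac{2-c^2}{2\cosh^2\big(\sqrt{2-c^2}\,x/2\big)},\quad v_c=-\frac{c\,\eta_c}{2(1-\eta_c)},\quad Q_{c,a}=(\eta_c,v_c)(\cdot-a).$$ Let $N\ge1$, let $\mathrm{Adm}_N$ be the set of $\mathfrak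 c=(c_1,\dots,c_N)\in(-\sqrt2,\sqrt2)^N$ with all $c_k\neq0$, and put $R_{\mathfrak c,\mathfrak a}=\sum_kQ_{c_k,a_k}$ for $\mathfrak a\in\mathbb{R}^N$. Let $\mathrm{Pos}_N(L)=\{\mathfrak a\in\mathbb{R}^N: a_{k+1}>a_k+L,\ 1\le k\le N-1\}$ and $\mathcal U_{\mathfrak c}(\alpha,L)=\{u\in X:\inf_{\mathfrak a\in \mathrm{Pos}_N(L)}\|u-R_{\mathfrak c,\mathfrak a}\|_X<\alpha\}$. Let $\mathfrak c^*\in\mathrm{Adm}_N$ with $c_1^*<\dots<c_N^*$. Put $\nu=\min_k\sqrt{2-(c_k^*)^2}$ and $\sigma^*=\frac12\min_{1\le k\le N-1}(c_{k+1}^*-c_k^*)$ (with $\sigma^*=0$ if $N=1$). Given $\alpha_1,L_1,K_1>0$, call modulation maps a pair of $C^1$ maps $\mathfrak C:\mathcal U_{\mathfrak c^*}(\alpha_1,L_1)\to\mathrm{Adm}_N$ and $\mathfrak A:\mathcal U_{\mathfrak c^*}(\alpha_1,L_1)\to\mathbb{R}^N$ such that, for $u\in \mathcal U_{\mathfrak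 c^*}(\alpha_1,L_1)$, $\mathfrak c=\mathfrak C(u)$, $\mathfrak a=\mathfrak A(u)$ and $\varepsilon=u-R_{\mathfrak c,\mathfrak a}$, one has $\langle\varepsilon,\partial_xQ_{c_k,a_k}\rangle_{L^2}=P'(Q_{c_k,a_k})(\varepsilon)=0$ for all $k$, and such that $\|\varepsilon\|_X+\sum_k|c_k-c_k^*|+\sum_k|a_k-a_k^*|\le K_1\alpha$ whenever $\|u-R_{\mathfrak c^*,\mathfrak a^*}\|_X\le\alpha$ with $\alpha\le\alpha_1$, $\mathfrak a^*\in\mathrm{Pos}_N(L)$ and $L\ge L_1$. For such maps and a function $u(t)=(\eta(\cdot,t),v(\cdot,t))$ with values in $\mathcal U_{\mathfrak c^*}(\alpha_1,L_1)$ put $\mathfrak a(t)=\mathfrak A(u(t))$, let $\Psi_1=1$, $\Psi_{N+1}=0$ and $$\Psi_k(x)=\frac12\Big(1+\tanh\Big(\frac{\nu}{16}\Big(x-\frac{a_{k-1}(t)+a_k(t)}2\Big)\Big)\Big)\quad(2\le k\le N),$$ and set $$Q_k(t)=\int_{\mathbb{R}}\Psi_k\,p(\eta,v)\,dx,\qquad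 \mathcal G(t)=E(\eta,v)+\sum_{k=1}^Nc_k^*\int_{\mathbb{R}}p(\eta,v)(\Psi_k-\Psi_{k+1})\,dx.$$ Then there are positive numbers $\alpha_1,L_1,K_1$, depending only on $\mathfrak c^*$, such that $\mathcal U_{\mathfrak c^*}(\alpha_1,L_1)\subset\mathcal{NV}$ and modulation maps exist, and positive numbers $\alpha_4\le\alpha_1$, $L_4\ge L_1$ and $K$, depending only on $\mathfrak c^*$, such that the following holds for all modulation maps (for these $\alpha_1,L_1,K_1$). Let $\alpha\le\alpha_4$, $L\ge L_4$, $T>0$, and let $u=(\eta,v)\in C^0([0,T],\mathcal{NV})$ be a solution of (HGP) in the sense of distributions with $u(t)\in\mathcal U_{\mathfrak c^*}(\alpha,L)$ for all $t\in[0,T]$. Then $Q_1,\dots,Q_N$ and $\mathcal G$ are differentiable on $[0,T]$ (one-sidedly at the endpoints) and, for all $t\in[0,T]$ and $1\le k\le N$, $$\frac{d}{dt}Q_k(t)\le K\exp\Big(-\frac{\nu(L+\sigma^*t)}{16}\Big),\qquad \frac{d}{dt}\mathcal G(t)\le K\exp\Big(-\frac{\nu(L+\sigma^*t)}{16}\Big).$$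 -/

import Mathlib

open MeasureTheory Set
open scoped ContDiff

noncomputable section

namespace GPChain

/-! ### The energy space -/

/-- The real Hilbert space `L²(ℝ)`. -/
abbrev L2 : Type := Lp ℝ 2 (volume : Measure ℝ)

/-- `φ` is a test function: smooth with compact support. -/
def IsTest (φ : ℝ → ℝ) : Prop := ContDiff ℝ ∞ φ ∧ HasCompactSupport φ

theorem IsTest.memLp {φ : ℝ → ℝ} (h : IsTest φ) : MemLp φ 2 volume :=
  h.1.continuous.memLp_of_hasCompactSupport h.2

theorem IsTest.deriv {φ : ℝ → ℝ} (h : IsTest φ) : IsTest (deriv φ) :=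
  ⟨((contDiff_infty_iff_deriv (𝕜 := ℝ)).1 h.1).2, h.2.deriv⟩

theorem integrable_mul_test (f : L2) {φ : ℝ → ℝ} (h : IsTest φ) :
    Integrable (fun x => f x * φ x) volume :=
  (Lp.memLp f).integrable_mul h.memLp

/-- `g` is the weak derivative of `f`. -/
def HasWeakDeriv (f g : L2) : Prop :=
  ∀ φ : ℝ → ℝ, IsTest φ → ∫ x, f x * deriv φ x = -∫ x, g x * φ x

/-- The Sobolev space `H¹(ℝ)`: an element is a pair `(f, f')` of functions in `L²(ℝ)`, the second
being the weak derivative of the first (which determines it), with the norm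
`‖f‖² + ‖f'‖²` (squared), inherited from the Hilbert sum `L² ⊕ L²`. -/
def H1 : Submodule ℝ (WithLp 2 (L2 × L2)) where
  carrier := {w | HasWeakDeriv w.fst w.snd}
  zero_mem' := by
    intro φ _
    have h0 : ((0 : L2) : ℝ → ℝ) =ᵐ[volume] 0 := Lp.coeFn_zero ℝ 2 volume
    have e1 : ∫ x, ((0 : L2) : ℝ → ℝ) x * deriv φ x = 0 := by
      rw [integral_congr_ae (g := fun _ => (0 : ℝ)) (by filter_upwards [h0] with x hx; rw [hx]; simp)]
      simp
    have e2 : ∫ x, ((0 : L2) : ℝ → ℝ) x * φ x = 0 := by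
      rw [integral_congr_ae (g := fun _ => (0 : ℝ)) (by filter_upwards [h0] with x hx; rw [hx]; simp)]
      simp
    exact e1.trans (by rw [neg_eq_zero.2]; exact e2)
  add_mem' := by
    intro w z hw hz φ hφ
    have key : ∀ (f g : L2) (ψ : ℝ → ℝ), IsTest ψ →
        ∫ x, ((f + g : L2) : ℝ → ℝ) x * ψ x = (∫ x, f x * ψ x) + ∫ x, g x * ψ x := by
      intro f g ψ hψ
      rw [← integral_add (integrable_mul_test f hψ) (integrable_mul_test g hψ)]
      refine integral_congr_ae ?_
      filter_upwards [Lp.coeFn_add f g] with x hx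
      rw [hx, Pi.add_apply, add_mul]
    have h1 := hw φ hφ
    have h2 := hz φ hφ
    change ∫ x, ((w.fst + z.fst : L2) : ℝ → ℝ) x * deriv φ x
      = -∫ x, ((w.snd + z.snd : L2) : ℝ → ℝ) x * φ x
    rw [key _ _ _ hφ.deriv, key _ _ _ hφ, h1, h2]
    ring
  smul_mem' := by
    intro r w hw φ hφ
    have key : ∀ (f : L2) (ψ : ℝ → ℝ),
        ∫ x, ((r • f : L2) : ℝ → ℝ) x * ψ x = r * ∫ x, f x * ψ x := by
      intro f ψ
      rw [← integral_const_mul]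
      refine integral_congr_ae ?_
      filter_upwards [Lp.coeFn_smul r f] with x hx
      rw [hx, Pi.smul_apply, smul_eq_mul, mul_assoc]
    have h1 := hw φ hφ
    change ∫ x, ((r • w.fst : L2) : ℝ → ℝ) x * deriv φ x
      = -∫ x, ((r • w.snd : L2) : ℝ → ℝ) x * φ x
    rw [key, key, h1]
    ring

/-- The space `X(ℝ) = H¹(ℝ) × L²(ℝ)`, with `‖(η, v)‖² = ‖η‖²_{H¹} + ‖v‖²_{L²}`. -/
abbrev XSpace : Type := WithLp 2 (H1 × L2)

/-- The component `η` of a state `(η, v)`. -/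
def eta (u : XSpace) : ℝ → ℝ := (u.fst : WithLp 2 (L2 × L2)).fst

/-- The weak derivative `∂ₓη` of the component `η` of a state `(η, v)`. -/
def etaX (u : XSpace) : ℝ → ℝ := (u.fst : WithLp 2 (L2 × L2)).snd

/-- The component `v` of a state `(η, v)`. -/
def vel (u : XSpace) : ℝ → ℝ := u.snd

/-- The non-vanishing states: `max η < 1`. -/
def NV : Set XSpace := {u | ∃ m : ℝ, m < 1 ∧ ∀ᵐ x, eta u x ≤ m}

/-- The state in `X(ℝ)` with components `f` and `w`, where `f` is differentiable. -/
def mkState (f w : ℝ → ℝ) (hf : MemLp f 2 volume) (hd : Differentiable ℝ f)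
    (hf' : MemLp (deriv f) 2 volume) (hw : MemLp w 2 volume) :
    XSpace :=
  WithLp.toLp 2 (⟨WithLp.toLp 2 (hf.toLp f, hf'.toLp (deriv f)), by
    intro φ hφ
    change ∫ x, (hf.toLp f : ℝ → ℝ) x * deriv φ x = -∫ x, (hf'.toLp (deriv f) : ℝ → ℝ) x * φ x
    have e1 : ∫ x, (hf.toLp f : ℝ → ℝ) x * deriv φ x = ∫ x, f x * deriv φ x :=
      integral_congr_ae (by filter_upwards [hf.coeFn_toLp] with x hx; rw [hx])
    have e2 : ∫ x, (hf'.toLp (deriv f) : ℝ → ℝ) x * φ x = ∫ x, deriv f x * φ x :=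
      integral_congr_ae (by filter_upwards [hf'.coeFn_toLp] with x hx; rw [hx])
    rw [e1, e2]
    have i1 : Integrable (f * deriv φ) volume := hf.integrable_mul hφ.deriv.memLp
    have i2 : Integrable (deriv f * φ) volume := hf'.integrable_mul hφ.memLp
    have i3 : Integrable (f * φ) volume := hf.integrable_mul hφ.memLp
    exact integral_mul_deriv_eq_deriv_mul_of_integrable
      (fun x _ => (hd x).hasDerivAt)
      (fun x _ => ((hφ.1.differentiable (by simp)) x).hasDerivAt) i1 i2 i3⟩,
    hw.toLp w)

/-! ### Solitons -/

/-- The profile `η_c`. -/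
def solEta (c x : ℝ) : ℝ :=
  (2 - c ^ 2) / (2 * Real.cosh (Real.sqrt (2 - c ^ 2) * x / 2) ^ 2)

/-- The profile `v_c`. -/
def solV (c x : ℝ) : ℝ := -(c * solEta c x) / (2 * (1 - solEta c x))

/-- The admissible speeds of one soliton: `0 < |c| < √2`. -/
def AdmSpeed (c : ℝ) : Prop := c ≠ 0 ∧ c ∈ Ioo (-Real.sqrt 2) (Real.sqrt 2)

theorem AdmSpeed.sq_lt {c : ℝ} (h : AdmSpeed c) : c ^ 2 < 2 := by
  have := sq_lt_sq' h.2.1 h.2.2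
  rwa [Real.sq_sqrt (by norm_num)] at this

theorem memLp_of_bound {f : ℝ → ℝ} (hf : Continuous f) {C k a : ℝ} (hk : k ≠ 0)
    (hb : ∀ x, |f x| ≤ C / Real.cosh (k * (x - a)) ^ 2) : MemLp f 2 volume := by
  have hC : 0 ≤ C := by
    have := (abs_nonneg _).trans (hb a)
    simpa using this
  have hcosh : ∀ y : ℝ, 1 + y ^ 2 ≤ Real.cosh y ^ 2 := by
    intro y
    have h1 : |y| ≤ Real.sinh |y| := Real.self_le_sinh_iff.2 (abs_nonneg y)
    have h2 : y ^ 2 ≤ Real.sinh y ^ 2 := by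
      rw [← sq_abs y, ← sq_abs (Real.sinh y), Real.abs_sinh]
      gcongr
    rw [Real.cosh_sq]; linarith
  have hg : Integrable (fun x : ℝ => (1 + (k * (x - a)) ^ 2)⁻¹) volume :=
    (integrable_inv_one_add_sq.comp_mul_left' hk).comp_sub_right a
  rw [memLp_two_iff_integrable_sq hf.aestronglyMeasurable]
  refine (hg.const_mul (C ^ 2)).mono' (by fun_prop) (Filter.Eventually.of_forall fun x => ?_)
  have hp : 0 < 1 + (k * (x - a)) ^ 2 := by positivity
  have h1 : |f x| ≤ C * (1 + (k * (x - a)) ^ 2)⁻¹ := by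
    refine (hb x).trans ?_
    rw [div_eq_mul_inv]
    gcongr
    exact hcosh _
  have h3 : (1 + (k * (x - a)) ^ 2)⁻¹ ≤ 1 := inv_le_one_of_one_le₀ (by nlinarith [sq_nonneg (k * (x - a))])
  have h4 : 0 ≤ (1 + (k * (x - a)) ^ 2)⁻¹ := by positivity
  rw [Real.norm_eq_abs, abs_of_nonneg (sq_nonneg _), ← sq_abs]
  calc |f x| ^ 2 ≤ (C * (1 + (k * (x - a)) ^ 2)⁻¹) ^ 2 := by gcongr
    _ = C ^ 2 * ((1 + (k * (x - a)) ^ 2)⁻¹ * (1 + (k * (x - a)) ^ 2)⁻¹) := by ring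
    _ ≤ C ^ 2 * ((1 + (k * (x - a)) ^ 2)⁻¹ * 1) := by gcongr
    _ = _ := by ring

theorem hasDerivAt_solEta (c x : ℝ) : HasDerivAt (solEta c)
    (-((2 - c ^ 2) * Real.sqrt (2 - c ^ 2) / 2) * Real.sinh (Real.sqrt (2 - c ^ 2) * x / 2)
      / Real.cosh (Real.sqrt (2 - c ^ 2) * x / 2) ^ 3) x := by
  have h0 : HasDerivAt (fun x : ℝ => Real.sqrt (2 - c ^ 2) * x / 2)
      (Real.sqrt (2 - c ^ 2) / 2) x := by
    simpa using ((hasDerivAt_id x).const_mul (Real.sqrt (2 - c ^ 2))).div_const 2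
  have hp := Real.cosh_pos (Real.sqrt (2 - c ^ 2) * x / 2)
  have h1 := ((h0.cosh.pow 2).const_mul 2)
  have h2 := (hasDerivAt_const x (2 - c ^ 2)).div h1
    (show 2 * Real.cosh (Real.sqrt (2 - c ^ 2) * x / 2) ^ 2 ≠ 0 by positivity)
  convert! h2 using 1
  field_simp
  simp
  field_simp

theorem deriv_solEta (c : ℝ) : deriv (solEta c) = fun x =>
    -((2 - c ^ 2) * Real.sqrt (2 - c ^ 2) / 2) * Real.sinh (Real.sqrt (2 - c ^ 2) * x / 2)
      / Real.cosh (Real.sqrt (2 - c ^ 2) * x / 2) ^ 3 :=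
  funext fun x => (hasDerivAt_solEta c x).deriv

theorem differentiable_solEta (c : ℝ) : Differentiable ℝ (solEta c) :=
  fun x => (hasDerivAt_solEta c x).differentiableAt

theorem continuous_deriv_solEta (c : ℝ) : Continuous (deriv (solEta c)) := by
  rw [deriv_solEta]
  refine Continuous.div (by fun_prop) (by fun_prop) fun x => ?_
  have := Real.cosh_pos (Real.sqrt (2 - c ^ 2) * x / 2)
  positivity

theorem solEta_nonneg {c : ℝ} (h : AdmSpeed c) (x : ℝ) : 0 ≤ solEta c x := by
  have := h.sq_lt
  have : 0 < 2 - c ^ 2 := by linarith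
  unfold solEta; positivity

theorem solEta_le {c : ℝ} (h : AdmSpeed c) (x : ℝ) : solEta c x ≤ 1 - c ^ 2 / 2 := by
  have := h.sq_lt
  have h1 := Real.one_le_cosh (Real.sqrt (2 - c ^ 2) * x / 2)
  have h2 : 1 ≤ Real.cosh (Real.sqrt (2 - c ^ 2) * x / 2) ^ 2 := one_le_pow₀ h1
  unfold solEta
  rw [div_le_iff₀ (by positivity)]
  nlinarith

theorem one_sub_solEta_pos {c : ℝ} (h : AdmSpeed c) (x : ℝ) : c ^ 2 / 2 ≤ 1 - solEta c x := by
  have := solEta_le h x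
  linarith

theorem continuous_solV {c : ℝ} (h : AdmSpeed c) : Continuous (solV c) := by
  have hc := (differentiable_solEta c).continuous
  refine Continuous.div (by fun_prop) (by fun_prop) fun x => ?_
  have h1 := one_sub_solEta_pos h x
  have h2 : 0 < c ^ 2 := by have := h.1; positivity
  have : 0 < 1 - solEta c x := by linarith
  positivity

theorem memLp_solEta {c : ℝ} (h : AdmSpeed c) (a : ℝ) :
    MemLp (fun x => solEta c (x - a)) 2 volume := by
  have hs := h.sq_lt
  have hs' : 0 < Real.sqrt (2 - c ^ 2) := Real.sqrt_pos.2 (by linarith)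
  have hc := (differentiable_solEta c).continuous
  refine memLp_of_bound (C := (2 - c ^ 2) / 2) (k := Real.sqrt (2 - c ^ 2) / 2) (a := a)
    (by fun_prop) (by positivity) fun x => ?_
  rw [abs_of_nonneg (solEta_nonneg h _), solEta, div_div, div_mul_eq_mul_div]

theorem deriv_solEta_shift (c a : ℝ) :
    deriv (fun x => solEta c (x - a)) = fun x => deriv (solEta c) (x - a) :=
  funext fun x => deriv_comp_sub_const (f := solEta c) a x

theorem memLp_deriv_solEta {c : ℝ} (h : AdmSpeed c) (a : ℝ) :
    MemLp (deriv fun x => solEta c (x - a)) 2 volume := by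
  have hs := h.sq_lt
  have hs' : 0 < Real.sqrt (2 - c ^ 2) := Real.sqrt_pos.2 (by linarith)
  have hp : 0 < 2 - c ^ 2 := by linarith
  have hc := continuous_deriv_solEta c
  rw [deriv_solEta_shift]
  refine memLp_of_bound (C := (2 - c ^ 2) * Real.sqrt (2 - c ^ 2) / 2)
    (k := Real.sqrt (2 - c ^ 2) / 2) (a := a)
    (by fun_prop) (by positivity) fun x => ?_
  have hy0 : Real.sqrt (2 - c ^ 2) * (x - a) / 2 = Real.sqrt (2 - c ^ 2) / 2 * (x - a) := by ring
  rw [deriv_solEta]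
  simp only [hy0]
  set y := Real.sqrt (2 - c ^ 2) / 2 * (x - a)
  have hy := Real.cosh_pos y
  have hsc : |Real.sinh y| ≤ Real.cosh y := by
    rw [Real.abs_sinh, ← Real.cosh_abs]
    exact (Real.sinh_lt_cosh _).le
  rw [abs_div, abs_mul, abs_neg, abs_of_pos (show 0 < (2 - c ^ 2) * Real.sqrt (2 - c ^ 2) / 2 by
    positivity), abs_of_pos (show 0 < Real.cosh y ^ 3 by positivity)]
  rw [div_le_div_iff₀ (by positivity) (by positivity)]
  have : |Real.sinh y| * Real.cosh y ^ 2 ≤ Real.cosh y ^ 3 := by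
    calc |Real.sinh y| * Real.cosh y ^ 2 ≤ Real.cosh y * Real.cosh y ^ 2 := by gcongr
      _ = _ := by ring
  rw [mul_assoc]
  gcongr

theorem memLp_solV {c : ℝ} (h : AdmSpeed c) (a : ℝ) :
    MemLp (fun x => solV c (x - a)) 2 volume := by
  have hc := continuous_solV h
  refine (memLp_solEta h a).of_le_mul (c := 1 / |c|)
    (Continuous.aestronglyMeasurable (by fun_prop)) (Filter.Eventually.of_forall fun x => ?_)
  have h0 : 0 < |c| := abs_pos.2 h.1
  have h1 := one_sub_solEta_pos h (x - a)
  have h2 : 0 < c ^ 2 := by have := h.1; positivity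
  have h3 : 0 < 1 - solEta c (x - a) := by linarith
  have h4 := solEta_nonneg h (x - a)
  rw [Real.norm_eq_abs, Real.norm_eq_abs, solV, abs_div, abs_neg, abs_mul, abs_of_nonneg h4,
    abs_of_pos (show 0 < 2 * (1 - solEta c (x - a)) by positivity),
    div_mul_eq_mul_div, div_le_div_iff₀ (by positivity) h0]
  have : |c| * |c| = c ^ 2 := by rw [← sq, sq_abs]
  nlinarith

open Classical in
/-- The soliton `Q_{c,a} = (η_c(· - a), v_c(· - a))` as an element of `X(ℝ)`, for `0 < |c| < √2`
(and `0` by convention for the other values of `c`, where there is no soliton). -/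
def soliton (c a : ℝ) : XSpace :=
  if h : AdmSpeed c then
    mkState (fun x => solEta c (x - a)) (fun x => solV c (x - a)) (memLp_solEta h a)
      ((differentiable_solEta c).comp (differentiable_id.sub_const a))
      (memLp_deriv_solEta h a) (memLp_solV h a)
  else 0

/-- The admissible speeds `Adm_N`. -/
def Adm (N : ℕ) : Set (Fin N → ℝ) := {c | ∀ k, AdmSpeed (c k)}

/-- The sum of solitons `R_{c,a}`. -/
def chain {N : ℕ} (c a : Fin N → ℝ) : XSpace := ∑ k, soliton (c k) (a k)

/-- The admissible positions `Pos_N(L)`: `a_{k+1} > a_k + L` for consecutive indices. -/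
def Pos (N : ℕ) (L : ℝ) : Set (Fin N → ℝ) :=
  {a | ∀ j k : Fin N, (k : ℕ) = j + 1 → a j + L < a k}

/-- The neighbourhood `U_c(α, L)` of the sums of solitons with speeds `c` and positions in
`Pos_N(L)`. -/
def nbhd {N : ℕ} (c : Fin N → ℝ) (α L : ℝ) : Set XSpace :=
  {u | ∃ a ∈ Pos N L, ‖u - chain c a‖ < α}

/-- `ν_c = min_k √(2 - c_k²)`. -/
def nuMin {N : ℕ} (c : Fin N → ℝ) : ℝ := ⨅ k, Real.sqrt (2 - c k ^ 2)

/-- `σ = ½ min_k (c_{k+1} - c_k)` (and `0` if there is only one speed). -/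
def sigmaMin {N : ℕ} (c : Fin N → ℝ) : ℝ :=
  (⨅ p : {p : Fin N × Fin N // (p.2 : ℕ) = p.1 + 1}, (c p.1.2 - c p.1.1)) / 2

/-! ### The hydrodynamical Gross-Pitaevskii equation -/

/-- `u = (η, v)` belongs to `C⁰([0,T], NV(ℝ))` and solves
`∂ₜη = ∂ₓ(2v - 2ηv)`, `∂ₜv = ∂ₓ(η - v² - ∂ₓ(∂ₓη / (2(1-η))) + (∂ₓη)² / (4(1-η)²))`
in the sense of distributions: tested against any smooth compactly supported function of `x`, both
sides of the two equations agree at each time (one-sided derivatives are meant at `0` and `T`).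
As the fluxes are continuous in time with values in distributions, this is the same as testing
with functions of `(t, x)` in `(0, T) × ℝ`. -/
structure IsHGPSolution (T : ℝ) (u : ℝ → XSpace) : Prop where
  continuousOn : ContinuousOn u (Icc 0 T)
  mem_NV : ∀ t ∈ Icc 0 T, u t ∈ NV
  eq_eta : ∀ φ : ℝ → ℝ, IsTest φ → ∀ t ∈ Icc 0 T,
    HasDerivWithinAt (fun s => ∫ x, eta (u s) x * φ x)
      (-∫ x, (2 * vel (u t) x - 2 * eta (u t) x * vel (u t) x) * deriv φ x) (Icc 0 T) t
  eq_vel : ∀ φ : ℝ → ℝ, IsTest φ → ∀ t ∈ Icc 0 T,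
    HasDerivWithinAt (fun s => ∫ x, vel (u s) x * φ x)
      (-(∫ x, (eta (u t) x - vel (u t) x ^ 2
            + etaX (u t) x ^ 2 / (4 * (1 - eta (u t) x) ^ 2)) * deriv φ x)
        - ∫ x, etaX (u t) x / (2 * (1 - eta (u t) x)) * deriv (deriv φ) x) (Icc 0 T) t

/-- The Ginzburg-Landau energy `E(η, v)`. -/
def energy (u : XSpace) : ℝ :=
  1 / 8 * (∫ x, etaX u x ^ 2 / (1 - eta u x)) + 1 / 2 * (∫ x, (1 - eta u x) * vel u x ^ 2)
    + 1 / 4 * ∫ x, eta u x ^ 2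

/-- The momentum density `p(η, v) = ηv / 2`. -/
def momDensity (u : XSpace) (x : ℝ) : ℝ := 1 / 2 * (eta u x * vel u x)

/-! ### Modulation parameters -/

/-- The scalar product `⟨ε, ∂ₓQ_{c,a}⟩` in `L²(ℝ)²`. -/
def orthX (ε : XSpace) (c a : ℝ) : ℝ :=
  ∫ x, (eta ε x * deriv (solEta c) (x - a) + vel ε x * deriv (solV c) (x - a))

/-- `P'(Q_{c,a})(ε)`, the differential at `Q_{c,a}` of the momentum `P(η, v) = ½ ∫ ηv`. -/
def dMomentum (ε : XSpace) (c a : ℝ) : ℝ :=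
  1 / 2 * ∫ x, (solEta c (x - a) * vel ε x + solV c (x - a) * eta ε x)

/-- `C` and `A` are modulation maps on `U_{c*}(α₁, L₁)` with constant `K₁`: they are of class `C¹`,
`C` takes admissible values, the remainder `ε = u - R_{C(u), A(u)}` satisfies the orthogonality
conditions `⟨ε, ∂ₓQ_{c_k,a_k}⟩ = P'(Q_{c_k,a_k})(ε) = 0`, and `ε`, `C(u) - c*`, `A(u) - a*` are
controlled by the distance from `u` to `R_{c*,a*}`. -/
structure IsModulation {N : ℕ} (cs : Fin N → ℝ) (α₁ L₁ K₁ : ℝ)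
    (C A : XSpace → Fin N → ℝ) : Prop where
  contDiffOn_speed : ContDiffOn ℝ 1 C (nbhd cs α₁ L₁)
  contDiffOn_pos : ContDiffOn ℝ 1 A (nbhd cs α₁ L₁)
  adm : ∀ u ∈ nbhd cs α₁ L₁, C u ∈ Adm N
  orth : ∀ u ∈ nbhd cs α₁ L₁, ∀ k,
    orthX (u - chain (C u) (A u)) (C u k) (A u k) = 0 ∧
      dMomentum (u - chain (C u) (A u)) (C u k) (A u k) = 0
  estimate : ∀ u ∈ nbhd cs α₁ L₁, ∀ α L : ℝ, α ≤ α₁ → L₁ ≤ L → ∀ as ∈ Pos N L,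
    ‖u - chain cs as‖ ≤ α →
      ‖u - chain (C u) (A u)‖ + ∑ k, |C u k - cs k| + ∑ k, |A u k - as k| ≤ K₁ * α

/-- The localizing functions, with indices shifted by one: `cutoff cs a k` is `Ψ_{k+1}`, i.e. `1`
for `k = 0`, `½(1 + tanh((ν/16)(x - (a_{k-1} + a_k)/2)))` for `1 ≤ k ≤ N - 1` (positions being
numbered from `0` to `N - 1`), and `0` for `k ≥ N`. -/
def cutoff {N : ℕ} (cs a : Fin N → ℝ) (k : ℕ) (x : ℝ) : ℝ :=
  if k = 0 then 1
  else if h : k < N then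
    1 / 2 * (1 + Real.tanh (nuMin cs / 16 *
      (x - (a ⟨k - 1, lt_of_le_of_lt (Nat.sub_le k 1) h⟩ + a ⟨k, h⟩) / 2)))
  else 0

/-- The localized momenta `Q_k = ∫ Ψ_k p(η, v)` (index shifted by one). -/
def locMomentum {N : ℕ} (cs a : Fin N → ℝ) (k : ℕ) (u : XSpace) : ℝ :=
  ∫ x, cutoff cs a k x * momDensity u x

/-- The functional `G = E + ∑_k c_k* ∫ p(η, v) (Ψ_k - Ψ_{k+1})`. -/
def functionalG {N : ℕ} (cs a : Fin N → ℝ) (u : XSpace) : ℝ :=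
  energy u + ∑ k : Fin N, cs k *
    ∫ x, momDensity u x * (cutoff cs a k x - cutoff cs a (k + 1) x)

end GPChain

end

noncomputable section
namespace GPChain

open Filter Topology

theorem norm_fst_le_L2 {E F : Type*} [SeminormedAddCommGroup E] [SeminormedAddCommGroup F]
    (w : WithLp 2 (E × F)) : ‖w.fst‖ ≤ ‖w‖ := by
  have := WithLp.prod_norm_sq_eq_of_L2 w
  nlinarith [norm_nonneg w, norm_nonneg w.fst, norm_nonneg w.snd]

theorem norm_snd_le_L2 {E F : Type*} [SeminormedAddCommGroup E] [SeminormedAddCommGroup F]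
    (w : WithLp 2 (E × F)) : ‖w.snd‖ ≤ ‖w‖ := by
  have := WithLp.prod_norm_sq_eq_of_L2 w
  nlinarith [norm_nonneg w, norm_nonneg w.fst, norm_nonneg w.snd]

/-! ### The `L²` seminorm of real functions -/

/-- The `L²` seminorm of a real function, as a real number. -/
def N2 (f : ℝ → ℝ) : ℝ := (eLpNorm f 2 (volume : Measure ℝ)).toReal

theorem N2_nonneg (f : ℝ → ℝ) : 0 ≤ N2 f := ENNReal.toReal_nonneg

theorem N2_congr {f g : ℝ → ℝ} (h : f =ᵐ[volume] g) : N2 f = N2 g := by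
  unfold N2; rw [eLpNorm_congr_ae h]

theorem N2_toLp {f : ℝ → ℝ} (hf : MemLp f 2) : ‖hf.toLp f‖ = N2 f := Lp.norm_toLp f hf

theorem N2_coe (f : L2) : N2 f = ‖f‖ := (Lp.norm_def f).symm

theorem inner_L2 (f g : L2) : inner ℝ f g = ∫ x, f x * g x := by
  rw [L2.inner_def]
  refine integral_congr_ae (.of_forall fun x => ?_)
  simp [mul_comm]

theorem inner_toLp {f g : ℝ → ℝ} (hf : MemLp f 2) (hg : MemLp g 2) :
    inner ℝ (hf.toLp f) (hg.toLp g) = ∫ x, f x * g x := by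
  rw [inner_L2]
  refine integral_congr_ae ?_
  filter_upwards [hf.coeFn_toLp, hg.coeFn_toLp] with x h1 h2
  rw [h1, h2]

theorem N2_sq {f : ℝ → ℝ} (hf : MemLp f 2) : N2 f ^ 2 = ∫ x, f x ^ 2 := by
  rw [← N2_toLp hf, ← real_inner_self_eq_norm_sq, inner_toLp]
  simp only [sq]

theorem abs_integral_mul_le {f g : ℝ → ℝ} (hf : MemLp f 2) (hg : MemLp g 2) :
    |∫ x, f x * g x| ≤ N2 f * N2 g := by
  rw [← inner_toLp hf hg, ← N2_toLp hf, ← N2_toLp hg]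
  exact abs_real_inner_le_norm _ _

theorem integrable_mul_L2 {f g : ℝ → ℝ} (hf : MemLp f 2) (hg : MemLp g 2) :
    Integrable (fun x => f x * g x) := hf.integrable_mul hg

theorem N2_abs (f : ℝ → ℝ) : N2 (fun x => |f x|) = N2 f := by
  unfold N2
  exact congrArg _ (eLpNorm_norm f)

theorem integral_abs_mul_le {f g : ℝ → ℝ} (hf : MemLp f 2) (hg : MemLp g 2) :
    ∫ x, |f x * g x| ≤ N2 f * N2 g := by
  have h := abs_integral_mul_le (f := fun x => |f x|) (g := fun x => |g x|) hf.norm hg.norm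
  rw [N2_abs, N2_abs] at h
  simp only [abs_mul]
  exact (le_abs_self _).trans h

theorem N2_add_le {f g : ℝ → ℝ} (hf : MemLp f 2) (hg : MemLp g 2) :
    N2 (fun x => f x + g x) ≤ N2 f + N2 g := by
  rw [← N2_toLp hf, ← N2_toLp hg]
  exact (N2_toLp (hf.add hg)).symm.trans_le (norm_add_le (hf.toLp f) (hg.toLp g))

theorem N2_sub_le {f g : ℝ → ℝ} (hf : MemLp f 2) (hg : MemLp g 2) :
    N2 (fun x => f x - g x) ≤ N2 f + N2 g := by
  rw [← N2_toLp hf, ← N2_toLp hg]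
  exact (N2_toLp (hf.sub hg)).symm.trans_le (norm_sub_le (hf.toLp f) (hg.toLp g))

theorem N2_const_mul (r : ℝ) (f : ℝ → ℝ) : N2 (fun x => r * f x) = |r| * N2 f := by
  unfold N2
  rw [show (fun x => r * f x) = r • f from rfl, eLpNorm_const_smul]
  simp

theorem N2_mono {f g : ℝ → ℝ} (hg : MemLp g 2) (h : ∀ᵐ x, |f x| ≤ |g x|) :
    N2 f ≤ N2 g := by
  refine ENNReal.toReal_mono hg.eLpNorm_ne_top (eLpNorm_mono_ae ?_)
  filter_upwards [h] with x hx using hx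

theorem _root_.MeasureTheory.MemLp.shift {f : ℝ → ℝ} (hf : MemLp f 2) (h : ℝ) :
    MemLp (fun x => f (x + h)) 2 :=
  hf.comp_measurePreserving (measurePreserving_add_right volume h)

theorem N2_shift {f : ℝ → ℝ} (hf : AEStronglyMeasurable f) (h : ℝ) :
    N2 (fun x => f (x + h)) = N2 f := by
  unfold N2
  exact congrArg _ (eLpNorm_comp_measurePreserving hf (measurePreserving_add_right volume h))

theorem ae_shift {p : ℝ → Prop} (h : ∀ᵐ x, p x) (a : ℝ) : ∀ᵐ x : ℝ, p (x + a) :=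
  (measurePreserving_add_right volume a).quasiMeasurePreserving.ae h

theorem memLp_bdd_mul {f b : ℝ → ℝ} (hf : MemLp f 2) (hb : AEStronglyMeasurable b)
    (C : ℝ) (hC : ∀ᵐ x, |b x| ≤ C) : MemLp (fun x => b x * f x) 2 := by
  refine hf.of_le_mul (c := C) (hb.mul hf.1) ?_
  filter_upwards [hC] with x hx
  rw [norm_mul]
  exact mul_le_mul_of_nonneg_right hx (norm_nonneg _)

theorem N2_bdd_mul_le {f b : ℝ → ℝ} (hf : MemLp f 2) {C : ℝ}
    (hC : ∀ᵐ x, |b x| ≤ C) : N2 (fun x => b x * f x) ≤ C * N2 f := by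
  have h0 : 0 ≤ C := by
    obtain ⟨x, hx⟩ := hC.exists
    exact (abs_nonneg _).trans hx
  rw [← abs_of_nonneg h0, ← N2_const_mul]
  refine N2_mono (hf.const_mul C) ?_
  filter_upwards [hC] with x hx
  rw [abs_mul, abs_mul, abs_of_nonneg h0]
  exact mul_le_mul_of_nonneg_right hx (abs_nonneg _)

theorem abs_intervalIntegral_le_N2 {f : ℝ → ℝ} (hf : MemLp f 2) (a b : ℝ) :
    |∫ x in a..b, f x| ≤ Real.sqrt |b - a| * N2 f := by
  have hi : MemLp ((uIoc a b).indicator (fun _ => (1 : ℝ))) 2 :=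
    memLp_indicator_const 2 measurableSet_uIoc 1 (Or.inr (by simp [uIoc]))
  have hN : N2 ((uIoc a b).indicator (fun _ => (1 : ℝ))) = Real.sqrt |b - a| := by
    rw [← Real.sqrt_sq (N2_nonneg _), N2_sq hi]
    congr 1
    have : (fun x => ((uIoc a b).indicator (fun _ => (1 : ℝ)) x) ^ 2)
        = (uIoc a b).indicator (fun _ => (1 : ℝ)) := by
      funext x; by_cases hx : x ∈ uIoc a b <;> simp [hx]
    rw [this, integral_indicator measurableSet_uIoc]
    simp [uIoc, Measure.real, max_sub_min_eq_abs]
  have h1 : |∫ x in a..b, f x| = |∫ x, (uIoc a b).indicator (fun _ => (1 : ℝ)) x * f x| := by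
    rw [intervalIntegral.abs_intervalIntegral_eq, ← integral_indicator measurableSet_uIoc]
    congr 2
    funext x
    by_cases hx : x ∈ uIoc a b <;> simp [hx]
  rw [h1, ← hN]
  exact abs_integral_mul_le hi hf

theorem _root_.MeasureTheory.MemLp.intervalIntegrable {f : ℝ → ℝ} (hf : MemLp f 2) (a b : ℝ) :
    IntervalIntegrable f volume a b :=
  ((hf.locallyIntegrable (by norm_num)).integrableOn_isCompact isCompact_uIcc).mono_set
    uIoc_subset_uIcc |> intervalIntegrable_iff.2

/-! ### Functions in `H¹(ℝ)` with their continuous representative -/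

/-- `f` is locally absolutely continuous. -/
def LocAC (f : ℝ → ℝ) : Prop := ∀ a b, AbsolutelyContinuousOnInterval f a b

/-- `f ∈ H¹(ℝ)` is the continuous representative, with derivative `g` (almost everywhere). -/
structure Sob (f g : ℝ → ℝ) : Prop where
  memLp : MemLp f 2
  memLp' : MemLp g 2
  ftc : ∀ a b, ∫ x in a..b, g x = f b - f a

theorem locAC_of_ftc {f g : ℝ → ℝ} (hg : ∀ a b, IntervalIntegrable g volume a b)
    (h : ∀ a b, ∫ x in a..b, g x = f b - f a) : LocAC f := by
  intro a b
  have h1 := (hg a b).absolutelyContinuousOnInterval_intervalIntegral (c := a) (by simp)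
  have h2 : AbsolutelyContinuousOnInterval (fun _ : ℝ => f a) a b :=
    ((LipschitzWith.const (f a)).lipschitzOnWith (s := uIcc a b)).absolutelyContinuousOnInterval
  convert! h1.add h2 using 1
  funext x
  simp [h]

theorem Sob.locAC {f g : ℝ → ℝ} (h : Sob f g) : LocAC f :=
  locAC_of_ftc (h.memLp'.intervalIntegrable) h.ftc

theorem LocAC.continuous {f : ℝ → ℝ} (h : LocAC f) : Continuous f := by
  rw [continuous_iff_continuousAt]
  intro x
  exact (h (x - 1) (x + 1)).continuousOn.continuousAt
    (by rw [uIcc_of_le (by linarith)]; exact Icc_mem_nhds (by linarith) (by linarith))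

theorem Sob.continuous {f g : ℝ → ℝ} (h : Sob f g) : Continuous f := h.locAC.continuous

theorem Sob.hasDerivAt_ae {f g : ℝ → ℝ} (h : Sob f g) : ∀ᵐ x, HasDerivAt f (g x) x := by
  filter_upwards [LocallyIntegrable.ae_hasDerivAt_integral (h.memLp'.locallyIntegrable (by norm_num))] with x hx
  have := (hx 0).add_const (f 0)
  convert! this using 1
  funext y
  simp [h.ftc]

theorem LocAC.ftc {f g : ℝ → ℝ} (h : LocAC f) (hd : ∀ᵐ x, HasDerivAt f (g x) x) (a b : ℝ) :
    ∫ x in a..b, g x = f b - f a := by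
  rw [← (h a b).integral_deriv_eq_sub]
  refine intervalIntegral.integral_congr_ae ?_
  filter_upwards [hd] with x hx _
  exact hx.deriv.symm

theorem LocAC.sob {f g : ℝ → ℝ} (h : LocAC f) (hd : ∀ᵐ x, HasDerivAt f (g x) x)
    (hf : MemLp f 2) (hg : MemLp g 2) : Sob f g :=
  ⟨hf, hg, h.ftc hd⟩

theorem LocAC.add {f g : ℝ → ℝ} (hf : LocAC f) (hg : LocAC g) : LocAC fun x => f x + g x :=
  fun a b => (hf a b).add (hg a b)

theorem LocAC.mul {f g : ℝ → ℝ} (hf : LocAC f) (hg : LocAC g) : LocAC fun x => f x * g x :=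
  fun a b => (hf a b).mul (hg a b)

theorem LocAC.const (c : ℝ) : LocAC fun _ => c :=
  fun a b => ((LipschitzWith.const c).lipschitzOnWith (s := uIcc a b)).absolutelyContinuousOnInterval

theorem LocAC.of_contDiff {f : ℝ → ℝ} (hf : ContDiff ℝ 1 f) : LocAC f :=
  fun _ _ => hf.contDiffOn.absolutelyContinuousOnInterval

theorem LocAC.comp_lipschitz {f F : ℝ → ℝ} (hf : LocAC f) {K : NNReal} {s : Set ℝ}
    (hF : LipschitzOnWith K F s) (hs : ∀ x, f x ∈ s) : LocAC fun x => F (f x) := by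
  intro a b
  have h0 := hf a b
  rw [absolutelyContinuousOnInterval_iff] at h0 ⊢
  intro ε hε
  obtain ⟨δ, hδ, h⟩ := h0 (ε / (K + 1)) (by positivity)
  refine ⟨δ, hδ, fun E hE hE' => ?_⟩
  have h1 := h E hE hE'
  calc ∑ i ∈ Finset.range E.1, dist (F (f (E.2 i).1)) (F (f (E.2 i).2))
      ≤ ∑ i ∈ Finset.range E.1, K * dist (f (E.2 i).1) (f (E.2 i).2) :=
        Finset.sum_le_sum fun i _ => hF.dist_le_mul _ (hs _) _ (hs _)
    _ = K * ∑ i ∈ Finset.range E.1, dist (f (E.2 i).1) (f (E.2 i).2) := by rw [Finset.mul_sum]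
    _ ≤ K * (ε / (K + 1)) := by gcongr
    _ < (K + 1) * (ε / (K + 1)) := by gcongr; linarith
    _ = ε := by field_simp

theorem LocAC.shift {f : ℝ → ℝ} (hf : LocAC f) (h : ℝ) : LocAC fun x => f (x + h) := by
  intro a b
  have h0 := hf (a + h) (b + h)
  rw [absolutelyContinuousOnInterval_iff] at h0 ⊢
  intro ε hε
  obtain ⟨δ, hδ, H⟩ := h0 ε hε
  refine ⟨δ, hδ, fun E hE hE' => ?_⟩
  have hmem : (E.1, fun i => ((E.2 i).1 + h, (E.2 i).2 + h)) ∈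
      AbsolutelyContinuousOnInterval.disjWithin (a + h) (b + h) := by
    obtain ⟨h1, h2⟩ := hE
    refine ⟨fun i hi => ?_, fun i hi j hj hij => ?_⟩
    · have := h1 i hi
      simp only [← image_add_const_uIcc]
      exact ⟨mem_image_of_mem _ this.1, mem_image_of_mem _ this.2⟩
    · have := h2 hi hj hij
      have e : ∀ u v : ℝ, uIoc (u + h) (v + h) = (fun x => x + h) '' uIoc u v := fun u v => by
        simp only [uIoc, image_add_const_Ioc, min_add_add_right, max_add_add_right]
      simp only [Function.onFun, e] at this ⊢
      exact (disjoint_image_iff (add_left_injective h)).2 this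
  have := H _ hmem (by simpa using hE')
  simpa using this

theorem Sob.shift {f g : ℝ → ℝ} (h : Sob f g) (a : ℝ) :
    Sob (fun x => f (x + a)) (fun x => g (x + a)) :=
  ⟨h.memLp.shift a, h.memLp'.shift a, fun c d => by
    rw [intervalIntegral.integral_comp_add_right (fun x => g x)]
    exact h.ftc _ _⟩

theorem Sob.add {f g p q : ℝ → ℝ} (h : Sob f g) (k : Sob p q) :
    Sob (fun x => f x + p x) (fun x => g x + q x) :=
  ⟨h.memLp.add k.memLp, h.memLp'.add k.memLp', fun a b => by
    rw [intervalIntegral.integral_add (h.memLp'.intervalIntegrable a b)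
      (k.memLp'.intervalIntegrable a b), h.ftc, k.ftc]; ring⟩

theorem Sob.sub {f g p q : ℝ → ℝ} (h : Sob f g) (k : Sob p q) :
    Sob (fun x => f x - p x) (fun x => g x - q x) :=
  ⟨h.memLp.sub k.memLp, h.memLp'.sub k.memLp', fun a b => by
    rw [intervalIntegral.integral_sub (h.memLp'.intervalIntegrable a b)
      (k.memLp'.intervalIntegrable a b), h.ftc, k.ftc]; ring⟩

theorem Sob.const_mul {f g : ℝ → ℝ} (h : Sob f g) (r : ℝ) :
    Sob (fun x => r * f x) (fun x => r * g x) :=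
  ⟨h.memLp.const_mul r, h.memLp'.const_mul r, fun a b => by
    rw [intervalIntegral.integral_const_mul, h.ftc]; ring⟩

theorem Sob.congr' {f g g' : ℝ → ℝ} (h : Sob f g) (hg : g =ᵐ[volume] g') : Sob f g' :=
  ⟨h.memLp, h.memLp'.ae_eq hg, fun a b => by
    rw [← h.ftc]
    exact intervalIntegral.integral_congr_ae (by filter_upwards [hg] with x hx _ using hx.symm)⟩

theorem Sob.of_hasDerivAt {f g : ℝ → ℝ} (hd : ∀ x, HasDerivAt f (g x) x) (hf : MemLp f 2)
    (hg : MemLp g 2) : Sob f g :=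
  ⟨hf, hg, fun a b => intervalIntegral.integral_eq_sub_of_hasDerivAt (fun x _ => hd x)
    (hg.intervalIntegrable a b)⟩

theorem IsTest.hasDerivAt {φ : ℝ → ℝ} (h : IsTest φ) (x : ℝ) : HasDerivAt φ (_root_.deriv φ x) x :=
  ((h.1.differentiable (by simp)) x).hasDerivAt

theorem IsTest.sob {φ : ℝ → ℝ} (h : IsTest φ) : Sob φ (_root_.deriv φ) :=
  Sob.of_hasDerivAt h.hasDerivAt h.memLp h.deriv.memLp

theorem Sob.abs_sub_le {f g : ℝ → ℝ} (h : Sob f g) (x y : ℝ) :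
    |f y - f x| ≤ Real.sqrt |y - x| * N2 g := by
  rw [← h.ftc]; exact abs_intervalIntegral_le_N2 h.memLp' _ _

theorem Sob.abs_le {f g : ℝ → ℝ} (h : Sob f g) (x : ℝ) : |f x| ≤ N2 f + N2 g := by
  have hi : IntervalIntegrable f volume x (x + 1) := h.memLp.intervalIntegrable _ _
  have h1 : |∫ y in x..(x + 1), f y| ≤ N2 f := by
    have := abs_intervalIntegral_le_N2 h.memLp x (x + 1)
    simpa using this
  have h2 : |∫ y in x..(x + 1), (f y - f x)| ≤ N2 g := by
    have : ‖∫ y in x..(x + 1), (f y - f x)‖ ≤ N2 g * |x + 1 - x| := by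
      refine intervalIntegral.norm_integral_le_of_norm_le_const fun y hy => ?_
      rw [uIoc_of_le (by linarith)] at hy
      refine (h.abs_sub_le x y).trans ?_
      have : Real.sqrt |y - x| ≤ 1 := by
        rw [Real.sqrt_le_one, abs_of_pos (by linarith [hy.1])]
        linarith [hy.2]
      nlinarith [N2_nonneg g]
    simpa using this
  have h3 : f x = (∫ y in x..(x + 1), f y) - ∫ y in x..(x + 1), (f y - f x) := by
    rw [intervalIntegral.integral_sub hi (by simp)]
    simp
  rw [h3]
  exact (abs_sub _ _).trans (add_le_add h1 h2)

theorem integral_mul_deriv_test_of_locAC {f g φ : ℝ → ℝ} (h : LocAC f)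
    (hd : ∀ᵐ x, HasDerivAt f (g x) x) (hφ : IsTest φ) :
    ∫ x, f x * deriv φ x = -∫ x, g x * φ x := by
  obtain ⟨R, hR⟩ := (hφ.2.isCompact.isBounded).subset_closedBall 0
  have hz : ∀ x, x ∉ Ioc (-(|R| + 1)) (|R| + 1) → φ x = 0 ∧ deriv φ x = 0 := by
    intro x hx
    have h0 : x ∉ tsupport φ := fun hx' => hx (by
      have := hR hx'
      rw [Real.closedBall_eq_Icc] at this
      have hh := le_abs_self R
      exact ⟨by linarith [this.1], by linarith [this.2]⟩)
    exact ⟨image_eq_zero_of_notMem_tsupport h0,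
      image_eq_zero_of_notMem_tsupport fun h' => h0 (tsupport_deriv_subset h')⟩
  have hab : -(|R| + 1) ≤ |R| + 1 := by linarith [abs_nonneg R]
  have e : ∀ F : ℝ → ℝ, (∀ x, x ∉ Ioc (-(|R| + 1)) (|R| + 1) → F x = 0) →
      ∫ x, F x = ∫ x in (-(|R| + 1))..(|R| + 1), F x := fun F hF =>
    (intervalIntegral.integral_eq_integral_of_support_subset fun x hx => by
      by_contra h'; exact hx (hF x h')).symm
  rw [e _ fun x hx => by rw [(hz x hx).2, mul_zero], e _ fun x hx => by rw [(hz x hx).1, mul_zero]]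
  have hφac : LocAC φ := LocAC.of_contDiff (hφ.1.of_le (by simp))
  rw [(h _ _).integral_mul_deriv_eq_deriv_mul (hφac _ _), (hz (-(|R| + 1)) (by simp)).1]
  have hzR : φ (|R| + 1) = 0 := by
    refine image_eq_zero_of_notMem_tsupport fun hx' => ?_
    have := hR hx'
    rw [Real.closedBall_eq_Icc] at this
    linarith [le_abs_self R, this.2]
  rw [hzR, mul_zero, mul_zero, sub_zero, zero_sub]
  congr 1
  refine intervalIntegral.integral_congr_ae ?_
  filter_upwards [hd] with x hx _
  rw [hx.deriv]

theorem Sob.weak {f g φ : ℝ → ℝ} (h : Sob f g) (hφ : IsTest φ) :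
    ∫ x, f x * deriv φ x = -∫ x, g x * φ x :=
  integral_mul_deriv_test_of_locAC h.locAC h.hasDerivAt_ae hφ

theorem Sob.hasWeakDeriv {f g : ℝ → ℝ} (h : Sob f g) :
    HasWeakDeriv (h.memLp.toLp f) (h.memLp'.toLp g) := by
  intro φ hφ
  have e1 : ∫ x, (h.memLp.toLp f : ℝ → ℝ) x * deriv φ x = ∫ x, f x * deriv φ x :=
    integral_congr_ae (by filter_upwards [h.memLp.coeFn_toLp] with x hx; rw [hx])
  have e2 : ∫ x, (h.memLp'.toLp g : ℝ → ℝ) x * φ x = ∫ x, g x * φ x :=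
    integral_congr_ae (by filter_upwards [h.memLp'.coeFn_toLp] with x hx; rw [hx])
  rw [e1, e2, h.weak hφ]

/-- The element of `H1` given by a function and its derivative. -/
def Sob.toH1 {f g : ℝ → ℝ} (h : Sob f g) : H1 :=
  ⟨WithLp.toLp 2 (h.memLp.toLp f, h.memLp'.toLp g), h.hasWeakDeriv⟩

theorem exists_test_integral_one : ∃ κ : ℝ → ℝ, IsTest κ ∧ ∫ x, κ x = 1 := by
  let b : ContDiffBump (0 : ℝ) := ⟨1, 2, by norm_num, by norm_num⟩
  exact ⟨b.normed volume, ⟨b.contDiff_normed, b.hasCompactSupport_normed⟩, b.integral_normed⟩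

theorem IsTest.exists_antideriv {φ : ℝ → ℝ} (h : IsTest φ) (h0 : ∫ x, φ x = 0) :
    ∃ Φ : ℝ → ℝ, IsTest Φ ∧ _root_.deriv Φ = φ := by
  obtain ⟨R, hR⟩ := (h.2.isCompact.isBounded).subset_closedBall 0
  have hz : ∀ x, R < |x| → φ x = 0 := by
    intro x hx
    refine image_eq_zero_of_notMem_tsupport fun hx' => ?_
    have := hR hx'
    rw [mem_closedBall_zero_iff, Real.norm_eq_abs] at this
    linarith
  set a := -(|R| + 1) with ha
  have hd : ∀ x, HasDerivAt (fun x => ∫ y in a..x, φ y) (φ x) x := fun x =>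
    intervalIntegral.integral_hasDerivAt_right (h.1.continuous.intervalIntegrable _ _)
      h.1.continuous.stronglyMeasurable.stronglyMeasurableAtFilter h.1.continuous.continuousAt
  have hder : _root_.deriv (fun x => ∫ y in a..x, φ y) = φ := funext fun x => (hd x).deriv
  refine ⟨fun x => ∫ y in a..x, φ y, ⟨?_, ?_⟩, hder⟩
  · rw [contDiff_infty_iff_deriv, hder]
    exact ⟨fun x => (hd x).differentiableAt, h.1⟩
  · refine HasCompactSupport.of_support_subset_isCompact (isCompact_Icc (a := a) (b := -a)) ?_
    intro x hx
    by_contra hx'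
    apply hx
    rcases lt_or_ge x a with h1 | h1
    · have : ∀ y ∈ uIcc a x, φ y = 0 := fun y hy => by
        rw [uIcc_of_ge h1.le] at hy
        refine hz y ?_
        rw [abs_of_neg (by linarith [hy.2, abs_nonneg R])]
        linarith [hy.2, le_abs_self R]
      show ∫ y in a..x, φ y = 0
      rw [intervalIntegral.integral_congr this]; simp
    · have h2 : -a < x := by
        by_contra h3
        exact hx' ⟨h1, not_lt.1 h3⟩
      show ∫ y in a..x, φ y = 0
      rw [← h0]
      refine intervalIntegral.integral_eq_integral_of_support_subset fun y hy => ?_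
      by_contra hy'
      refine hy (hz y ?_)
      rcases le_or_gt y a with h3 | h3
      · rw [abs_of_neg (by linarith [abs_nonneg R])]
        linarith [le_abs_self R]
      · have : x < y := by
          by_contra h4
          exact hy' ⟨h3, not_lt.1 h4⟩
        rw [abs_of_pos (by linarith [abs_nonneg R])]
        linarith [le_abs_self R]

theorem IsTest.sub {φ ψ : ℝ → ℝ} (h : IsTest φ) (k : IsTest ψ) : IsTest fun x => φ x - ψ x :=
  ⟨h.1.sub k.1, h.2.sub k.2⟩

theorem IsTest.add {φ ψ : ℝ → ℝ} (h : IsTest φ) (k : IsTest ψ) : IsTest fun x => φ x + ψ x :=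
  ⟨h.1.add k.1, h.2.add k.2⟩

theorem IsTest.const_mul {φ : ℝ → ℝ} (h : IsTest φ) (r : ℝ) : IsTest fun x => r * φ x :=
  ⟨contDiff_const.mul h.1, h.2.mul_left⟩

theorem IsTest.integrable {φ : ℝ → ℝ} (h : IsTest φ) : Integrable φ :=
  h.1.continuous.integrable_of_hasCompactSupport h.2

theorem integrable_loc_mul_test {f φ : ℝ → ℝ} (hf : LocallyIntegrable f)
    (h : IsTest φ) : Integrable (fun x => f x * φ x) := by
  have := hf.integrable_smul_left_of_hasCompactSupport h.1.continuous h.2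
  simpa [mul_comm] using this

/-- Every weakly differentiable function has a continuous representative. -/
theorem HasWeakDeriv.exists_sob {f g : L2} (h : HasWeakDeriv f g) :
    ∃ F : ℝ → ℝ, Sob F g ∧ F =ᵐ[volume] f := by
  have hg : MemLp g 2 := Lp.memLp g
  have hf : MemLp f 2 := Lp.memLp f
  set F : ℝ → ℝ := fun x => ∫ y in (0 : ℝ)..x, g y with hF
  have hftc : ∀ a b, ∫ x in a..b, g x = F b - F a := fun a b => by
    rw [hF, ← intervalIntegral.integral_interval_sub_left (hg.intervalIntegrable _ _)
      (hg.intervalIntegrable _ _)]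
  have hac : LocAC F := locAC_of_ftc hg.intervalIntegrable hftc
  have hdF : ∀ᵐ x, HasDerivAt F (g x) x := by
    filter_upwards [LocallyIntegrable.ae_hasDerivAt_integral (hg.locallyIntegrable (by norm_num))] with x hx
    exact hx 0
  obtain ⟨κ, hκ, hκ1⟩ := exists_test_integral_one
  have hfl : LocallyIntegrable f := hf.locallyIntegrable (by norm_num)
  have hFl : LocallyIntegrable F := hac.continuous.locallyIntegrable
  set c := ∫ x, (f x - F x) * κ x with hc
  have hL : LocallyIntegrable (fun x => f x - F x) := hfl.sub hFl
  have key : ∀ φ, IsTest φ → ∫ x, (f x - F x) * φ x = c * ∫ x, φ x := by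
    intro φ hφ
    obtain ⟨Φ, hΦ, hΦ'⟩ := (hφ.sub (hκ.const_mul (∫ x, φ x))).exists_antideriv (by
      rw [integral_sub hφ.integrable (hκ.const_mul _).integrable, integral_const_mul, hκ1]; ring)
    have h1 := h Φ hΦ
    have h2 := integral_mul_deriv_test_of_locAC hac hdF hΦ
    have h3 : ∫ x, (f x - F x) * deriv Φ x = 0 := by
      have : ∫ x, (f x - F x) * deriv Φ x
          = (∫ x, f x * deriv Φ x) - ∫ x, F x * deriv Φ x := by
        rw [← integral_sub (integrable_loc_mul_test hfl hΦ.deriv)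
          (integrable_loc_mul_test hFl hΦ.deriv)]
        simp only [sub_mul]
      rw [this, h1, h2]; ring
    rw [hΦ'] at h3
    have h4 : ∫ x, (f x - F x) * (φ x - (∫ x, φ x) * κ x)
        = (∫ x, (f x - F x) * φ x) - (∫ x, φ x) * c := by
      rw [hc, ← integral_const_mul, ← integral_sub (integrable_loc_mul_test hL hφ)
        ((integrable_loc_mul_test hL hκ).const_mul _)]
      congr 1; funext x; ring
    linarith
  have hcl : LocallyIntegrable (fun _ : ℝ => c) := continuous_const.locallyIntegrable
  have hae : ∀ᵐ x, f x - F x = c := by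
    refine ae_eq_of_integral_contDiff_smul_eq (μ := volume) hL hcl fun φ hφ hφc => ?_
    have := key φ ⟨hφ, hφc⟩
    simp only [smul_eq_mul]
    rw [integral_mul_const, mul_comm _ c, ← this]
    congr 1; funext x; ring
  refine ⟨fun x => F x + c, ⟨hf.ae_eq ?_, hg, fun a b => by rw [hftc]; ring⟩, ?_⟩
  · filter_upwards [hae] with x hx; linarith
  · filter_upwards [hae] with x hx; linarith

theorem Sob.eq_zero_of_deriv_eq {f : ℝ → ℝ} {r : ℝ} (hr : r ≠ 0) (h : Sob f fun x => r * f x)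
    (x : ℝ) : f x = 0 := by
  have hc := h.continuous
  have hd : ∀ x, HasDerivAt f (r * f x) x := fun x => by
    have h1 := intervalIntegral.integral_hasDerivAt_right (a := 0) (b := x)
      ((hc.const_mul r).intervalIntegrable _ _)
      (hc.const_mul r).stronglyMeasurable.stronglyMeasurableAtFilter
      (hc.const_mul r).continuousAt
    convert! h1.add_const (f 0) using 1
    funext y; rw [h.ftc]; ring
  have hconst : ∀ x y, f x * Real.exp (-(r * x)) = f y * Real.exp (-(r * y)) := by
    refine is_const_of_deriv_eq_zero (f := fun x => f x * Real.exp (-(r * x))) ?_ ?_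
    · intro x
      exact (hd x).differentiableAt.mul (by fun_prop)
    · intro x
      have h1 : HasDerivAt (fun x => Real.exp (-(r * x))) (Real.exp (-(r * x)) * -(r * 1)) x :=
        (((hasDerivAt_id x).const_mul r).neg).exp
      refine ((hd x).mul h1).deriv.trans ?_
      ring
  set B := N2 f + N2 (fun x => r * f x)
  have hB : ∀ y, |f x| * Real.exp (r * (y - x)) ≤ B := fun y => by
    have h1 := hconst x y
    have h2 : f y = f x * Real.exp (r * (y - x)) := by
      have : f y = (f y * Real.exp (-(r * y))) * Real.exp (r * y) := by
        rw [mul_assoc, ← Real.exp_add]; simp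
      rw [this, ← h1, mul_assoc, ← Real.exp_add]; congr 2; ring
    have h3 := h.abs_le y
    rw [h2, abs_mul, abs_of_pos (Real.exp_pos _)] at h3
    exact h3
  by_contra hx
  have hx' : 0 < |f x| := abs_pos.2 hx
  have h1 := hB (x + (B / |f x|) / r)
  have h2 : r * (x + (B / |f x|) / r - x) = B / |f x| := by field_simp; ring
  rw [h2] at h1
  have h3 := Real.add_one_le_exp (B / |f x|)
  have h4 : |f x| * (B / |f x| + 1) ≤ B := (mul_le_mul_of_nonneg_left h3 hx'.le).trans h1
  rw [mul_add, mul_div_cancel₀ _ hx'.ne'] at h4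
  linarith

/-- The test functions as a subspace of `H1`. -/
def testSubmodule : Submodule ℝ H1 where
  carrier := {w | ∃ φ : ℝ → ℝ, IsTest φ ∧ (w.1.fst : ℝ → ℝ) =ᵐ[volume] φ ∧
    (w.1.snd : ℝ → ℝ) =ᵐ[volume] _root_.deriv φ}
  zero_mem' := by
    refine ⟨fun _ => 0, ⟨contDiff_const, HasCompactSupport.zero⟩, Lp.coeFn_zero ℝ 2 volume, ?_⟩
    simp only [deriv_const']
    exact Lp.coeFn_zero ℝ 2 volume
  add_mem' := by
    rintro w z ⟨φ, hφ, h1, h2⟩ ⟨ψ, hψ, h3, h4⟩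
    refine ⟨_, hφ.add hψ, ?_, ?_⟩
    · filter_upwards [Lp.coeFn_add w.1.fst z.1.fst, h1, h3] with x a b c
      change ((w.1.fst + z.1.fst : L2) : ℝ → ℝ) x = _
      rw [a, Pi.add_apply, b, c]
    · filter_upwards [Lp.coeFn_add w.1.snd z.1.snd, h2, h4] with x a b c
      change ((w.1.snd + z.1.snd : L2) : ℝ → ℝ) x = _
      rw [a, Pi.add_apply, b, c]
      exact ((hφ.hasDerivAt x).add (hψ.hasDerivAt x)).deriv.symm
  smul_mem' := by
    rintro r w ⟨φ, hφ, h1, h2⟩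
    refine ⟨_, hφ.const_mul r, ?_, ?_⟩
    · filter_upwards [Lp.coeFn_smul r w.1.fst, h1] with x a b
      change ((r • w.1.fst : L2) : ℝ → ℝ) x = _
      rw [a, Pi.smul_apply, b, smul_eq_mul]
    · filter_upwards [Lp.coeFn_smul r w.1.snd, h2] with x a b
      change ((r • w.1.snd : L2) : ℝ → ℝ) x = _
      rw [a, Pi.smul_apply, b, smul_eq_mul, ((hφ.hasDerivAt x).const_mul r).deriv]

theorem isClosed_H1 : IsClosed (H1 : Set (WithLp 2 (L2 × L2))) := by
  have : (H1 : Set (WithLp 2 (L2 × L2))) = ⋂ φ : {φ : ℝ → ℝ // IsTest φ},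
      {w | inner ℝ w.fst (φ.2.deriv.memLp.toLp (deriv φ.1)) = -inner ℝ w.snd (φ.2.memLp.toLp φ.1)} := by
    ext w
    simp only [mem_iInter, mem_ofPred_eq, inner_L2]
    have e : ∀ (f : L2) (φ : ℝ → ℝ) (h : MemLp φ 2),
        ∫ x, f x * (h.toLp φ : ℝ → ℝ) x = ∫ x, f x * φ x := fun f φ h =>
      integral_congr_ae (by filter_upwards [h.coeFn_toLp] with x hx; rw [hx])
    simp only [e]
    exact ⟨fun h φ => h φ.1 φ.2, fun h φ hφ => h ⟨φ, hφ⟩⟩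
  rw [this]
  refine isClosed_iInter fun φ => isClosed_eq ?_ ?_
  · exact (WithLp.prod_continuous_ofLp 2 L2 L2).fst.inner continuous_const
  · exact ((WithLp.prod_continuous_ofLp 2 L2 L2).snd.inner continuous_const).neg

instance : CompleteSpace H1 := isClosed_H1.completeSpace_coe

theorem dense_testSubmodule : testSubmodule.topologicalClosure = ⊤ := by
  rw [Submodule.topologicalClosure_eq_top_iff, Submodule.eq_bot_iff]
  intro w hw
  have hweak : HasWeakDeriv w.1.snd w.1.fst := by
    intro φ hφ
    have h1 := (Submodule.mem_orthogonal _ _).1 hw hφ.sob.toH1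
      ⟨φ, hφ, hφ.memLp.coeFn_toLp, hφ.deriv.memLp.coeFn_toLp⟩
    have h2 : inner ℝ (hφ.memLp.toLp φ) w.1.fst + inner ℝ (hφ.deriv.memLp.toLp _) w.1.snd = 0 := h1
    have e : ∀ (f : L2) (φ : ℝ → ℝ) (h : MemLp φ 2),
        inner ℝ (h.toLp φ) f = ∫ x, f x * φ x := fun f φ h => by
      rw [inner_L2]
      exact integral_congr_ae (by filter_upwards [h.coeFn_toLp] with x hx; rw [hx, mul_comm])
    rw [e, e] at h2
    linarith
  obtain ⟨F, hF, hFe⟩ := HasWeakDeriv.exists_sob w.2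
  obtain ⟨G, hG, hGe⟩ := hweak.exists_sob
  have h1 : Sob (fun x => F x + G x) (fun x => 1 * (F x + G x)) := (hF.add hG).congr' (by
    filter_upwards [hFe, hGe] with x a b; rw [← a, ← b]; ring)
  have h2 : Sob (fun x => F x - G x) (fun x => -1 * (F x - G x)) := (hF.sub hG).congr' (by
    filter_upwards [hFe, hGe] with x a b; rw [← a, ← b]; ring)
  have hz1 := h1.eq_zero_of_deriv_eq one_ne_zero
  have hz2 := h2.eq_zero_of_deriv_eq (by norm_num)
  have e1 : w.1.fst = 0 := by
    refine Lp.ext ?_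
    filter_upwards [hFe, Lp.coeFn_zero ℝ 2 volume] with x a b
    rw [b, ← a]
    have := hz1 x
    have := hz2 x
    simp only [Pi.zero_apply]; linarith
  have e2 : w.1.snd = 0 := by
    refine Lp.ext ?_
    filter_upwards [hGe, Lp.coeFn_zero ℝ 2 volume] with x a b
    rw [b, ← a]
    have := hz1 x
    have := hz2 x
    simp only [Pi.zero_apply]; linarith
  refine Subtype.ext ?_
  exact WithLp.ofLp_injective 2 (Prod.ext e1 e2)

theorem Sob.exists_approx {p q : ℝ → ℝ} (h : Sob p q) : ∃ φ : ℕ → ℝ → ℝ, (∀ n, IsTest (φ n)) ∧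
    Tendsto (fun n => N2 fun x => φ n x - p x) atTop (𝓝 0) ∧
    Tendsto (fun n => N2 fun x => deriv (φ n) x - q x) atTop (𝓝 0) := by
  have hcl : h.toH1 ∈ closure (testSubmodule : Set H1) := by
    rw [← Submodule.topologicalClosure_coe, dense_testSubmodule]; trivial
  obtain ⟨w, hw, hlim⟩ := mem_closure_iff_seq_limit.1 hcl
  choose φ hφ h1 h2 using hw
  have hn : Tendsto (fun n => ‖w n - h.toH1‖) atTop (𝓝 0) := tendsto_iff_norm_sub_tendsto_zero.1 hlim
  refine ⟨φ, hφ, squeeze_zero (fun n => N2_nonneg _) (fun n => ?_) hn,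
    squeeze_zero (fun n => N2_nonneg _) (fun n => ?_) hn⟩
  · have e : N2 (fun x => φ n x - p x) = ‖(w n).1.fst - h.memLp.toLp p‖ := by
      rw [← N2_coe]
      refine N2_congr ?_
      filter_upwards [Lp.coeFn_sub (w n).1.fst (h.memLp.toLp p), h1 n, h.memLp.coeFn_toLp] with x a b c
      rw [a, Pi.sub_apply, b, c]
    rw [e]
    exact norm_fst_le_L2 ((w n).1 - h.toH1.1)
  · have e : N2 (fun x => deriv (φ n) x - q x) = ‖(w n).1.snd - h.memLp'.toLp q‖ := by
      rw [← N2_coe]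
      refine N2_congr ?_
      filter_upwards [Lp.coeFn_sub (w n).1.snd (h.memLp'.toLp q), h2 n, h.memLp'.coeFn_toLp] with x a b c
      rw [a, Pi.sub_apply, b, c]
    rw [e]
    exact norm_snd_le_L2 ((w n).1 - h.toH1.1)

section

/-! ### Components of a state -/

/-- The continuous representative of the component `η`. -/
def etaC (u : XSpace) : ℝ → ℝ := (HasWeakDeriv.exists_sob u.fst.2).choose

theorem sob_eta (u : XSpace) : Sob (etaC u) (etaX u) :=
  (HasWeakDeriv.exists_sob u.fst.2).choose_spec.1

theorem etaC_ae (u : XSpace) : etaC u =ᵐ[volume] eta u :=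
  (HasWeakDeriv.exists_sob u.fst.2).choose_spec.2

theorem continuous_etaC (u : XSpace) : Continuous (etaC u) := (sob_eta u).continuous

theorem memLp_vel (u : XSpace) : MemLp (vel u) 2 := Lp.memLp u.snd

theorem memLp_etaX (u : XSpace) : MemLp (etaX u) 2 := (sob_eta u).memLp'

theorem memLp_etaC (u : XSpace) : MemLp (etaC u) 2 := (sob_eta u).memLp

theorem norm_sq_eq (u : XSpace) : ‖u‖ ^ 2 = N2 (etaC u) ^ 2 + N2 (etaX u) ^ 2 + N2 (vel u) ^ 2 := by
  rw [WithLp.prod_norm_sq_eq_of_L2, N2_congr (etaC_ae u)]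
  have h1 : ‖u.fst‖ ^ 2 = ‖u.fst.1.fst‖ ^ 2 + ‖u.fst.1.snd‖ ^ 2 :=
    WithLp.prod_norm_sq_eq_of_L2 (u.fst : WithLp 2 (L2 × L2))
  rw [h1, ← N2_coe, ← N2_coe, ← N2_coe]
  rfl

theorem N2_etaC_le (u : XSpace) : N2 (etaC u) ≤ ‖u‖ := by
  nlinarith [norm_sq_eq u, norm_nonneg u, N2_nonneg (etaC u), N2_nonneg (etaX u), N2_nonneg (vel u)]

theorem N2_etaX_le (u : XSpace) : N2 (etaX u) ≤ ‖u‖ := by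
  nlinarith [norm_sq_eq u, norm_nonneg u, N2_nonneg (etaC u), N2_nonneg (etaX u), N2_nonneg (vel u)]

theorem N2_vel_le (u : XSpace) : N2 (vel u) ≤ ‖u‖ := by
  nlinarith [norm_sq_eq u, norm_nonneg u, N2_nonneg (etaC u), N2_nonneg (etaX u), N2_nonneg (vel u)]

theorem etaX_sub (u w : XSpace) : etaX (u - w) =ᵐ[volume] fun x => etaX u x - etaX w x :=
  Lp.coeFn_sub u.fst.1.snd w.fst.1.snd

theorem vel_sub (u w : XSpace) : vel (u - w) =ᵐ[volume] fun x => vel u x - vel w x :=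
  Lp.coeFn_sub u.snd w.snd

theorem eta_sub (u w : XSpace) : eta (u - w) =ᵐ[volume] fun x => eta u x - eta w x :=
  Lp.coeFn_sub u.fst.1.fst w.fst.1.fst

theorem etaC_sub (u w : XSpace) (x : ℝ) : etaC (u - w) x = etaC u x - etaC w x := by
  have h : etaC (u - w) =ᵐ[volume] fun x => etaC u x - etaC w x := by
    filter_upwards [etaC_ae u, etaC_ae w, etaC_ae (u - w), eta_sub u w] with x a b c d
    rw [a, b, c, d]
  exact congrFun (((continuous_etaC _).ae_eq_iff_eq volume
    ((continuous_etaC u).sub (continuous_etaC w))).1 h) x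

theorem N2_etaC_sub (u w : XSpace) : N2 (fun x => etaC u x - etaC w x) ≤ ‖u - w‖ := by
  rw [← funext (etaC_sub u w)]; exact N2_etaC_le _

theorem N2_etaX_sub (u w : XSpace) : N2 (fun x => etaX u x - etaX w x) ≤ ‖u - w‖ := by
  rw [← N2_congr (etaX_sub u w)]; exact N2_etaX_le _

theorem N2_vel_sub (u w : XSpace) : N2 (fun x => vel u x - vel w x) ≤ ‖u - w‖ := by
  rw [← N2_congr (vel_sub u w)]; exact N2_vel_le _

theorem abs_etaC_le (u : XSpace) (x : ℝ) : |etaC u x| ≤ 2 * ‖u‖ :=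
  ((sob_eta u).abs_le x).trans (by linarith [N2_etaC_le u, N2_etaX_le u])

theorem abs_etaC_sub_le (u w : XSpace) (x : ℝ) : |etaC u x - etaC w x| ≤ 2 * ‖u - w‖ := by
  rw [← etaC_sub]; exact abs_etaC_le _ _

theorem le_of_ae_le_of_continuous {f : ℝ → ℝ} (hf : Continuous f) {m : ℝ} (h : ∀ᵐ x, f x ≤ m)
    (x : ℝ) : f x ≤ m := by
  have h1 : (fun x => max (f x) m) =ᵐ[volume] fun _ => m := by
    filter_upwards [h] with x hx using max_eq_right hx
  have h2 := congrFun (((hf.max continuous_const).ae_eq_iff_eq volume continuous_const).1 h1) x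
  exact max_eq_right_iff.1 h2

theorem mem_NV_iff (u : XSpace) : u ∈ NV ↔ ∃ m < 1, ∀ x, etaC u x ≤ m := by
  constructor
  · rintro ⟨m, hm, h⟩
    refine ⟨m, hm, le_of_ae_le_of_continuous (continuous_etaC u) ?_⟩
    filter_upwards [h, etaC_ae u] with x a b
    rwa [b]
  · rintro ⟨m, hm, h⟩
    refine ⟨m, hm, ?_⟩
    filter_upwards [etaC_ae u] with x b
    rw [← b]; exact h x

/-! ### Convergence in `L²` and uniform convergence -/

variable {ι : Type*}

/-- `f i → g` in `L²(ℝ)` along `l`. -/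
structure TL2 (l : Filter ι) (f : ι → ℝ → ℝ) (g : ℝ → ℝ) : Prop where
  memLp : ∀ᶠ i in l, MemLp (f i) 2
  memLp' : MemLp g 2
  tendsto : Tendsto (fun i => N2 fun x => f i x - g x) l (𝓝 0)

/-- `b i → c` uniformly along `l`, the limit being bounded. -/
structure TU (l : Filter ι) (b : ι → ℝ → ℝ) (c : ℝ → ℝ) : Prop where
  meas : ∀ i, AEStronglyMeasurable (b i)
  meas' : AEStronglyMeasurable c
  bdd : ∃ C, ∀ x, |c x| ≤ C
  unif : ∀ ε > 0, ∀ᶠ i in l, ∀ x, |b i x - c x| ≤ ε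

variable {l : Filter ι}

theorem TL2.const {g : ℝ → ℝ} (hg : MemLp g 2) : TL2 l (fun _ => g) g :=
  ⟨.of_forall fun _ => hg, hg, by simpa [N2] using tendsto_const_nhds⟩

theorem TL2.add {f p : ι → ℝ → ℝ} {g q : ℝ → ℝ} (h : TL2 l f g) (k : TL2 l p q) :
    TL2 l (fun i x => f i x + p i x) (fun x => g x + q x) := by
  refine ⟨by filter_upwards [h.1, k.1] with i a b using a.add b, h.2.add k.2, ?_⟩
  refine squeeze_zero' (.of_forall fun _ => N2_nonneg _) ?_
    (by simpa using h.tendsto.add k.tendsto)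
  filter_upwards [h.1, k.1] with i a b
  have := N2_add_le (a.sub h.2) (b.sub k.2)
  refine le_trans (le_of_eq ?_) this
  congr 1; funext x; simp; ring

theorem TL2.sub {f p : ι → ℝ → ℝ} {g q : ℝ → ℝ} (h : TL2 l f g) (k : TL2 l p q) :
    TL2 l (fun i x => f i x - p i x) (fun x => g x - q x) := by
  refine ⟨by filter_upwards [h.1, k.1] with i a b using a.sub b, h.2.sub k.2, ?_⟩
  refine squeeze_zero' (.of_forall fun _ => N2_nonneg _) ?_
    (by simpa using h.tendsto.add k.tendsto)
  filter_upwards [h.1, k.1] with i a b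
  have := N2_sub_le (a.sub h.2) (b.sub k.2)
  refine le_trans (le_of_eq ?_) this
  congr 1; funext x; simp; ring

theorem TL2.eventually_N2_le {f : ι → ℝ → ℝ} {g : ℝ → ℝ} (h : TL2 l f g) :
    ∀ᶠ i in l, N2 (f i) ≤ N2 g + 1 := by
  filter_upwards [h.1, h.tendsto.eventually (ge_mem_nhds one_pos)] with i a b
  have := N2_add_le (a.sub h.2) h.2
  have e : (fun x => (f i - g) x + g x) = f i := by funext x; simp
  rw [e] at this
  have e2 : N2 (f i - g) ≤ 1 := b
  linarith

theorem TL2.congr {f p : ι → ℝ → ℝ} {g q : ℝ → ℝ} (h : TL2 l f g)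
    (h1 : ∀ᶠ i in l, f i =ᵐ[volume] p i) (h2 : g =ᵐ[volume] q) : TL2 l p q := by
  refine ⟨by filter_upwards [h.1, h1] with i a b using (memLp_congr_ae b).1 a,
    (memLp_congr_ae h2).1 h.2, h.tendsto.congr' ?_⟩
  filter_upwards [h1] with i b
  refine N2_congr ?_
  filter_upwards [b, h2] with x b c
  rw [b, c]

theorem TU.const {b : ℝ → ℝ} (hb : AEStronglyMeasurable b) {C : ℝ} (hC : ∀ x, |b x| ≤ C) :
    TU l (fun _ => b) b :=
  ⟨fun _ => hb, hb, ⟨C, hC⟩, fun ε hε => .of_forall fun _ x => by simpa using hε.le⟩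

theorem TU.mul {b p : ι → ℝ → ℝ} {c q : ℝ → ℝ} (h : TU l b c) (k : TU l p q) :
    TU l (fun i x => b i x * p i x) (fun x => c x * q x) := by
  obtain ⟨C, hC⟩ := h.bdd
  obtain ⟨D, hD⟩ := k.bdd
  have hC0 : 0 ≤ C := (abs_nonneg _).trans (hC 0)
  have hD0 : 0 ≤ D := (abs_nonneg _).trans (hD 0)
  refine ⟨fun i => (h.meas i).mul (k.meas i), h.meas'.mul k.meas', ⟨C * D, fun x => ?_⟩,
    fun ε hε => ?_⟩
  · rw [abs_mul]; exact mul_le_mul (hC x) (hD x) (abs_nonneg _) hC0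
  · have hδ : 0 < min 1 (ε / (C + D + 1)) := by positivity
    filter_upwards [h.unif _ hδ, k.unif _ hδ] with i a a' x
    set δ := min 1 (ε / (C + D + 1))
    have h1 : δ ≤ 1 := min_le_left _ _
    have h2 : δ * (C + D + 1) ≤ ε := by
      rw [← le_div_iff₀ (by positivity)]; exact min_le_right _ _
    have e : b i x * p i x - c x * q x = (b i x - c x) * (p i x - q x)
        + (b i x - c x) * q x + c x * (p i x - q x) := by ring
    have a1 : |(b i x - c x) * (p i x - q x)| ≤ δ * 1 := by
      rw [abs_mul]; exact mul_le_mul (a x) ((a' x).trans h1) (abs_nonneg _) hδ.le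
    have a2 : |(b i x - c x) * q x| ≤ δ * D := by
      rw [abs_mul]; exact mul_le_mul (a x) (hD x) (abs_nonneg _) hδ.le
    have a3 : |c x * (p i x - q x)| ≤ C * δ := by
      rw [abs_mul]; exact mul_le_mul (hC x) (a' x) (abs_nonneg _) hC0
    rw [e]
    refine ((abs_add_le _ _).trans (add_le_add (abs_add_le _ _) le_rfl)).trans ?_
    linarith

theorem TU.sub {b p : ι → ℝ → ℝ} {c q : ℝ → ℝ} (h : TU l b c) (k : TU l p q) :
    TU l (fun i x => b i x - p i x) (fun x => c x - q x) := by
  obtain ⟨C, hC⟩ := h.bdd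
  obtain ⟨D, hD⟩ := k.bdd
  refine ⟨fun i => (h.meas i).sub (k.meas i), h.meas'.sub k.meas', ⟨C + D, fun x => ?_⟩,
    fun ε hε => ?_⟩
  · exact (abs_sub _ _).trans (add_le_add (hC x) (hD x))
  · filter_upwards [h.unif _ (half_pos hε), k.unif _ (half_pos hε)] with i a a' x
    rw [show b i x - p i x - (c x - q x) = (b i x - c x) - (p i x - q x) by ring]
    refine (abs_sub _ _).trans ?_
    linarith [a x, a' x]

theorem TU.eventually_bdd {b : ι → ℝ → ℝ} {c : ℝ → ℝ} (h : TU l b c) :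
    ∃ C, 0 ≤ C ∧ (∀ x, |c x| ≤ C) ∧ ∀ᶠ i in l, ∀ x, |b i x| ≤ C := by
  obtain ⟨C, hC⟩ := h.bdd
  have hC0 : 0 ≤ C := (abs_nonneg _).trans (hC 0)
  refine ⟨C + 1, by linarith, fun x => (hC x).trans (by linarith), ?_⟩
  filter_upwards [h.unif 1 one_pos] with i a x
  have := abs_add_le (b i x - c x) (c x)
  rw [sub_add_cancel] at this
  linarith [a x, hC x]

theorem TU.comp {b : ι → ℝ → ℝ} {c : ℝ → ℝ} (h : TU l b c) {F : ℝ → ℝ} (hF : Continuous F) :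
    TU l (fun i x => F (b i x)) (fun x => F (c x)) := by
  obtain ⟨C, hC0, hC, hb⟩ := h.eventually_bdd
  refine ⟨fun i => hF.comp_aestronglyMeasurable (h.meas i),
    hF.comp_aestronglyMeasurable h.meas', ?_, fun ε hε => ?_⟩
  · obtain ⟨M, hM⟩ := (isCompact_Icc (a := -C) (b := C)).exists_bound_of_continuousOn
      hF.continuousOn
    exact ⟨M, fun x => hM _ (abs_le.1 (hC x))⟩
  · obtain ⟨δ, hδ, H⟩ := Metric.uniformContinuousOn_iff.1
      ((isCompact_Icc (a := -C) (b := C)).uniformContinuousOn_of_continuous hF.continuousOn) ε hε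
    filter_upwards [h.unif _ (half_pos hδ), hb] with i a b' x
    have := H (b i x) (abs_le.1 (b' x)) (c x) (abs_le.1 (hC x))
      (by rw [Real.dist_eq]; linarith [a x])
    rw [Real.dist_eq] at this
    exact this.le

theorem TU.inv {b : ι → ℝ → ℝ} {c : ℝ → ℝ} (h : TU l b c) {δ : ℝ} (hδ : 0 < δ)
    (hc : ∀ x, δ ≤ c x) : TU l (fun i x => (b i x)⁻¹) (fun x => (c x)⁻¹) := by
  refine ⟨fun i => (h.meas i).inv₀, h.meas'.inv₀, ⟨δ⁻¹, fun x => ?_⟩, fun ε hε => ?_⟩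
  · have := hc x
    rw [abs_of_pos (inv_pos.2 (hδ.trans_le this))]
    gcongr
  · have hp : 0 < min (δ / 2) (ε * (δ / 2 * δ)) := by positivity
    filter_upwards [h.unif _ hp] with i a x
    have h0 := hc x
    have h1 := (a x).trans (min_le_left _ _)
    have h2 := (a x).trans (min_le_right _ _)
    have h3 : δ / 2 ≤ b i x := by linarith [(abs_le.1 h1).1]
    have h4 : 0 < b i x := by linarith
    have h5 : 0 < c x := by linarith
    rw [inv_sub_inv h4.ne' h5.ne', abs_div, abs_of_pos (mul_pos h4 h5), div_le_iff₀ (mul_pos h4 h5),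
      abs_sub_comm]
    refine h2.trans ?_
    gcongr

theorem TU.mul_TL2 {b f : ι → ℝ → ℝ} {c g : ℝ → ℝ} (h : TU l b c) (k : TL2 l f g) :
    TL2 l (fun i x => b i x * f i x) (fun x => c x * g x) := by
  obtain ⟨C, hC0, hC, hb⟩ := h.eventually_bdd
  refine ⟨?_, memLp_bdd_mul k.2 h.meas' C (.of_forall hC), ?_⟩
  · filter_upwards [hb, k.1] with i a b
    exact memLp_bdd_mul b (h.meas i) C (.of_forall a)
  · rw [Metric.tendsto_nhds]
    intro ε hε
    have hg := N2_nonneg g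
    have h1 : ∀ᶠ i in l, N2 (fun x => f i x - g x) < ε / (2 * (C + 1)) :=
      k.tendsto.eventually (gt_mem_nhds (by positivity))
    filter_upwards [hb, k.1, h1, h.unif (ε / (2 * (N2 g + 1))) (by positivity)] with i a b' d e
    have e1 := N2_bdd_mul_le (b := b i) (b'.sub k.2) (.of_forall a)
    have e2 := N2_bdd_mul_le (b := fun x => b i x - c x) k.2 (.of_forall e)
    have e3 := N2_add_le (memLp_bdd_mul (b'.sub k.2) (h.meas i) C (.of_forall a))
      (memLp_bdd_mul k.2 ((h.meas i).sub h.meas') _ (.of_forall e))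
    have e4 : N2 (fun x => b i x * f i x - c x * g x) ≤
        C * N2 (fun x => f i x - g x) + ε / (2 * (N2 g + 1)) * N2 g := by
      refine le_trans (le_of_eq ?_) (e3.trans (add_le_add e1 e2))
      congr 1; funext x; simp only [Pi.sub_apply]; ring
    rw [Real.dist_eq, sub_zero, abs_of_nonneg (N2_nonneg _)]
    have h5 : C * N2 (fun x => f i x - g x) ≤ C * (ε / (2 * (C + 1))) := by gcongr
    have h6 : C * (ε / (2 * (C + 1))) < ε / 2 := by
      rw [mul_div_assoc', div_lt_div_iff₀ (by positivity) (by positivity)]; nlinarith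
    have h7 : ε / (2 * (N2 g + 1)) * N2 g < ε / 2 := by
      rw [div_mul_eq_mul_div, div_lt_div_iff₀ (by positivity) (by positivity)]; nlinarith
    linarith

theorem TL2.integral_mul {f p : ι → ℝ → ℝ} {g q : ℝ → ℝ} (h : TL2 l f g) (k : TL2 l p q) :
    Tendsto (fun i => ∫ x, f i x * p i x) l (𝓝 (∫ x, g x * q x)) := by
  rw [tendsto_iff_norm_sub_tendsto_zero]
  refine squeeze_zero' (.of_forall fun _ => norm_nonneg _)
    (g := fun i => N2 (fun x => f i x - g x) * (N2 q + 1) + N2 g * N2 (fun x => p i x - q x)) ?_ ?_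
  · filter_upwards [h.1, k.1, k.eventually_N2_le] with i a b c
    have e : (∫ x, f i x * p i x) - ∫ x, g x * q x
        = (∫ x, (f i x - g x) * p i x) + ∫ x, g x * (p i x - q x) := by
      rw [← integral_sub (integrable_mul_L2 a b) (integrable_mul_L2 h.2 k.2)]
      refine Eq.trans ?_ (integral_add (integrable_mul_L2 (a.sub h.2) b)
        (integrable_mul_L2 h.2 (b.sub k.2)))
      congr 1; funext x; change _ = (f i x - g x) * p i x + g x * (p i x - q x); ring
    rw [e, Real.norm_eq_abs]
    refine (abs_add_le _ _).trans (add_le_add ?_ (abs_integral_mul_le h.2 (b.sub k.2)))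
    exact (abs_integral_mul_le (a.sub h.2) b).trans
      (mul_le_mul_of_nonneg_left c (N2_nonneg _))
  · simpa using (h.tendsto.mul_const (N2 q + 1)).add (k.tendsto.const_mul (N2 g))

/-! ### Continuity of the nonlinear quantities -/

/-- The quantity `∂ₓη / (2(1-η))`. -/
def slope (u : XSpace) (x : ℝ) : ℝ := etaX u x / (2 * (1 - etaC u x))

/-- The modulus `ρ = √(1-η)`. -/
def rho (u : XSpace) (x : ℝ) : ℝ := Real.sqrt (1 - etaC u x)

theorem tU_etaC {U : ι → XSpace} {u : XSpace} (h : Tendsto U l (𝓝 u)) :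
    TU l (fun i => etaC (U i)) (etaC u) := by
  refine ⟨fun i => (continuous_etaC _).aestronglyMeasurable,
    (continuous_etaC _).aestronglyMeasurable, ⟨_, abs_etaC_le u⟩, fun ε hε => ?_⟩
  filter_upwards [(tendsto_iff_norm_sub_tendsto_zero.1 h).eventually
    (gt_mem_nhds (half_pos hε))] with i hi x
  linarith [abs_etaC_sub_le (U i) u x]

theorem tL2_etaX {U : ι → XSpace} {u : XSpace} (h : Tendsto U l (𝓝 u)) :
    TL2 l (fun i => etaX (U i)) (etaX u) :=
  ⟨.of_forall fun _ => memLp_etaX _, memLp_etaX u,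
    squeeze_zero (fun _ => N2_nonneg _) (fun _ => N2_etaX_sub _ _)
      (tendsto_iff_norm_sub_tendsto_zero.1 h)⟩

theorem tL2_etaC {U : ι → XSpace} {u : XSpace} (h : Tendsto U l (𝓝 u)) :
    TL2 l (fun i => etaC (U i)) (etaC u) :=
  ⟨.of_forall fun _ => memLp_etaC _, memLp_etaC u,
    squeeze_zero (fun _ => N2_nonneg _) (fun _ => N2_etaC_sub _ _)
      (tendsto_iff_norm_sub_tendsto_zero.1 h)⟩

theorem tL2_vel {U : ι → XSpace} {u : XSpace} (h : Tendsto U l (𝓝 u)) :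
    TL2 l (fun i => vel (U i)) (vel u) :=
  ⟨.of_forall fun _ => memLp_vel _, memLp_vel u,
    squeeze_zero (fun _ => N2_nonneg _) (fun _ => N2_vel_sub _ _)
      (tendsto_iff_norm_sub_tendsto_zero.1 h)⟩

theorem tU_one_sub {U : ι → XSpace} {u : XSpace} (h : Tendsto U l (𝓝 u)) :
    TU l (fun i x => 1 - etaC (U i) x) (fun x => 1 - etaC u x) :=
  (TU.const aestronglyMeasurable_const (C := 1) (by simp)).sub (tU_etaC h)

theorem tU_rho {U : ι → XSpace} {u : XSpace} (h : Tendsto U l (𝓝 u)) :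
    TU l (fun i => rho (U i)) (rho u) := (tU_one_sub h).comp Real.continuous_sqrt

theorem tL2_slope {U : ι → XSpace} {u : XSpace} (h : Tendsto U l (𝓝 u)) (hu : u ∈ NV) :
    TL2 l (fun i => slope (U i)) (slope u) := by
  obtain ⟨m, hm, hle⟩ := (mem_NV_iff u).1 hu
  have h1 := ((TU.const (l := l) aestronglyMeasurable_const (C := |2|) (b := fun _ : ℝ => (2 : ℝ))
    (fun _ => le_rfl)).mul (tU_one_sub h)).inv (δ := 2 * (1 - m)) (by linarith)
    (fun x => by linarith [hle x])
  refine (h1.mul_TL2 (tL2_etaX h)).congr (.of_forall fun i =>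
    .of_forall fun x => ?_) (.of_forall fun x => ?_)
  · simp only [slope]; rw [mul_comm, div_eq_mul_inv]
  · simp only [slope]; rw [mul_comm, div_eq_mul_inv]

theorem memLp_slope {u : XSpace} (hu : u ∈ NV) : MemLp (slope u) 2 :=
  (tL2_slope (l := (pure u : Filter XSpace)) (U := id) (by simpa using tendsto_pure_nhds id u) hu).2

/-! ### Averages and translations -/

/-- `∫_x^{x+h} v`. -/
def incr (h : ℝ) (v : ℝ → ℝ) (x : ℝ) : ℝ := ∫ y in x..(x + h), v y

theorem exists_test_N2_lt {f : ℝ → ℝ} (hf : MemLp f 2) {ε : ℝ} (hε : 0 < ε) :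
    ∃ φ, IsTest φ ∧ N2 (fun x => f x - φ x) < ε := by
  let S : Submodule ℝ L2 :=
    { carrier := {w | ∃ φ : ℝ → ℝ, IsTest φ ∧ (w : ℝ → ℝ) =ᵐ[volume] φ}
      zero_mem' := ⟨fun _ => 0, ⟨contDiff_const, HasCompactSupport.zero⟩, Lp.coeFn_zero ℝ 2 volume⟩
      add_mem' := by
        rintro w z ⟨φ, hφ, h1⟩ ⟨ψ, hψ, h3⟩
        refine ⟨_, hφ.add hψ, ?_⟩
        filter_upwards [Lp.coeFn_add w z, h1, h3] with x a b c
        rw [a, Pi.add_apply, b, c]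
      smul_mem' := by
        rintro r w ⟨φ, hφ, h1⟩
        refine ⟨_, hφ.const_mul r, ?_⟩
        filter_upwards [Lp.coeFn_smul r w, h1] with x a b
        rw [a, Pi.smul_apply, b, smul_eq_mul] }
  have hS : S.topologicalClosure = ⊤ := by
    rw [Submodule.topologicalClosure_eq_top_iff, Submodule.eq_bot_iff]
    intro w hw
    refine Lp.ext ?_
    have hae : ∀ᵐ x, (w : ℝ → ℝ) x = 0 := ae_eq_zero_of_integral_contDiff_smul_eq_zero
      ((Lp.memLp w).locallyIntegrable (by norm_num)) fun φ hφ hφc => ?_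
    · filter_upwards [hae, Lp.coeFn_zero ℝ 2 volume] with x a b
      rw [a, b]; rfl
    have hφ' : IsTest φ := ⟨hφ, hφc⟩
    have h1 := (Submodule.mem_orthogonal _ _).1 hw (hφ'.memLp.toLp φ) ⟨φ, hφ', hφ'.memLp.coeFn_toLp⟩
    rw [inner_L2] at h1
    rw [← h1]
    refine integral_congr_ae ?_
    filter_upwards [hφ'.memLp.coeFn_toLp] with x hx
    rw [hx, smul_eq_mul]
  have hcl : hf.toLp f ∈ closure (S : Set L2) := by
    rw [← Submodule.topologicalClosure_coe, hS]; trivial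
  obtain ⟨w, ⟨φ, hφ, hw⟩, hd⟩ := Metric.mem_closure_iff.1 hcl ε hε
  refine ⟨φ, hφ, lt_of_le_of_lt (le_of_eq ?_) hd⟩
  rw [dist_eq_norm, ← N2_coe]
  refine N2_congr ?_
  filter_upwards [Lp.coeFn_sub (hf.toLp f) w, hf.coeFn_toLp, hw] with x a b c
  rw [a, Pi.sub_apply, b, c]

theorem integrable_incr {F : ℝ → ℝ} (hF : Integrable F) {h : ℝ} (hh : 0 ≤ h) :
    Integrable (incr h F) ∧ ∫ x, incr h F x = h * ∫ x, F x := by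
  set g : ℝ → ℝ := (Ioc (-h) 0).indicator fun _ => 1
  have hg : Integrable g :=
    IntegrableOn.integrable_indicator (integrable_const (1 : ℝ)) measurableSet_Ioc
  have e : incr h F = convolution g F (ContinuousLinearMap.mul ℝ ℝ) volume := by
    funext x
    have h1 : ∀ t, (ContinuousLinearMap.mul ℝ ℝ) (g t) (F (x - t))
        = (Ioc (-h) 0).indicator (fun t => F (x - t)) t := fun t => by
      by_cases ht : t ∈ Ioc (-h) 0 <;> simp [g, ht]
    simp only [convolution, h1]
    rw [integral_indicator measurableSet_Ioc, ← intervalIntegral.integral_of_le (by linarith),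
      intervalIntegral.integral_comp_sub_left (fun t => F t)]
    simp [incr]
  rw [e]
  refine ⟨hg.integrable_convolution _ hF, ?_⟩
  rw [integral_convolution _ hg hF]
  have : ∫ x, g x = h := by
    simp only [g]
    rw [integral_indicator measurableSet_Ioc]
    simp [Measure.real, hh]
  simp [this]

theorem sob_incr_aux {v : ℝ → ℝ} (hv : MemLp v 2) (h : ℝ) (a b : ℝ) :
    ∫ x in a..b, (v (x + h) - v x) = incr h v b - incr h v a := by
  rw [intervalIntegral.integral_sub ((hv.shift h).intervalIntegrable a b) (hv.intervalIntegrable a b),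
    intervalIntegral.integral_comp_add_right (fun x => v x)]
  simp only [incr]
  have := fun a b => hv.intervalIntegrable a b
  have e1 := intervalIntegral.integral_add_adjacent_intervals (this a (a + h)) (this (a + h) (b + h))
  have e2 := intervalIntegral.integral_add_adjacent_intervals (this a b) (this b (b + h))
  linarith

theorem continuous_incr {v : ℝ → ℝ} (hv : MemLp v 2) (h : ℝ) : Continuous (incr h v) :=
  (locAC_of_ftc (((hv.shift h).sub hv).intervalIntegrable) (sob_incr_aux hv h)).continuous

theorem memLp_incr {v : ℝ → ℝ} (hv : MemLp v 2) {h : ℝ} (hh : 0 ≤ h) :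
    MemLp (incr h v) 2 ∧ N2 (incr h v) ≤ h * N2 v := by
  have hi := integrable_incr hv.integrable_sq hh
  have hle : ∀ x, incr h v x ^ 2 ≤ h * incr h (fun x => v x ^ 2) x := fun x => by
    have h1 : MemLp ((Ioc x (x + h)).indicator v) 2 := hv.indicator measurableSet_Ioc
    have h2 : MemLp ((Ioc x (x + h)).indicator fun _ => (1 : ℝ)) 2 :=
      memLp_indicator_const 2 measurableSet_Ioc 1 (Or.inr (by simp))
    have h3 := abs_integral_mul_le h1 h2
    have e1 : ∫ y, (Ioc x (x + h)).indicator v y * (Ioc x (x + h)).indicator (fun _ => (1 : ℝ)) y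
        = incr h v x := by
      rw [incr, intervalIntegral.integral_of_le (by linarith), ← integral_indicator measurableSet_Ioc]
      congr 1; funext y
      by_cases hy : y ∈ Ioc x (x + h) <;> simp [hy]
    have e2 : N2 ((Ioc x (x + h)).indicator v) ^ 2 = incr h (fun x => v x ^ 2) x := by
      rw [N2_sq h1, incr, intervalIntegral.integral_of_le (by linarith),
        ← integral_indicator measurableSet_Ioc]
      congr 1; funext y
      by_cases hy : y ∈ Ioc x (x + h) <;> simp [hy]
    have e3 : N2 ((Ioc x (x + h)).indicator fun _ => (1 : ℝ)) ^ 2 = h := by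
      rw [N2_sq h2]
      have : (fun y => ((Ioc x (x + h)).indicator (fun _ => (1 : ℝ)) y) ^ 2)
          = (Ioc x (x + h)).indicator fun _ => 1 := by
        funext y
        by_cases hy : y ∈ Ioc x (x + h) <;> simp [hy]
      rw [this, integral_indicator measurableSet_Ioc]
      simp [Measure.real, hh]
    rw [e1] at h3
    rw [← sq_abs, ← e2]
    nth_rw 2 [← e3]
    rw [← mul_pow, mul_comm]
    gcongr
  have hm : MemLp (incr h v) 2 := by
    rw [memLp_two_iff_integrable_sq (continuous_incr hv h).aestronglyMeasurable]
    refine (hi.1.const_mul h).mono' ((continuous_incr hv h).pow 2).aestronglyMeasurable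
      (.of_forall fun x => ?_)
    rw [Real.norm_eq_abs, abs_of_nonneg (sq_nonneg _)]
    exact hle x
  refine ⟨hm, ?_⟩
  have h1 : N2 (incr h v) ^ 2 ≤ (h * N2 v) ^ 2 := by
    rw [N2_sq hm, mul_pow, N2_sq hv, sq h, mul_assoc, ← hi.2, ← integral_const_mul]
    exact integral_mono hm.integrable_sq (hi.1.const_mul h) hle
  exact (sq_le_sq₀ (N2_nonneg _) (mul_nonneg hh (N2_nonneg _))).1 h1

theorem sob_incr {v : ℝ → ℝ} (hv : MemLp v 2) {h : ℝ} (hh : 0 ≤ h) :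
    Sob (incr h v) (fun x => v (x + h) - v x) :=
  ⟨(memLp_incr hv hh).1, (hv.shift h).sub hv, sob_incr_aux hv h⟩

theorem Sob.incr_deriv {f g : ℝ → ℝ} (hf : Sob f g) (h x : ℝ) : incr h g x = f (x + h) - f x :=
  hf.ftc _ _

theorem Sob.N2_shift_sub_le {f g : ℝ → ℝ} (hf : Sob f g) {h : ℝ} (hh : 0 ≤ h) :
    N2 (fun x => f (x + h) - f x) ≤ h * N2 g := by
  rw [← funext (hf.incr_deriv h)]; exact (memLp_incr hf.memLp' hh).2

theorem incr_sub {v w : ℝ → ℝ} (hv : MemLp v 2) (hw : MemLp w 2) (h x : ℝ) :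
    incr h (fun x => v x - w x) x = incr h v x - incr h w x :=
  intervalIntegral.integral_sub (hv.intervalIntegrable _ _) (hw.intervalIntegrable _ _)

theorem Sob.N2_avg_sub_le {f g : ℝ → ℝ} (hf : Sob f g) {h : ℝ} (hh : 0 < h) :
    N2 (fun x => h⁻¹ * incr h f x - f x) ≤ h * N2 g := by
  have hg : MemLp (fun x => |g x|) 2 := hf.memLp'.norm
  have h1 := memLp_incr hg hh.le
  rw [← N2_abs g]
  refine le_trans (N2_mono h1.1 (.of_forall fun x => ?_)) h1.2
  have hnn : 0 ≤ incr h (fun x => |g x|) x :=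
    intervalIntegral.integral_nonneg (by linarith) fun y _ => abs_nonneg _
  rw [abs_of_nonneg hnn]
  have e : h⁻¹ * incr h f x - f x = h⁻¹ * ∫ y in x..(x + h), (f y - f x) := by
    rw [intervalIntegral.integral_sub (hf.memLp.intervalIntegrable _ _) (by simp)]
    simp only [intervalIntegral.integral_const, incr]
    simp
    field_simp
  have hb : ‖∫ y in x..(x + h), (f y - f x)‖ ≤ incr h (fun x => |g x|) x * |x + h - x| := by
    refine intervalIntegral.norm_integral_le_of_norm_le_const fun y hy => ?_
    rw [uIoc_of_le (by linarith)] at hy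
    rw [← hf.ftc, Real.norm_eq_abs]
    refine (intervalIntegral.abs_integral_le_integral_abs hy.1.le).trans ?_
    exact intervalIntegral.integral_mono_interval le_rfl hy.1.le hy.2
      (.of_forall fun _ => abs_nonneg _) (hg.intervalIntegrable _ _)
  rw [add_sub_cancel_left, abs_of_pos hh, Real.norm_eq_abs] at hb
  rw [e, abs_mul, abs_of_pos (inv_pos.2 hh), inv_mul_le_iff₀ hh, mul_comm]
  exact hb

theorem TL2.shift {f : ι → ℝ → ℝ} {g : ℝ → ℝ} (k : TL2 l f g) {h : ι → ℝ}
    (hp : ∀ᶠ i in l, 0 < h i) (h0 : Tendsto h l (𝓝 0)) : TL2 l (fun i x => f i (x + h i)) g := by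
  refine ⟨by filter_upwards [k.1] with i a using a.shift _, k.2, ?_⟩
  rw [Metric.tendsto_nhds]
  intro ε hε
  obtain ⟨φ, hφ, hlt⟩ := exists_test_N2_lt k.2 (show 0 < ε / 4 by positivity)
  have h1 : ∀ᶠ i in l, h i * N2 (deriv φ) < ε / 4 := by
    have := h0.mul_const (N2 (deriv φ))
    rw [zero_mul] at this
    exact this.eventually (gt_mem_nhds (by positivity))
  filter_upwards [k.1, hp, h1, k.tendsto.eventually (gt_mem_nhds (show 0 < ε / 4 by positivity))]
    with i a b c d
  rw [Real.dist_eq, sub_zero, abs_of_nonneg (N2_nonneg _)]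
  have m1 : MemLp (fun x => f i x - g x) 2 := a.sub k.2
  have m2 : MemLp (fun x => g x - φ x) 2 := k.2.sub hφ.memLp
  have e1 := N2_shift m1.1 (h i)
  have e2 := N2_shift m2.1 (h i)
  have m3 : MemLp (fun x => φ (x + h i) - φ x) 2 := (hφ.memLp.shift _).sub hφ.memLp
  have e3 := hφ.sob.N2_shift_sub_le b.le
  have s1 := N2_add_le (m1.shift (h i)) (m2.shift (h i))
  have s2 := N2_sub_le m3 m2
  have s3 := N2_add_le ((m1.shift (h i)).add (m2.shift (h i))) (m3.sub m2)
  have e : (fun x => f i (x + h i) - g x) = fun x =>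
      ((fun x => f i (x + h i) - g (x + h i)) + fun x => g (x + h i) - φ (x + h i)) x
      + ((fun x => φ (x + h i) - φ x) - fun x => g x - φ x) x := by
    funext x; simp only [Pi.add_apply, Pi.sub_apply]; ring
  rw [e]
  have t1 : N2 ((fun x => f i (x + h i) - g (x + h i)) + fun x => g (x + h i) - φ (x + h i))
    ≤ _ := s1
  have t2 : N2 ((fun x => φ (x + h i) - φ x) - fun x => g x - φ x) ≤ _ := s2
  linarith

theorem TL2.avg {f : ι → ℝ → ℝ} {g : ℝ → ℝ} (k : TL2 l f g) {h : ι → ℝ}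
    (hp : ∀ᶠ i in l, 0 < h i) (h0 : Tendsto h l (𝓝 0)) :
    TL2 l (fun i x => (h i)⁻¹ * incr (h i) (f i) x) g := by
  refine ⟨by filter_upwards [k.1, hp] with i a b using (memLp_incr a b.le).1.const_mul _, k.2, ?_⟩
  have hN : ∀ {w : ℝ → ℝ} {h : ℝ}, MemLp w 2 → 0 < h →
      N2 (fun x => h⁻¹ * incr h w x) ≤ N2 w := fun {w h} hw hh => by
    rw [N2_const_mul, abs_of_pos (inv_pos.2 hh), inv_mul_le_iff₀ hh]
    exact (memLp_incr hw hh.le).2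
  rw [Metric.tendsto_nhds]
  intro ε hε
  obtain ⟨φ, hφ, hlt⟩ := exists_test_N2_lt k.2 (show 0 < ε / 4 by positivity)
  have h1 : ∀ᶠ i in l, h i * N2 (deriv φ) < ε / 4 := by
    have := h0.mul_const (N2 (deriv φ))
    rw [zero_mul] at this
    exact this.eventually (gt_mem_nhds (by positivity))
  filter_upwards [k.1, hp, h1, k.tendsto.eventually (gt_mem_nhds (show 0 < ε / 4 by positivity))]
    with i a b c d
  rw [Real.dist_eq, sub_zero, abs_of_nonneg (N2_nonneg _)]
  have m1 : MemLp (fun x => f i x - g x) 2 := a.sub k.2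
  have m2 : MemLp (fun x => g x - φ x) 2 := k.2.sub hφ.memLp
  have m3 : MemLp (fun x => (h i)⁻¹ * incr (h i) φ x - φ x) 2 :=
    ((memLp_incr hφ.memLp b.le).1.const_mul _).sub hφ.memLp
  have e3 := hφ.sob.N2_avg_sub_le b
  have n1 : MemLp (fun x => (h i)⁻¹ * incr (h i) (fun x => f i x - g x) x) 2 :=
    (memLp_incr m1 b.le).1.const_mul _
  have n2 : MemLp (fun x => (h i)⁻¹ * incr (h i) (fun x => g x - φ x) x) 2 :=
    (memLp_incr m2 b.le).1.const_mul _
  have s1 := N2_add_le n1 n2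
  have s2 := N2_sub_le m3 m2
  have s3 := N2_add_le (n1.add n2) (m3.sub m2)
  have e1 := hN m1 b
  have e2 := hN m2 b
  have e : (fun x => (h i)⁻¹ * incr (h i) (f i) x - g x) = fun x =>
      ((fun x => (h i)⁻¹ * incr (h i) (fun x => f i x - g x) x)
        + fun x => (h i)⁻¹ * incr (h i) (fun x => g x - φ x) x) x
      + ((fun x => (h i)⁻¹ * incr (h i) φ x - φ x) - fun x => g x - φ x) x := by
    funext x
    simp only [Pi.add_apply, Pi.sub_apply, incr_sub a k.2, incr_sub k.2 hφ.memLp]; ring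
  rw [e]
  have t1 : N2 ((fun x => (h i)⁻¹ * incr (h i) (fun x => f i x - g x) x)
        + fun x => (h i)⁻¹ * incr (h i) (fun x => g x - φ x) x) ≤ _ := s1
  have t2 : N2 ((fun x => (h i)⁻¹ * incr (h i) φ x - φ x) - fun x => g x - φ x) ≤ _ := s2
  linarith

end

theorem memLp_fsub {f g : ℝ → ℝ} (hf : MemLp f 2) (hg : MemLp g 2) :
    MemLp (fun x => f x - g x) 2 := hf.sub hg

theorem memLp_fadd {f g : ℝ → ℝ} (hf : MemLp f 2) (hg : MemLp g 2) :
    MemLp (fun x => f x + g x) 2 := hf.add hg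

theorem integrable_fsub {f g : ℝ → ℝ} (hf : Integrable f) (hg : Integrable g) :
    Integrable (fun x => f x - g x) := hf.sub hg

theorem integrable_fadd {f g : ℝ → ℝ} (hf : Integrable f) (hg : Integrable g) :
    Integrable (fun x => f x + g x) := hf.add hg

/-! ### Time derivatives in the dual of `H¹` -/

/-- The curve `y` has, at `t₀`, the time derivative `ℓ` in the norm of the dual of `H¹(ℝ)`. -/
def DualDeriv (I : Set ℝ) (y : ℝ → ℝ → ℝ) (ℓ : (ℝ → ℝ) → (ℝ → ℝ) → ℝ) (t₀ : ℝ) : Prop :=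
  ∀ ε > 0, ∀ᶠ t in 𝓝[I] t₀, ∀ p q, Sob p q →
    |(∫ x, (y t x - y t₀ x) * p x) - (t - t₀) * ℓ p q| ≤ ε * |t - t₀| * (N2 p + N2 q)

theorem TL2.of_N2 {ι : Type*} {l : Filter ι} {f : ι → ℝ → ℝ} {g : ℝ → ℝ}
    (hf : ∀ i, MemLp (f i) 2) (hg : MemLp g 2)
    (h : Tendsto (fun i => N2 fun x => f i x - g x) l (𝓝 0)) : TL2 l f g :=
  ⟨.of_forall hf, hg, h⟩

theorem Sob.exists_approx_TL2 {p q : ℝ → ℝ} (h : Sob p q) : ∃ φ : ℕ → ℝ → ℝ,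
    (∀ n, IsTest (φ n)) ∧ TL2 atTop φ p ∧ TL2 atTop (fun n => deriv (φ n)) q ∧ TU atTop φ p := by
  obtain ⟨φ, hφ, h1, h2⟩ := h.exists_approx
  refine ⟨φ, hφ, .of_N2 (fun n => (hφ n).memLp) h.memLp h1,
    .of_N2 (fun n => (hφ n).deriv.memLp) h.memLp' h2,
    ⟨fun n => (hφ n).1.continuous.aestronglyMeasurable, h.continuous.aestronglyMeasurable,
      ⟨_, h.abs_le⟩, fun ε hε => ?_⟩⟩
  have h3 := h1.add h2
  rw [add_zero] at h3
  filter_upwards [h3.eventually (gt_mem_nhds hε)] with n hn x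
  exact (((hφ n).sob.sub h).abs_le x).trans hn.le

theorem TL2.N2_tendsto {ι : Type*} {l : Filter ι} {f : ι → ℝ → ℝ} {g : ℝ → ℝ} (h : TL2 l f g) :
    Tendsto (fun i => N2 (f i)) l (𝓝 (N2 g)) := by
  have h1 := (h.integral_mul h).sqrt
  refine (h1.congr' ?_).trans (le_of_eq ?_)
  · filter_upwards [h.1] with i hi
    rw [← Real.sqrt_sq (N2_nonneg (f i)), N2_sq hi]; simp only [sq]
  · rw [← Real.sqrt_sq (N2_nonneg g), N2_sq h.2]; simp only [sq]

theorem TU.integral_mul {ι : Type*} {l : Filter ι} {b : ι → ℝ → ℝ} {c : ℝ → ℝ} (h : TU l b c)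
    {f : ℝ → ℝ} (hf : Integrable f) :
    Tendsto (fun i => ∫ x, f x * b i x) l (𝓝 (∫ x, f x * c x)) := by
  obtain ⟨C, hC0, hC, hb⟩ := h.eventually_bdd
  have hI : ∀ {k : ℝ → ℝ} {D : ℝ}, AEStronglyMeasurable k → (∀ x, |k x| ≤ D) →
      Integrable (fun x => f x * k x) := fun hk hD =>
    hf.mul_bdd hk (.of_forall hD)
  rw [Metric.tendsto_nhds]
  intro ε hε
  set M := ∫ x, |f x|
  have hM : 0 ≤ M := integral_nonneg fun _ => abs_nonneg _
  filter_upwards [hb, h.unif (ε / (M + 1)) (by positivity)] with i h1 h2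
  rw [Real.dist_eq, ← integral_sub (hI (h.meas i) h1) (hI h.meas' hC)]
  refine (abs_integral_le_integral_abs).trans_lt ?_
  have h3 : ∫ x, |f x * b i x - f x * c x| ≤ ∫ x, |f x| * (ε / (M + 1)) := by
    refine integral_mono_of_nonneg (.of_forall fun _ => abs_nonneg _)
      (hf.abs.mul_const _) (.of_forall fun x => ?_)
    simp only
    rw [← mul_sub, abs_mul]
    exact mul_le_mul_of_nonneg_left (h2 x) (abs_nonneg _)
  rw [integral_mul_const] at h3
  refine h3.trans_lt ?_
  rw [mul_div_assoc', div_lt_iff₀ (by positivity)]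
  change M * ε < _
  nlinarith

theorem abs_le_of_test {a b c : ℝ → ℝ} (ha : MemLp a 2) (hb : Integrable b)
    (hc : MemLp c 2) {C : ℝ}
    (h : ∀ φ, IsTest φ → |(∫ x, a x * φ x) + (∫ x, b x * φ x) + ∫ x, c x * deriv φ x|
      ≤ C * (N2 φ + N2 (deriv φ))) {p q : ℝ → ℝ} (hpq : Sob p q) :
    |(∫ x, a x * p x) + (∫ x, b x * p x) + ∫ x, c x * q x| ≤ C * (N2 p + N2 q) := by
  obtain ⟨φ, hφ, h1, h2, h3⟩ := hpq.exists_approx_TL2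
  refine le_of_tendsto_of_tendsto' ((((TL2.const ha).integral_mul h1).add
    (h3.integral_mul hb)).add ((TL2.const hc).integral_mul h2)).abs
    ((h1.N2_tendsto.add h2.N2_tendsto).const_mul C) fun n => h _ (hφ n)

theorem Sob.integral_mul_deriv {f g p q : ℝ → ℝ} (h : Sob f g) (k : Sob p q) :
    ∫ x, f x * q x = -∫ x, g x * p x := by
  obtain ⟨φ, hφ, h1, h2, h3⟩ := k.exists_approx_TL2
  refine tendsto_nhds_unique ((TL2.const h.memLp).integral_mul h2) ?_
  refine (((TL2.const h.memLp').integral_mul h1).neg).congr fun n => ?_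
  rw [h.weak (hφ n)]

theorem dualDeriv_of_test {I : Set ℝ} (hI : Convex ℝ I) {t₀ : ℝ} (ht₀ : t₀ ∈ I)
    {y α β γ : ℝ → ℝ → ℝ} (hy : ∀ t ∈ I, MemLp (y t) 2)
    (hα : TL2 (𝓝[I] t₀) α (α t₀)) (hγ : TL2 (𝓝[I] t₀) γ (γ t₀))
    (hβi : ∀ t ∈ I, Integrable (β t))
    (hβ : Tendsto (fun t => ∫ x, |β t x - β t₀ x|) (𝓝[I] t₀) (𝓝 0))
    (hd : ∀ φ, IsTest φ → ∀ t ∈ I, HasDerivWithinAt (fun t => ∫ x, y t x * φ x)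
      ((∫ x, α t x * φ x) + (∫ x, β t x * φ x) + ∫ x, γ t x * deriv φ x) I t) :
    DualDeriv I y (fun p q => (∫ x, α t₀ x * p x) + (∫ x, β t₀ x * p x) + ∫ x, γ t₀ x * q x) t₀ := by
  intro ε hε
  have e1 : ∀ᶠ t in 𝓝[I] t₀, t ∈ I → MemLp (α t) 2 ∧ MemLp (γ t) 2 ∧
      N2 (fun x => α t x - α t₀ x) < ε / 3 ∧ N2 (fun x => γ t x - γ t₀ x) < ε / 3 ∧
      ∫ x, |β t x - β t₀ x| < ε / 3 := by
    filter_upwards [hα.1, hγ.1, hα.tendsto.eventually (gt_mem_nhds (show 0 < ε / 3 by positivity)),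
      hγ.tendsto.eventually (gt_mem_nhds (show 0 < ε / 3 by positivity)),
      hβ.eventually (gt_mem_nhds (show 0 < ε / 3 by positivity))] with t a b c d e _
    exact ⟨a, b, c, d, e⟩
  obtain ⟨δ, hδ, hball⟩ := Metric.mem_nhdsWithin_iff.1 e1
  filter_upwards [inter_mem_nhdsWithin I (Metric.ball_mem_nhds t₀ hδ)] with t ht p q hpq
  set J := I ∩ Metric.ball t₀ δ
  have hJ : Convex ℝ J := hI.inter (convex_ball _ _)
  have ht₀J : t₀ ∈ J := ⟨ht₀, Metric.mem_ball_self hδ⟩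
  have hα0 : MemLp (α t₀) 2 := hα.2
  have hγ0 : MemLp (γ t₀) 2 := hγ.2
  have key : ∀ φ, IsTest φ → |(∫ x, (y t x - y t₀ x) * φ x) - (t - t₀) *
      ((∫ x, α t₀ x * φ x) + (∫ x, β t₀ x * φ x) + ∫ x, γ t₀ x * deriv φ x)|
      ≤ ε * |t - t₀| * (N2 φ + N2 (deriv φ)) := by
    intro φ hφ
    set L := (∫ x, α t₀ x * φ x) + (∫ x, β t₀ x * φ x) + ∫ x, γ t₀ x * deriv φ x
    have hb := Convex.norm_image_sub_le_of_norm_hasDerivWithin_le (𝕜 := ℝ) (s := J)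
      (f := fun t => (∫ x, y t x * φ x) - t * L)
      (f' := fun t => ((∫ x, α t x * φ x) + (∫ x, β t x * φ x) + ∫ x, γ t x * deriv φ x) - 1 * L)
      (C := ε * (N2 φ + N2 (deriv φ)))
      (fun s hs => ((hd φ hφ s hs.1).mono inter_subset_left).sub
        ((hasDerivWithinAt_id _ _).mul_const _)) (fun s hs => ?_) hJ ht₀J ht
    · have e : (∫ x, (y t x - y t₀ x) * φ x) = (∫ x, y t x * φ x) - ∫ x, y t₀ x * φ x := by
        rw [← integral_sub (integrable_mul_L2 (hy t ht.1) hφ.memLp)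
          (integrable_mul_L2 (hy t₀ ht₀) hφ.memLp)]
        simp only [sub_mul]
      rw [e]
      simp only [Real.norm_eq_abs] at hb
      refine (le_of_eq ?_).trans (hb.trans (le_of_eq (by ring)))
      congr 1; ring
    · obtain ⟨m1, m2, n1, n2, n3⟩ := hball ⟨hs.2, hs.1⟩ hs.1
      have d1 : (∫ x, α s x * φ x) - ∫ x, α t₀ x * φ x = ∫ x, (α s x - α t₀ x) * φ x := by
        rw [← integral_sub (integrable_mul_L2 m1 hφ.memLp) (integrable_mul_L2 hα0 hφ.memLp)]
        simp only [sub_mul]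
      have d2 : (∫ x, γ s x * deriv φ x) - ∫ x, γ t₀ x * deriv φ x
          = ∫ x, (γ s x - γ t₀ x) * deriv φ x := by
        rw [← integral_sub (integrable_mul_L2 m2 hφ.deriv.memLp)
          (integrable_mul_L2 hγ0 hφ.deriv.memLp)]
        simp only [sub_mul]
      have hbd : ∀ {k : ℝ → ℝ}, Integrable k → Integrable (fun x => k x * φ x) :=
        fun hk => hk.mul_bdd (c := N2 φ + N2 (deriv φ)) hφ.1.continuous.aestronglyMeasurable
          (.of_forall hφ.sob.abs_le)
      have d3 : (∫ x, β s x * φ x) - ∫ x, β t₀ x * φ x = ∫ x, (β s x - β t₀ x) * φ x := by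
        rw [← integral_sub (hbd (hβi s hs.1)) (hbd (hβi t₀ ht₀))]
        simp only [sub_mul]
      have b1 := abs_integral_mul_le (m1.sub hα0) hφ.memLp
      have b2 := abs_integral_mul_le (m2.sub hγ0) hφ.deriv.memLp
      have b3 : |∫ x, (β s x - β t₀ x) * φ x| ≤ (ε / 3) * (N2 φ + N2 (deriv φ)) := by
        refine abs_integral_le_integral_abs.trans ?_
        have : ∫ x, |(β s x - β t₀ x) * φ x| ≤ ∫ x, |β s x - β t₀ x| * (N2 φ + N2 (deriv φ)) := by
          refine integral_mono_of_nonneg (.of_forall fun _ => abs_nonneg _)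
            (((hβi s hs.1).sub (hβi t₀ ht₀)).abs.mul_const _) (.of_forall fun x => ?_)
          simp only [abs_mul]
          exact mul_le_mul_of_nonneg_left (hφ.sob.abs_le x) (abs_nonneg _)
        rw [integral_mul_const] at this
        refine this.trans ?_
        have := N2_nonneg φ
        have := N2_nonneg (deriv φ)
        gcongr
      rw [Real.norm_eq_abs]
      have e : ((∫ x, α s x * φ x) + (∫ x, β s x * φ x) + ∫ x, γ s x * deriv φ x) - 1 * L
          = (∫ x, (α s x - α t₀ x) * φ x) + (∫ x, (β s x - β t₀ x) * φ x)
            + ∫ x, (γ s x - γ t₀ x) * deriv φ x := by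
        rw [← d1, ← d2, ← d3]; simp only [L]; ring
      rw [e]
      have c1 : |∫ x, (α s x - α t₀ x) * φ x| ≤ ε / 3 * N2 φ :=
        b1.trans (mul_le_mul_of_nonneg_right n1.le (N2_nonneg _))
      have c2 : |∫ x, (γ s x - γ t₀ x) * deriv φ x| ≤ ε / 3 * N2 (deriv φ) :=
        b2.trans (mul_le_mul_of_nonneg_right n2.le (N2_nonneg _))
      refine ((abs_add_le _ _).trans (add_le_add (abs_add_le _ _) le_rfl)).trans ?_
      have := N2_nonneg φ
      have := N2_nonneg (deriv φ)
      nlinarith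
  have hfin := abs_le_of_test (a := fun x => (y t x - y t₀ x) - (t - t₀) * α t₀ x)
    (b := fun x => -(t - t₀) * β t₀ x) (c := fun x => -(t - t₀) * γ t₀ x)
    (((hy t ht.1).sub (hy t₀ ht₀)).sub (hα0.const_mul _)) ((hβi t₀ ht₀).const_mul _)
    (hγ0.const_mul _) (C := ε * |t - t₀|) (fun φ hφ => ?_) hpq
  · refine (le_of_eq ?_).trans hfin
    have : ∫ x, ((y t x - y t₀ x) - (t - t₀) * α t₀ x) * p x
        = (∫ x, (y t x - y t₀ x) * p x) - (t - t₀) * ∫ x, α t₀ x * p x := by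
      rw [← integral_const_mul, ← integral_sub
        (integrable_mul_L2 (memLp_fsub (hy t ht.1) (hy t₀ ht₀)) hpq.memLp)
        ((integrable_mul_L2 hα0 hpq.memLp).const_mul _)]
      congr 1; funext x; ring
    rw [this]
    simp only [mul_assoc, integral_const_mul]
    congr 1; ring
  · refine (le_of_eq ?_).trans (key φ hφ)
    have : ∫ x, ((y t x - y t₀ x) - (t - t₀) * α t₀ x) * φ x
        = (∫ x, (y t x - y t₀ x) * φ x) - (t - t₀) * ∫ x, α t₀ x * φ x := by
      rw [← integral_const_mul, ← integral_sub
        (integrable_mul_L2 (memLp_fsub (hy t ht.1) (hy t₀ ht₀)) hφ.memLp)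
        ((integrable_mul_L2 hα0 hφ.memLp).const_mul _)]
      congr 1; funext x; ring
    rw [this]
    simp only [mul_assoc, integral_const_mul]
    congr 1; ring

/-- The chain rule for integral functionals of curves in `H¹` with a time derivative in the dual
of `H¹`. -/
theorem hasDerivWithinAt_integral_of_dualDeriv {n : ℕ} {I : Set ℝ} {t₀ : ℝ} (ht₀ : t₀ ∈ I)
    {y y' : Fin n → ℝ → ℝ → ℝ} {ℓ : Fin n → (ℝ → ℝ) → (ℝ → ℝ) → ℝ} {F : ℝ → ℝ → ℝ}
    {p q : Fin n → ℝ → ℝ} {C : ℝ}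
    (hy : ∀ i, ∀ t ∈ I, Sob (y i t) (y' i t))
    (hy0 : ∀ i, TL2 (𝓝[I] t₀) (y i) (y i t₀)) (hy1 : ∀ i, TL2 (𝓝[I] t₀) (y' i) (y' i t₀))
    (hd : ∀ i, DualDeriv I (y i) (ℓ i) t₀)
    (hℓ : ∀ i, ∃ D, ∀ p q, Sob p q → |ℓ i p q| ≤ D * (N2 p + N2 q))
    (hp : ∀ i, Sob (p i) (q i)) (hF : ∀ t ∈ I, Integrable (F t))
    (hT : ∀ᶠ t in 𝓝[I] t₀, ∀ x, |F t x - F t₀ x - ∑ i, p i x * (y i t x - y i t₀ x)|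
      ≤ C * ∑ i, (y i t x - y i t₀ x) ^ 2) :
    HasDerivWithinAt (fun t => ∫ x, F t x) (∑ i, ℓ i (p i) (q i)) I t₀ := by
  choose D hD using hℓ
  rw [hasDerivWithinAt_iff_isLittleO, Asymptotics.isLittleO_iff]
  intro c hc
  set S := ∑ i, (N2 (p i) + N2 (q i)) with hS
  have hS0 : 0 ≤ S := Finset.sum_nonneg fun i _ => add_nonneg (N2_nonneg _) (N2_nonneg _)
  set ε := min 1 (c / (2 * (S + 1))) with hε
  have hε0 : 0 < ε := by positivity
  have hsmall : Tendsto (fun t => ∑ i, |C| * ((|D i| + 1) *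
      (N2 (fun x => y i t x - y i t₀ x) + N2 (fun x => y' i t x - y' i t₀ x)))) (𝓝[I] t₀) (𝓝 0) := by
    have : Tendsto (fun t => ∑ i : Fin n, |C| * ((|D i| + 1) *
      (N2 (fun x => y i t x - y i t₀ x) + N2 (fun x => y' i t x - y' i t₀ x)))) (𝓝[I] t₀)
      (𝓝 (∑ i : Fin n, |C| * ((|D i| + 1) * (0 + 0)))) :=
      tendsto_finsetSum _ fun i _ => (((hy0 i).tendsto.add (hy1 i).tendsto).const_mul _).const_mul _
    simpa using this
  filter_upwards [hT, self_mem_nhdsWithin, eventually_all.2 fun i => hd i ε hε0,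
    hsmall.eventually (gt_mem_nhds (half_pos hc))] with t h1 h2 h3 h4
  have hsob : ∀ i, Sob (fun x => y i t x - y i t₀ x) (fun x => y' i t x - y' i t₀ x) :=
    fun i => (hy i t h2).sub (hy i t₀ ht₀)
  set R : ℝ → ℝ := fun x => F t x - F t₀ x - ∑ i, p i x * (y i t x - y i t₀ x)
  have hpi : ∀ i, Integrable (fun x => p i x * (y i t x - y i t₀ x)) := fun i =>
    integrable_mul_L2 (hp i).memLp (hsob i).memLp
  have hsum : Integrable (fun x => ∑ i, p i x * (y i t x - y i t₀ x)) :=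
    integrable_finsetSum _ fun i _ => hpi i
  have hR : ∫ x, R x = (∫ x, F t x) - (∫ x, F t₀ x) - ∑ i, ∫ x, (y i t x - y i t₀ x) * p i x := by
    simp only [R]
    rw [integral_sub (integrable_fsub (hF t h2) (hF t₀ ht₀)) hsum, integral_sub (hF t h2) (hF t₀ ht₀),
      integral_finsetSum _ fun i _ => hpi i]
    simp only [mul_comm]
  have hsq : ∀ i, ∫ x, (y i t x - y i t₀ x) ^ 2 ≤ |t - t₀| * ((|D i| + 1) *
      (N2 (fun x => y i t x - y i t₀ x) + N2 (fun x => y' i t x - y' i t₀ x))) := fun i => by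
    have a := h3 i _ _ (hsob i)
    have b := hD i _ _ (hsob i)
    have hn := add_nonneg (N2_nonneg fun x => y i t x - y i t₀ x)
      (N2_nonneg fun x => y' i t x - y' i t₀ x)
    set M := N2 (fun x => y i t x - y i t₀ x) + N2 (fun x => y' i t x - y' i t₀ x)
    have e : ∫ x, (y i t x - y i t₀ x) ^ 2 = ∫ x, (y i t x - y i t₀ x) * (y i t x - y i t₀ x) := by
      simp only [sq]
    rw [e]
    have a' := (abs_le.1 a).2
    have b' : (t - t₀) * ℓ i (fun x => y i t x - y i t₀ x) (fun x => y' i t x - y' i t₀ x)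
        ≤ |t - t₀| * (|D i| * M) := by
      refine (le_abs_self _).trans ?_
      rw [abs_mul]
      refine mul_le_mul_of_nonneg_left (b.trans ?_) (abs_nonneg _)
      exact mul_le_mul_of_nonneg_right (le_abs_self _) hn
    have c' : ε * |t - t₀| * M ≤ 1 * |t - t₀| * M := by
      have : ε ≤ 1 := min_le_left _ _
      gcongr
    nlinarith
  have hRle : |∫ x, R x| ≤ |t - t₀| * (c / 2) := by
    refine abs_integral_le_integral_abs.trans ?_
    have hI2 : Integrable (fun x => |C| * ∑ i, (y i t x - y i t₀ x) ^ 2) :=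
      (integrable_finsetSum _ fun i _ => (hsob i).memLp.integrable_sq).const_mul _
    have a : ∫ x, |R x| ≤ ∫ x, |C| * ∑ i, (y i t x - y i t₀ x) ^ 2 := by
      refine integral_mono_of_nonneg (.of_forall fun _ => abs_nonneg _) hI2
        (.of_forall fun x => (h1 x).trans ?_)
      exact mul_le_mul_of_nonneg_right (le_abs_self _) (Finset.sum_nonneg fun i _ => sq_nonneg _)
    refine a.trans ?_
    rw [integral_const_mul, integral_finsetSum _ fun i _ => (hsob i).memLp.integrable_sq,
      Finset.mul_sum]
    have b : ∑ i, |C| * ∫ x, (y i t x - y i t₀ x) ^ 2 ≤ ∑ i, |t - t₀| * (|C| * ((|D i| + 1) *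
      (N2 (fun x => y i t x - y i t₀ x) + N2 (fun x => y' i t x - y' i t₀ x)))) := by
      refine Finset.sum_le_sum fun i _ => ?_
      have := mul_le_mul_of_nonneg_left (hsq i) (abs_nonneg C)
      linarith
    refine b.trans ?_
    rw [← Finset.mul_sum]
    exact mul_le_mul_of_nonneg_left h4.le (abs_nonneg _)
  have hlin : |(∑ i, ∫ x, (y i t x - y i t₀ x) * p i x) - (t - t₀) * ∑ i, ℓ i (p i) (q i)|
      ≤ |t - t₀| * (c / 2) := by
    rw [Finset.mul_sum, ← Finset.sum_sub_distrib]
    refine (Finset.abs_sum_le_sum_abs _ _).trans ?_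
    refine (Finset.sum_le_sum fun i _ => h3 i _ _ (hp i)).trans ?_
    rw [← Finset.mul_sum]
    have : ε * S ≤ c / 2 := by
      have h5 : ε ≤ c / (2 * (S + 1)) := min_le_right _ _
      have h6 : ε * (2 * (S + 1)) ≤ c := (le_div_iff₀ (by positivity)).1 h5
      nlinarith
    have := mul_le_mul_of_nonneg_left this (abs_nonneg (t - t₀))
    rw [← hS]; linarith
  rw [smul_eq_mul, Real.norm_eq_abs, Real.norm_eq_abs]
  have e : (∫ x, F t x) - (∫ x, F t₀ x) - (t - t₀) * ∑ i, ℓ i (p i) (q i)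
      = (∫ x, R x) + ((∑ i, ∫ x, (y i t x - y i t₀ x) * p i x) - (t - t₀) * ∑ i, ℓ i (p i) (q i)) := by
    rw [hR]; ring
  rw [e]
  refine (abs_add_le _ _).trans ?_
  linarith

/-- A limit of differentiable functions, the derivatives being equicontinuous at a point. -/
theorem hasDerivWithinAt_of_tendsto {I : Set ℝ} (hI : Convex ℝ I) {t₀ : ℝ} (ht₀ : t₀ ∈ I)
    {f : ℝ → ℝ} {F D : ℝ → ℝ → ℝ} {d : ℝ}
    (hd : ∀ h > 0, ∀ t ∈ I, HasDerivWithinAt (F h) (D h t) I t)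
    (hf : ∀ t ∈ I, Tendsto (fun h => F h t) (𝓝[>] 0) (𝓝 (f t)))
    (hD : Tendsto (fun i : ℝ × ℝ => D i.1 i.2) (𝓝[>] 0 ×ˢ 𝓝[I] t₀) (𝓝 d)) :
    HasDerivWithinAt f d I t₀ := by
  rw [hasDerivWithinAt_iff_isLittleO, Asymptotics.isLittleO_iff]
  intro c hc
  have h1 := hD.eventually (Metric.closedBall_mem_nhds d hc)
  obtain ⟨p, hp, q, hq, hpq⟩ := eventually_prod_iff.1 h1
  obtain ⟨δ, hδ, hball⟩ := Metric.mem_nhdsWithin_iff.1 hq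
  filter_upwards [inter_mem_nhdsWithin I (Metric.ball_mem_nhds t₀ hδ)] with t ht
  have hJ : Convex ℝ (I ∩ Metric.ball t₀ δ) := hI.inter (convex_ball _ _)
  have key : ∀ᶠ h in 𝓝[>] (0 : ℝ), |F h t - F h t₀ - (t - t₀) * d| ≤ c * |t - t₀| := by
    filter_upwards [hp, self_mem_nhdsWithin] with h hh hpos
    have hb := Convex.norm_image_sub_le_of_norm_hasDerivWithin_le (𝕜 := ℝ)
      (s := I ∩ Metric.ball t₀ δ) (f := fun t => F h t - t * d)
      (f' := fun t => D h t - 1 * d) (C := c)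
      (fun s hs => ((hd h hpos s hs.1).mono inter_subset_left).sub
        ((hasDerivWithinAt_id _ _).mul_const _)) (fun s hs => ?_) hJ
      ⟨ht₀, Metric.mem_ball_self hδ⟩ ht
    · rw [Real.norm_eq_abs, Real.norm_eq_abs] at hb
      refine (le_of_eq ?_).trans hb
      congr 1; ring
    · have := hpq hh (hball ⟨hs.2, hs.1⟩)
      rw [one_mul, ← dist_eq_norm]
      exact this
  have hlim : Tendsto (fun h => |F h t - F h t₀ - (t - t₀) * d|) (𝓝[>] 0)
      (𝓝 |f t - f t₀ - (t - t₀) * d|) :=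
    (((hf t ht.1).sub (hf t₀ ht₀)).sub_const _).abs
  rw [smul_eq_mul, Real.norm_eq_abs, Real.norm_eq_abs]
  exact le_of_tendsto hlim key

section

variable {ι : Type*} {l : Filter ι}

theorem TL2.shift_const {f : ι → ℝ → ℝ} {g : ℝ → ℝ} (k : TL2 l f g) (h : ℝ) :
    TL2 l (fun i x => f i (x + h)) (fun x => g (x + h)) := by
  refine ⟨by filter_upwards [k.1] with i a using a.shift h, k.2.shift h, k.tendsto.congr' ?_⟩
  filter_upwards [k.1] with i a
  exact (N2_shift (f := fun x => f i x - g x) (memLp_fsub a k.2).1 h).symm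

theorem TL2.integral_abs_mul_sub {f p : ι → ℝ → ℝ} {g q : ℝ → ℝ} (h : TL2 l f g) (k : TL2 l p q) :
    Tendsto (fun i => ∫ x, |f i x * p i x - g x * q x|) l (𝓝 0) := by
  refine squeeze_zero' (.of_forall fun _ => integral_nonneg fun _ => abs_nonneg _)
    (g := fun i => N2 (fun x => f i x - g x) * (N2 q + 1) + N2 g * N2 (fun x => p i x - q x)) ?_ ?_
  · filter_upwards [h.1, k.1, k.eventually_N2_le] with i a b c
    have m1 := memLp_fsub a h.2
    have m2 := memLp_fsub b k.2
    have i1 := (integrable_mul_L2 m1 b).abs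
    have i2 := (integrable_mul_L2 h.2 m2).abs
    have e : ∫ x, |f i x * p i x - g x * q x|
        ≤ ∫ x, (|(f i x - g x) * p i x| + |g x * (p i x - q x)|) := by
      refine integral_mono_of_nonneg (.of_forall fun _ => abs_nonneg _) (i1.add i2)
        (.of_forall fun x => ?_)
      simp only
      rw [show f i x * p i x - g x * q x = (f i x - g x) * p i x + g x * (p i x - q x) by ring]
      exact abs_add_le _ _
    rw [integral_add i1 i2] at e
    refine e.trans (add_le_add ((integral_abs_mul_le m1 b).trans
      (mul_le_mul_of_nonneg_left c (N2_nonneg _))) (integral_abs_mul_le h.2 m2))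
  · simpa using (h.tendsto.mul_const (N2 q + 1)).add (k.tendsto.const_mul (N2 g))

theorem IsTest.shift {φ : ℝ → ℝ} (hφ : IsTest φ) (h : ℝ) : IsTest fun x => φ (x + h) :=
  ⟨hφ.1.comp (contDiff_id.add contDiff_const),
    hφ.2.comp_homeomorph (Homeomorph.addRight h)⟩

theorem deriv_shift (φ : ℝ → ℝ) (h x : ℝ) : deriv (fun x => φ (x + h)) x = deriv φ (x + h) :=
  deriv_comp_add_const (f := φ) h x

theorem integral_shift_mul (f g : ℝ → ℝ) (h : ℝ) :
    ∫ x, f (x + h) * g x = ∫ x, f x * g (x + -h) := by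
  rw [← integral_add_right_eq_self (fun x => f x * g (x + -h)) h]
  congr 1; funext x; simp

theorem IsTest.exists_incr {φ : ℝ → ℝ} (hφ : IsTest φ) (h : ℝ) :
    ∃ Φ : ℝ → ℝ, IsTest Φ ∧ _root_.deriv Φ = fun x => φ x - φ (x + -h) :=
  (hφ.sub (hφ.shift (-h))).exists_antideriv (by
    rw [integral_sub hφ.integrable (hφ.shift _).integrable,
      integral_add_right_eq_self (fun x => φ x), sub_self])

theorem integral_incr_mul {v φ Φ : ℝ → ℝ} (hv : MemLp v 2) {h : ℝ}
    (hφ : IsTest φ) (hΦ : IsTest Φ) (hd : deriv Φ = fun x => φ x - φ (x + -h)) :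
    ∫ x, incr h v x * φ x = ∫ x, v x * Φ x := by
  set V : ℝ → ℝ := fun x => ∫ y in (0 : ℝ)..x, v y
  have hi := hv.intervalIntegrable
  have hV : LocAC V := locAC_of_ftc hi fun a b => by
    have := intervalIntegral.integral_add_adjacent_intervals (hi 0 a) (hi a b)
    simp only [V]; linarith
  have hVd : ∀ᵐ x, HasDerivAt V (v x) x := by
    filter_upwards [LocallyIntegrable.ae_hasDerivAt_integral (hv.locallyIntegrable (by norm_num))] with x hx
    exact hx 0
  have h1 := integral_mul_deriv_test_of_locAC hV hVd hΦ
  rw [hd] at h1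
  have hVl := hV.continuous.locallyIntegrable (μ := volume)
  have hVl' := (hV.shift h).continuous.locallyIntegrable (μ := volume)
  have h2 : ∫ x, incr h v x * φ x = (∫ x, V (x + h) * φ x) - ∫ x, V x * φ x := by
    rw [← integral_sub (integrable_loc_mul_test hVl' hφ)
      (integrable_loc_mul_test hVl hφ)]
    congr 1; funext x
    have := intervalIntegral.integral_add_adjacent_intervals (hi 0 x) (hi x (x + h))
    simp only [V, incr, ← this]; ring
  have h3 : ∫ x, V x * (φ x - φ (x + -h)) = (∫ x, V x * φ x) - ∫ x, V x * φ (x + -h) := by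
    rw [← integral_sub (integrable_loc_mul_test hVl hφ)
      (integrable_loc_mul_test hVl (hφ.shift _))]
    simp only [mul_sub]
  rw [h2, integral_shift_mul]
  linarith

/-! ### The equations for weak solutions -/

/-- The flux `-2(1-η)v` of the mass. -/
def massFlux (u : XSpace) (x : ℝ) : ℝ := -2 * ((1 - etaC u x) * vel u x)

/-- The quantity `(∂ₓη)² / (4(1-η)²) - v²`. -/
def quadFlux (u : XSpace) (x : ℝ) : ℝ := slope u x * slope u x - vel u x * vel u x

theorem tL2_massFlux {U : ι → XSpace} {u : XSpace} (h : Tendsto U l (𝓝 u)) :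
    TL2 l (fun i => massFlux (U i)) (massFlux u) :=
  (TU.const aestronglyMeasurable_const (C := |-2|) (b := fun _ : ℝ => (-2 : ℝ))
    (fun _ => le_rfl)).mul_TL2 ((tU_one_sub h).mul_TL2 (tL2_vel h))

theorem memLp_massFlux (u : XSpace) : MemLp (massFlux u) 2 :=
  (tL2_massFlux (l := (pure u : Filter XSpace)) (U := id) (by simpa using tendsto_pure_nhds id u)).2

theorem integrable_quadFlux {u : XSpace} (hu : u ∈ NV) : Integrable (quadFlux u) :=
  integrable_fsub (integrable_mul_L2 (memLp_slope hu) (memLp_slope hu))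
    (integrable_mul_L2 (memLp_vel u) (memLp_vel u))

theorem tendsto_quadFlux {U : ι → XSpace} {u : XSpace} (h : Tendsto U l (𝓝 u)) (hu : u ∈ NV) :
    Tendsto (fun i => ∫ x, |quadFlux (U i) x - quadFlux u x|) l (𝓝 0) := by
  have h1 := (tL2_slope h hu).integral_abs_mul_sub (tL2_slope h hu)
  have h2 := (tL2_vel h).integral_abs_mul_sub (tL2_vel h)
  have h3 := h1.add h2
  rw [add_zero] at h3
  refine squeeze_zero' (.of_forall fun _ => integral_nonneg fun _ => abs_nonneg _) ?_ h3
  filter_upwards [(tL2_slope h hu).1] with i a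
  have i1 := (integrable_fsub (integrable_mul_L2 a a)
    (integrable_mul_L2 (memLp_slope hu) (memLp_slope hu))).abs
  have i2 := (integrable_fsub (integrable_mul_L2 (memLp_vel (U i)) (memLp_vel (U i)))
    (integrable_mul_L2 (memLp_vel u) (memLp_vel u))).abs
  rw [← integral_add i1 i2]
  refine integral_mono_of_nonneg (.of_forall fun _ => abs_nonneg _) (i1.add i2)
        (.of_forall fun x => ?_)
  simp only [quadFlux]
  refine le_trans (le_of_eq ?_) (abs_sub _ _)
  congr 1; ring

namespace IsHGPSolution

variable {T : ℝ} {u : ℝ → XSpace} (hu : IsHGPSolution T u)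
include hu

theorem tendsto {t : ℝ} (ht : t ∈ Icc 0 T) : Tendsto u (𝓝[Icc 0 T] t) (𝓝 (u t)) :=
  hu.continuousOn t ht

theorem hasDerivWithinAt_eta {φ : ℝ → ℝ} (hφ : IsTest φ) {t : ℝ} (ht : t ∈ Icc 0 T) :
    HasDerivWithinAt (fun s => ∫ x, etaC (u s) x * φ x) (∫ x, massFlux (u t) x * deriv φ x)
      (Icc 0 T) t := by
  have h1 := hu.eq_eta φ hφ t ht
  have e1 : ∀ s, ∫ x, etaC (u s) x * φ x = ∫ x, eta (u s) x * φ x := fun s =>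
    integral_congr_ae (by filter_upwards [etaC_ae (u s)] with x hx; rw [hx])
  simp only [e1]
  convert! h1 using 1
  rw [← integral_neg]
  refine integral_congr_ae ?_
  filter_upwards [etaC_ae (u t)] with x hx
  simp only [massFlux, hx]; ring

theorem hasDerivWithinAt_vel {φ : ℝ → ℝ} (hφ : IsTest φ) {t : ℝ} (ht : t ∈ Icc 0 T) :
    HasDerivWithinAt (fun s => ∫ x, vel (u s) x * φ x)
      (-(∫ x, etaC (u t) x * deriv φ x) - (∫ x, quadFlux (u t) x * deriv φ x)
        - ∫ x, slope (u t) x * deriv (deriv φ) x) (Icc 0 T) t := by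
  convert! hu.eq_vel φ hφ t ht using 1
  have hb : Integrable (fun x => quadFlux (u t) x * deriv φ x) :=
    (integrable_quadFlux (hu.mem_NV t ht)).mul_bdd (c := N2 (deriv φ) + N2 (deriv (deriv φ)))
      hφ.deriv.1.continuous.aestronglyMeasurable (.of_forall hφ.deriv.sob.abs_le)
  rw [← neg_add', ← integral_add (integrable_mul_L2 (memLp_etaC _) hφ.deriv.memLp) hb]
  congr 1
  · congr 1
    refine integral_congr_ae ?_
    filter_upwards [etaC_ae (u t)] with x hx
    simp only [quadFlux, slope, hx]
    rw [show etaX (u t) x ^ 2 / (4 * (1 - eta (u t) x) ^ 2)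
      = (etaX (u t) x / (2 * (1 - eta (u t) x))) * (etaX (u t) x / (2 * (1 - eta (u t) x))) by
        rw [div_mul_div_comm]; congr 1 <;> ring]
    ring
  · refine integral_congr_ae ?_
    filter_upwards [etaC_ae (u t)] with x hx
    simp only [slope, hx]

theorem dualDeriv_etaC {t : ℝ} (ht : t ∈ Icc 0 T) :
    DualDeriv (Icc 0 T) (fun t => etaC (u t)) (fun _ q => ∫ x, massFlux (u t) x * q x) t := by
  have := dualDeriv_of_test (convex_Icc 0 T) ht (y := fun t => etaC (u t)) (α := fun _ _ => 0)
    (β := fun _ _ => 0) (γ := fun t => massFlux (u t)) (fun t _ => memLp_etaC _)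
    (TL2.const MemLp.zero) (tL2_massFlux (hu.tendsto ht)) (fun _ _ => integrable_zero _ _ _)
    (by simpa using tendsto_const_nhds) (fun φ hφ t ht => by simpa using hu.hasDerivWithinAt_eta hφ ht)
  simpa using this

theorem dualDeriv_etaC_shift {t : ℝ} (ht : t ∈ Icc 0 T) (h : ℝ) :
    DualDeriv (Icc 0 T) (fun t x => etaC (u t) (x + h))
      (fun _ q => ∫ x, massFlux (u t) (x + h) * q x) t := by
  have := dualDeriv_of_test (convex_Icc 0 T) ht (y := fun t x => etaC (u t) (x + h))
    (α := fun _ _ => 0)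
    (β := fun _ _ => 0) (γ := fun t x => massFlux (u t) (x + h)) (fun t _ => (memLp_etaC _).shift h)
    (TL2.const MemLp.zero) ((tL2_massFlux (hu.tendsto ht)).shift_const h)
    (fun _ _ => integrable_zero _ _ _)
    (by simpa using tendsto_const_nhds) (fun φ hφ t ht => by
      have := hu.hasDerivWithinAt_eta (hφ.shift (-h)) ht
      simp only [deriv_shift] at this
      simpa [integral_shift_mul] using this)
  simpa using this

theorem dualDeriv_incr {t : ℝ} (ht : t ∈ Icc 0 T) {h : ℝ} (hh : 0 ≤ h) :
    DualDeriv (Icc 0 T) (fun t => incr h (vel (u t)))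
      (fun p q => (∫ x, (etaC (u t) (x + h) - etaC (u t) x) * p x)
        + (∫ x, (quadFlux (u t) (x + h) - quadFlux (u t) x) * p x)
        + ∫ x, (slope (u t) (x + h) - slope (u t) x) * q x) t := by
  have hq : ∀ t ∈ Icc 0 T, Integrable (fun x => quadFlux (u t) (x + h) - quadFlux (u t) x) :=
    fun t ht => integrable_fsub ((integrable_quadFlux (hu.mem_NV t ht)).comp_add_right h)
      (integrable_quadFlux (hu.mem_NV t ht))
  refine dualDeriv_of_test (convex_Icc 0 T) ht (y := fun t => incr h (vel (u t)))
    (α := fun t x => etaC (u t) (x + h) - etaC (u t) x)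
    (β := fun t x => quadFlux (u t) (x + h) - quadFlux (u t) x)
    (γ := fun t x => slope (u t) (x + h) - slope (u t) x)
    (fun t _ => (memLp_incr (memLp_vel _) hh).1)
    (((tL2_etaC (hu.tendsto ht)).shift_const h).sub (tL2_etaC (hu.tendsto ht)))
    (((tL2_slope (hu.tendsto ht) (hu.mem_NV t ht)).shift_const h).sub
      (tL2_slope (hu.tendsto ht) (hu.mem_NV t ht))) hq ?_ ?_
  · have h1 := tendsto_quadFlux (hu.tendsto ht) (hu.mem_NV t ht)
    have h2 := h1.add h1
    rw [add_zero] at h2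
    refine squeeze_zero' (.of_forall fun _ => integral_nonneg fun _ => abs_nonneg _) ?_ h2
    filter_upwards [self_mem_nhdsWithin] with s hs
    have i1 := (integrable_fsub (integrable_quadFlux (hu.mem_NV s hs))
      (integrable_quadFlux (hu.mem_NV t ht))).abs
    have i2 := i1.comp_add_right h
    nth_rw 1 [← integral_add_right_eq_self (fun x => |quadFlux (u s) x - quadFlux (u t) x|) h]
    rw [← integral_add i2 i1]
    refine integral_mono_of_nonneg (.of_forall fun _ => abs_nonneg _) (i2.add i1)
        (.of_forall fun x => ?_)
    refine le_trans (le_of_eq ?_) (abs_sub _ _)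
    ring_nf
  · intro φ hφ s hs
    obtain ⟨Φ, hΦ, hd⟩ := hφ.exists_incr h
    have h1 := hu.hasDerivWithinAt_vel hΦ hs
    have e : ∀ s, ∫ x, incr h (vel (u s)) x * φ x = ∫ x, vel (u s) x * Φ x :=
      fun s => integral_incr_mul (memLp_vel _) hφ hΦ hd
    simp only [e]
    convert! h1 using 1
    have hd2 : deriv (deriv Φ) = fun x => deriv φ x - deriv φ (x + -h) := by
      rw [hd]; funext x
      refine ((hφ.hasDerivAt x).sub ((hφ.shift (-h)).hasDerivAt x)).deriv.trans ?_
      rw [deriv_shift]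
    have key : ∀ {f ψ : ℝ → ℝ}, LocallyIntegrable f → IsTest ψ →
        ∫ x, (f (x + h) - f x) * ψ x = -∫ x, f x * (ψ x - ψ (x + -h)) := by
      intro f ψ hf hψ
      have i1 := integrable_loc_mul_test hf hψ
      have i2 := integrable_loc_mul_test hf (hψ.shift (-h))
      have i3 : Integrable (fun x => f (x + h) * ψ x) := by
        have := i2.comp_add_right h
        simpa using this
      simp only [sub_mul, mul_sub]
      rw [integral_sub i3 i1, integral_sub i1 i2, integral_shift_mul]
      ring
    rw [hd2, hd, key ((memLp_etaC _).locallyIntegrable (by norm_num)) hφ,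
      key (integrable_quadFlux (hu.mem_NV s hs)).locallyIntegrable hφ,
      key ((memLp_slope (hu.mem_NV s hs)).locallyIntegrable (by norm_num)) hφ.deriv]
    ring

end IsHGPSolution

end

/-! ### Locally absolutely continuous functions with their derivative -/

/-- `f` is locally absolutely continuous, with derivative `g` almost everywhere. -/
structure ACD (f g : ℝ → ℝ) : Prop where
  locAC : LocAC f
  ae : ∀ᵐ x, HasDerivAt f (g x) x

theorem Sob.acd {f g : ℝ → ℝ} (h : Sob f g) : ACD f g := ⟨h.locAC, h.hasDerivAt_ae⟩

theorem ACD.sob {f g : ℝ → ℝ} (h : ACD f g) (hf : MemLp f 2) (hg : MemLp g 2) :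
    Sob f g := h.locAC.sob h.ae hf hg

theorem ACD.const (c : ℝ) : ACD (fun _ => c) fun _ => 0 :=
  ⟨.const c, .of_forall fun x => hasDerivAt_const x c⟩

theorem ACD.add {f g p q : ℝ → ℝ} (h : ACD f g) (k : ACD p q) :
    ACD (fun x => f x + p x) fun x => g x + q x :=
  ⟨h.1.add k.1, by filter_upwards [h.2, k.2] with x a b using a.add b⟩

theorem ACD.mul {f g p q : ℝ → ℝ} (h : ACD f g) (k : ACD p q) :
    ACD (fun x => f x * p x) fun x => g x * p x + f x * q x :=
  ⟨h.1.mul k.1, by filter_upwards [h.2, k.2] with x a b using a.mul b⟩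

theorem ACD.congr' {f g g' : ℝ → ℝ} (h : ACD f g) (e : ∀ x, g x = g' x) : ACD f g' := by
  rwa [← funext e]

theorem ACD.shift {f g : ℝ → ℝ} (h : ACD f g) (a : ℝ) :
    ACD (fun x => f (x + a)) fun x => g (x + a) :=
  ⟨h.1.shift a, by filter_upwards [ae_shift h.2 a] with x hx using hx.comp_add_const x a⟩

theorem ACD.of_hasDerivAt {f g : ℝ → ℝ} (h : ∀ x, HasDerivAt f (g x) x) (hg : Continuous g) :
    ACD f g := by
  refine ⟨.of_contDiff (contDiff_one_iff_deriv.2 ⟨fun x => (h x).differentiableAt, ?_⟩),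
    .of_forall h⟩
  rwa [funext fun x => (h x).deriv]

theorem ACD.comp {f g F F' : ℝ → ℝ} (h : ACD f g) {s : Set ℝ} (hs : Convex ℝ s) {K : ℝ}
    (hK : ∀ y ∈ s, |F' y| ≤ K) (hF : ∀ y ∈ s, HasDerivAt F (F' y) y) (hf : ∀ x, f x ∈ s) :
    ACD (fun x => F (f x)) fun x => F' (f x) * g x := by
  refine ⟨h.1.comp_lipschitz (K := K.toNNReal) (s := s)
    (hs.lipschitzOnWith_of_nnnorm_hasDerivWithin_le (fun y hy => (hF y hy).hasDerivWithinAt)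
      fun y hy => ?_) hf, ?_⟩
  · rw [← NNReal.coe_le_coe, coe_nnnorm, Real.norm_eq_abs]
    exact (hK y hy).trans (Real.le_coe_toNNReal K)
  · filter_upwards [h.2] with x hx using (hF _ (hf x)).comp x hx

/-! ### Bounded measurable functions -/

/-- Bounded measurable functions. -/
structure Bdd (b : ℝ → ℝ) : Prop where
  meas : AEStronglyMeasurable b
  bound : ∃ C, ∀ x, |b x| ≤ C

theorem Bdd.const (c : ℝ) : Bdd fun _ => c := ⟨aestronglyMeasurable_const, |c|, fun _ => le_rfl⟩

theorem Bdd.sub {b c : ℝ → ℝ} (hb : Bdd b) (hc : Bdd c) : Bdd fun x => b x - c x := by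
  obtain ⟨C, hC⟩ := hb.2
  obtain ⟨D, hD⟩ := hc.2
  exact ⟨hb.1.sub hc.1, C + D, fun x => (abs_sub _ _).trans (add_le_add (hC x) (hD x))⟩

theorem Bdd.mul {b c : ℝ → ℝ} (hb : Bdd b) (hc : Bdd c) : Bdd fun x => b x * c x := by
  obtain ⟨C, hC⟩ := hb.2
  obtain ⟨D, hD⟩ := hc.2
  refine ⟨hb.1.mul hc.1, C * D, fun x => ?_⟩
  rw [abs_mul]
  exact mul_le_mul (hC x) (hD x) (abs_nonneg _) ((abs_nonneg _).trans (hC x))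

theorem Bdd.shift {b : ℝ → ℝ} (hb : Bdd b) (h : ℝ) : Bdd fun x => b (x + h) := by
  obtain ⟨C, hC⟩ := hb.2
  exact ⟨hb.1.comp_measurePreserving (measurePreserving_add_right volume h), C, fun x => hC _⟩

theorem Bdd.mul_L2 {b f : ℝ → ℝ} (hb : Bdd b) (hf : MemLp f 2) :
    MemLp (fun x => b x * f x) 2 := by
  obtain ⟨C, hC⟩ := hb.2
  exact memLp_bdd_mul hf hb.1 C (.of_forall hC)

theorem Bdd.integrable_mul {b f : ℝ → ℝ} (hb : Bdd b) (hf : Integrable f) :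
    Integrable (fun x => b x * f x) := by
  obtain ⟨C, hC⟩ := hb.2
  exact hf.bdd_mul hb.1 (.of_forall hC)

theorem memLp_of_abs_le {f g : ℝ → ℝ} (hf : AEStronglyMeasurable f) (hg : MemLp g 2)
    {C : ℝ} (h : ∀ x, |f x| ≤ C * |g x|) : MemLp f 2 :=
  hg.of_le_mul (c := C) hf (.of_forall h)

/-! ### Products of second-order expansions -/

/-- `λ` approximates `z - z₀` up to `O(q)`, with `(z - z₀)² = O(q)` and `z`, `z₀` bounded. -/
structure Expand (K q z z₀ lam : ℝ) : Prop where
  lin : |z - z₀ - lam| ≤ K * q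
  sq : (z - z₀) ^ 2 ≤ K * q
  bd : |z| ≤ K
  bd₀ : |z₀| ≤ K

theorem Expand.mul {K q z z₀ lam w w₀ mu : ℝ} (hK : 1 ≤ K) (hq : 0 ≤ q) (h : Expand K q z z₀ lam)
    (k : Expand K q w w₀ mu) : Expand (4 * K ^ 3) q (z * w) (z₀ * w₀) (z₀ * mu + w₀ * lam) := by
  have hK2 : K ^ 2 ≤ 4 * K ^ 3 := by nlinarith [mul_nonneg (sq_nonneg K) (show 0 ≤ K - 1 by linarith)]
  have hz2 : z ^ 2 ≤ K ^ 2 := by rw [← sq_abs]; gcongr; exact h.bd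
  have hw2 : w₀ ^ 2 ≤ K ^ 2 := by rw [← sq_abs]; gcongr; exact k.bd₀
  have hKq : 0 ≤ K * q := by positivity
  have bd : ∀ {a b : ℝ}, |a| ≤ K → |b| ≤ K → |a * b| ≤ 4 * K ^ 3 := fun ha hb => by
    rw [abs_mul]
    refine (mul_le_mul ha hb (abs_nonneg _) (by linarith)).trans ?_
    linarith [pow_two K]
  refine ⟨?_, ?_, bd h.bd k.bd, bd h.bd₀ k.bd₀⟩
  · have e : z * w - z₀ * w₀ - (z₀ * mu + w₀ * lam)
        = z₀ * (w - w₀ - mu) + w₀ * (z - z₀ - lam) + (z - z₀) * (w - w₀) := by ring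
    rw [e]
    have a1 : |z₀ * (w - w₀ - mu)| ≤ K * (K * q) := by
      rw [abs_mul]; exact mul_le_mul h.bd₀ k.lin (abs_nonneg _) (by linarith)
    have a2 : |w₀ * (z - z₀ - lam)| ≤ K * (K * q) := by
      rw [abs_mul]; exact mul_le_mul k.bd₀ h.lin (abs_nonneg _) (by linarith)
    have a3 : |(z - z₀) * (w - w₀)| ≤ K * q := by
      rw [abs_le]; constructor <;> nlinarith [sq_nonneg (z - z₀ + (w - w₀)),
        sq_nonneg (z - z₀ - (w - w₀)), h.sq, k.sq]
    refine ((abs_add_le _ _).trans (add_le_add (abs_add_le _ _) le_rfl)).trans ?_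
    have : 3 * K ^ 2 ≤ 4 * K ^ 3 := by
      nlinarith [mul_nonneg (sq_nonneg K) (show 0 ≤ K - 1 by linarith)]
    nlinarith
  · have e : (z * w - z₀ * w₀) ^ 2 ≤ 2 * (z ^ 2 * (w - w₀) ^ 2) + 2 * (w₀ ^ 2 * (z - z₀) ^ 2) := by
      nlinarith [sq_nonneg (z * (w - w₀) - w₀ * (z - z₀))]
    have a1 : z ^ 2 * (w - w₀) ^ 2 ≤ K ^ 2 * (K * q) := by
      exact mul_le_mul hz2 k.sq (sq_nonneg _) (sq_nonneg _)
    have a2 : w₀ ^ 2 * (z - z₀) ^ 2 ≤ K ^ 2 * (K * q) := by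
      exact mul_le_mul hw2 h.sq (sq_nonneg _) (sq_nonneg _)
    nlinarith

theorem Expand.mono {K K' q z z₀ lam : ℝ} (h : Expand K q z z₀ lam) (hK : K ≤ K') (hq : 0 ≤ q) :
    Expand K' q z z₀ lam :=
  ⟨h.1.trans (by gcongr), h.2.trans (by gcongr), h.3.trans hK, h.4.trans hK⟩

theorem expand_sqrt {δ B a a₀ q : ℝ} (hδ : 0 < δ) (hδ1 : δ ≤ 1) (ha : δ ^ 2 ≤ 1 - a)
    (ha₀ : δ ^ 2 ≤ 1 - a₀) (hB : 1 - a ≤ B ^ 2) (hB₀ : 1 - a₀ ≤ B ^ 2) (hB1 : 0 ≤ B)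
    (hq : (a - a₀) ^ 2 ≤ q) :
    Expand (B + 1 / δ ^ 3) q (√(1 - a)) (√(1 - a₀)) (-(1 / 2) * (√(1 - a₀))⁻¹ * (a - a₀)) := by
  have hr : δ ≤ √(1 - a) := Real.le_sqrt_of_sq_le ha
  have hr₀ : δ ≤ √(1 - a₀) := Real.le_sqrt_of_sq_le ha₀
  have e : √(1 - a) ^ 2 = 1 - a := Real.sq_sqrt (by nlinarith [sq_nonneg δ])
  have e₀ : √(1 - a₀) ^ 2 = 1 - a₀ := Real.sq_sqrt (by nlinarith [sq_nonneg δ])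
  have b : √(1 - a) ≤ B := Real.sqrt_le_iff.2 ⟨hB1, hB⟩
  have b₀ : √(1 - a₀) ≤ B := Real.sqrt_le_iff.2 ⟨hB1, hB₀⟩
  set r := √(1 - a)
  set r₀ := √(1 - a₀)
  have hrp : 0 < r := hδ.trans_le hr
  have hrp₀ : 0 < r₀ := hδ.trans_le hr₀
  have hd : a - a₀ = -(r - r₀) * (r + r₀) := by nlinarith
  have hpos : 0 < 1 / δ ^ 3 := by positivity
  have hq0 : 0 ≤ q := (sq_nonneg _).trans hq
  have hδ3 : δ ^ 3 ≤ 1 := pow_le_one₀ hδ.le hδ1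
  have h1 : (r - r₀) ^ 2 * δ ^ 2 * 4 ≤ q := by
    refine le_trans ?_ hq
    rw [hd]
    have : (2 * δ) ^ 2 ≤ (r + r₀) ^ 2 := by gcongr; linarith
    nlinarith [sq_nonneg (r - r₀)]
  have h2 : (r - r₀) ^ 2 ≤ q * (1 / δ ^ 3) := by
    rw [mul_one_div, le_div_iff₀ (by positivity)]
    have : (r - r₀) ^ 2 * δ ^ 3 ≤ (r - r₀) ^ 2 * δ ^ 2 * 1 := by
      rw [show (r - r₀) ^ 2 * δ ^ 3 = (r - r₀) ^ 2 * δ ^ 2 * δ by ring]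
      exact mul_le_mul_of_nonneg_left hδ1 (by positivity)
    nlinarith [mul_nonneg (sq_nonneg (r - r₀)) (sq_nonneg δ)]
  refine ⟨?_, ?_, ?_, ?_⟩
  · have h3 : r - r₀ - -(1 / 2) * r₀⁻¹ * (a - a₀) = -((r - r₀) ^ 2 / (2 * r₀)) := by
      rw [hd]; field_simp; ring
    rw [h3, abs_neg, abs_of_nonneg (by positivity)]
    have h4 : (r - r₀) ^ 2 / (2 * r₀) ≤ q * (1 / δ ^ 3) := by
      rw [mul_one_div, div_le_div_iff₀ (by positivity) (by positivity)]
      have : (r - r₀) ^ 2 * δ ^ 3 = (r - r₀) ^ 2 * δ ^ 2 * δ := by ring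
      rw [this]
      nlinarith [mul_nonneg (sq_nonneg (r - r₀)) (sq_nonneg δ), mul_nonneg hq0 hδ.le]
    nlinarith
  · nlinarith
  · rw [abs_of_nonneg (by positivity)]; linarith
  · rw [abs_of_nonneg (by positivity)]; linarith

theorem abs_sin_sub_le (x : ℝ) : |Real.sin x - x| ≤ 2 * x ^ 2 := by
  have key : ∀ x : ℝ, 0 ≤ x → x - 2 * x ^ 2 ≤ Real.sin x := fun x hx => by
    rcases eq_or_lt_of_le hx with rfl | hx
    · simp
    rcases le_or_gt x 1 with h | h
    · have := Real.sin_gt_sub_cube hx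
      nlinarith [sq_nonneg x, mul_nonneg (sq_nonneg x) (show 0 ≤ 1 - x by linarith)]
    · nlinarith [Real.neg_one_le_sin x]
  rcases le_total 0 x with h | h
  · have h1 := Real.sin_le h
    rw [abs_of_nonpos (by linarith)]
    linarith [key x h]
  · have h1 := Real.sin_le (show 0 ≤ -x by linarith)
    have h2 := key (-x) (by linarith)
    rw [Real.sin_neg] at h1 h2
    rw [abs_of_nonneg (by linarith)]
    nlinarith

theorem abs_cos_sub_one_le (x : ℝ) : |Real.cos x - 1| ≤ 2 * x ^ 2 := by
  have h1 := Real.one_sub_sq_div_two_le_cos (x := x)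
  have h2 := Real.cos_le_one x
  rw [abs_of_nonpos (by linarith)]
  nlinarith [sq_nonneg x]

/-- The trigonometric polynomial `κ cos + μ sin`. -/
def trig (κ μ x : ℝ) : ℝ := κ * Real.cos x + μ * Real.sin x

theorem hasDerivAt_trig (κ μ x : ℝ) : HasDerivAt (trig κ μ) (trig μ (-κ) x) x := by
  refine (((Real.hasDerivAt_cos x).const_mul κ).add ((Real.hasDerivAt_sin x).const_mul μ)).congr_deriv ?_
  simp only [trig]; ring

theorem abs_trig_le (κ μ x : ℝ) : |trig κ μ x| ≤ |κ| + |μ| := by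
  refine (abs_add_le _ _).trans (add_le_add ?_ ?_)
  · rw [abs_mul]; exact mul_le_of_le_one_right (abs_nonneg _) (Real.abs_cos_le_one x)
  · rw [abs_mul]; exact mul_le_of_le_one_right (abs_nonneg _) (Real.abs_sin_le_one x)

theorem continuous_trig (κ μ : ℝ) : Continuous (trig κ μ) := by unfold trig; fun_prop

theorem trig_zero (κ μ : ℝ) : trig κ μ 0 = κ := by simp [trig]

theorem abs_trig_sub_le (κ μ x y : ℝ) : |trig κ μ x - trig κ μ y| ≤ (|κ| + |μ|) * |x - y| := by
  have := convex_univ.norm_image_sub_le_of_norm_hasDerivWithin_le (𝕜 := ℝ) (f := trig κ μ)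
    (f' := trig μ (-κ)) (C := |κ| + |μ|) (s := univ) (x := y) (y := x)
    (fun x _ => (hasDerivAt_trig κ μ x).hasDerivWithinAt) (fun x _ => ?_) trivial trivial
  · exact this
  · have := abs_trig_le μ (-κ) x
    rw [abs_neg] at this
    rw [Real.norm_eq_abs]; linarith

theorem abs_trig_taylor (κ μ x y : ℝ) :
    |trig κ μ x - trig κ μ y - trig μ (-κ) y * (x - y)| ≤ 4 * (|κ| + |μ|) * (x - y) ^ 2 := by
  have e : trig κ μ x - trig κ μ y - trig μ (-κ) y * (x - y)
      = trig κ μ y * (Real.cos (x - y) - 1) + trig μ (-κ) y * (Real.sin (x - y) - (x - y)) := by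
    have h1 : x = y + (x - y) := by ring
    have h2 : trig κ μ x = trig κ μ y * Real.cos (x - y) + trig μ (-κ) y * Real.sin (x - y) := by
      nth_rw 1 [h1]
      simp only [trig, Real.cos_add, Real.sin_add]; ring
    rw [h2]; ring
  have h3 := abs_trig_le μ (-κ) y
  rw [abs_neg] at h3
  rw [e]
  refine (abs_add_le _ _).trans ?_
  rw [abs_mul, abs_mul]
  have a1 := mul_le_mul (abs_trig_le κ μ y) (abs_cos_sub_one_le (x - y)) (abs_nonneg _) (by positivity)
  have a2 := mul_le_mul h3 (abs_sin_sub_le (x - y)) (abs_nonneg _) (by positivity)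
  linarith

theorem expand_trig (κ μ : ℝ) {m m₀ q : ℝ} (hq : (m - m₀) ^ 2 ≤ q) :
    Expand ((4 * (|κ| + |μ|) + 1) ^ 2) q (trig κ μ m) (trig κ μ m₀) (trig μ (-κ) m₀ * (m - m₀)) := by
  have hA : 0 ≤ |κ| + |μ| := by positivity
  set A := |κ| + |μ|
  have hq0 : 0 ≤ q := (sq_nonneg _).trans hq
  refine ⟨?_, ?_, (abs_trig_le _ _ _).trans (by change A ≤ _; nlinarith),
    (abs_trig_le _ _ _).trans (by change A ≤ _; nlinarith)⟩
  · refine (abs_trig_taylor _ _ _ _).trans ?_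
    refine mul_le_mul ?_ hq (sq_nonneg _) (by positivity)
    change 4 * A ≤ _; nlinarith
  · rw [← sq_abs]
    refine (pow_le_pow_left₀ (abs_nonneg _) (abs_trig_sub_le κ μ m m₀) 2).trans ?_
    rw [mul_pow, sq_abs]
    refine mul_le_mul ?_ hq (sq_nonneg _) (by positivity)
    change A ^ 2 ≤ _; nlinarith

/-- Second-order expansion of `√(1-a) √(1-b) (κ cos m + μ sin m)`. -/
theorem exists_taylor_bound (κ μ : ℝ) {δ B : ℝ} (hδ : 0 < δ) (hδ1 : δ ≤ 1) (hB : 0 ≤ B) :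
    ∃ C, 0 ≤ C ∧ ∀ a b m a₀ b₀ m₀ : ℝ, δ ^ 2 ≤ 1 - a → δ ^ 2 ≤ 1 - a₀ → δ ^ 2 ≤ 1 - b →
      δ ^ 2 ≤ 1 - b₀ → 1 - a ≤ B ^ 2 → 1 - a₀ ≤ B ^ 2 → 1 - b ≤ B ^ 2 → 1 - b₀ ≤ B ^ 2 →
      |√(1 - a) * √(1 - b) * trig κ μ m - √(1 - a₀) * √(1 - b₀) * trig κ μ m₀
        - (-(1 / 2) * (√(1 - b₀) * (√(1 - a₀))⁻¹ * trig κ μ m₀) * (a - a₀)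
          + -(1 / 2) * (√(1 - a₀) * (√(1 - b₀))⁻¹ * trig κ μ m₀) * (b - b₀)
          + √(1 - a₀) * √(1 - b₀) * trig μ (-κ) m₀ * (m - m₀))|
      ≤ C * ((a - a₀) ^ 2 + (b - b₀) ^ 2 + (m - m₀) ^ 2) := by
  set K₁ := B + 1 / δ ^ 3 with hK₁
  have hK₁' : 1 ≤ K₁ := by
    have : 1 ≤ 1 / δ ^ 3 := by
      rw [le_div_iff₀ (by positivity), one_mul]; exact pow_le_one₀ hδ.le hδ1
    linarith
  set K₂ := 4 * K₁ ^ 3 + (4 * (|κ| + |μ|) + 1) ^ 2 with hK₂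
  have hK₂' : 1 ≤ K₂ := by
    have : 1 ≤ K₁ ^ 3 := one_le_pow₀ hK₁'
    nlinarith [sq_nonneg (4 * (|κ| + |μ|) + 1)]
  refine ⟨4 * K₂ ^ 3, by positivity, fun a b m a₀ b₀ m₀ h1 h2 h3 h4 h5 h6 h7 h8 => ?_⟩
  set q := (a - a₀) ^ 2 + (b - b₀) ^ 2 + (m - m₀) ^ 2 with hq
  have s1 := sq_nonneg (a - a₀)
  have s2 := sq_nonneg (b - b₀)
  have s3 := sq_nonneg (m - m₀)
  have hq0 : 0 ≤ q := by positivity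
  have E1 := expand_sqrt hδ hδ1 h1 h2 h5 h6 hB (q := q) (by linarith)
  have E2 := expand_sqrt hδ hδ1 h3 h4 h7 h8 hB (q := q) (by linarith)
  have E3 := expand_trig κ μ (m := m) (m₀ := m₀) (q := q) (by linarith)
  have E4 := (E1.mul hK₁' hq0 E2).mono (K' := K₂) (by rw [hK₂]; nlinarith [sq_nonneg (4 * (|κ| + |μ|) + 1)]) hq0
  have E5 := (E4.mul hK₂' hq0 (E3.mono (by rw [hK₂]; nlinarith [one_le_pow₀ (n := 3) hK₁']) hq0)).lin
  refine le_trans (le_of_eq ?_) E5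
  congr 1; ring

section

theorem _root_.MeasureTheory.MemLp.congr_fun {f g : ℝ → ℝ} (hf : MemLp f 2)
    (h : ∀ x, f x = g x) : MemLp g 2 := by rwa [← funext h]

theorem exists_uniform_bounds {ι : Type*} {l : Filter ι} {U : ι → XSpace} {u : XSpace}
    (h : Tendsto U l (𝓝 u)) (hu : u ∈ NV) :
    ∃ δ B : ℝ, 0 < δ ∧ δ ≤ 1 ∧ 0 ≤ B ∧ (∀ x, δ ^ 2 ≤ 1 - etaC u x ∧ 1 - etaC u x ≤ B ^ 2) ∧
      ∀ᶠ i in l, ∀ x, δ ^ 2 ≤ 1 - etaC (U i) x ∧ 1 - etaC (U i) x ≤ B ^ 2 := by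
  obtain ⟨m, hm, hle⟩ := (mem_NV_iff u).1 hu
  have hp : 0 < (1 - m) / 2 := by linarith
  set δ := min 1 ((1 - m) / 2)
  have hδ : 0 < δ := by positivity
  have hδ1 : δ ≤ 1 := min_le_left _ _
  have hδ2 : δ ≤ (1 - m) / 2 := min_le_right _ _
  have hδsq : δ ^ 2 ≤ δ := by nlinarith
  have hn := norm_nonneg u
  have key : ∀ y x : ℝ, |y - etaC u x| ≤ δ → δ ^ 2 ≤ 1 - y ∧ 1 - y ≤ (2 * ‖u‖ + 2) ^ 2 := by
    intro y x hy
    have h1 := abs_le.1 hy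
    have h2 := abs_le.1 (abs_etaC_le u x)
    have h3 := hle x
    constructor
    · linarith
    · nlinarith
  refine ⟨δ, 2 * ‖u‖ + 2, hδ, hδ1, by positivity, fun x => key _ x (by simpa using hδ.le), ?_⟩
  filter_upwards [(tU_etaC h).unif δ hδ] with i hi x using key _ x (hi x)

theorem exists_bounds {u : XSpace} (hu : u ∈ NV) : ∃ δ B : ℝ, 0 < δ ∧ δ ≤ 1 ∧ 0 ≤ B ∧
    ∀ x, δ ^ 2 ≤ 1 - etaC u x ∧ 1 - etaC u x ≤ B ^ 2 := by
  obtain ⟨δ, B, h1, h2, h3, h4, -⟩ := exists_uniform_bounds (tendsto_const_nhds (f := (⊤ : Filter ℝ))) hu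
  exact ⟨δ, B, h1, h2, h3, h4⟩

theorem exists_rho_bounds {u : XSpace} (hu : u ∈ NV) : ∃ δ B : ℝ, 0 < δ ∧ 0 ≤ B ∧
    ∀ x, δ ≤ rho u x ∧ rho u x ≤ B := by
  obtain ⟨δ, B, h1, h2, h3, h4⟩ := exists_bounds hu
  exact ⟨δ, B, h1, h3, fun x => ⟨Real.le_sqrt_of_sq_le (h4 x).1, Real.sqrt_le_iff.2 ⟨h3, (h4 x).2⟩⟩⟩

theorem rho_pos {u : XSpace} (hu : u ∈ NV) (x : ℝ) : 0 < rho u x := by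
  obtain ⟨δ, B, h1, -, h⟩ := exists_rho_bounds hu
  exact h1.trans_le (h x).1

theorem one_sub_etaC_pos {u : XSpace} (hu : u ∈ NV) (x : ℝ) : 0 < 1 - etaC u x :=
  Real.sqrt_pos.1 (rho_pos hu x)

theorem rho_sq {u : XSpace} (hu : u ∈ NV) (x : ℝ) : rho u x ^ 2 = 1 - etaC u x :=
  Real.sq_sqrt (one_sub_etaC_pos hu x).le

theorem continuous_rho (u : XSpace) : Continuous (rho u) :=
  Real.continuous_sqrt.comp (continuous_const.sub (continuous_etaC u))

theorem bdd_rho {u : XSpace} (hu : u ∈ NV) : Bdd (rho u) := by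
  obtain ⟨δ, B, h1, h2, h⟩ := exists_rho_bounds hu
  exact ⟨(continuous_rho u).aestronglyMeasurable, B, fun x => by
    rw [abs_of_pos (rho_pos hu x)]; exact (h x).2⟩

theorem bdd_inv_rho {u : XSpace} (hu : u ∈ NV) : Bdd fun x => (rho u x)⁻¹ := by
  obtain ⟨δ, B, h1, h2, h⟩ := exists_rho_bounds hu
  refine ⟨((continuous_rho u).inv₀ fun x => (rho_pos hu x).ne').aestronglyMeasurable, δ⁻¹, fun x => ?_⟩
  have := rho_pos hu x
  rw [abs_of_pos (by positivity)]
  exact inv_anti₀ h1 (h x).1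

theorem acd_rho {u : XSpace} (hu : u ∈ NV) : ACD (rho u) fun x => -(slope u x * rho u x) := by
  obtain ⟨δ, B, h1, h2, h3, h4⟩ := exists_bounds hu
  have hs : ∀ y ∈ Iic (1 - δ ^ 2), δ ≤ √(1 - y) := fun y hy =>
    Real.le_sqrt_of_sq_le (by have : y ≤ 1 - δ ^ 2 := hy; linarith)
  have hd : ∀ y ∈ Iic (1 - δ ^ 2), HasDerivAt (fun y => √(1 - y)) (-1 / (2 * √(1 - y))) y := by
    intro y hy
    refine ((hasDerivAt_id y).const_sub 1).sqrt ?_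
    have := Real.sqrt_pos.1 (h1.trans_le (hs y hy))
    exact this.ne'
  refine ((sob_eta u).acd.comp (convex_Iic (1 - δ ^ 2)) (K := 1 / (2 * δ)) (fun y hy => ?_) hd
    fun x => by have := (h4 x).1; simp only [mem_Iic]; linarith).congr' fun x => ?_
  · have := hs y hy
    have h6 := h1.trans_le this
    rw [abs_div, abs_neg, abs_one, abs_of_pos (by positivity)]
    gcongr
  · have h5 := rho_sq hu x
    have h6 := rho_pos hu x
    change -1 / (2 * rho u x) * etaX u x = _
    rw [slope, ← h5]
    field_simp

theorem acd_inv_rho {u : XSpace} (hu : u ∈ NV) :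
    ACD (fun x => (rho u x)⁻¹) fun x => slope u x * (rho u x)⁻¹ := by
  obtain ⟨δ, B, h1, h2, h⟩ := exists_rho_bounds hu
  refine ((acd_rho hu).comp (F := fun y => y⁻¹) (F' := fun y => -(y ^ 2)⁻¹) (convex_Ici δ)
    (K := (δ ^ 2)⁻¹)
    (fun y hy => ?_) (fun y hy => hasDerivAt_inv (h1.trans_le hy).ne') fun x => (h x).1).congr'
      fun x => ?_
  · have hy' : δ ≤ y := hy
    rw [abs_neg, abs_of_nonneg (by positivity)]
    gcongr
  · have h6 := rho_pos hu x
    field_simp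

theorem memLp_rho_sub_one {u : XSpace} (hu : u ∈ NV) : MemLp (fun x => rho u x - 1) 2 := by
  refine memLp_of_abs_le ((continuous_rho u).sub continuous_const).aestronglyMeasurable
    (memLp_etaC u) (C := 1) fun x => ?_
  have h5 := rho_sq hu x
  have h6 := rho_pos hu x
  have e : etaC u x = -((rho u x - 1) * (rho u x + 1)) := by nlinarith
  rw [e, abs_neg, abs_mul, abs_of_pos (show 0 < rho u x + 1 by linarith), one_mul]
  nlinarith [abs_nonneg (rho u x - 1)]

theorem memLp_trig_incr (κ μ : ℝ) {v : ℝ → ℝ} (hv : MemLp v 2) {h : ℝ} (hh : 0 ≤ h) :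
    MemLp (fun x => trig κ μ (incr h v x) - κ) 2 := by
  refine memLp_of_abs_le (((continuous_trig κ μ).comp (continuous_incr hv h)).sub
    continuous_const).aestronglyMeasurable (memLp_incr hv hh).1 (C := |κ| + |μ|) fun x => ?_
  have := abs_trig_sub_le κ μ (incr h v x) 0
  rwa [trig_zero, sub_zero] at this

theorem bdd_trig_incr (κ μ : ℝ) {v : ℝ → ℝ} (hv : MemLp v 2) (h : ℝ) :
    Bdd fun x => trig κ μ (incr h v x) :=
  ⟨((continuous_trig κ μ).comp (continuous_incr hv h)).aestronglyMeasurable, _,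
    fun _ => abs_trig_le _ _ _⟩

theorem acd_trig_incr (κ μ : ℝ) {v : ℝ → ℝ} (hv : MemLp v 2) {h : ℝ} (hh : 0 ≤ h) :
    ACD (fun x => trig κ μ (incr h v x))
      fun x => trig μ (-κ) (incr h v x) * (v (x + h) - v x) :=
  (sob_incr hv hh).acd.comp convex_univ (K := |μ| + |(-κ)|) (fun _ _ => abs_trig_le _ _ _)
    (fun y _ => hasDerivAt_trig κ μ y) fun _ => trivial

theorem memLp_prod_rho_sub_one {u : XSpace} (hu : u ∈ NV) (h : ℝ) :
    MemLp (fun x => rho u x * rho u (x + h) - 1) 2 := by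
  refine (memLp_fadd ((bdd_rho hu).mul_L2 ((memLp_rho_sub_one hu).shift h))
    (memLp_rho_sub_one hu)).congr_fun fun x => ?_
  ring

/-- A weight: bounded, of class `C¹`, with bounded derivative. -/
structure Weight (χ χ' : ℝ → ℝ) : Prop where
  hasDerivAt : ∀ x, HasDerivAt χ (χ' x) x
  continuous' : Continuous χ'
  bound : ∃ C, ∀ x, |χ x| ≤ C
  bound' : ∃ C, ∀ x, |χ' x| ≤ C

theorem Weight.continuous {χ χ' : ℝ → ℝ} (w : Weight χ χ') : Continuous χ :=
  continuous_iff_continuousAt.2 fun x => (w.1 x).continuousAt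

theorem Weight.bdd {χ χ' : ℝ → ℝ} (w : Weight χ χ') : Bdd χ :=
  ⟨w.continuous.aestronglyMeasurable, w.bound⟩

theorem Weight.bdd' {χ χ' : ℝ → ℝ} (w : Weight χ χ') : Bdd χ' :=
  ⟨w.continuous'.aestronglyMeasurable, w.bound'⟩

theorem Weight.acd {χ χ' : ℝ → ℝ} (w : Weight χ χ') : ACD χ χ' :=
  .of_hasDerivAt w.1 w.2

theorem Weight.mul_sob {χ χ' f g : ℝ → ℝ} (w : Weight χ χ') (h : Sob f g) :
    Sob (fun x => χ x * f x) fun x => χ' x * f x + χ x * g x :=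
  (w.acd.mul h.acd).sob (w.bdd.mul_L2 h.memLp) ((w.bdd'.mul_L2 h.memLp).add (w.bdd.mul_L2 h.memLp'))

section Density

variable (κ μ h : ℝ) (u : XSpace)

/-- The difference quotient of order `h` of a density. -/
def diffDensity (χ : ℝ → ℝ) (x : ℝ) : ℝ :=
  χ x * (κ * (1 - 1 / 2 * (etaC u x + etaC u (x + h))) + μ * incr h (vel u) x
    - rho u x * rho u (x + h) * trig κ μ (incr h (vel u) x))

/-- The time derivative of the integral of `diffDensity`. -/
def diffRate (χ χ' : ℝ → ℝ) (x : ℝ) : ℝ :=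
  χ x * (μ * (quadFlux u (x + h) - quadFlux u x) + (etaC u (x + h) - etaC u x)
      * (μ - rho u x * rho u (x + h) * trig μ (-κ) (incr h (vel u) x)))
    + χ' x * (κ * (rho u x ^ 2 * vel u x + rho u (x + h) ^ 2 * vel u (x + h))
      - rho u x * rho u (x + h) * (vel u x + vel u (x + h)) * trig κ μ (incr h (vel u) x)
      + (slope u (x + h) - slope u x)
        * (μ - rho u x * rho u (x + h) * trig μ (-κ) (incr h (vel u) x)))

variable {u h} (hu : u ∈ NV) (hh : 0 ≤ h)
include hu hh

theorem sob_grad_left :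
    Sob (fun x => -(κ / 2) + 1 / 2 * (rho u (x + h) * (rho u x)⁻¹ * trig κ μ (incr h (vel u) x)))
      (fun x => 1 / 2 * (rho u (x + h) * (rho u x)⁻¹)
        * ((slope u x - slope u (x + h)) * trig κ μ (incr h (vel u) x)
          + (vel u (x + h) - vel u x) * trig μ (-κ) (incr h (vel u) x))) := by
  have hv := memLp_vel u
  have r := bdd_rho hu
  have i := bdd_inv_rho hu
  have A := (r.shift h).mul i
  have hs := memLp_slope hu
  refine ACD.sob ?_ ?_ ?_
  · refine ((ACD.const (-(κ / 2))).add ((ACD.const (1 / 2)).mul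
      ((((acd_rho hu).shift h).mul (acd_inv_rho hu)).mul (acd_trig_incr κ μ hv hh)))).congr'
        fun x => ?_
    ring
  · have h1 := A.mul_L2 (memLp_trig_incr κ μ hv hh)
    have h2 := ((Bdd.const κ).mul i).mul_L2
      (memLp_fsub ((memLp_rho_sub_one hu).shift h) (memLp_rho_sub_one hu))
    refine ((memLp_fadd h1 h2).const_mul (1 / 2)).congr_fun fun x => ?_
    have := rho_pos hu x
    field_simp
    ring
  · exact ((Bdd.const _).mul A).mul_L2 (memLp_fadd
      (((bdd_trig_incr κ μ hv h).mul_L2 (memLp_fsub hs (hs.shift h))).congr_fun fun _ => mul_comm _ _)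
      (((bdd_trig_incr μ (-κ) hv h).mul_L2 (memLp_fsub (hv.shift h) hv)).congr_fun fun _ => mul_comm _ _))

theorem sob_grad_right :
    Sob (fun x => -(κ / 2) + 1 / 2 * (rho u x * (rho u (x + h))⁻¹ * trig κ μ (incr h (vel u) x)))
      (fun x => 1 / 2 * (rho u x * (rho u (x + h))⁻¹)
        * ((slope u (x + h) - slope u x) * trig κ μ (incr h (vel u) x)
          + (vel u (x + h) - vel u x) * trig μ (-κ) (incr h (vel u) x))) := by
  have hv := memLp_vel u
  have r := bdd_rho hu
  have i := bdd_inv_rho hu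
  have A := r.mul (i.shift h)
  have hs := memLp_slope hu
  refine ACD.sob ?_ ?_ ?_
  · refine ((ACD.const (-(κ / 2))).add ((ACD.const (1 / 2)).mul
      (((acd_rho hu).mul ((acd_inv_rho hu).shift h)).mul (acd_trig_incr κ μ hv hh)))).congr'
        fun x => ?_
    ring
  · have h1 := A.mul_L2 (memLp_trig_incr κ μ hv hh)
    have h2 := ((Bdd.const κ).mul (i.shift h)).mul_L2
      (memLp_fsub (memLp_rho_sub_one hu) ((memLp_rho_sub_one hu).shift h))
    refine ((memLp_fadd h1 h2).const_mul (1 / 2)).congr_fun fun x => ?_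
    have := rho_pos hu (x + h)
    field_simp
    ring
  · exact ((Bdd.const _).mul A).mul_L2 (memLp_fadd
      (((bdd_trig_incr κ μ hv h).mul_L2 (memLp_fsub (hs.shift h) hs)).congr_fun fun _ => mul_comm _ _)
      (((bdd_trig_incr μ (-κ) hv h).mul_L2 (memLp_fsub (hv.shift h) hv)).congr_fun fun _ => mul_comm _ _))

theorem sob_grad_incr :
    Sob (fun x => μ - rho u x * rho u (x + h) * trig μ (-κ) (incr h (vel u) x))
      (fun x => rho u x * rho u (x + h)
        * ((slope u x + slope u (x + h)) * trig μ (-κ) (incr h (vel u) x)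
          + (vel u (x + h) - vel u x) * trig κ μ (incr h (vel u) x))) := by
  have hv := memLp_vel u
  have r := bdd_rho hu
  have A := r.mul (r.shift h)
  have hs := memLp_slope hu
  refine ACD.sob ?_ ?_ ?_
  · have := ((ACD.const μ).add ((ACD.const (-1)).mul
      (((acd_rho hu).mul ((acd_rho hu).shift h)).mul (acd_trig_incr μ (-κ) hv hh))))
    have e : ∀ y, trig (-κ) (-μ) y = -trig κ μ y := fun y => by simp only [trig]; ring
    simp only [e] at this
    convert! this using 1
    · funext x; ring
    · funext x; ring
  · have h1 := A.mul_L2 (memLp_trig_incr μ (-κ) hv hh)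
    have h2 := (Bdd.const μ).mul_L2 (memLp_prod_rho_sub_one hu h)
    refine (memLp_fadd h1 h2).neg.congr_fun fun x => ?_
    simp only [Pi.neg_apply]
    ring
  · exact A.mul_L2 (memLp_fadd
      (((bdd_trig_incr μ (-κ) hv h).mul_L2 (memLp_fadd hs (hs.shift h))).congr_fun fun _ => mul_comm _ _)
      (((bdd_trig_incr κ μ hv h).mul_L2 (memLp_fsub (hv.shift h) hv)).congr_fun fun _ => mul_comm _ _))

theorem integrable_diffDensity {χ : ℝ → ℝ} (hχ : Bdd χ) :
    Integrable (diffDensity κ μ h u χ) := by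
  have hv := memLp_vel u
  have r := bdd_rho hu
  have A := r.mul (r.shift h)
  have hm := memLp_incr hv hh
  -- `κ/2 (ρ - τρ)² + (1 - ρτρ) (S - κ) + (κ + μ m - S)`
  have i1 := ((memLp_fsub (memLp_rho_sub_one hu) ((memLp_rho_sub_one hu).shift h)).integrable_sq).const_mul (κ / 2)
  have i2 := integrable_mul_L2 (memLp_prod_rho_sub_one hu h) (memLp_trig_incr κ μ hv hh)
  have i3 : Integrable (fun x => trig κ μ (incr h (vel u) x) - κ - μ * incr h (vel u) x) := by
    refine (hm.1.integrable_sq.const_mul (4 * (|κ| + |μ|))).mono'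
      ((((continuous_trig κ μ).comp (continuous_incr hv h)).sub continuous_const).sub
        (continuous_const.mul (continuous_incr hv h))).aestronglyMeasurable
      (.of_forall fun x => ?_)
    have := abs_trig_taylor κ μ (incr h (vel u) x) 0
    simpa [trig_zero] using this
  refine (hχ.integrable_mul (integrable_fsub (integrable_fsub i1 i2) i3)).congr
    (.of_forall fun x => ?_)
  simp only [diffDensity]
  have e1 := rho_sq hu x
  have e2 := rho_sq hu (x + h)
  rw [show etaC u x = 1 - rho u x ^ 2 by linarith, show etaC u (x + h) = 1 - rho u (x + h) ^ 2 by linarith]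
  ring

theorem integral_diffRate {χ χ' : ℝ → ℝ} (w : Weight χ χ') :
    Integrable (diffRate κ μ h u χ χ') ∧
    ∫ x, diffRate κ μ h u χ χ' x =
    (∫ x, massFlux u x * (χ' x * (-(κ / 2) + 1 / 2 * (rho u (x + h) * (rho u x)⁻¹
        * trig κ μ (incr h (vel u) x)))
      + χ x * (1 / 2 * (rho u (x + h) * (rho u x)⁻¹)
        * ((slope u x - slope u (x + h)) * trig κ μ (incr h (vel u) x)
          + (vel u (x + h) - vel u x) * trig μ (-κ) (incr h (vel u) x)))))
    + (∫ x, massFlux u (x + h) * (χ' x * (-(κ / 2) + 1 / 2 * (rho u x * (rho u (x + h))⁻¹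
        * trig κ μ (incr h (vel u) x)))
      + χ x * (1 / 2 * (rho u x * (rho u (x + h))⁻¹)
        * ((slope u (x + h) - slope u x) * trig κ μ (incr h (vel u) x)
          + (vel u (x + h) - vel u x) * trig μ (-κ) (incr h (vel u) x)))))
    + ((∫ x, (etaC u (x + h) - etaC u x)
        * (χ x * (μ - rho u x * rho u (x + h) * trig μ (-κ) (incr h (vel u) x))))
      + (∫ x, (quadFlux u (x + h) - quadFlux u x)
        * (χ x * (μ - rho u x * rho u (x + h) * trig μ (-κ) (incr h (vel u) x))))
      + ∫ x, (slope u (x + h) - slope u x)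
        * (χ' x * (μ - rho u x * rho u (x + h) * trig μ (-κ) (incr h (vel u) x))
          + χ x * (rho u x * rho u (x + h)
        * ((slope u x + slope u (x + h)) * trig μ (-κ) (incr h (vel u) x)
          + (vel u (x + h) - vel u x) * trig κ μ (incr h (vel u) x))))) := by
  have hs := memLp_slope hu
  have S0 := w.mul_sob (sob_grad_left κ μ hu hh)
  have S1 := w.mul_sob (sob_grad_right κ μ hu hh)
  have S2 := w.mul_sob (sob_grad_incr κ μ hu hh)
  have j1 := integrable_mul_L2 (memLp_massFlux u) S0.memLp'
  have j2 := integrable_mul_L2 ((memLp_massFlux u).shift h) S1.memLp'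
  have j3 := integrable_mul_L2 (memLp_fsub ((memLp_etaC u).shift h) (memLp_etaC u)) S2.memLp
  have j4 : Integrable (fun x => (quadFlux u (x + h) - quadFlux u x)
        * (χ x * (μ - rho u x * rho u (x + h) * trig μ (-κ) (incr h (vel u) x)))) volume :=
    (integrable_fsub ((integrable_quadFlux hu).comp_add_right h) (integrable_quadFlux hu)).mul_bdd
      S2.continuous.aestronglyMeasurable (.of_forall S2.abs_le)
  have j5 := integrable_mul_L2 (memLp_fsub (hs.shift h) hs) S2.memLp'
  have hpt : ∀ x, diffRate κ μ h u χ χ' x = _ := fun x => show _ =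
    (massFlux u x * (χ' x * (-(κ / 2) + 1 / 2 * (rho u (x + h) * (rho u x)⁻¹
        * trig κ μ (incr h (vel u) x)))
      + χ x * (1 / 2 * (rho u (x + h) * (rho u x)⁻¹)
        * ((slope u x - slope u (x + h)) * trig κ μ (incr h (vel u) x)
          + (vel u (x + h) - vel u x) * trig μ (-κ) (incr h (vel u) x)))))
    + (massFlux u (x + h) * (χ' x * (-(κ / 2) + 1 / 2 * (rho u x * (rho u (x + h))⁻¹
        * trig κ μ (incr h (vel u) x)))
      + χ x * (1 / 2 * (rho u x * (rho u (x + h))⁻¹)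
        * ((slope u (x + h) - slope u x) * trig κ μ (incr h (vel u) x)
          + (vel u (x + h) - vel u x) * trig μ (-κ) (incr h (vel u) x)))))
    + (((etaC u (x + h) - etaC u x)
        * (χ x * (μ - rho u x * rho u (x + h) * trig μ (-κ) (incr h (vel u) x))))
      + ((quadFlux u (x + h) - quadFlux u x)
        * (χ x * (μ - rho u x * rho u (x + h) * trig μ (-κ) (incr h (vel u) x))))
      + (slope u (x + h) - slope u x)
        * (χ' x * (μ - rho u x * rho u (x + h) * trig μ (-κ) (incr h (vel u) x))
          + χ x * (rho u x * rho u (x + h)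
        * ((slope u x + slope u (x + h)) * trig μ (-κ) (incr h (vel u) x)
          + (vel u (x + h) - vel u x) * trig κ μ (incr h (vel u) x))))) by
    have e1 := rho_sq hu x
    have e2 := rho_sq hu (x + h)
    have p1 := rho_pos hu x
    have p2 := rho_pos hu (x + h)
    simp only [diffRate, massFlux, quadFlux, ← e1, ← e2]
    field_simp
    ring
  have J := (j1.add j2).add ((j3.add j4).add j5)
  constructor
  · exact J.congr (.of_forall fun x => (hpt x).symm)
  · rw [← integral_add j1 j2, ← integral_add j3 j4, ← integral_add (integrable_fadd j3 j4) j5,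
      ← integral_add (integrable_fadd j1 j2) (integrable_fadd (integrable_fadd j3 j4) j5)]
    exact integral_congr_ae (.of_forall hpt)

end Density

end

theorem TL2.incr_const {ι : Type*} {l : Filter ι} {f : ι → ℝ → ℝ} {g : ℝ → ℝ} (k : TL2 l f g)
    {h : ℝ} (hh : 0 ≤ h) : TL2 l (fun i => incr h (f i)) (incr h g) := by
  refine ⟨by filter_upwards [k.1] with i a using (memLp_incr a hh).1, (memLp_incr k.2 hh).1, ?_⟩
  refine squeeze_zero' (.of_forall fun _ => N2_nonneg _) ?_
    (by simpa using k.tendsto.const_mul h)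
  filter_upwards [k.1] with i a
  rw [← funext (incr_sub a k.2 h)]
  exact (memLp_incr (memLp_fsub a k.2) hh).2

theorem abs_integral_bdd_le {b q : ℝ → ℝ} (hb : Integrable b) {M : ℝ} (hM : ∀ x, |q x| ≤ M) :
    |∫ x, b x * q x| ≤ (∫ x, |b x|) * M := by
  refine abs_integral_le_integral_abs.trans ?_
  rw [← integral_mul_const]
  refine integral_mono_of_nonneg (.of_forall fun _ => abs_nonneg _) (hb.abs.mul_const _)
    (.of_forall fun x => ?_)
  simp only [abs_mul]
  exact mul_le_mul_of_nonneg_left (hM x) (abs_nonneg _)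

theorem IsHGPSolution.hasDerivWithinAt_diffDensity {T : ℝ} {u : ℝ → XSpace} (hu : IsHGPSolution T u)
    (κ μ : ℝ) {h : ℝ} (hh : 0 ≤ h) {χ χ' : ℝ → ℝ} (w : Weight χ χ') {t : ℝ} (ht : t ∈ Icc 0 T) :
    HasDerivWithinAt (fun t => ∫ x, diffDensity κ μ h (u t) χ x)
      (∫ x, diffRate κ μ h (u t) χ χ' x) (Icc 0 T) t := by
  have hN := hu.mem_NV t ht
  have hc := hu.tendsto ht
  obtain ⟨δ, B, hδ, hδ1, hB, hb0, hb⟩ := exists_uniform_bounds hc hN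
  obtain ⟨C, hC0, hC⟩ := exists_taylor_bound κ μ hδ hδ1 hB
  obtain ⟨X, hX⟩ := w.bound
  have hX0 : 0 ≤ X := (abs_nonneg _).trans (hX 0)
  have S0 := w.mul_sob (sob_grad_left κ μ hN hh)
  have S1 := w.mul_sob (sob_grad_right κ μ hN hh)
  have S2 := w.mul_sob (sob_grad_incr κ μ hN hh)
  have e := hasDerivWithinAt_integral_of_dualDeriv (n := 3) ht
    (y := ![fun t => etaC (u t), fun t x => etaC (u t) (x + h), fun t => incr h (vel (u t))])
    (y' := ![fun t => etaX (u t), fun t x => etaX (u t) (x + h),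
      fun t x => vel (u t) (x + h) - vel (u t) x])
    (ℓ := ![fun _ q => ∫ x, massFlux (u t) x * q x, fun _ q => ∫ x, massFlux (u t) (x + h) * q x,
      fun p q => (∫ x, (etaC (u t) (x + h) - etaC (u t) x) * p x)
        + (∫ x, (quadFlux (u t) (x + h) - quadFlux (u t) x) * p x)
        + ∫ x, (slope (u t) (x + h) - slope (u t) x) * q x])
    (F := fun t => diffDensity κ μ h (u t) χ)
    (p := ![_, _, _]) (q := ![_, _, _]) (C := X * C)
    (fun i => by
      fin_cases i
      · exact fun t _ => sob_eta (u t)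
      · exact fun t _ => (sob_eta (u t)).shift h
      · exact fun t _ => sob_incr (memLp_vel (u t)) hh)
    (fun i => by
      fin_cases i
      · exact tL2_etaC hc
      · exact (tL2_etaC hc).shift_const h
      · exact (tL2_vel hc).incr_const hh)
    (fun i => by
      fin_cases i
      · exact tL2_etaX hc
      · exact (tL2_etaX hc).shift_const h
      · exact ((tL2_vel hc).shift_const h).sub (tL2_vel hc))
    (fun i => by
      fin_cases i
      · exact hu.dualDeriv_etaC ht
      · exact hu.dualDeriv_etaC_shift ht h
      · exact hu.dualDeriv_incr ht hh)
    (fun i => by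
      have key : ∀ {f : ℝ → ℝ}, MemLp f 2 → ∃ D, ∀ p q, Sob p q →
          |∫ x, f x * q x| ≤ D * (N2 p + N2 q) := fun {f} hf => ⟨N2 f, fun p q hpq =>
        (abs_integral_mul_le hf hpq.memLp').trans (mul_le_mul_of_nonneg_left
          (by linarith [N2_nonneg p]) (N2_nonneg _))⟩
      fin_cases i
      · exact key (memLp_massFlux _)
      · exact key ((memLp_massFlux _).shift h)
      · have m1 := memLp_fsub ((memLp_etaC (u t)).shift h) (memLp_etaC (u t))
        have m2 := integrable_fsub ((integrable_quadFlux hN).comp_add_right h) (integrable_quadFlux hN)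
        have m3 := memLp_fsub ((memLp_slope hN).shift h) (memLp_slope hN)
        refine ⟨N2 (fun x => etaC (u t) (x + h) - etaC (u t) x)
          + (∫ x, |quadFlux (u t) (x + h) - quadFlux (u t) x|)
          + N2 (fun x => slope (u t) (x + h) - slope (u t) x), fun p q hpq => ?_⟩
        have b1 := abs_integral_mul_le m1 hpq.memLp
        have b2 := abs_integral_bdd_le m2 hpq.abs_le
        have b3 := abs_integral_mul_le m3 hpq.memLp'
        refine ((abs_add_le _ _).trans (add_le_add (abs_add_le _ _) le_rfl)).trans ?_
        nlinarith [N2_nonneg p, N2_nonneg q,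
          mul_nonneg (N2_nonneg fun x => etaC (u t) (x + h) - etaC (u t) x) (N2_nonneg q),
          mul_nonneg (N2_nonneg fun x => slope (u t) (x + h) - slope (u t) x) (N2_nonneg p)])
    (fun i => by
      fin_cases i
      · exact S0
      · exact S1
      · exact S2)
    (fun t ht => integrable_diffDensity κ μ (hu.mem_NV t ht) hh w.bdd)
    (by
      filter_upwards [hb] with s hs x
      have := hC (etaC (u s) x) (etaC (u s) (x + h)) (incr h (vel (u s)) x) (etaC (u t) x)
        (etaC (u t) (x + h)) (incr h (vel (u t)) x) (hs x).1 (hb0 x).1 (hs (x + h)).1 (hb0 (x + h)).1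
        (hs x).2 (hb0 x).2 (hs (x + h)).2 (hb0 (x + h)).2
      simp only [Fin.sum_univ_three, Matrix.cons_val_zero, Matrix.cons_val_one, Matrix.cons_val,
        diffDensity]
      refine (le_of_eq ?_).trans ((mul_le_mul_of_nonneg_left this (abs_nonneg (χ x))).trans ?_)
      · rw [← abs_mul, ← abs_neg (χ x * _)]
        congr 1
        simp only [rho]
        ring
      · rw [mul_assoc]
        exact mul_le_mul_of_nonneg_right (hX x) (by positivity))
  rw [(integral_diffRate κ μ hN hh w).2]
  convert! e using 1
  simp [Fin.sum_univ_three]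

section

variable {ι : Type*} {l : Filter ι}

theorem TU.of_tendsto_zero {b : ι → ℝ → ℝ} {c : ℝ → ℝ} (hm : ∀ i, Continuous (b i))
    (hc : Continuous c) (hb : ∃ C, ∀ x, |c x| ≤ C) {ε : ι → ℝ} (h0 : Tendsto ε l (𝓝 0))
    (h : ∀ᶠ i in l, ∀ x, |b i x - c x| ≤ ε i) : TU l b c := by
  refine ⟨fun i => (hm i).aestronglyMeasurable, hc.aestronglyMeasurable, hb, fun e he => ?_⟩
  filter_upwards [h, h0.eventually (gt_mem_nhds he)] with i h1 h2 x using (h1 x).trans h2.le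

theorem mul_sinc (x : ℝ) : x * Real.sinc x = Real.sin x := by
  rcases eq_or_ne x 0 with rfl | h
  · simp
  · rw [Real.sinc_of_ne_zero h]; field_simp

theorem one_sub_cos_eq (x : ℝ) :
    1 - Real.cos x = 1 / 2 * ((x * Real.sinc (x / 2)) * (x * Real.sinc (x / 2))) := by
  have h1 := mul_sinc (x / 2)
  have h2 : Real.cos x = 1 - 2 * Real.sin (x / 2) ^ 2 := by
    have := Real.cos_sq' (x / 2)
    have h3 := Real.cos_two_mul (x / 2)
    rw [show 2 * (x / 2) = x by ring] at h3
    linarith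
  rw [h2, ← h1]; ring

/-- Steps tending to `0` from above and states tending to a non-vanishing state. -/
structure Approach (l : Filter ι) (H : ι → ℝ) (U : ι → XSpace) (u : XSpace) : Prop where
  pos : ∀ᶠ i in l, 0 < H i
  lim : Tendsto H l (𝓝 0)
  conv : Tendsto U l (𝓝 u)
  nv : u ∈ NV
  nv' : ∀ᶠ i in l, U i ∈ NV

namespace Approach

variable {H : ι → ℝ} {U : ι → XSpace} {u : XSpace} (A : Approach l H U u)
include A

theorem sqrt_lim : Tendsto (fun i => √(H i)) l (𝓝 0) := by
  simpa using A.lim.sqrt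

theorem tU_incr : TU l (fun i => incr (H i) (vel (U i))) fun _ => 0 := by
  have h1 := A.sqrt_lim.mul_const (N2 (vel u) + 1)
  rw [zero_mul] at h1
  refine TU.of_tendsto_zero (fun i => continuous_incr (memLp_vel _) _) continuous_const
    ⟨0, by simp⟩ h1 ?_
  filter_upwards [A.pos, (tL2_vel A.conv).eventually_N2_le] with i h2 h3 x
  rw [sub_zero]
  have := abs_intervalIntegral_le_N2 (memLp_vel (U i)) x (x + H i)
  rw [add_sub_cancel_left, abs_of_pos h2] at this
  exact this.trans (mul_le_mul_of_nonneg_left h3 (Real.sqrt_nonneg _))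

theorem tU_comp_incr {F : ℝ → ℝ} (hF : Continuous F) :
    TU l (fun i x => F (incr (H i) (vel (U i)) x)) fun _ => F 0 := A.tU_incr.comp hF

theorem tU_etaC_shift : TU l (fun i x => etaC (U i) (x + H i)) (etaC u) := by
  have h1 := ((tendsto_iff_norm_sub_tendsto_zero.1 A.conv).const_mul 2).add
    (A.sqrt_lim.mul_const (N2 (etaX u)))
  rw [zero_mul, mul_zero, add_zero] at h1
  refine TU.of_tendsto_zero (fun i => (continuous_etaC _).comp (continuous_id.add continuous_const))
    (continuous_etaC u) ⟨_, abs_etaC_le u⟩ h1 ?_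
  filter_upwards [A.pos] with i h2 x
  have h3 := (sob_eta u).abs_sub_le x (x + H i)
  rw [add_sub_cancel_left, abs_of_pos h2] at h3
  have h4 := abs_etaC_sub_le (U i) u (x + H i)
  refine (abs_sub_le _ (etaC u (x + H i)) _).trans (add_le_add h4 h3)

theorem tU_rho_shift : TU l (fun i x => rho (U i) (x + H i)) (rho u) :=
  ((TU.const aestronglyMeasurable_const (C := 1) (by simp)).sub A.tU_etaC_shift).comp
    Real.continuous_sqrt

theorem tU_prod_rho : TU l (fun i x => rho (U i) x * rho (U i) (x + H i))
    (fun x => rho u x * rho u x) := (tU_rho A.conv).mul A.tU_rho_shift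

theorem tL2_incr_vel : TL2 l (fun i x => (H i)⁻¹ * incr (H i) (vel (U i)) x) (vel u) :=
  (tL2_vel A.conv).avg A.pos A.lim

theorem tL2_incr_slope : TL2 l (fun i x => (H i)⁻¹ * incr (H i) (slope (U i)) x) (slope u) :=
  (tL2_slope A.conv A.nv).avg A.pos A.lim

theorem tL2_vel_shift : TL2 l (fun i x => vel (U i) (x + H i)) (vel u) :=
  (tL2_vel A.conv).shift A.pos A.lim

theorem tL2_slope_shift : TL2 l (fun i x => slope (U i) (x + H i)) (slope u) :=
  (tL2_slope A.conv A.nv).shift A.pos A.lim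

theorem tL2_diff_etaC : TL2 l (fun i x => (H i)⁻¹ * (etaC (U i) (x + H i) - etaC (U i) x))
    (etaX u) := by
  have := (tL2_etaX A.conv).avg A.pos A.lim
  simpa only [(sob_eta _).incr_deriv] using this

theorem tL2_slope_rho : TL2 l (fun i x => -(slope (U i) x * rho (U i) x))
    (fun x => -(slope u x * rho u x)) := by
  have := ((TU.const (l := l) (b := fun _ : ℝ => (-1 : ℝ)) aestronglyMeasurable_const
    (C := |-1|) fun _ => le_rfl).mul (tU_rho A.conv)).mul_TL2 (tL2_slope A.conv A.nv)
  refine this.congr (.of_forall fun i => .of_forall fun x => ?_)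
    (.of_forall fun x => ?_) <;> ring

theorem tL2_diff_rho : TL2 l (fun i x => (H i)⁻¹ * (rho (U i) (x + H i) - rho (U i) x))
    (fun x => -(slope u x * rho u x)) := by
  refine (A.tL2_slope_rho.avg A.pos A.lim).congr ?_ EventuallyEq.rfl
  filter_upwards [A.nv'] with i hi
  refine .of_forall fun x => ?_
  have := (acd_rho hi).1.ftc (acd_rho hi).2 x (x + H i)
  simp only [incr, this]

theorem tL2_sin : TL2 l (fun i x => (H i)⁻¹ * Real.sin (incr (H i) (vel (U i)) x)) (vel u) := by
  have := (A.tU_comp_incr Real.continuous_sinc).mul_TL2 A.tL2_incr_vel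
  refine this.congr (.of_forall fun i => .of_forall fun x => ?_)
    (.of_forall fun x => ?_)
  · simp only [← mul_sinc (incr _ _ _)]; ring
  · simp

theorem tL2_half : TL2 l (fun i x => (H i)⁻¹ * (incr (H i) (vel (U i)) x
    * Real.sinc (incr (H i) (vel (U i)) x / 2))) (vel u) := by
  have := (A.tU_comp_incr (F := fun y => Real.sinc (y / 2))
    (Real.continuous_sinc.comp (continuous_id.div_const 2))).mul_TL2 A.tL2_incr_vel
  refine this.congr (.of_forall fun i => .of_forall fun x => ?_)
    (.of_forall fun x => ?_)
  · ring
  · simp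

theorem tL2_one_sub_cos :
    TL2 l (fun i x => (H i)⁻¹ * (1 - Real.cos (incr (H i) (vel (U i)) x))) fun _ => 0 := by
  have := (A.tU_comp_incr (F := fun y => 1 / 2 * (y * Real.sinc (y / 2)))
    (continuous_const.mul (continuous_id.mul
      (Real.continuous_sinc.comp (continuous_id.div_const 2))))).mul_TL2 A.tL2_half
  refine this.congr (.of_forall fun i => .of_forall fun x => ?_)
    (.of_forall fun x => ?_)
  · simp only [one_sub_cos_eq]; ring
  · simp

end Approach

/-! ### Conservation of the energy -/

theorem weight_one : Weight (fun _ => 1) fun _ => 0 :=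
  ⟨fun x => hasDerivAt_const x 1, continuous_const, ⟨1, by simp⟩, ⟨0, by simp⟩⟩

theorem Approach.tendsto_diffDensity_energy {H : ι → ℝ} {U : ι → XSpace} {u : XSpace}
    (A : Approach l H U u) :
    Tendsto (fun i => ((H i) ^ 2)⁻¹ * ∫ x, diffDensity 1 0 (H i) (U i) (fun _ => 1) x) l
      (𝓝 (1 / 2 * (∫ x, -(slope u x * rho u x) * -(slope u x * rho u x))
        + 1 / 2 * ∫ x, (rho u x * rho u x * vel u x) * vel u x)) := by
  have t1 := A.tL2_diff_rho
  have t2 := A.tL2_half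
  have t3 := A.tU_prod_rho.mul_TL2 t2
  refine (((t1.integral_mul t1).const_mul (1 / 2)).add
    ((t3.integral_mul t2).const_mul (1 / 2))).congr' ?_
  filter_upwards [t1.1, t2.1, t3.1, A.nv'] with i m1 m2 m3 hi
  rw [← integral_const_mul, ← integral_const_mul, ← integral_const_mul,
    ← integral_add ((integrable_mul_L2 m1 m1).const_mul _) ((integrable_mul_L2 m3 m2).const_mul _)]
  congr 1; funext x
  simp only [diffDensity]
  have e1 := rho_sq hi x
  have e2 := rho_sq hi (x + H i)
  have e3 := one_sub_cos_eq (incr (H i) (vel (U i)) x)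
  set m := incr (H i) (vel (U i)) x
  rw [show etaC (U i) x = 1 - rho (U i) x ^ 2 by linarith,
    show etaC (U i) (x + H i) = 1 - rho (U i) (x + H i) ^ 2 by linarith,
    show trig 1 0 m = 1 - 1 / 2 * ((m * Real.sinc (m / 2)) * (m * Real.sinc (m / 2))) by
      rw [← e3]; simp [trig]]
  rw [show ((H i) ^ 2)⁻¹ = (H i)⁻¹ * (H i)⁻¹ by rw [sq, mul_inv]]
  ring

theorem Approach.tendsto_diffRate_energy {H : ι → ℝ} {U : ι → XSpace} {u : XSpace}
    (A : Approach l H U u) :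
    Tendsto (fun i => ((H i) ^ 2)⁻¹ * ∫ x, diffRate 1 0 (H i) (U i) (fun _ => 1) (fun _ => 0) x) l
      (𝓝 (∫ x, etaX u x * (rho u x * rho u x * vel u x))) := by
  refine (A.tL2_diff_etaC.integral_mul (A.tU_prod_rho.mul_TL2 A.tL2_sin)).congr fun i => ?_
  rw [← integral_const_mul]
  congr 1; funext x
  simp only [diffRate, trig]
  rw [show ((H i) ^ 2)⁻¹ = (H i)⁻¹ * (H i)⁻¹ by rw [sq, mul_inv]]
  ring

theorem energy_eq {u : XSpace} (hu : u ∈ NV) : energy u =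
    1 / 2 * (∫ x, -(slope u x * rho u x) * -(slope u x * rho u x))
      + 1 / 2 * (∫ x, (rho u x * rho u x * vel u x) * vel u x)
      + ∫ x, 1 / 4 * etaC u x ^ 2 := by
  have e1 : 1 / 8 * (∫ x, etaX u x ^ 2 / (1 - eta u x))
      = 1 / 2 * (∫ x, -(slope u x * rho u x) * -(slope u x * rho u x)) := by
    rw [← integral_const_mul, ← integral_const_mul]
    refine integral_congr_ae ?_
    filter_upwards [etaC_ae u] with x hx
    have h1 := rho_sq hu x
    have h2 := rho_pos hu x
    rw [← hx, slope, ← h1]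
    field_simp
    ring
  have e2 : 1 / 2 * (∫ x, (1 - eta u x) * vel u x ^ 2)
      = 1 / 2 * (∫ x, (rho u x * rho u x * vel u x) * vel u x) := by
    congr 1
    refine integral_congr_ae ?_
    filter_upwards [etaC_ae u] with x hx
    have h1 := rho_sq hu x
    rw [← hx, ← h1]; ring
  have e3 : 1 / 4 * (∫ x, eta u x ^ 2) = ∫ x, 1 / 4 * etaC u x ^ 2 := by
    rw [integral_const_mul]
    congr 1
    refine integral_congr_ae ?_
    filter_upwards [etaC_ae u] with x hx
    rw [hx]
  rw [energy, e1, e2, e3]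

namespace IsHGPSolution

variable {T : ℝ} {u : ℝ → XSpace} (hu : IsHGPSolution T u)
include hu

theorem approach {t : ℝ} (ht : t ∈ Icc 0 T) : Approach (𝓝[>] (0 : ℝ) ×ˢ 𝓝[Icc 0 T] t)
    (fun i => i.1) (fun i => u i.2) (u t) where
  pos := tendsto_fst.eventually self_mem_nhdsWithin
  lim := (tendsto_id.mono_left nhdsWithin_le_nhds).comp tendsto_fst
  conv := (hu.tendsto ht).comp tendsto_snd
  nv := hu.mem_NV t ht
  nv' := tendsto_snd.eventually (p := fun t => u t ∈ NV)
    (by filter_upwards [self_mem_nhdsWithin] with s hs using hu.mem_NV s hs)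

theorem approach_const {t : ℝ} (ht : t ∈ Icc 0 T) : Approach (𝓝[>] (0 : ℝ))
    (fun i => i) (fun _ => u t) (u t) where
  pos := self_mem_nhdsWithin
  lim := tendsto_id.mono_left nhdsWithin_le_nhds
  conv := tendsto_const_nhds
  nv := hu.mem_NV t ht
  nv' := .of_forall fun _ => hu.mem_NV t ht

theorem hasDerivWithinAt_integral_sq {t : ℝ} (ht : t ∈ Icc 0 T) :
    HasDerivWithinAt (fun t => ∫ x, 1 / 4 * etaC (u t) x ^ 2)
      (∫ x, massFlux (u t) x * (1 / 2 * etaX (u t) x)) (Icc 0 T) t := by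
  have hc := hu.tendsto ht
  have e := hasDerivWithinAt_integral_of_dualDeriv (n := 1) ht
    (y := fun _ t => etaC (u t)) (y' := fun _ t => etaX (u t))
    (ℓ := fun _ _ q => ∫ x, massFlux (u t) x * q x)
    (F := fun t x => 1 / 4 * etaC (u t) x ^ 2) (p := fun _ x => 1 / 2 * etaC (u t) x)
    (q := fun _ x => 1 / 2 * etaX (u t) x) (C := 1 / 4)
    (fun _ t _ => sob_eta (u t)) (fun _ => tL2_etaC hc) (fun _ => tL2_etaX hc)
    (fun _ => hu.dualDeriv_etaC ht)
    (fun _ => ⟨N2 (massFlux (u t)), fun p q hpq =>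
        (abs_integral_mul_le (memLp_massFlux _) hpq.memLp').trans (mul_le_mul_of_nonneg_left
          (by linarith [N2_nonneg p]) (N2_nonneg _))⟩)
    (fun _ => (sob_eta (u t)).const_mul _)
    (fun t _ => (memLp_etaC (u t)).integrable_sq.const_mul _)
    (.of_forall fun s x => by
      simp only [Finset.univ_unique, Finset.sum_singleton]
      refine le_of_eq ?_
      rw [← abs_of_nonneg (show 0 ≤ 1 / 4 * (etaC (u s) x - etaC (u t) x) ^ 2 by positivity)]
      congr 1; ring)
  simpa using e

theorem hasDerivWithinAt_energy {t : ℝ} (ht : t ∈ Icc 0 T) :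
    HasDerivWithinAt (fun t => energy (u t)) 0 (Icc 0 T) t := by
  have h1 := hasDerivWithinAt_of_tendsto (convex_Icc 0 T) ht
    (F := fun h t => (h ^ 2)⁻¹ * ∫ x, diffDensity 1 0 h (u t) (fun _ => 1) x)
    (D := fun h t => (h ^ 2)⁻¹ * ∫ x, diffRate 1 0 h (u t) (fun _ => 1) (fun _ => 0) x)
    (fun h hh t ht => (hu.hasDerivWithinAt_diffDensity 1 0 (le_of_lt hh) weight_one ht).const_mul _)
    (fun t ht => (hu.approach_const ht).tendsto_diffDensity_energy)
    (hu.approach ht).tendsto_diffRate_energy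
  have h2 := h1.add (hu.hasDerivWithinAt_integral_sq ht)
  have h3 : (∫ x, etaX (u t) x * (rho (u t) x * rho (u t) x * vel (u t) x))
      + ∫ x, massFlux (u t) x * (1 / 2 * etaX (u t) x) = 0 := by
    rw [← neg_eq_iff_add_eq_zero, ← integral_neg]
    congr 1; funext x
    have := rho_sq (hu.mem_NV t ht) x
    rw [massFlux, ← this]; ring
  rw [h3] at h2
  refine h2.congr (fun s hs => energy_eq (hu.mem_NV s hs)) (energy_eq (hu.mem_NV t ht))

end IsHGPSolution

end

section

variable {ι : Type*} {l : Filter ι}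

/-- A weight of class `C²`, with derivatives bounded and square integrable. -/
structure Weight2 (χ χ' χ'' : ℝ → ℝ) : Prop where
  weight : Weight χ χ'
  weight' : Weight χ' χ''
  memLp : MemLp χ' 2
  memLp' : MemLp χ'' 2

theorem Weight2.sob {χ χ' χ'' : ℝ → ℝ} (w : Weight2 χ χ' χ'') : Sob χ' χ'' :=
  .of_hasDerivAt w.weight'.1 w.memLp w.memLp'

theorem Bdd.tU {b : ℝ → ℝ} (hb : Bdd b) : TU l (fun _ => b) b :=
  TU.const hb.1 hb.2.choose_spec

theorem Weight2.tU_diff {χ χ' χ'' : ℝ → ℝ} (w : Weight2 χ χ' χ'') {H : ι → ℝ}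
    (hp : ∀ᶠ i in l, 0 < H i) (h0 : Tendsto H l (𝓝 0)) :
    TU l (fun i x => (H i)⁻¹ * (χ (x + H i) - χ x)) χ' := by
  obtain ⟨C, hC⟩ := w.weight'.bound'
  have h1 := h0.const_mul C
  rw [mul_zero] at h1
  refine TU.of_tendsto_zero (fun i => ?_) w.weight.continuous' w.weight'.bound h1 ?_
  · have := w.weight.continuous
    fun_prop
  · filter_upwards [hp] with i hi x
    have hb := (convex_Icc x (x + H i)).norm_image_sub_le_of_norm_hasDerivWithin_le (𝕜 := ℝ)
      (f := fun y => χ y - y * χ' x) (f' := fun y => χ' y - 1 * χ' x) (C := C * H i)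
      (fun y _ => ((w.weight.1 y).sub ((hasDerivAt_id y).mul_const _)).hasDerivWithinAt)
      (fun y hy => ?_) (left_mem_Icc.2 (by linarith)) (right_mem_Icc.2 (by linarith))
    · simp only [Real.norm_eq_abs, add_sub_cancel_left, abs_of_pos hi] at hb
      have e : (H i)⁻¹ * (χ (x + H i) - χ x) - χ' x
          = (H i)⁻¹ * (χ (x + H i) - (x + H i) * χ' x - (χ x - x * χ' x)) := by
        field_simp; ring
      rw [e, abs_mul, abs_of_pos (inv_pos.2 hi), inv_mul_le_iff₀ hi]
      linarith
    · have h2 := convex_univ.norm_image_sub_le_of_norm_hasDerivWithin_le (𝕜 := ℝ) (f := χ')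
        (f' := χ'') (C := C) (fun y _ => (w.weight'.1 y).hasDerivWithinAt) (fun y _ => hC y)
        (mem_univ x) (mem_univ y)
      rw [one_mul]
      refine h2.trans ?_
      have hC0 : 0 ≤ C := (abs_nonneg _).trans (hC 0)
      rw [Real.norm_eq_abs, abs_of_nonneg (by linarith [hy.1])]
      exact mul_le_mul_of_nonneg_left (by linarith [hy.2]) hC0

/-- The rate of change of the integral of `χηv`. -/
def momRate (χ' χ'' : ℝ → ℝ) (u : XSpace) : ℝ :=
  -(∫ x, χ' x * ((1 - 2 * etaC u x) * vel u x ^ 2 + (3 - 2 * etaC u x) * slope u x ^ 2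
      + 1 / 2 * etaC u x ^ 2)) - ∫ x, χ'' x * (slope u x * etaC u x)

theorem Approach.tL2_one_sub_prod {H : ι → ℝ} {U : ι → XSpace} {u : XSpace}
    (A : Approach l H U u) :
    TL2 l (fun i x => 1 - rho (U i) x * rho (U i) (x + H i)) (etaC u) := by
  have r1 := tU_rho A.conv
  have b := r1.mul_TL2 ((TU.const (l := l) (b := fun _ : ℝ => (1 : ℝ)) aestronglyMeasurable_const
    (C := |1|) fun _ => le_rfl).mul_TL2 A.tL2_diff_rho)
  have hH : TU l (fun i (_ : ℝ) => -H i) fun _ => 0 :=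
    TU.of_tendsto_zero (fun _ => continuous_const) continuous_const ⟨0, by simp⟩
      (ε := fun i => |H i|) (by simpa using A.lim.abs) (by simp)
  have c := (hH.mul_TL2 b).add (tL2_etaC A.conv)
  refine c.congr ?_ (.of_forall fun x => by simp)
  filter_upwards [A.pos, A.nv'] with i hi hn
  refine .of_forall fun x => ?_
  have := rho_sq hn x
  have h2 : etaC (U i) x = 1 - rho (U i) x ^ 2 := by linarith
  simp only [h2]
  field_simp
  ring

theorem Approach.tendsto_diffDensity_mom {H : ι → ℝ} {U : ι → XSpace} {u : XSpace}
    (A : Approach l H U u) {χ : ℝ → ℝ} (hχ : Bdd χ) :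
    Tendsto (fun i => (H i)⁻¹ * ∫ x, diffDensity 0 1 (H i) (U i) χ x) l
      (𝓝 (∫ x, χ x * (etaC u x * vel u x))) := by
  have hsm : TL2 l (fun i x => 1 - Real.sinc (incr (H i) (vel (U i)) x)) fun _ => 0 := by
    have h1 := A.lim.mul_const (2 * (N2 (vel u) + 1))
    rw [zero_mul] at h1
    have key : ∀ y, |1 - Real.sinc y| ≤ 2 * |y| := fun y => by
      rcases eq_or_ne y 0 with rfl | hy
      · simp
      · have := abs_sin_sub_le y
        have hy' := abs_pos.2 hy
        rw [← mul_sinc y, show y * Real.sinc y - y = -(y * (1 - Real.sinc y)) by ring, abs_neg,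
          abs_mul, ← sq_abs y] at this
        nlinarith
    have hm : ∀ i, AEStronglyMeasurable (fun x => 1 - Real.sinc (incr (H i) (vel (U i)) x)) :=
      fun i => (continuous_const.sub (Real.continuous_sinc.comp
        (continuous_incr (memLp_vel _) _))).aestronglyMeasurable
    refine ⟨?_, MemLp.zero, ?_⟩
    · filter_upwards [A.pos] with i hi
      exact memLp_of_abs_le (hm i) (memLp_incr (memLp_vel (U i)) hi.le).1 fun x => key _
    · refine squeeze_zero' (.of_forall fun _ => N2_nonneg _) ?_ h1
      filter_upwards [A.pos, (tL2_vel A.conv).eventually_N2_le] with i hi h3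
      have h4 := memLp_incr (memLp_vel (U i)) hi.le
      simp only [sub_zero]
      refine (N2_mono (h4.1.const_mul 2) (.of_forall fun x => ?_)).trans
        ((N2_const_mul 2 _).trans_le ?_)
      · rw [abs_mul, abs_two]; exact key _
      · rw [abs_two]
        have := mul_le_mul_of_nonneg_left h3 hi.le
        linarith [h4.2]
  have t0 := A.tL2_one_sub_prod
  have hb := hχ.tU (l := l)
  have t1 := hb.mul_TL2 t0
  have t2 := A.tL2_incr_vel
  have t3 := (hb.mul A.tU_prod_rho).mul_TL2 t2
  have e := (t1.integral_mul t2).add (t3.integral_mul hsm)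
  have e2 : (∫ x, χ x * etaC u x * vel u x) + ∫ x, χ x * (rho u x * rho u x) * vel u x * 0
      = ∫ x, χ x * (etaC u x * vel u x) := by
    simp only [mul_zero, integral_zero, add_zero, mul_assoc]
  rw [e2] at e
  refine e.congr' ?_
  filter_upwards [t1.1, t2.1, t3.1, hsm.1] with i m1 m2 m3 m4
  rw [← integral_const_mul, ← integral_add (integrable_mul_L2 m1 m2) (integrable_mul_L2 m3 m4)]
  congr 1; funext x
  simp only [diffDensity, trig, ← mul_sinc (incr _ _ _)]
  ring

theorem integral_shift_diff_mul {χ χ' : ℝ → ℝ} (w : Weight χ χ') {B : ℝ → ℝ}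
    (hB : Integrable B) (h : ℝ) :
    ∫ x, χ x * (B (x + h) - B x) = -∫ x, (χ (x + h) - χ x) * B (x + h) := by
  have i1 := w.bdd.integrable_mul hB
  have i2 := w.bdd.integrable_mul (hB.comp_add_right h)
  have i3 := i1.comp_add_right h
  have e : ∫ x, χ (x + h) * B (x + h) = ∫ x, χ x * B x :=
    integral_add_right_eq_self (fun x => χ x * B x) h
  simp only [mul_sub, sub_mul]
  rw [integral_sub i2 i1, integral_sub i3 i2, e]
  ring

/-- The correction `ρ τρ cos m - ρ²`. -/
def corr (h : ℝ) (u : XSpace) (x : ℝ) : ℝ :=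
  rho u x * rho u (x + h) * Real.cos (incr h (vel u) x) - rho u x ^ 2

theorem sob_corr {u : XSpace} (hu : u ∈ NV) {h : ℝ} (hh : 0 ≤ h) : Sob (corr h u)
    (fun x => -(rho u x * rho u (x + h) * ((slope u x + slope u (x + h))
      * Real.cos (incr h (vel u) x) + (vel u (x + h) - vel u x) * Real.sin (incr h (vel u) x)))
      + etaX u x) := by
  have h1 := ((sob_grad_incr 0 1 hu hh).const_mul (-1)).add (sob_eta u)
  convert! h1 using 1
  · funext x
    have := rho_sq hu x
    simp only [corr, trig]
    linarith
  · funext x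
    simp only [trig]; ring

theorem etaX_eq {u : XSpace} (hu : u ∈ NV) (x : ℝ) : etaX u x = 2 * slope u x * rho u x ^ 2 := by
  rw [rho_sq hu, slope]
  have := one_sub_etaC_pos hu x
  field_simp

theorem integral_diffRate_mom {u : XSpace} (hu : u ∈ NV) {h : ℝ} (hh : 0 ≤ h) {χ χ' χ'' : ℝ → ℝ}
    (w : Weight2 χ χ' χ'') :
    ∫ x, diffRate 0 1 h u χ χ' x =
      -(∫ x, (χ (x + h) - χ x) * quadFlux u (x + h))
      + (∫ x, (etaC u (x + h) - etaC u x)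
          * (χ x * (1 - rho u x * rho u (x + h) * Real.cos (incr h (vel u) x))))
      + -(∫ x, χ'' x * incr h (slope u) x)
      + -(∫ x, χ'' x * corr h u x)
      + (∫ x, corr h u x * (χ' x * (2 * slope u x)))
      - ∫ x, (rho u x * rho u (x + h) * Real.sin (incr h (vel u) x)) * (χ' x * (2 * vel u x)) := by
  have hs := memLp_slope hu
  have hv := memLp_vel u
  have Sc := sob_corr hu hh
  have q := integrable_fsub ((integrable_quadFlux hu).comp_add_right h) (integrable_quadFlux hu)
  have c1 : Bdd fun x => rho u x * rho u (x + h) * Real.sin (incr h (vel u) x) := by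
    have := ((bdd_rho hu).mul ((bdd_rho hu).shift h)).mul (bdd_trig_incr 0 1 hv h)
    simpa [trig] using this
  have c2 : Bdd fun x => 1 - rho u x * rho u (x + h) * Real.cos (incr h (vel u) x) := by
    have := (Bdd.const 1).sub (((bdd_rho hu).mul ((bdd_rho hu).shift h)).mul (bdd_trig_incr 1 0 hv h))
    simpa [trig] using this
  have S2 := w.weight.mul_sob (sob_grad_incr 0 1 hu hh)
  have m2 : MemLp (fun x => χ x * (1 - rho u x * rho u (x + h) * Real.cos (incr h (vel u) x))) 2 := by
    simpa [trig] using S2.memLp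
  have j1 := w.weight.bdd.integrable_mul q
  have j2 := integrable_mul_L2 (memLp_fsub ((memLp_etaC u).shift h) (memLp_etaC u)) m2
  have j3 := integrable_mul_L2 w.memLp (sob_incr hs hh).memLp'
  have j4 := integrable_mul_L2 w.memLp Sc.memLp'
  have j5 := integrable_mul_L2 Sc.memLp (w.weight.bdd'.mul_L2 (hs.const_mul 2))
  have j6 := integrable_mul_L2 (c1.mul_L2 w.memLp) (hv.const_mul 2)
  have e6 : ∫ x, (rho u x * rho u (x + h) * Real.sin (incr h (vel u) x)) * (χ' x * (2 * vel u x))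
      = ∫ x, rho u x * rho u (x + h) * Real.sin (incr h (vel u) x) * χ' x * (2 * vel u x) := by
    congr 1; funext x; ring
  rw [← integral_shift_diff_mul w.weight (integrable_quadFlux hu),
    ← w.sob.integral_mul_deriv (sob_incr hs hh), ← w.sob.integral_mul_deriv Sc, e6,
    ← integral_add j1 j2, ← integral_add (integrable_fadd j1 j2) j3,
    ← integral_add (integrable_fadd (integrable_fadd j1 j2) j3) j4,
    ← integral_add (integrable_fadd (integrable_fadd (integrable_fadd j1 j2) j3) j4) j5,
    ← integral_sub (integrable_fadd (integrable_fadd (integrable_fadd (integrable_fadd j1 j2) j3) j4) j5) j6]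
  congr 1; funext x
  have e1 := rho_sq hu x
  have e2 := rho_sq hu (x + h)
  simp only [diffRate, trig, corr, etaX_eq hu]
  ring

theorem Approach.tendsto_diffRate_mom {H : ι → ℝ} {U : ι → XSpace} {u : XSpace}
    (A : Approach l H U u) {χ χ' χ'' : ℝ → ℝ} (w : Weight2 χ χ' χ'') :
    Tendsto (fun i => (H i)⁻¹ * ∫ x, diffRate 0 1 (H i) (U i) χ χ' x) l
      (𝓝 (momRate χ' χ'' u)) := by
  have b1 := w.tU_diff A.pos A.lim
  have bχ := w.weight.bdd.tU (l := l)
  have bχ' := w.weight.bdd'.tU (l := l)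
  have s0 := tL2_slope A.conv A.nv
  have v0 := tL2_vel A.conv
  have s1 := A.tL2_slope_shift
  have v1 := A.tL2_vel_shift
  have r2 := A.tU_prod_rho
  have c2 : TL2 l (fun i => χ'') χ'' := TL2.const w.memLp'
  have hcos0 : TL2 l (fun i x => 1 - Real.cos (incr (H i) (vel (U i)) x)) fun _ => 0 := by
    have hH : TU l (fun i (_ : ℝ) => H i) fun _ => 0 :=
      TU.of_tendsto_zero (fun _ => continuous_const) continuous_const ⟨0, by simp⟩
        (ε := fun i => |H i|) (by simpa using A.lim.abs) (by simp)
    refine (hH.mul_TL2 A.tL2_one_sub_cos).congr ?_ (.of_forall fun x => by simp)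
    filter_upwards [A.pos] with i hi
    exact .of_forall fun x => by field_simp
  have hrr : TL2 l (fun i x => 1 - rho (U i) x * rho (U i) (x + H i)) (etaC u) := A.tL2_one_sub_prod
  have hone : TL2 l (fun i x => 1 - rho (U i) x * rho (U i) (x + H i)
      * Real.cos (incr (H i) (vel (U i)) x)) (etaC u) := by
    refine (hrr.add (r2.mul_TL2 hcos0)).congr (.of_forall fun i =>
      .of_forall fun x => ?_) (.of_forall fun x => ?_)
    · ring
    · ring
  have hcorr : TL2 l (fun i x => (H i)⁻¹ * corr (H i) (U i) x)
      (fun x => rho u x * -(slope u x * rho u x)) := by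
    refine (((tU_rho A.conv).mul_TL2 A.tL2_diff_rho).sub (r2.mul_TL2 A.tL2_one_sub_cos)).congr
      (.of_forall fun i => .of_forall fun x => ?_)
      (.of_forall fun x => ?_)
    · simp only [corr]; ring
    · ring
  have m2s : TL2 l (fun i x => χ' x * (2 * slope (U i) x)) fun x => χ' x * (2 * slope u x) :=
    bχ'.mul_TL2 ((Bdd.const 2).tU.mul_TL2 s0)
  have m2v : TL2 l (fun i x => χ' x * (2 * vel (U i) x)) fun x => χ' x * (2 * vel u x) :=
    bχ'.mul_TL2 ((Bdd.const 2).tU.mul_TL2 v0)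
  have T1s := (b1.mul_TL2 s1).integral_mul s1
  have T1v := (b1.mul_TL2 v1).integral_mul v1
  have T2 := A.tL2_diff_etaC.integral_mul (bχ.mul_TL2 hone)
  have T3 := c2.integral_mul A.tL2_incr_slope
  have T4 := c2.integral_mul hcorr
  have T5 := hcorr.integral_mul m2s
  have T6 := (r2.mul_TL2 A.tL2_sin).integral_mul m2v
  have T := (((((T1s.sub T1v).neg.add T2).add T3.neg).add T4.neg).add T5).sub T6
  have hfin : -((∫ x, χ' x * slope u x * slope u x) - ∫ x, χ' x * vel u x * vel u x)
      + (∫ x, etaX u x * (χ x * etaC u x)) + -(∫ x, χ'' x * slope u x)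
      + -(∫ x, χ'' x * (rho u x * -(slope u x * rho u x)))
      + (∫ x, rho u x * -(slope u x * rho u x) * (χ' x * (2 * slope u x)))
      - ∫ x, rho u x * rho u x * vel u x * (χ' x * (2 * vel u x)) = momRate χ' χ'' u := by
    have hs := s0.2
    have hv := v0.2
    have hn := A.nv
    have he := memLp_etaC u
    have B1 := w.weight.bdd'
    have R := (bdd_rho hn).mul (bdd_rho hn)
    have hη : ∫ x, etaX u x * (χ x * etaC u x) = ∫ x, χ' x * (-(1 / 2) * etaC u x) * etaC u x := by
      have S := w.weight.mul_sob (sob_eta u)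
      have e1 := S.integral_mul_deriv (sob_eta u)
      have i1 := integrable_mul_L2 (B1.mul_L2 he) he
      have i2 := integrable_mul_L2 (w.weight.bdd.mul_L2 (memLp_etaX u)) he
      have e2 : ∫ x, (χ' x * etaC u x + χ x * etaX u x) * etaC u x
          = (∫ x, χ' x * etaC u x * etaC u x) + ∫ x, χ x * etaX u x * etaC u x := by
        rw [← integral_add i1 i2]; simp only [add_mul]
      have e3 : ∫ x, etaX u x * (χ x * etaC u x) = ∫ x, χ x * etaC u x * etaX u x := by
        simp only [mul_comm]
      have e4 : ∫ x, χ x * etaX u x * etaC u x = ∫ x, χ x * etaC u x * etaX u x := by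
        congr 1; funext x; ring
      have e5 : ∫ x, χ' x * (-(1 / 2) * etaC u x) * etaC u x
          = -(1 / 2) * ∫ x, χ' x * etaC u x * etaC u x := by
        rw [← integral_const_mul]; congr 1; funext x; ring
      linarith
    have j1 := integrable_mul_L2 (B1.mul_L2 hs) hs
    have j2 := integrable_mul_L2 (B1.mul_L2 hv) hv
    have j3 := integrable_mul_L2 (B1.mul_L2 (he.const_mul (-(1 / 2)))) he
    have j4 := integrable_mul_L2 w.memLp' hs
    have j5 := integrable_mul_L2 w.memLp' hcorr.2
    have j6 := integrable_mul_L2 hcorr.2 m2s.2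
    have j7 := integrable_mul_L2 (R.mul_L2 hv) m2v.2
    have j8 : Integrable (fun x => χ'' x * (slope u x * etaC u x)) := by
      have := integrable_mul_L2 (w.weight'.bdd'.mul_L2 hs) he
      simpa only [mul_assoc] using this
    have jn : Integrable (fun x => -(χ' x * slope u x * slope u x - χ' x * vel u x * vel u x))
        volume := (integrable_fsub j1 j2).neg
    have eA : (∫ x, χ'' x * (slope u x * etaC u x)) = (∫ x, χ'' x * slope u x)
        + ∫ x, χ'' x * (rho u x * -(slope u x * rho u x)) := by
      rw [← integral_add j4 j5]
      congr 1; funext x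
      have := rho_sq hn x
      rw [show etaC u x = 1 - rho u x ^ 2 by linarith]; ring
    have eB : -(∫ x, χ' x * ((1 - 2 * etaC u x) * vel u x ^ 2 + (3 - 2 * etaC u x) * slope u x ^ 2
        + 1 / 2 * etaC u x ^ 2)) =
        -((∫ x, χ' x * slope u x * slope u x) - ∫ x, χ' x * vel u x * vel u x)
        + (∫ x, χ' x * (-(1 / 2) * etaC u x) * etaC u x)
        + (∫ x, rho u x * -(slope u x * rho u x) * (χ' x * (2 * slope u x)))
        - ∫ x, rho u x * rho u x * vel u x * (χ' x * (2 * vel u x)) := by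
      rw [← integral_neg, ← integral_sub j1 j2, ← integral_neg,
        ← integral_add jn j3, ← integral_add (integrable_fadd jn j3) j6,
        ← integral_sub (integrable_fadd (integrable_fadd jn j3) j6) j7]
      congr 1; funext x
      have := rho_sq hn x
      rw [show etaC u x = 1 - rho u x ^ 2 by linarith]; ring
    rw [momRate, eA, eB, hη]
    ring
  rw [← hfin]
  refine T.congr' ?_
  filter_upwards [A.pos, A.nv', s1.1, v1.1, (b1.mul_TL2 s1).1, (b1.mul_TL2 v1).1]
    with i hi hn ms mv ms' mv'
  rw [integral_diffRate_mom hn hi.le w]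
  have e1 : (∫ x, (H i)⁻¹ * (χ (x + H i) - χ x) * slope (U i) (x + H i) * slope (U i) (x + H i))
      - (∫ x, (H i)⁻¹ * (χ (x + H i) - χ x) * vel (U i) (x + H i) * vel (U i) (x + H i))
      = (H i)⁻¹ * ∫ x, (χ (x + H i) - χ x) * quadFlux (U i) (x + H i) := by
    rw [← integral_const_mul, ← integral_sub (integrable_mul_L2 ms' ms) (integrable_mul_L2 mv' mv)]
    congr 1; funext x
    simp only [quadFlux]; ring
  rw [e1]
  have pull : ∀ {f g : ℝ → ℝ}, (∀ x, f x = (H i)⁻¹ * g x) → ∫ x, f x = (H i)⁻¹ * ∫ x, g x := by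
    intro f g hfg
    rw [← integral_const_mul]; simp only [hfg]
  rw [pull (f := fun x => (H i)⁻¹ * (etaC (U i) (x + H i) - etaC (U i) x) * _)
      (fun x => mul_assoc _ _ _),
    pull (f := fun x => χ'' x * ((H i)⁻¹ * incr (H i) (slope (U i)) x))
      (fun x => mul_left_comm _ _ _),
    pull (f := fun x => χ'' x * ((H i)⁻¹ * corr (H i) (U i) x))
      (fun x => mul_left_comm _ _ _),
    pull (f := fun x => (H i)⁻¹ * corr (H i) (U i) x * _) (fun x => mul_assoc _ _ _),
    pull (f := fun x => rho (U i) x * rho (U i) (x + H i)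
      * ((H i)⁻¹ * Real.sin (incr (H i) (vel (U i)) x)) * (χ' x * (2 * vel (U i) x)))
      (fun x => show _ = (H i)⁻¹ * ((rho (U i) x * rho (U i) (x + H i)
        * Real.sin (incr (H i) (vel (U i)) x)) * (χ' x * (2 * vel (U i) x))) by ring)]
  ring

theorem IsHGPSolution.hasDerivWithinAt_mom {T : ℝ} {u : ℝ → XSpace} (hu : IsHGPSolution T u)
    {χ χ' χ'' : ℝ → ℝ} (w : Weight2 χ χ' χ'') {t : ℝ} (ht : t ∈ Icc 0 T) :
    HasDerivWithinAt (fun t => ∫ x, χ x * (etaC (u t) x * vel (u t) x)) (momRate χ' χ'' (u t))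
      (Icc 0 T) t :=
  hasDerivWithinAt_of_tendsto (convex_Icc 0 T) ht
    (F := fun h t => h⁻¹ * ∫ x, diffDensity 0 1 h (u t) χ x)
    (D := fun h t => h⁻¹ * ∫ x, diffRate 0 1 h (u t) χ χ' x)
    (fun _ hh _ ht => (hu.hasDerivWithinAt_diffDensity 0 1 (le_of_lt hh) w.weight ht).const_mul _)
    (fun _ ht => (hu.approach_const ht).tendsto_diffDensity_mom w.weight.bdd)
    ((hu.approach ht).tendsto_diffRate_mom w)

end

section

/-! ### Functions of a speed and a position -/

/-- `g` is differentiable at `(c, y)` with partial derivatives `gc` and `gy`. -/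
def PD (g : ℝ → ℝ → ℝ) (gc gy c y : ℝ) : Prop :=
  HasFDerivAt (fun p : ℝ × ℝ => g p.1 p.2)
    (gc • ContinuousLinearMap.fst ℝ ℝ ℝ + gy • ContinuousLinearMap.snd ℝ ℝ ℝ) (c, y)

theorem PD.congr {g : ℝ → ℝ → ℝ} {gc gy gc' gy' c y : ℝ} (h : PD g gc gy c y) (h1 : gc = gc')
    (h2 : gy = gy') : PD g gc' gy' c y := by rwa [← h1, ← h2]

theorem PD.mul {f g : ℝ → ℝ → ℝ} {fc fy gc gy c y : ℝ} (hf : PD f fc fy c y) (hg : PD g gc gy c y) :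
    PD (fun c y => f c y * g c y) (fc * g c y + f c y * gc) (fy * g c y + f c y * gy) c y := by
  refine (HasFDerivAt.mul hf hg).congr_fderiv ?_
  ext <;> simp <;> ring

theorem PD.add {f g : ℝ → ℝ → ℝ} {fc fy gc gy c y : ℝ} (hf : PD f fc fy c y) (hg : PD g gc gy c y) :
    PD (fun c y => f c y + g c y) (fc + gc) (fy + gy) c y := by
  refine (HasFDerivAt.add hf hg).congr_fderiv ?_
  ext <;> simp

theorem PD.comp {f : ℝ → ℝ → ℝ} {F : ℝ → ℝ} {F' fc fy c y : ℝ} (hF : HasDerivAt F F' (f c y))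
    (hf : PD f fc fy c y) : PD (fun c y => F (f c y)) (F' * fc) (F' * fy) c y := by
  refine (HasDerivAt.comp_hasFDerivAt (c, y) (h₂ := F) (f := fun p : ℝ × ℝ => f p.1 p.2) hF hf).congr_fderiv ?_
  ext <;> simp

theorem PD.fst (c y : ℝ) : PD (fun c _ => c) 1 0 c y := by
  refine (hasFDerivAt_fst (𝕜 := ℝ) (p := (c, y))).congr_fderiv ?_
  ext <;> simp

theorem PD.snd (c y : ℝ) : PD (fun _ y => y) 0 1 c y := by
  refine (hasFDerivAt_snd (𝕜 := ℝ) (p := (c, y))).congr_fderiv ?_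
  ext <;> simp

theorem PD.const (k c y : ℝ) : PD (fun _ _ => k) 0 0 c y := by
  refine (hasFDerivAt_const k (c, y)).congr_fderiv ?_
  ext <;> simp

theorem PD.hasDerivAt_right {g : ℝ → ℝ → ℝ} {gc gy c y : ℝ} (h : PD g gc gy c y) :
    HasDerivAt (g c) gy y := by
  have h1 : HasDerivAt (fun y : ℝ => (c, y)) ((0 : ℝ), (1 : ℝ)) y :=
    (hasDerivAt_const y c).prodMk (hasDerivAt_id y)
  have h2 := (show HasFDerivAt (fun p : ℝ × ℝ => g p.1 p.2) _ (c, y) from h).comp_hasDerivAt y h1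
  exact HasDerivAt.congr_deriv (f := g c) h2 (by simp)

theorem PD.continuousAt {g : ℝ → ℝ → ℝ} {gc gy c y : ℝ} (h : PD g gc gy c y) :
    ContinuousAt (fun p : ℝ × ℝ => g p.1 p.2) (c, y) := HasFDerivAt.continuousAt h

/-- Speeds bounded away from `0` and `±√2`. -/
def speeds (κ : ℝ) : Set ℝ := {c | κ ≤ c ^ 2 ∧ κ ≤ 2 - c ^ 2}

theorem admSpeed_of_mem {κ c : ℝ} (hκ : 0 < κ) (h : c ∈ speeds κ) : AdmSpeed c := by
  obtain ⟨h1, h2⟩ := h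
  refine ⟨fun h => ?_, ?_⟩
  · rw [h] at h1; norm_num at h1; linarith
  · rw [mem_Ioo, ← abs_lt]
    exact Real.lt_sqrt_of_sq_lt (by rw [sq_abs]; linarith)

theorem AdmSpeed.exists_mem {c : ℝ} (h : AdmSpeed c) : ∃ κ > 0, ∀ᶠ b in 𝓝 c, b ∈ speeds κ := by
  have h1 : 0 < c ^ 2 := by have := h.1; positivity
  have h2 := h.sq_lt
  refine ⟨min (c ^ 2) (2 - c ^ 2) / 2, by have : 0 < 2 - c ^ 2 := by linarith
                                          positivity, ?_⟩
  have h3 : min (c ^ 2) (2 - c ^ 2) / 2 < c ^ 2 := by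
    linarith [min_le_left (c ^ 2) (2 - c ^ 2)]
  have h4 : min (c ^ 2) (2 - c ^ 2) / 2 < 2 - c ^ 2 := by
    linarith [min_le_right (c ^ 2) (2 - c ^ 2)]
  have c1 : ContinuousAt (fun b : ℝ => b ^ 2) c := by fun_prop
  have c2 : ContinuousAt (fun b : ℝ => 2 - b ^ 2) c := by fun_prop
  filter_upwards [c1.eventually (lt_mem_nhds h3), c2.eventually (lt_mem_nhds h4)] with b a1 a2
  exact ⟨a1.le, a2.le⟩

/-- The weight `1/(1+y²)`. -/
def wt (y : ℝ) : ℝ := (1 + y ^ 2)⁻¹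

theorem wt_pos (y : ℝ) : 0 < wt y := by unfold wt; positivity

theorem wt_le_one (y : ℝ) : wt y ≤ 1 := inv_le_one_of_one_le₀ (by nlinarith [sq_nonneg y])

theorem continuous_wt : Continuous wt := by
  unfold wt
  exact Continuous.inv₀ (by fun_prop) fun y => by positivity

/-- Functions bounded uniformly in the position, locally uniformly in the speed. -/
def UB (f : ℝ → ℝ → ℝ) : Prop := ∀ κ > 0, ∃ C, 0 ≤ C ∧ ∀ c ∈ speeds κ, ∀ y, |f c y| ≤ C

/-- Functions bounded by `1/(1+y²)`, locally uniformly in the speed. -/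
def UD (f : ℝ → ℝ → ℝ) : Prop := ∀ κ > 0, ∃ C, 0 ≤ C ∧ ∀ c ∈ speeds κ, ∀ y, |f c y| ≤ C * wt y

theorem UB.mul {f g : ℝ → ℝ → ℝ} (hf : UB f) (hg : UB g) : UB fun c y => f c y * g c y := by
  intro κ hκ
  obtain ⟨C, hC, h1⟩ := hf κ hκ
  obtain ⟨D, hD, h2⟩ := hg κ hκ
  refine ⟨C * D, mul_nonneg hC hD, fun c hc y => ?_⟩
  rw [abs_mul]; exact mul_le_mul (h1 c hc y) (h2 c hc y) (abs_nonneg _) hC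

theorem UB.mul_UD {f g : ℝ → ℝ → ℝ} (hf : UB f) (hg : UD g) : UD fun c y => f c y * g c y := by
  intro κ hκ
  obtain ⟨C, hC, h1⟩ := hf κ hκ
  obtain ⟨D, hD, h2⟩ := hg κ hκ
  refine ⟨C * D, mul_nonneg hC hD, fun c hc y => ?_⟩
  rw [abs_mul, mul_assoc]; exact mul_le_mul (h1 c hc y) (h2 c hc y) (abs_nonneg _) hC

theorem UD.add {f g : ℝ → ℝ → ℝ} (hf : UD f) (hg : UD g) : UD fun c y => f c y + g c y := by
  intro κ hκ
  obtain ⟨C, hC, h1⟩ := hf κ hκ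
  obtain ⟨D, hD, h2⟩ := hg κ hκ
  refine ⟨C + D, add_nonneg hC hD, fun c hc y => (abs_add_le _ _).trans ?_⟩
  rw [add_mul]; exact add_le_add (h1 c hc y) (h2 c hc y)

theorem UD.UB {f : ℝ → ℝ → ℝ} (hf : UD f) : UB f := by
  intro κ hκ
  obtain ⟨C, hC, h1⟩ := hf κ hκ
  exact ⟨C, hC, fun c hc y => (h1 c hc y).trans (mul_le_of_le_one_right hC (wt_le_one y))⟩

theorem UD.congr {f g : ℝ → ℝ → ℝ} (hf : UD f) (h : ∀ c y, f c y = g c y) : UD g := by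
  have : f = g := by funext c y; exact h c y
  rwa [← this]

theorem UB.const (k : ℝ) : UB fun _ _ => k := fun _ _ => ⟨|k|, abs_nonneg _, fun _ _ _ => le_rfl⟩

theorem UB.fst : UB fun c _ => c := fun κ hκ => ⟨√2, Real.sqrt_nonneg _, fun c hc _ => by
  refine Real.abs_le_sqrt ?_
  linarith [hc.2]⟩

/-! ### The derivatives of the soliton profiles -/

/-- `√(2 - c²)`. -/
def sc (c : ℝ) : ℝ := √(2 - c ^ 2)

theorem hasDerivAt_tanh (z : ℝ) : HasDerivAt Real.tanh (1 / Real.cosh z ^ 2) z := by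
  have h := (Real.hasDerivAt_sinh z).div (Real.hasDerivAt_cosh z) (Real.cosh_pos z).ne'
  rw [funext Real.tanh_eq_sinh_div_cosh]
  refine h.congr_deriv ?_
  have := Real.cosh_sq z
  congr 1
  linarith

/-- `tanh(√(2 - c²) y / 2)`. -/
def solTh (c y : ℝ) : ℝ := Real.tanh (sc c * y / 2)

/-- The inverse of `1 - η_c`. -/
def solInv (c y : ℝ) : ℝ := (1 - solEta c y)⁻¹

/-- `∂_y η_c`. -/
def eY (c y : ℝ) : ℝ := -(sc c * (solTh c y * solEta c y))

/-- `∂_c η_c`. -/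
def eC (c y : ℝ) : ℝ :=
  -c * (sc c)⁻¹ * (2 * (sc c)⁻¹ * solEta c y - solTh c y * (y * solEta c y))

/-- `∂_y² η_c`. -/
def eYY (c y : ℝ) : ℝ := sc c ^ 2 * solEta c y - 3 * solEta c y * solEta c y

/-- `∂_c ∂_y η_c`. -/
def eYC (c y : ℝ) : ℝ := c * (sc c)⁻¹ * (solTh c y * solEta c y)
  + c * (sc c)⁻¹ * (sc c)⁻¹ * solEta c y * (y * solEta c y) - sc c * solTh c y * eC c y

/-- `∂_y³ η_c`. -/
def eYYY (c y : ℝ) : ℝ := sc c ^ 2 * eY c y - 6 * solEta c y * eY c y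

/-- `∂_y v_c`. -/
def vY (c y : ℝ) : ℝ := -(1 / 2) * c * (solInv c y * solInv c y) * eY c y

/-- `∂_c v_c`. -/
def vC (c y : ℝ) : ℝ := -(1 / 2) * solInv c y * solEta c y
  + -(1 / 2) * c * (solInv c y * solInv c y) * eC c y

/-- `∂_y² v_c`. -/
def vYY (c y : ℝ) : ℝ := -(1 / 2) * c * (solInv c y * solInv c y)
  * (eYY c y + 2 * solInv c y * eY c y * eY c y)

/-- `∂_c ∂_y v_c`. -/
def vYC (c y : ℝ) : ℝ := -(1 / 2) * (solInv c y * solInv c y) * eY c y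
  + -(1 / 2) * c * (solInv c y * solInv c y) * (eYC c y + 2 * solInv c y * eC c y * eY c y)

/-- `∂_y³ v_c`. -/
def vYYY (c y : ℝ) : ℝ := -(1 / 2) * c * (solInv c y * solInv c y)
  * (eYYY c y + 6 * solInv c y * eY c y * eYY c y
    + 6 * (solInv c y * solInv c y) * (eY c y * eY c y) * eY c y)

section

variable {c : ℝ} (h : AdmSpeed c)
include h

theorem sc_pos : 0 < sc c := Real.sqrt_pos.2 (by linarith [h.sq_lt])

theorem sc_sq : sc c ^ 2 = 2 - c ^ 2 := Real.sq_sqrt (by linarith [h.sq_lt])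

theorem solEta_eq (y : ℝ) : solEta c y = 1 / 2 * (sc c ^ 2 * (1 - solTh c y ^ 2)) := by
  have h1 := Real.cosh_pos (sc c * y / 2)
  have h2 := Real.cosh_sq (sc c * y / 2)
  rw [solEta, solTh, Real.tanh_eq_sinh_div_cosh, sc_sq h]
  change (2 - c ^ 2) / (2 * Real.cosh (sc c * y / 2) ^ 2) = _
  field_simp
  rw [h2]; ring

theorem solInv_pos (y : ℝ) : 0 < 1 - solEta c y := by
  have := one_sub_solEta_pos h y
  have h1 := h.1
  have : 0 < c ^ 2 := by positivity
  linarith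

theorem solV_eq (y : ℝ) : solV c y = -(1 / 2) * c * (solEta c y * solInv c y) := by
  have := solInv_pos h y
  rw [solV, solInv]; field_simp

theorem pd_sc (y : ℝ) : PD (fun c _ => sc c) (-c * (sc c)⁻¹) 0 c y := by
  have h1 := (PD.const 2 c y).add ((PD.const (-1) c y).mul ((PD.fst c y).mul (PD.fst c y)))
  have h2 : 0 < 2 + -1 * (c * c) := by nlinarith [h.sq_lt]
  have h3 := PD.comp (F := Real.sqrt) (f := fun c _ => 2 + -1 * (c * c)) (Real.hasDerivAt_sqrt h2.ne') h1
  have e : (fun c (_ : ℝ) => sc c) = fun c _ => √(2 + -1 * (c * c)) := by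
    funext c _; simp only [sc]; congr 1; ring
  rw [e]
  refine h3.congr ?_ (by simp)
  have h4 := sc_pos h
  rw [show √(2 + -1 * (c * c)) = sc c from (congrFun (congrFun e c) 0).symm]
  field_simp
  ring

theorem pd_th (y : ℝ) : PD solTh (-c * (sc c)⁻¹ * (sc c)⁻¹ * (sc c)⁻¹ * (y * solEta c y))
    ((sc c)⁻¹ * solEta c y) c y := by
  have h1 := ((pd_sc h y).mul (PD.snd c y)).mul (PD.const (1 / 2) c y)
  have h2 : HasDerivAt Real.tanh (1 - Real.tanh (sc c * y * (1 / 2)) ^ 2) (sc c * y * (1 / 2)) :=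
    (hasDerivAt_tanh _).congr_deriv (by
      have := Real.cosh_pos (sc c * y * (1 / 2))
      rw [Real.tanh_eq_sinh_div_cosh, div_pow, Real.sinh_sq]; field_simp; ring)
  have h3 := PD.comp (F := Real.tanh) (f := fun c y => sc c * y * (1 / 2)) h2 h1
  have e : solTh = fun c y => Real.tanh (sc c * y * (1 / 2)) := by
    funext c y; simp only [solTh]; congr 1; ring
  have h4 := sc_pos h
  have h5 := solEta_eq h y
  rw [e] at h5 ⊢
  refine h3.congr ?_ ?_ <;> rw [h5] <;> field_simp <;> ring

theorem pd_eta (y : ℝ) : PD solEta (eC c y) (eY c y) c y := by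
  have hT := pd_th h y
  have hs := pd_sc h y
  have h1 := (PD.const (1 / 2) c y).mul ((hs.mul hs).mul
    ((PD.const 1 c y).add ((PD.const (-1) c y).mul (hT.mul hT))))
  have h4 := sc_pos h
  have h5 := solEta_eq h y
  have hev : (fun p : ℝ × ℝ => solEta p.1 p.2) =ᶠ[𝓝 (c, y)] fun p => 1 / 2 * (sc p.1 * sc p.1
      * (1 + -1 * (solTh p.1 p.2 * solTh p.1 p.2))) := by
    obtain ⟨κ, hκ, hev⟩ := h.exists_mem
    have := (continuous_fst.tendsto (c, y)).eventually hev
    filter_upwards [this] with p hp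
    rw [solEta_eq (admSpeed_of_mem hκ hp)]; ring
  refine PD.congr (HasFDerivAt.congr_of_eventuallyEq h1 hev) ?_ ?_
  · simp only [eC]
    have e2 : solTh c y * solTh c y = 1 - 2 * solEta c y / sc c ^ 2 := by
      rw [h5]; field_simp; ring
    rw [e2]
    field_simp
    ring
  · simp only [eY]
    field_simp
    ring

theorem pd_inv (y : ℝ) : PD solInv (solInv c y * solInv c y * eC c y)
    (solInv c y * solInv c y * eY c y) c y := by
  have hp := solInv_pos h y
  have h1 := (PD.const 1 c y).add ((PD.const (-1) c y).mul (pd_eta h y))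
  have hp' : 1 + -1 * solEta c y ≠ 0 := by linarith
  have h2 := PD.comp (F := fun z => z⁻¹) (f := fun c y => 1 + -1 * solEta c y) (hasDerivAt_inv hp') h1
  have e : solInv = fun c y => (1 + -1 * solEta c y)⁻¹ := by
    funext c y; simp only [solInv]; congr 1; ring
  rw [e]
  refine h2.congr ?_ ?_
  · field_simp; ring
  · field_simp; ring

theorem pd_eY (y : ℝ) : PD eY (eYC c y) (eYY c y) c y := by
  have h1 := (PD.const (-1) c y).mul ((pd_sc h y).mul ((pd_th h y).mul (pd_eta h y)))
  have e : eY = fun c y => -1 * (sc c * (solTh c y * solEta c y)) := by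
    funext c y; simp only [eY]; ring
  have h4 := sc_pos h
  rw [e]
  refine h1.congr ?_ ?_
  · simp only [eYC]
    field_simp
    ring
  · have e2 : solTh c y * solTh c y = 1 - 2 * solEta c y / sc c ^ 2 := by
      rw [solEta_eq h]; field_simp; ring
    have e3 : solTh c y * eY c y = -(sc c * solEta c y * (1 - 2 * solEta c y / sc c ^ 2)) := by
      rw [← e2]; simp only [eY]; ring
    simp only [eYY, e3]
    field_simp
    ring

theorem pd_v (y : ℝ) : PD solV (vC c y) (vY c y) c y := by
  have h1 := ((PD.const (-(1 / 2)) c y).mul (PD.fst c y)).mul ((pd_eta h y).mul (pd_inv h y))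
  have hev : (fun p : ℝ × ℝ => solV p.1 p.2) =ᶠ[𝓝 (c, y)] fun p => -(1 / 2) * p.1
      * (solEta p.1 p.2 * solInv p.1 p.2) := by
    obtain ⟨κ, hκ, hev⟩ := h.exists_mem
    have := (continuous_fst.tendsto (c, y)).eventually hev
    filter_upwards [this] with p hp
    rw [solV_eq (admSpeed_of_mem hκ hp)]
  have hp := solInv_pos h y
  have e : solEta c y = 1 - (solInv c y)⁻¹ := by rw [solInv, inv_inv]; ring
  have hi : 0 < solInv c y := inv_pos.2 hp
  refine PD.congr (HasFDerivAt.congr_of_eventuallyEq h1 hev) ?_ ?_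
  · simp only [vC, e]
    field_simp
    ring
  · simp only [vY, e]
    field_simp
    ring

theorem pd_vY (y : ℝ) : PD vY (vYC c y) (vYY c y) c y := by
  have h1 := (((PD.const (-(1 / 2)) c y).mul (PD.fst c y)).mul ((pd_inv h y).mul (pd_inv h y))).mul
    (pd_eY h y)
  refine PD.congr h1 ?_ ?_
  · simp only [vYC]; ring
  · simp only [vYY]; ring

theorem hasDerivAt_eYY (y : ℝ) : HasDerivAt (eYY c) (eYYY c y) y := by
  have h1 := (pd_eta h y).hasDerivAt_right
  refine ((h1.const_mul (sc c ^ 2)).sub ((h1.const_mul 3).mul h1)).congr_deriv ?_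
  simp only [eYYY]; ring

theorem hasDerivAt_vYY (y : ℝ) : HasDerivAt (vYY c) (vYYY c y) y := by
  have h1 := (pd_eY h y).hasDerivAt_right
  have h2 := (pd_inv h y).hasDerivAt_right
  refine (((h2.mul h2).const_mul (-(1 / 2) * c)).mul ((hasDerivAt_eYY h y).add
    (((h2.const_mul 2).mul h1).mul h1))).congr_deriv ?_
  simp only [vYYY, Pi.mul_apply, Pi.add_apply]
  ring

end

theorem deriv_solEta_eq {c : ℝ} (h : AdmSpeed c) : deriv (solEta c) = eY c :=
  funext fun y => (pd_eta h y).hasDerivAt_right.deriv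

theorem deriv_solV_eq {c : ℝ} (h : AdmSpeed c) : deriv (solV c) = vY c :=
  funext fun y => (pd_v h y).hasDerivAt_right.deriv

/-! ### Decay -/

theorem ub_th : UB solTh := fun _ _ => ⟨1, zero_le_one, fun _ _ _ => (Real.abs_tanh_lt_one _).le⟩

theorem ub_sc : UB fun c _ => sc c := fun κ hκ => ⟨√2, Real.sqrt_nonneg _, fun c _ _ => by
  change |√(2 - c ^ 2)| ≤ √2
  rw [abs_of_nonneg (Real.sqrt_nonneg _)]
  exact Real.sqrt_le_sqrt (by nlinarith [sq_nonneg c])⟩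

theorem ub_sc_inv : UB fun c _ => (sc c)⁻¹ := fun κ hκ => ⟨(√κ)⁻¹, by positivity, fun c hc _ => by
  have : √κ ≤ sc c := Real.sqrt_le_sqrt hc.2
  have := Real.sqrt_pos.2 hκ
  change |(sc c)⁻¹| ≤ _
  rw [abs_of_pos (inv_pos.2 (by linarith))]
  gcongr⟩

theorem ub_inv : UB solInv := fun κ hκ => ⟨2 / κ, by positivity, fun c hc y => by
  have h := admSpeed_of_mem hκ hc
  have h1 := one_sub_solEta_pos h y
  have h2 := hc.1
  have h3 := solInv_pos h y
  rw [solInv, abs_of_pos (inv_pos.2 h3), inv_le_comm₀ h3 (by positivity), inv_div]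
  linarith⟩

theorem cosh_ge (z : ℝ) : 1 + z ^ 2 / 2 ≤ Real.cosh z := by
  have h := Real.cosh_two_mul (z / 2)
  have h2 := Real.cosh_sq (z / 2)
  have h3 : |z / 2| ≤ Real.sinh |z / 2| := Real.self_le_sinh_iff.2 (abs_nonneg _)
  have h4 : (z / 2) ^ 2 ≤ Real.sinh (z / 2) ^ 2 := by
    rw [← sq_abs (z / 2), ← sq_abs (Real.sinh (z / 2)), Real.abs_sinh]
    gcongr
  rw [show 2 * (z / 2) = z by ring] at h
  nlinarith

theorem solEta_decay {κ : ℝ} (hκ : 0 < κ) {c : ℝ} (hc : c ∈ speeds κ) (y : ℝ) :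
    |solEta c y| ≤ (1 + 8 / κ) ^ 2 * wt y ^ 2 := by
  have h := admSpeed_of_mem hκ hc
  rw [abs_of_nonneg (solEta_nonneg h y), solEta, wt, inv_pow, ← div_eq_mul_inv]
  have h1 := cosh_ge (√(2 - c ^ 2) * y / 2)
  have h2 : (√(2 - c ^ 2) * y / 2) ^ 2 = (2 - c ^ 2) * y ^ 2 / 4 := by
    rw [div_pow, mul_pow, Real.sq_sqrt (by linarith [h.sq_lt])]; norm_num
  rw [h2] at h1
  set C := Real.cosh (√(2 - c ^ 2) * y / 2)
  have hC : 0 < C := Real.cosh_pos _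
  have h3 : 1 + y ^ 2 ≤ (1 + 8 / κ) * C := by
    have : κ * y ^ 2 ≤ (2 - c ^ 2) * y ^ 2 := mul_le_mul_of_nonneg_right hc.2 (sq_nonneg y)
    have h4 : κ * (1 + y ^ 2) ≤ (κ + 8) * C := by nlinarith [sq_nonneg y]
    have h5 : (1 + 8 / κ) * C = (κ + 8) * C / κ := by field_simp
    rw [h5, le_div_iff₀ hκ]; linarith
  rw [div_le_div_iff₀ (by positivity) (by positivity)]
  have h6 : (1 + y ^ 2) ^ 2 ≤ ((1 + 8 / κ) * C) ^ 2 := by gcongr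
  have h7 : 0 ≤ (1 + 8 / κ) ^ 2 * C ^ 2 := by positivity
  rw [mul_pow] at h6
  have h8 : 2 - c ^ 2 ≤ 2 := by nlinarith [sq_nonneg c]
  nlinarith [h.sq_lt, sq_nonneg (1 + y ^ 2)]

theorem ud_eta : UD solEta := fun κ hκ => ⟨(1 + 8 / κ) ^ 2, by positivity, fun c hc y => by
  refine (solEta_decay hκ hc y).trans ?_
  have := wt_pos y
  have := wt_le_one y
  gcongr
  nlinarith⟩

theorem ud_y_eta : UD fun c y => y * solEta c y := fun κ hκ => ⟨(1 + 8 / κ) ^ 2, by positivity,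
  fun c hc y => by
  rw [abs_mul]
  have h1 := solEta_decay hκ hc y
  have h2 := wt_pos y
  have h3 : |y| * wt y ≤ 1 := by
    rw [wt, ← div_eq_mul_inv, div_le_one (by positivity), ← sq_abs]
    nlinarith [sq_nonneg (|y| - 1), abs_nonneg y]
  calc |y| * |solEta c y| ≤ |y| * ((1 + 8 / κ) ^ 2 * wt y ^ 2) := by gcongr
    _ = (1 + 8 / κ) ^ 2 * ((|y| * wt y) * wt y) := by ring
    _ ≤ (1 + 8 / κ) ^ 2 * (1 * wt y) := by gcongr
    _ = _ := by ring⟩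

theorem ud_eY : UD eY := ((((UB.const (-1)).mul ub_sc).mul ub_th).mul_UD ud_eta).congr fun c y => by
  simp only [eY]; ring

theorem ud_eC : UD eC := (((((UB.const (-1)).mul UB.fst).mul ub_sc_inv).mul_UD
  ((((UB.const 2).mul ub_sc_inv).mul_UD ud_eta).add
    (((UB.const (-1)).mul ub_th).mul_UD ud_y_eta)))).congr fun c y => by
  simp only [eC]; ring

theorem ud_eYY : UD eYY := (((ub_sc.mul ub_sc).mul_UD ud_eta).add
  (((UB.const (-3)).mul ud_eta.UB).mul_UD ud_eta)).congr fun c y => by simp only [eYY]; ring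

theorem ud_eYC : UD eYC := ((((UB.fst.mul ub_sc_inv).mul ub_th).mul_UD ud_eta).add
  (((((UB.fst.mul ub_sc_inv).mul ub_sc_inv).mul ud_eta.UB).mul_UD ud_y_eta).add
    ((((UB.const (-1)).mul ub_sc).mul ub_th).mul_UD ud_eC))).congr fun c y => by
  simp only [eYC]; ring

theorem ud_eYYY : UD eYYY := (((ub_sc.mul ub_sc).mul_UD ud_eY).add
  (((UB.const (-6)).mul ud_eta.UB).mul_UD ud_eY)).congr fun c y => by simp only [eYYY]; ring

theorem ub_vfac : UB fun c y => -(1 / 2) * c * (solInv c y * solInv c y) :=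
  ((UB.const (-(1 / 2))).mul UB.fst).mul (ub_inv.mul ub_inv)

/-- On admissible speeds `solV` has the decay of `solEta`. -/
theorem ud_v : UD solV := fun κ hκ => by
  obtain ⟨C, hC, h1⟩ := (((UB.const (-(1 / 2))).mul UB.fst).mul ub_inv).mul_UD ud_eta κ hκ
  refine ⟨C, hC, fun c hc y => ?_⟩
  rw [solV_eq (admSpeed_of_mem hκ hc)]
  refine (le_of_eq ?_).trans (h1 c hc y)
  congr 1; ring

theorem ud_vY : UD vY := ub_vfac.mul_UD ud_eY

theorem ud_vC : UD vC := (((UB.const (-(1 / 2))).mul ub_inv).mul_UD ud_eta).add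
  (ub_vfac.mul_UD ud_eC)

theorem ud_vYY : UD vYY := ub_vfac.mul_UD
  (ud_eYY.add ((((UB.const 2).mul ub_inv).mul ud_eY.UB).mul_UD ud_eY))

theorem ud_vYC : UD vYC := (((UB.const (-(1 / 2))).mul (ub_inv.mul ub_inv)).mul_UD ud_eY).add
  (ub_vfac.mul_UD (ud_eYC.add ((((UB.const 2).mul ub_inv).mul ud_eC.UB).mul_UD ud_eY)))

theorem ud_vYYY : UD vYYY := ub_vfac.mul_UD
  ((ud_eYYY.add ((((UB.const 6).mul ub_inv).mul ud_eY.UB).mul_UD ud_eYY)).add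
    ((((UB.const 6).mul (ub_inv.mul ub_inv)).mul (ud_eY.UB.mul ud_eY.UB)).mul_UD ud_eY))

end

section

open Metric

/-! ### Joint continuity -/

/-- Functions of a speed and a position, jointly continuous at admissible speeds. -/
def CA (g : ℝ → ℝ → ℝ) : Prop :=
  ∀ c, AdmSpeed c → ∀ y, ContinuousAt (fun p : ℝ × ℝ => g p.1 p.2) (c, y)

theorem CA.mul {f g : ℝ → ℝ → ℝ} (hf : CA f) (hg : CA g) : CA fun c y => f c y * g c y :=
  fun c h y => (hf c h y).mul (hg c h y)

theorem CA.add {f g : ℝ → ℝ → ℝ} (hf : CA f) (hg : CA g) : CA fun c y => f c y + g c y :=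
  fun c h y => (hf c h y).add (hg c h y)

theorem CA.const (k : ℝ) : CA fun _ _ => k := fun _ _ _ => continuousAt_const

theorem CA.fst : CA fun c _ => c := fun _ _ _ => continuousAt_fst

theorem CA.snd : CA fun _ y => y := fun _ _ _ => continuousAt_snd

theorem CA.congr {f g : ℝ → ℝ → ℝ} (hf : CA f) (h : ∀ c y, f c y = g c y) : CA g := by
  have : f = g := by funext c y; exact h c y
  rwa [← this]

theorem CA.continuous {g : ℝ → ℝ → ℝ} (hg : CA g) {c : ℝ} (h : AdmSpeed c) : Continuous (g c) :=
  continuous_iff_continuousAt.2 fun y =>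
    ContinuousAt.comp (f := fun y : ℝ => (c, y)) (g := fun p : ℝ × ℝ => g p.1 p.2) (hg c h y)
      (by fun_prop)

theorem ca_sc : CA fun c _ => sc c := fun _ h y => (pd_sc h y).continuousAt
theorem ca_sc_inv : CA fun c _ => (sc c)⁻¹ := fun _ h y => (ca_sc _ h y).inv₀ (sc_pos h).ne'
theorem ca_th : CA solTh := fun _ h y => (pd_th h y).continuousAt
theorem ca_eta : CA solEta := fun _ h y => (pd_eta h y).continuousAt
theorem ca_inv : CA solInv := fun _ h y => (pd_inv h y).continuousAt
theorem ca_eY : CA eY := fun _ h y => (pd_eY h y).continuousAt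
theorem ca_vY : CA vY := fun _ h y => (pd_vY h y).continuousAt

theorem ca_eC : CA eC := ((((CA.const (-1)).mul CA.fst).mul ca_sc_inv).mul
  ((((CA.const 2).mul ca_sc_inv).mul ca_eta).add
    (((CA.const (-1)).mul ca_th).mul (CA.snd.mul ca_eta)))).congr fun c y => by simp only [eC]; ring

theorem ca_eYY : CA eYY := (((ca_sc.mul ca_sc).mul ca_eta).add
  (((CA.const (-3)).mul ca_eta).mul ca_eta)).congr fun c y => by simp only [eYY]; ring

theorem ca_eYC : CA eYC := ((((CA.fst.mul ca_sc_inv).mul ca_th).mul ca_eta).add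
  (((((CA.fst.mul ca_sc_inv).mul ca_sc_inv).mul ca_eta).mul (CA.snd.mul ca_eta)).add
    ((((CA.const (-1)).mul ca_sc).mul ca_th).mul ca_eC))).congr fun c y => by simp only [eYC]; ring

theorem ca_vfac : CA fun c y => -(1 / 2) * c * (solInv c y * solInv c y) :=
  ((CA.const (-(1 / 2))).mul CA.fst).mul (ca_inv.mul ca_inv)

theorem ca_vC : CA vC := (((CA.const (-(1 / 2))).mul ca_inv).mul ca_eta).add (ca_vfac.mul ca_eC)

theorem ca_vYY : CA vYY :=
  ca_vfac.mul (ca_eYY.add ((((CA.const 2).mul ca_inv).mul ca_eY).mul ca_eY))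

theorem ca_vYC : CA vYC := (((CA.const (-(1 / 2))).mul (ca_inv.mul ca_inv)).mul ca_eY).add
  (ca_vfac.mul (ca_eYC.add ((((CA.const 2).mul ca_inv).mul ca_eC).mul ca_eY)))

/-- Decaying functions of a speed and a position. -/
structure Decay (g : ℝ → ℝ → ℝ) : Prop where
  ud : UD g
  ca : CA g

/-- Decaying functions with decaying partial derivatives. -/
structure Profile (g gc gy : ℝ → ℝ → ℝ) : Prop where
  pd : ∀ c, AdmSpeed c → ∀ y, PD g (gc c y) (gy c y) c y
  ud : UD g
  dc : Decay gc
  dy : Decay gy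

theorem Profile.decay {g gc gy : ℝ → ℝ → ℝ} (h : Profile g gc gy) : Decay g :=
  ⟨h.ud, fun c hc y => (h.pd c hc y).continuousAt⟩

theorem profile_eta : Profile solEta eC eY :=
  ⟨fun _ h y => pd_eta h y, ud_eta, ⟨ud_eC, ca_eC⟩, ⟨ud_eY, ca_eY⟩⟩
theorem profile_v : Profile solV vC vY :=
  ⟨fun _ h y => pd_v h y, ud_v, ⟨ud_vC, ca_vC⟩, ⟨ud_vY, ca_vY⟩⟩
theorem profile_eY : Profile eY eYC eYY :=
  ⟨fun _ h y => pd_eY h y, ud_eY, ⟨ud_eYC, ca_eYC⟩, ⟨ud_eYY, ca_eYY⟩⟩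
theorem profile_vY : Profile vY vYC vYY :=
  ⟨fun _ h y => pd_vY h y, ud_vY, ⟨ud_vYC, ca_vYC⟩, ⟨ud_vYY, ca_vYY⟩⟩

/-! ### Square integrability -/

theorem integrable_wt (a : ℝ) : Integrable (fun x => wt (x - a)) :=
  integrable_inv_one_add_sq.comp_sub_right a

theorem integral_wt (a : ℝ) : ∫ x, wt (x - a) = Real.pi := by
  rw [integral_sub_right_eq_self (fun x => wt x)]
  exact integral_univ_inv_one_add_sq

theorem memLp_wt (a : ℝ) : MemLp (fun x => wt (x - a)) 2 := by
  have hc : Continuous fun x => wt (x - a) := continuous_wt.comp (continuous_id.sub continuous_const)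
  rw [memLp_two_iff_integrable_sq hc.aestronglyMeasurable]
  refine (integrable_wt a).mono' (hc.pow 2).aestronglyMeasurable (.of_forall fun x => ?_)
  have h1 := wt_pos (x - a)
  have h2 := wt_le_one (x - a)
  rw [Real.norm_eq_abs, abs_of_nonneg (by positivity)]
  nlinarith

theorem memLp_of_le_wt {f : ℝ → ℝ} (hf : AEStronglyMeasurable f) {C a : ℝ}
    (h : ∀ x, |f x| ≤ C * wt (x - a)) : MemLp f 2 :=
  memLp_of_abs_le hf (memLp_wt a) fun x => by rw [abs_of_pos (wt_pos _)]; exact h x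

theorem wt_shift_le {d : ℝ} (hd : |d| ≤ 1) (y : ℝ) : wt (y + d) ≤ 3 * wt y := by
  unfold wt
  rw [← div_eq_mul_inv, inv_le_comm₀ (by positivity) (by positivity), inv_div, div_le_iff₀ (by norm_num)]
  have := sq_abs d
  nlinarith [sq_nonneg (y + 2 * d), abs_nonneg d, sq_nonneg (y + d)]

theorem Decay.continuous {g : ℝ → ℝ → ℝ} (hg : Decay g) {c : ℝ} (h : AdmSpeed c) (a : ℝ) :
    Continuous fun x => g c (x - a) := (hg.ca.continuous h).comp (continuous_id.sub continuous_const)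

theorem AdmSpeed.mem_speeds {c : ℝ} (h : AdmSpeed c) : ∃ κ > 0, c ∈ speeds κ := by
  obtain ⟨κ, hκ, h⟩ := h.exists_mem
  exact ⟨κ, hκ, h.self_of_nhds⟩

theorem Decay.memLp {g : ℝ → ℝ → ℝ} (hg : Decay g) {c : ℝ} (h : AdmSpeed c) (a : ℝ) :
    MemLp (fun x => g c (x - a)) 2 := by
  obtain ⟨κ, hκ, hc⟩ := h.mem_speeds
  obtain ⟨C, -, hC⟩ := hg.ud κ hκ
  exact memLp_of_le_wt (hg.continuous h a).aestronglyMeasurable fun x => hC c hc _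

theorem TL2.of_dominated {ι : Type*} {l : Filter ι} [l.IsCountablyGenerated] [l.NeBot]
    {f : ι → ℝ → ℝ} {g W : ℝ → ℝ} (hf : ∀ᶠ i in l, AEStronglyMeasurable (f i))
    (hg : AEStronglyMeasurable g) (hW : MemLp W 2)
    (hb : ∀ᶠ i in l, ∀ x, |f i x| ≤ W x) (hl : ∀ x, Tendsto (fun i => f i x) l (𝓝 (g x))) :
    TL2 l f g := by
  have hgW : ∀ x, |g x| ≤ W x := fun x =>
    le_of_tendsto (hl x).abs (by filter_upwards [hb] with i hi using hi x)
  have hW0 : ∀ x, 0 ≤ W x := fun x => (abs_nonneg _).trans (hgW x)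
  have hgL : MemLp g 2 := memLp_of_abs_le hg hW (C := 1) fun x => by
    rw [one_mul, abs_of_nonneg (hW0 x)]; exact hgW x
  have hfL : ∀ᶠ i in l, MemLp (f i) 2 := by
    filter_upwards [hf, hb] with i h1 h2
    exact memLp_of_abs_le h1 hW (C := 1) fun x => by
      rw [one_mul, abs_of_nonneg (hW0 x)]; exact h2 x
  refine ⟨hfL, hgL, ?_⟩
  have h0 : Tendsto (fun i => ∫ x, (f i x - g x) ^ 2) l (𝓝 (∫ x : ℝ, (0 : ℝ))) := by
    refine tendsto_integral_filter_of_dominated_convergence (fun x => (2 * W x) ^ 2) ?_ ?_ ?_ ?_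
    · filter_upwards [hf] with i h1 using (h1.sub hg).pow 2
    · filter_upwards [hb] with i h1
      refine .of_forall fun x => ?_
      rw [Real.norm_eq_abs, abs_of_nonneg (sq_nonneg _), ← sq_abs]
      have := (abs_sub (f i x) (g x)).trans (add_le_add (h1 x) (hgW x))
      exact pow_le_pow_left₀ (abs_nonneg _) (by linarith) 2
    · exact (hW.const_mul 2).integrable_sq
    · refine .of_forall fun x => ?_
      have := ((hl x).sub_const (g x)).pow 2
      simpa using this
  have h1 := h0.sqrt
  simp only [integral_zero, Real.sqrt_zero] at h1
  refine h1.congr' ?_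
  filter_upwards [hfL] with i hi
  rw [← N2_sq (memLp_fsub hi hgL), Real.sqrt_sq (N2_nonneg _)]

/-! ### The translates as functions with values in `L²` -/

open Classical in
/-- The function `g c (· - a)` as an element of `L²(ℝ)`, `p = (c, a)`. -/
def shiftL2 (g : ℝ → ℝ → ℝ) (p : ℝ × ℝ) : L2 :=
  if h : MemLp (fun x => g p.1 (x - p.2)) 2 then h.toLp _ else 0

theorem Decay.shiftL2_eq {g : ℝ → ℝ → ℝ} (hg : Decay g) {p : ℝ × ℝ} (h : AdmSpeed p.1) :
    shiftL2 g p = (hg.memLp h p.2).toLp _ := dif_pos (hg.memLp h p.2)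

theorem Decay.shiftL2_ae {g : ℝ → ℝ → ℝ} (hg : Decay g) {p : ℝ × ℝ} (h : AdmSpeed p.1) :
    (shiftL2 g p : ℝ → ℝ) =ᵐ[volume] fun x => g p.1 (x - p.2) := by
  rw [hg.shiftL2_eq h]; exact (hg.memLp h p.2).coeFn_toLp

/-- A neighbourhood of `p₀` on which the speeds are uniformly admissible. -/
theorem exists_ball_speeds {p₀ : ℝ × ℝ} (h : AdmSpeed p₀.1) : ∃ κ > 0, ∃ r > 0, r ≤ 1 ∧
    ∀ p ∈ ball p₀ r, p.1 ∈ speeds κ ∧ ∀ x, wt (x - p.2) ≤ 3 * wt (x - p₀.2) := by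
  obtain ⟨κ, hκ, hev⟩ := h.exists_mem
  obtain ⟨r, hr, hb⟩ := eventually_nhds_iff_ball.1 hev
  refine ⟨κ, hκ, min r 1, by positivity, min_le_right _ _, fun p hp => ?_⟩
  rw [mem_ball, Prod.dist_eq, max_lt_iff] at hp
  refine ⟨hb _ (hp.1.trans_le (min_le_left _ _)), fun x => ?_⟩
  have h1 := hp.2.trans_le (min_le_right _ _)
  rw [Real.dist_eq] at h1
  have := wt_shift_le (d := p₀.2 - p.2) (by rw [abs_sub_comm]; exact h1.le) (x - p₀.2)
  rwa [sub_add_sub_cancel] at this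

theorem Decay.tL2 {g : ℝ → ℝ → ℝ} (hg : Decay g) {p₀ : ℝ × ℝ} (h : AdmSpeed p₀.1) :
    TL2 (𝓝 p₀) (fun (p : ℝ × ℝ) x => g p.1 (x - p.2)) (fun x => g p₀.1 (x - p₀.2)) := by
  obtain ⟨κ, hκ, r, hr, -, hb⟩ := exists_ball_speeds h
  obtain ⟨C, hC, hd⟩ := hg.ud κ hκ
  have hball := ball_mem_nhds p₀ hr
  refine TL2.of_dominated (W := fun x => C * 3 * wt (x - p₀.2)) ?_
    (hg.continuous h _).aestronglyMeasurable ((memLp_wt _).const_mul _) ?_ fun x => ?_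
  · filter_upwards [hball] with p hp
    exact (hg.continuous (admSpeed_of_mem hκ (hb p hp).1) _).aestronglyMeasurable
  · filter_upwards [hball] with p hp x
    refine (hd _ (hb p hp).1 _).trans ?_
    rw [mul_assoc]
    exact mul_le_mul_of_nonneg_left ((hb p hp).2 x) hC
  · exact ContinuousAt.tendsto (ContinuousAt.comp (f := fun p : ℝ × ℝ => (p.1, x - p.2))
      (g := fun p : ℝ × ℝ => g p.1 p.2) (hg.ca _ h _) (by fun_prop))

theorem eventually_admSpeed {p₀ : ℝ × ℝ} (h : AdmSpeed p₀.1) : ∀ᶠ p in 𝓝 p₀, AdmSpeed p.1 := by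
  obtain ⟨κ, hκ, r, hr, -, hb⟩ := exists_ball_speeds h
  filter_upwards [ball_mem_nhds p₀ hr] with p hp using admSpeed_of_mem hκ (hb p hp).1

theorem Decay.continuousAt_shiftL2 {g : ℝ → ℝ → ℝ} (hg : Decay g) {p₀ : ℝ × ℝ} (h : AdmSpeed p₀.1) :
    ContinuousAt (shiftL2 g) p₀ := by
  rw [ContinuousAt, tendsto_iff_norm_sub_tendsto_zero]
  refine (hg.tL2 h).tendsto.congr' ?_
  filter_upwards [eventually_admSpeed h] with p hp
  rw [← N2_coe]
  refine N2_congr ?_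
  filter_upwards [Lp.coeFn_sub (shiftL2 g p) (shiftL2 g p₀), hg.shiftL2_ae hp, hg.shiftL2_ae h]
    with x h1 h2 h3
  rw [h1, Pi.sub_apply, h2, h3]

/-- The derivative of `shiftL2 g`. -/
def shiftD (gc gy : ℝ → ℝ → ℝ) (p : ℝ × ℝ) : ℝ × ℝ →L[ℝ] L2 :=
  (ContinuousLinearMap.fst ℝ ℝ ℝ).smulRight (shiftL2 gc p)
    - (ContinuousLinearMap.snd ℝ ℝ ℝ).smulRight (shiftL2 gy p)

theorem Profile.hasFDerivAt_shift {g gc gy : ℝ → ℝ → ℝ} (hg : Profile g gc gy) {p : ℝ × ℝ}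
    (h : AdmSpeed p.1) (x : ℝ) : HasFDerivAt (fun p : ℝ × ℝ => g p.1 (x - p.2))
      (gc p.1 (x - p.2) • ContinuousLinearMap.fst ℝ ℝ ℝ
        - gy p.1 (x - p.2) • ContinuousLinearMap.snd ℝ ℝ ℝ) p := by
  have h1 : HasFDerivAt (fun p : ℝ × ℝ => (p.1, x - p.2))
      ((ContinuousLinearMap.fst ℝ ℝ ℝ).prod (-ContinuousLinearMap.snd ℝ ℝ ℝ)) p :=
    hasFDerivAt_fst.prodMk (hasFDerivAt_snd.const_sub x)
  refine ((show HasFDerivAt (fun p : ℝ × ℝ => g p.1 p.2) _ ((fun p : ℝ × ℝ => (p.1, x - p.2)) p)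
    from hg.pd _ h (x - p.2)).comp p h1).congr_fderiv ?_
  ext <;> simp

theorem Profile.lipschitz_pointwise {g gc gy : ℝ → ℝ → ℝ} (hg : Profile g gc gy) {p₀ : ℝ × ℝ}
    (h : AdmSpeed p₀.1) : ∃ r > 0, ∃ C, 0 ≤ C ∧ ∀ p ∈ ball p₀ r, ∀ x,
      |g p.1 (x - p.2) - g p₀.1 (x - p₀.2)| ≤ C * wt (x - p₀.2) * ‖p - p₀‖ := by
  obtain ⟨κ, hκ, r, hr, -, hb⟩ := exists_ball_speeds h
  obtain ⟨C, hC, h1⟩ := hg.dc.ud κ hκ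
  obtain ⟨D, hD, h2⟩ := hg.dy.ud κ hκ
  refine ⟨r, hr, 3 * (C + D), by positivity, fun p hp x => ?_⟩
  refine (convex_ball p₀ r).norm_image_sub_le_of_norm_hasFDerivWithin_le (𝕜 := ℝ)
    (f := fun p : ℝ × ℝ => g p.1 (x - p.2)) (fun q hq => (hg.hasFDerivAt_shift
      (admSpeed_of_mem hκ (hb q hq).1) x).hasFDerivWithinAt) (fun q hq => ?_)
    (mem_ball_self hr) hp
  refine (norm_sub_le _ _).trans ?_
  rw [norm_smul, norm_smul, Real.norm_eq_abs, Real.norm_eq_abs]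
  have a1 := h1 _ (hb q hq).1 (x - q.2)
  have a2 := h2 _ (hb q hq).1 (x - q.2)
  have a3 := (hb q hq).2 x
  have n1 := ContinuousLinearMap.norm_fst_le ℝ ℝ ℝ
  have n2 := ContinuousLinearMap.norm_snd_le ℝ ℝ ℝ
  have b1 := mul_le_mul a1 n1 (norm_nonneg _) (mul_nonneg hC (wt_pos _).le)
  have b2 := mul_le_mul a2 n2 (norm_nonneg _) (mul_nonneg hD (wt_pos _).le)
  have b3 := mul_le_mul_of_nonneg_left a3 (add_nonneg hC hD)
  linarith

theorem Profile.hasFDerivAt_shiftL2 {g gc gy : ℝ → ℝ → ℝ} (hg : Profile g gc gy) {p₀ : ℝ × ℝ}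
    (h : AdmSpeed p₀.1) : HasFDerivAt (shiftL2 g) (shiftD gc gy p₀) p₀ := by
  obtain ⟨r, hr, C, hC, hL⟩ := hg.lipschitz_pointwise h
  obtain ⟨κ, hκ, r', hr', -, hb⟩ := exists_ball_speeds h
  obtain ⟨D, hD, h1⟩ := hg.dc.ud κ hκ
  obtain ⟨E, hE, h2⟩ := hg.dy.ud κ hκ
  have hc0 := (hb p₀ (mem_ball_self hr')).1
  rw [hasFDerivAt_iff_tendsto]
  set F : ℝ × ℝ → ℝ → ℝ := fun p x => ‖p - p₀‖⁻¹ * (g p.1 (x - p.2) - g p₀.1 (x - p₀.2)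
    - ((p.1 - p₀.1) * gc p₀.1 (x - p₀.2) - (p.2 - p₀.2) * gy p₀.1 (x - p₀.2))) with hF
  have key : TL2 (𝓝 p₀) F fun _ => 0 := by
    refine TL2.of_dominated (W := fun x => (C + D + E) * wt (x - p₀.2)) ?_
      aestronglyMeasurable_const ((memLp_wt _).const_mul _) ?_ fun x => ?_
    · filter_upwards [eventually_admSpeed h] with p hp
      exact ((((hg.decay.continuous hp _).sub (hg.decay.continuous h _)).sub
        ((continuous_const.mul (hg.dc.continuous h _)).sub
          (continuous_const.mul (hg.dy.continuous h _)))).const_mul _).aestronglyMeasurable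
    · filter_upwards [ball_mem_nhds p₀ hr] with p hp x
      have a0 := hL p hp x
      have a1 := h1 _ hc0 (x - p₀.2)
      have a2 := h2 _ hc0 (x - p₀.2)
      have n1 : |p.1 - p₀.1| ≤ ‖p - p₀‖ := norm_fst_le (p - p₀)
      have n2 : |p.2 - p₀.2| ≤ ‖p - p₀‖ := norm_snd_le (p - p₀)
      simp only [hF]
      rcases eq_or_lt_of_le (norm_nonneg (p - p₀)) with h0 | h0
      · rw [← h0]; simp; have := wt_pos (x - p₀.2); positivity
      rw [abs_mul, abs_inv, abs_norm, inv_mul_le_iff₀ h0]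
      refine (abs_sub _ _).trans ((add_le_add a0 (abs_sub _ _)).trans ?_)
      rw [abs_mul, abs_mul]
      have b1 := mul_le_mul n1 a1 (abs_nonneg _) (norm_nonneg _)
      have b2 := mul_le_mul n2 a2 (abs_nonneg _) (norm_nonneg _)
      linarith
    · have hx := hg.hasFDerivAt_shift h x
      rw [hasFDerivAt_iff_tendsto, tendsto_zero_iff_abs_tendsto_zero] at hx
      rw [tendsto_zero_iff_abs_tendsto_zero]
      refine hx.congr fun p => ?_
      simp only [Function.comp, hF, abs_mul, Real.norm_eq_abs, abs_abs]
      congr 2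
      simp
      ring
  refine key.tendsto.congr' ?_
  filter_upwards [eventually_admSpeed h] with p hp
  simp only [sub_zero, hF]
  rw [N2_const_mul, abs_inv, abs_norm, ← N2_coe]
  congr 1
  refine N2_congr ?_
  have e : shiftL2 g p - shiftL2 g p₀ - shiftD gc gy p₀ (p - p₀) = shiftL2 g p - shiftL2 g p₀
    - ((p.1 - p₀.1) • shiftL2 gc p₀ - (p.2 - p₀.2) • shiftL2 gy p₀) := by simp [shiftD]
  rw [e]
  filter_upwards [Lp.coeFn_sub (shiftL2 g p - shiftL2 g p₀)
    ((p.1 - p₀.1) • shiftL2 gc p₀ - (p.2 - p₀.2) • shiftL2 gy p₀),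
    Lp.coeFn_sub (shiftL2 g p) (shiftL2 g p₀),
    Lp.coeFn_sub ((p.1 - p₀.1) • shiftL2 gc p₀) ((p.2 - p₀.2) • shiftL2 gy p₀),
    Lp.coeFn_smul (p.1 - p₀.1) (shiftL2 gc p₀), Lp.coeFn_smul (p.2 - p₀.2) (shiftL2 gy p₀),
    hg.decay.shiftL2_ae hp, hg.decay.shiftL2_ae h, hg.dc.shiftL2_ae h, hg.dy.shiftL2_ae h]
    with x e1 e2 e3 e4 e5 e6 e7 e8 e9
  rw [e1, Pi.sub_apply, e2, e3, Pi.sub_apply, Pi.sub_apply, e4, e5, Pi.smul_apply, Pi.smul_apply,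
    e6, e7, e8, e9, smul_eq_mul, smul_eq_mul]

theorem Decay.continuousAt_shiftD {gc gy : ℝ → ℝ → ℝ} (hc : Decay gc) (hy : Decay gy) {p : ℝ × ℝ}
    (h : AdmSpeed p.1) : ContinuousAt (shiftD gc gy) p := by
  have h1 := hc.continuousAt_shiftL2 h
  have h2 := hy.continuousAt_shiftL2 h
  unfold shiftD
  exact ((ContinuousLinearMap.smulRightL ℝ (ℝ × ℝ) L2 _).continuous.continuousAt.comp h1).sub
    ((ContinuousLinearMap.smulRightL ℝ (ℝ × ℝ) L2 _).continuous.continuousAt.comp h2)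

theorem Profile.contDiffAt_shiftL2 {g gc gy : ℝ → ℝ → ℝ} (hg : Profile g gc gy) {p : ℝ × ℝ}
    (h : AdmSpeed p.1) : ContDiffAt ℝ 1 (shiftL2 g) p :=
  contDiffAt_one_iff.2 ⟨shiftD gc gy, {p | AdmSpeed p.1}, eventually_admSpeed h,
    fun _ hq => (hg.dc.continuousAt_shiftD hg.dy hq).continuousWithinAt,
    fun _ hq => hg.hasFDerivAt_shiftL2 hq⟩

/-! ### Inner products of translates -/

theorem inner_shiftL2 {f g : ℝ → ℝ → ℝ} (hf : Decay f) (hg : Decay g) {p q : ℝ × ℝ}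
    (hp : AdmSpeed p.1) (hq : AdmSpeed q.1) :
    inner ℝ (shiftL2 f p) (shiftL2 g q) = ∫ x, f p.1 (x - p.2) * g q.1 (x - q.2) := by
  rw [hf.shiftL2_eq hp, hg.shiftL2_eq hq, inner_toLp]

theorem inner_shiftL2_same {f g : ℝ → ℝ → ℝ} (hf : Decay f) (hg : Decay g) {b c : ℝ}
    (hb : AdmSpeed b) (hc : AdmSpeed c) (a : ℝ) :
    inner ℝ (shiftL2 f (b, a)) (shiftL2 g (c, a)) = inner ℝ (shiftL2 f (b, 0)) (shiftL2 g (c, 0)) := by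
  rw [inner_shiftL2 hf hg hb hc, inner_shiftL2 hf hg hb hc]
  simp only [sub_zero]
  exact integral_sub_right_eq_self (fun x => f b x * g c x) a

/-- The decay rate of interactions. -/
def om (d : ℝ) : ℝ := √(2 * wt d)

theorem om_nonneg (d : ℝ) : 0 ≤ om d := Real.sqrt_nonneg _

theorem tendsto_om : Tendsto om atTop (𝓝 0) := by
  have h1 : Tendsto (fun d : ℝ => 1 + d ^ 2) atTop atTop :=
    tendsto_atTop_add_const_left _ _ (tendsto_pow_atTop (by norm_num))
  have := ((tendsto_inv_atTop_zero.comp h1).const_mul 2).sqrt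
  simp only [mul_zero, Real.sqrt_zero] at this
  exact this

theorem om_anti {d e : ℝ} (h : d ≤ |e|) (hd : 0 ≤ d) : om e ≤ om d := by
  unfold om wt
  have : d ^ 2 ≤ e ^ 2 := by rw [← sq_abs e]; gcongr
  gcongr

theorem wt_mul_le (p q : ℝ) : wt p * wt q ≤ om (p - q) * (1 / 2 * (wt p + wt q)) := by
  have h1 := wt_pos p
  have h2 := wt_pos q
  have h3 : wt p * wt q ≤ 2 * wt (p - q) := by
    unfold wt
    rw [← mul_inv, ← div_eq_mul_inv, le_div_iff₀ (by positivity), inv_mul_le_iff₀ (by positivity)]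
    nlinarith [sq_nonneg (p + q), mul_nonneg (sq_nonneg p) (sq_nonneg q)]
  have h4 : √(wt p * wt q) ≤ 1 / 2 * (wt p + wt q) := by
    refine Real.sqrt_le_iff.2 ⟨by positivity, ?_⟩
    nlinarith [sq_nonneg (wt p - wt q)]
  calc wt p * wt q = √(wt p * wt q) * √(wt p * wt q) := (Real.mul_self_sqrt (by positivity)).symm
    _ ≤ om (p - q) * (1 / 2 * (wt p + wt q)) :=
      mul_le_mul (Real.sqrt_le_sqrt h3) h4 (Real.sqrt_nonneg _) (om_nonneg _)

theorem abs_inner_shiftL2_le {f g : ℝ → ℝ → ℝ} (hf : Decay f) (hg : Decay g) {κ : ℝ} (hκ : 0 < κ) :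
    ∃ C, 0 ≤ C ∧ ∀ p q : ℝ × ℝ, p.1 ∈ speeds κ → q.1 ∈ speeds κ →
      |inner ℝ (shiftL2 f p) (shiftL2 g q)| ≤ C * om (p.2 - q.2) := by
  obtain ⟨C, hC, h1⟩ := hf.ud κ hκ
  obtain ⟨D, hD, h2⟩ := hg.ud κ hκ
  refine ⟨C * D * Real.pi, by positivity, fun p q hp hq => ?_⟩
  rw [inner_shiftL2 hf hg (admSpeed_of_mem hκ hp) (admSpeed_of_mem hκ hq)]
  refine abs_integral_le_integral_abs.trans ?_
  have hI : Integrable (fun x => C * D * om (p.2 - q.2) * (1 / 2 * (wt (x - p.2) + wt (x - q.2))))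
      volume := (((integrable_wt _).add (integrable_wt _)).const_mul _).const_mul _
  have h3 : ∫ x, |f p.1 (x - p.2) * g q.1 (x - q.2)| ≤
      ∫ x, C * D * om (p.2 - q.2) * (1 / 2 * (wt (x - p.2) + wt (x - q.2))) := by
    refine integral_mono_of_nonneg (.of_forall fun _ => abs_nonneg _) hI
      (.of_forall fun x => ?_)
    simp only
    rw [abs_mul]
    have h4 := wt_mul_le (x - p.2) (x - q.2)
    have e : om (x - p.2 - (x - q.2)) = om (p.2 - q.2) := by
      unfold om wt; congr 3; ring
    rw [e] at h4
    calc |f p.1 (x - p.2)| * |g q.1 (x - q.2)|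
        ≤ (C * wt (x - p.2)) * (D * wt (x - q.2)) :=
          mul_le_mul (h1 _ hp _) (h2 _ hq _) (abs_nonneg _) (mul_nonneg hC (wt_pos _).le)
      _ = C * D * (wt (x - p.2) * wt (x - q.2)) := by ring
      _ ≤ _ := by rw [mul_assoc (C * D)]; exact mul_le_mul_of_nonneg_left h4 (by positivity)
  rw [integral_const_mul, integral_const_mul, integral_add (integrable_wt _) (integrable_wt _),
    integral_wt, integral_wt] at h3
  refine h3.trans (le_of_eq ?_)
  ring

theorem norm_shiftL2_le {f : ℝ → ℝ → ℝ} (hf : Decay f) {κ : ℝ} (hκ : 0 < κ) :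
    ∃ C, 0 ≤ C ∧ ∀ p : ℝ × ℝ, p.1 ∈ speeds κ → ‖shiftL2 f p‖ ≤ C := by
  obtain ⟨C, hC, h1⟩ := abs_inner_shiftL2_le hf hf hκ
  refine ⟨√(C * om 0), Real.sqrt_nonneg _, fun p hp => Real.le_sqrt_of_sq_le ?_⟩
  have := h1 p p hp hp
  rw [sub_self, real_inner_self_eq_norm_sq, abs_of_nonneg (sq_nonneg _)] at this
  exact this

end

section

open Metric

/-! ### Linear components of a state -/

/-- The component `η`, as an element of `L²`. -/
def etaL : XSpace →L[ℝ] L2 :=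
  (WithLp.fstL 2 ℝ L2 L2).comp (H1.subtypeL.comp (WithLp.fstL 2 ℝ H1 L2))

/-- The derivative `∂ₓη`, as an element of `L²`. -/
def etaXL : XSpace →L[ℝ] L2 :=
  (WithLp.sndL 2 ℝ L2 L2).comp (H1.subtypeL.comp (WithLp.fstL 2 ℝ H1 L2))

/-- The component `v`, as an element of `L²`. -/
def velL : XSpace →L[ℝ] L2 := WithLp.sndL 2 ℝ H1 L2

theorem coe_etaL (u : XSpace) : (etaL u : ℝ → ℝ) = eta u := rfl
theorem coe_etaXL (u : XSpace) : (etaXL u : ℝ → ℝ) = etaX u := rfl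
theorem coe_velL (u : XSpace) : (velL u : ℝ → ℝ) = vel u := rfl

theorem norm_etaL_le (u : XSpace) : ‖etaL u‖ ≤ ‖u‖ := by
  rw [← N2_coe, coe_etaL, ← N2_congr (etaC_ae u)]; exact N2_etaC_le u

theorem norm_velL_le (u : XSpace) : ‖velL u‖ ≤ ‖u‖ := by
  rw [← N2_coe, coe_velL]; exact N2_vel_le u

theorem norm_le_components (u : XSpace) : ‖u‖ ≤ ‖etaL u‖ + ‖etaXL u‖ + ‖velL u‖ := by
  have h := norm_sq_eq u
  rw [N2_congr (etaC_ae u), ← coe_etaL, ← coe_etaXL, ← coe_velL, N2_coe, N2_coe, N2_coe] at h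
  refine abs_le_of_sq_le_sq' ?_ (by positivity) |>.2
  nlinarith [norm_nonneg (etaL u), norm_nonneg (etaXL u), norm_nonneg (velL u),
    mul_nonneg (norm_nonneg (etaL u)) (norm_nonneg (etaXL u)),
    mul_nonneg (norm_nonneg (etaL u)) (norm_nonneg (velL u)),
    mul_nonneg (norm_nonneg (etaXL u)) (norm_nonneg (velL u))]

theorem etaL_soliton {p : ℝ × ℝ} (h : AdmSpeed p.1) :
    etaL (soliton p.1 p.2) = shiftL2 solEta p := by
  rw [soliton, dif_pos h, profile_eta.decay.shiftL2_eq h]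
  rfl

theorem velL_soliton {p : ℝ × ℝ} (h : AdmSpeed p.1) :
    velL (soliton p.1 p.2) = shiftL2 solV p := by
  rw [soliton, dif_pos h, profile_v.decay.shiftL2_eq h]
  rfl

theorem etaXL_soliton {p : ℝ × ℝ} (h : AdmSpeed p.1) :
    etaXL (soliton p.1 p.2) = shiftL2 eY p := by
  rw [soliton, dif_pos h, profile_eY.decay.shiftL2_eq h]
  refine MemLp.toLp_congr (memLp_deriv_solEta h p.2) _ (.of_forall fun x => ?_)
  rw [deriv_solEta_shift, deriv_solEta_eq h]

theorem etaC_soliton {c : ℝ} (h : AdmSpeed c) (a x : ℝ) : etaC (soliton c a) x = solEta c (x - a) := by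
  have h1 : etaC (soliton c a) =ᵐ[volume] fun x => solEta c (x - a) := by
    refine (etaC_ae _).trans ?_
    rw [← coe_etaL, etaL_soliton (p := (c, a)) h]
    exact profile_eta.decay.shiftL2_ae (p := (c, a)) h
  exact congrFun (((continuous_etaC _).ae_eq_iff_eq volume
    (profile_eta.decay.continuous h a)).1 h1) x

theorem etaC_add (u w : XSpace) (x : ℝ) : etaC (u + w) x = etaC u x + etaC w x := by
  have := etaC_sub (u + w) w x
  rw [add_sub_cancel_right] at this
  linarith

theorem etaC_sum {ι : Type*} (s : Finset ι) (u : ι → XSpace) (x : ℝ) :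
    etaC (∑ i ∈ s, u i) x = ∑ i ∈ s, etaC (u i) x := by
  classical
  induction s using Finset.induction_on with
  | empty =>
    have := etaC_sub 0 0 x
    simpa using this
  | insert i s hi ih => rw [Finset.sum_insert hi, Finset.sum_insert hi, etaC_add, ih]

theorem etaC_chain {N : ℕ} {c : Fin N → ℝ} (h : c ∈ Adm N) (a : Fin N → ℝ) (x : ℝ) :
    etaC (chain c a) x = ∑ k, solEta (c k) (x - a k) := by
  rw [chain, etaC_sum]
  exact Finset.sum_congr rfl fun k _ => etaC_soliton (h k) _ _

/-! ### Lipschitz dependence -/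

theorem exists_window {N : ℕ} {cs : Fin N → ℝ} (h : cs ∈ Adm N) :
    ∃ κ > 0, ∃ δ > 0, ∀ k b, |b - cs k| ≤ δ → b ∈ speeds κ := by
  have h1 : ∀ k, ∀ᶠ κ in 𝓝[>] (0 : ℝ), ∀ᶠ b in 𝓝 (cs k), b ∈ speeds κ := by
    intro k
    obtain ⟨κ, hκ, hb⟩ := (h k).exists_mem
    filter_upwards [Ioo_mem_nhdsGT hκ] with κ' hκ'
    filter_upwards [hb] with b hb
    exact ⟨hκ'.2.le.trans hb.1, hκ'.2.le.trans hb.2⟩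
  obtain ⟨κ, hκ, hκ0⟩ := ((eventually_all.2 h1).and self_mem_nhdsWithin).exists
  have h2 : ∀ k, ∀ᶠ δ in 𝓝[>] (0 : ℝ), ∀ b, |b - cs k| ≤ δ → b ∈ speeds κ := by
    intro k
    obtain ⟨δ, hδ, hb⟩ := eventually_nhds_iff_ball.1 (hκ k)
    filter_upwards [Ioo_mem_nhdsGT hδ] with δ' hδ' b hb'
    exact hb b (by rw [mem_ball, Real.dist_eq]; exact hb'.trans_lt hδ'.2)
  obtain ⟨δ, hδ, hδ0⟩ := ((eventually_all.2 h2).and self_mem_nhdsWithin).exists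
  exact ⟨κ, hκ0, δ, hδ0, hδ⟩

theorem norm_shiftD_le {gc gy : ℝ → ℝ → ℝ} (hc : Decay gc) (hy : Decay gy) {κ : ℝ} (hκ : 0 < κ) :
    ∃ C, 0 ≤ C ∧ ∀ p : ℝ × ℝ, p.1 ∈ speeds κ → ∀ h, ‖shiftD gc gy p h‖ ≤ C * ‖h‖ := by
  obtain ⟨C, hC, h1⟩ := norm_shiftL2_le hc hκ
  obtain ⟨D, hD, h2⟩ := norm_shiftL2_le hy hκ
  refine ⟨C + D, by positivity, fun p hp h => ?_⟩
  have e : shiftD gc gy p h = h.1 • shiftL2 gc p - h.2 • shiftL2 gy p := by simp [shiftD]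
  rw [e]
  refine (norm_sub_le _ _).trans ?_
  rw [norm_smul, norm_smul]
  have a1 := mul_le_mul (norm_fst_le h) (h1 p hp) (norm_nonneg _) (norm_nonneg _)
  have a2 := mul_le_mul (norm_snd_le h) (h2 p hp) (norm_nonneg _) (norm_nonneg _)
  linarith

theorem Profile.lipschitz_shiftL2 {g gc gy : ℝ → ℝ → ℝ} (hg : Profile g gc gy) {κ : ℝ}
    (hκ : 0 < κ) : ∃ C, 0 ≤ C ∧ ∀ s : Set ℝ, Convex ℝ s → s ⊆ speeds κ → ∀ p q : ℝ × ℝ,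
      p.1 ∈ s → q.1 ∈ s → ‖shiftL2 g p - shiftL2 g q‖ ≤ C * ‖p - q‖ := by
  obtain ⟨C, hC, h1⟩ := norm_shiftD_le hg.dc hg.dy hκ
  refine ⟨C, hC, fun s hs hsub p q hp hq => ?_⟩
  have hconv : Convex ℝ {p : ℝ × ℝ | p.1 ∈ s} :=
    hs.is_linear_preimage (f := Prod.fst) (LinearMap.fst ℝ ℝ ℝ).isLinear
  exact hconv.norm_image_sub_le_of_norm_hasFDerivWithin_le (𝕜 := ℝ)
    (fun z hz => (hg.hasFDerivAt_shiftL2 (admSpeed_of_mem hκ (hsub hz))).hasFDerivWithinAt)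
    (fun z hz => ContinuousLinearMap.opNorm_le_bound _ hC (h1 z (hsub hz))) hq hp

theorem lipschitz_soliton {κ : ℝ} (hκ : 0 < κ) : ∃ C, 0 ≤ C ∧ ∀ s : Set ℝ, Convex ℝ s →
    s ⊆ speeds κ → ∀ p q : ℝ × ℝ, p.1 ∈ s → q.1 ∈ s →
      ‖soliton p.1 p.2 - soliton q.1 q.2‖ ≤ C * ‖p - q‖ := by
  obtain ⟨C₁, hC₁, h1⟩ := profile_eta.lipschitz_shiftL2 hκ
  obtain ⟨C₂, hC₂, h2⟩ := profile_eY.lipschitz_shiftL2 hκ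
  obtain ⟨C₃, hC₃, h3⟩ := profile_v.lipschitz_shiftL2 hκ
  refine ⟨C₁ + C₂ + C₃, by positivity, fun s hs hsub p q hp hq => ?_⟩
  have hp' := admSpeed_of_mem hκ (hsub hp)
  have hq' := admSpeed_of_mem hκ (hsub hq)
  refine (norm_le_components _).trans ?_
  rw [map_sub, map_sub, map_sub, etaL_soliton hp', etaL_soliton hq', etaXL_soliton hp',
    etaXL_soliton hq', velL_soliton hp', velL_soliton hq']
  have := h1 s hs hsub p q hp hq
  have := h2 s hs hsub p q hp hq
  have := h3 s hs hsub p q hp hq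
  linarith

/-! ### Positions -/

theorem Pos.gap {N : ℕ} {L : ℝ} (hL : 0 ≤ L) {a : Fin N → ℝ} (ha : a ∈ Pos N L) {j k : Fin N}
    (h : j < k) : a j + L < a k := by
  obtain ⟨j, hj⟩ := j
  obtain ⟨k, hk⟩ := k
  simp only [Fin.mk_lt_mk] at h
  induction k, h using Nat.le_induction with
  | base => exact ha ⟨j, hj⟩ ⟨j + 1, hk⟩ rfl
  | succ k h ih =>
    have h1 := ih (by omega)
    have h2 := ha ⟨k, by omega⟩ ⟨k + 1, hk⟩ rfl
    linarith

theorem Pos.abs_gap {N : ℕ} {L : ℝ} (hL : 0 ≤ L) {a : Fin N → ℝ} (ha : a ∈ Pos N L) {j k : Fin N}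
    (h : j ≠ k) : L ≤ |a j - a k| := by
  rcases lt_or_gt_of_ne h with h | h
  · have := Pos.gap hL ha h
    rw [abs_sub_comm]
    exact (by linarith : L ≤ a k - a j).trans (le_abs_self _)
  · have := Pos.gap hL ha h
    exact (by linarith : L ≤ a j - a k).trans (le_abs_self _)

theorem Pos.mono {N : ℕ} {L L' : ℝ} (h : L ≤ L') : Pos N L' ⊆ Pos N L :=
  fun _ ha j k hjk => by have := ha j k hjk; linarith

/-! ### Zeros of maps that are close to an isomorphism -/

theorem exists_zero_of_near_equiv {E : Type*} [NormedAddCommGroup E] [NormedSpace ℝ E]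
    [CompleteSpace E] (M : E ≃L[ℝ] E) {F : E → E} {F' : E → E →L[ℝ] E} {x₀ : E} {r K : ℝ}
    (hK : 0 < K) (hM : ‖(M.symm : E →L[ℝ] E)‖ ≤ K)
    (hd : ∀ x ∈ closedBall x₀ r, HasFDerivAt F (F' x) x)
    (hb : ∀ x ∈ closedBall x₀ r, ‖F' x - M‖ ≤ (2 * K)⁻¹)
    (h0 : 2 * K * ‖F x₀‖ ≤ r) :
    InjOn F (closedBall x₀ r) ∧ ∃ x ∈ closedBall x₀ (2 * K * ‖F x₀‖), F x = 0 := by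
  set c : NNReal := ⟨(2 * K)⁻¹, by positivity⟩
  have happ : ApproximatesLinearOn F (M : E →L[ℝ] E) (closedBall x₀ r) c := fun x hx y hy =>
    (convex_closedBall x₀ r).norm_image_sub_le_of_norm_hasFDerivWithin_le' (𝕜 := ℝ)
      (fun z hz => (hd z hz).hasFDerivWithinAt) hb hy hx
  have hinj : ∀ x, ‖x‖ ≤ K * ‖M x‖ := fun x => by
    calc ‖x‖ = ‖(M.symm : E →L[ℝ] E) (M x)‖ := by simp
      _ ≤ _ := (ContinuousLinearMap.le_opNorm _ _).trans (by gcongr)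
  constructor
  · intro x hx y hy hxy
    have h1 := happ x hx y hy
    rw [hxy, sub_self, zero_sub, norm_neg] at h1
    have h2 := hinj (x - y)
    have h3 : K * ‖M (x - y)‖ ≤ K * ((2 * K)⁻¹ * ‖x - y‖) := mul_le_mul_of_nonneg_left h1 hK.le
    have h4 : K * ((2 * K)⁻¹ * ‖x - y‖) = ‖x - y‖ / 2 := by field_simp
    have h5 : ‖x - y‖ = 0 := le_antisymm (by linarith) (norm_nonneg _)
    exact sub_eq_zero.1 (norm_eq_zero.1 h5)
  · set R : (M : E →L[ℝ] E).NonlinearRightInverse :=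
      ⟨M.symm, ⟨K, hK.le⟩, fun y => (ContinuousLinearMap.le_opNorm (M.symm : E →L[ℝ] E) y).trans
        (mul_le_mul_of_nonneg_right hM (norm_nonneg _)), fun y => by simp⟩
    have h1 := happ.surjOn_closedBall_of_nonlinearRightInverse R (ε := 2 * K * ‖F x₀‖) (b := x₀)
      (by positivity) (closedBall_subset_closedBall h0)
    have h2 : (0 : E) ∈ closedBall (F x₀)
        ((((R.nnnorm : NNReal) : ℝ)⁻¹ - c) * (2 * K * ‖F x₀‖)) := by
      rw [mem_closedBall, dist_zero_left]
      have : ((K)⁻¹ - (2 * K)⁻¹) * (2 * K * ‖F x₀‖) = ‖F x₀‖ := by field_simp; ring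
      exact this.ge
    exact h1 h2

theorem isInvertible_of_near {E : Type*} [NormedAddCommGroup E] [NormedSpace ℝ E]
    [FiniteDimensional ℝ E] (M : E ≃L[ℝ] E) {K : ℝ} (hK : 0 < K)
    (hM : ‖(M.symm : E →L[ℝ] E)‖ ≤ K) {D : E →L[ℝ] E} (h : ‖D - M‖ ≤ (2 * K)⁻¹) :
    D.IsInvertible := by
  have hker : Function.Injective (D : E →ₗ[ℝ] E) := by
    rw [← LinearMap.ker_eq_bot, LinearMap.ker_eq_bot']
    intro x hx
    have h1 : ‖x‖ ≤ K * ‖M x‖ := by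
      calc ‖x‖ = ‖(M.symm : E →L[ℝ] E) (M x)‖ := by simp
        _ ≤ _ := (ContinuousLinearMap.le_opNorm _ _).trans (by gcongr)
    have h2 := (D - M).le_opNorm x
    have hx' : D x = 0 := hx
    have h3 : (D - (M : E →L[ℝ] E)) x = -M x := by simp [hx']
    rw [h3, norm_neg] at h2
    have h4 : K * ‖M x‖ ≤ K * ((2 * K)⁻¹ * ‖x‖) :=
      mul_le_mul_of_nonneg_left (h2.trans (by gcongr)) hK.le
    have h5 : K * ((2 * K)⁻¹ * ‖x‖) = ‖x‖ / 2 := by field_simp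
    exact norm_eq_zero.1 (le_antisymm (by linarith) (norm_nonneg _))
  refine ⟨(LinearEquiv.ofInjectiveEndo _ hker).toContinuousLinearEquiv, ?_⟩
  ext x
  rfl

end

/-! ### Scalar products of profiles at the same position -/

/-- The scalar product in `L²` of two profiles with the same speed. -/
def profInner (f g : ℝ → ℝ → ℝ) (c : ℝ) : ℝ := inner ℝ (shiftL2 f (c, 0)) (shiftL2 g (c, 0))

theorem profInner_eq {f g : ℝ → ℝ → ℝ} (hf : Decay f) (hg : Decay g) {c : ℝ} (h : AdmSpeed c) :
    profInner f g c = ∫ y, f c y * g c y := by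
  rw [profInner, inner_shiftL2 hf hg h h]
  simp only [sub_zero]

theorem inner_shiftL2_self {f g : ℝ → ℝ → ℝ} (hf : Decay f) (hg : Decay g) {p : ℝ × ℝ}
    (h : AdmSpeed p.1) : inner ℝ (shiftL2 f p) (shiftL2 g p) = profInner f g p.1 :=
  inner_shiftL2_same hf hg h h p.2

theorem continuousAt_profInner {f g : ℝ → ℝ → ℝ} (hf : Decay f) (hg : Decay g) {c : ℝ}
    (h : AdmSpeed c) : ContinuousAt (profInner f g) c := by
  have h0 : ContinuousAt (fun b : ℝ => (b, (0 : ℝ))) c := by fun_prop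
  have h1 : ContinuousAt (fun b : ℝ => shiftL2 f (b, 0)) c :=
    ContinuousAt.comp (f := fun b : ℝ => (b, (0 : ℝ))) (g := shiftL2 f)
      (hf.continuousAt_shiftL2 (p₀ := (c, 0)) h) h0
  have h2 : ContinuousAt (fun b : ℝ => shiftL2 g (b, 0)) c :=
    ContinuousAt.comp (f := fun b : ℝ => (b, (0 : ℝ))) (g := shiftL2 g)
      (hg.continuousAt_shiftL2 (p₀ := (c, 0)) h) h0
  exact h1.inner h2

theorem hasDerivAt_profInner {f fc fy g gc gy : ℝ → ℝ → ℝ} (hf : Profile f fc fy)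
    (hg : Profile g gc gy) {c : ℝ} (h : AdmSpeed c) :
    HasDerivAt (profInner f g) (profInner f gc c + profInner fc g c) c := by
  have h0 : HasDerivAt (fun b : ℝ => (b, (0 : ℝ))) (1, 0) c :=
    (hasDerivAt_id c).prodMk (hasDerivAt_const c 0)
  have h1 := (hf.hasFDerivAt_shiftL2 (p₀ := (c, 0)) h).comp_hasDerivAt c h0
  have h2 := (hg.hasFDerivAt_shiftL2 (p₀ := (c, 0)) h).comp_hasDerivAt c h0
  refine (h1.inner ℝ h2).congr_deriv ?_
  simp [shiftD, profInner]

theorem solTh_pos {c : ℝ} (h : AdmSpeed c) {y : ℝ} (hy : 0 < y) : 0 < solTh c y := by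
  have := sc_pos h
  rw [solTh, Real.tanh_eq_sinh_div_cosh]
  exact div_pos (Real.sinh_pos_iff.2 (by positivity)) (Real.cosh_pos _)

theorem solTh_neg (c y : ℝ) : solTh c (-y) = -solTh c y := by
  simp only [solTh]; rw [← Real.tanh_neg]; congr 1; ring

theorem tendsto_wt : Tendsto wt atTop (𝓝 0) :=
  tendsto_inv_atTop_zero.comp
    (tendsto_atTop_add_const_left _ _ (tendsto_pow_atTop (by norm_num)))

theorem tendsto_solEta {c : ℝ} (h : AdmSpeed c) : Tendsto (solEta c) atTop (𝓝 0) := by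
  obtain ⟨κ, hκ, hc⟩ := h.mem_speeds
  obtain ⟨C, -, hC⟩ := ud_eta κ hκ
  refine squeeze_zero_norm (hC c hc) ?_
  simpa using tendsto_wt.const_mul C

theorem tendsto_solTh {c : ℝ} (h : AdmSpeed c) : Tendsto (solTh c) atTop (𝓝 1) := by
  have hs := sc_pos h
  have h1 : Tendsto (fun y => √(1 - 2 / sc c ^ 2 * solEta c y)) atTop (𝓝 1) := by
    simpa using (((tendsto_solEta h).const_mul (2 / sc c ^ 2)).const_sub 1).sqrt
  refine h1.congr' ?_
  filter_upwards [eventually_gt_atTop 0] with y hy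
  have : 1 - 2 / sc c ^ 2 * solEta c y = solTh c y ^ 2 := by
    rw [solEta_eq h]; field_simp; ring
  rw [this, Real.sqrt_sq (solTh_pos h hy).le]

theorem tendsto_solTh_atBot {c : ℝ} (h : AdmSpeed c) : Tendsto (solTh c) atBot (𝓝 (-1)) := by
  have := ((tendsto_solTh h).comp tendsto_neg_atBot_atTop).neg
  refine this.congr fun y => ?_
  simp [solTh_neg]

theorem profInner_eta_v {c : ℝ} (h : AdmSpeed c) :
    profInner solEta solV c = c * sc c - 2 * Real.arctan (sc c / c) := by
  rw [profInner_eq profile_eta.decay profile_v.decay h]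
  have hs := sc_pos h
  have hs2 := sc_sq h
  have hc := h.1
  have hT : ∀ y, HasDerivAt (solTh c) ((sc c)⁻¹ * solEta c y) y := fun y => (pd_th h y).hasDerivAt_right
  have hd : ∀ y, HasDerivAt (fun y => c / 2 * sc c * solTh c y - Real.arctan (sc c / c * solTh c y))
      (solEta c y * solV c y) y := by
    intro y
    refine (((hT y).const_mul (c / 2 * sc c)).sub ((hT y).const_mul (sc c / c)).arctan).congr_deriv ?_
    have h1 := solInv_pos h y
    have h2 : 1 - solEta c y = (c ^ 2 + sc c ^ 2 * solTh c y ^ 2) / 2 := by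
      rw [solEta_eq h]; nlinarith
    have h3 : 0 < c ^ 2 + sc c ^ 2 * solTh c y ^ 2 := by linarith
    have h4 : 1 + (sc c / c * solTh c y) ^ 2 = 2 * (1 - solEta c y) / c ^ 2 := by
      rw [h2]; field_simp
    rw [h4, solV]
    field_simp
    ring
  have hint : Integrable (fun y => solEta c y * solV c y) := by
    have h1 := profile_eta.decay.memLp h 0
    have h2 := profile_v.decay.memLp h 0
    simp only [sub_zero] at h1 h2
    exact integrable_mul_L2 h1 h2
  have htop := ((tendsto_solTh h).const_mul (c / 2 * sc c)).sub
    ((Real.continuous_arctan.tendsto _).comp ((tendsto_solTh h).const_mul (sc c / c)))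
  have hbot := ((tendsto_solTh_atBot h).const_mul (c / 2 * sc c)).sub
    ((Real.continuous_arctan.tendsto _).comp ((tendsto_solTh_atBot h).const_mul (sc c / c)))
  rw [integral_of_hasDerivAt_of_tendsto hd hint hbot htop, mul_one, mul_one, mul_neg_one,
    mul_neg_one, Real.arctan_neg]
  ring

theorem deriv_momentum {c : ℝ} (h : AdmSpeed c) :
    profInner solEta vC c + profInner eC solV c = 2 * sc c := by
  have h1 := hasDerivAt_profInner profile_eta profile_v h
  have hs := sc_pos h
  have hs2 := sc_sq h
  have hc := h.1
  have hsd : HasDerivAt sc (-c * (sc c)⁻¹) c := by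
    have h2 : 0 < 2 - c ^ 2 := by linarith [h.sq_lt]
    refine (((hasDerivAt_pow 2 c).const_sub 2).sqrt h2.ne').congr_deriv ?_
    simp only [sc, Nat.cast_ofNat, Nat.add_one_sub_one, pow_one]
    field_simp
  have h2 : HasDerivAt (fun c => c * sc c - 2 * Real.arctan (sc c / c)) (2 * sc c) c := by
    refine (((hasDerivAt_id c).mul hsd).sub (((hsd.div (hasDerivAt_id c) hc).arctan).const_mul 2)).congr_deriv ?_
    simp only [id_eq]
    have h4 : 1 + (sc c / c) ^ 2 = 2 / c ^ 2 := by field_simp; linarith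
    change 1 * sc c + c * (-c * (sc c)⁻¹) - 2 * (1 / (1 + (sc c / c) ^ 2) * _) = _
    rw [h4]
    field_simp
    nlinarith
  have h3 : profInner solEta solV =ᶠ[𝓝 c] fun c => c * sc c - 2 * Real.arctan (sc c / c) := by
    obtain ⟨κ, hκ, hb⟩ := h.exists_mem
    filter_upwards [hb] with b hb using profInner_eta_v (admSpeed_of_mem hκ hb)
  exact h1.unique (h2.congr_of_eventuallyEq h3)

theorem profInner_comm (f g : ℝ → ℝ → ℝ) (c : ℝ) : profInner f g c = profInner g f c :=
  real_inner_comm _ _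

theorem deriv_momentum_translation {c : ℝ} (h : AdmSpeed c) :
    profInner solEta vY c + profInner eY solV c = 0 := by
  have e := profile_eta.decay.memLp h 0
  have v := profile_v.decay.memLp h 0
  have ey := profile_eY.decay.memLp h 0
  have vy := profile_vY.decay.memLp h 0
  simp only [sub_zero] at e v ey vy
  rw [profInner_eq profile_eta.decay profile_vY.decay h, profInner_eq profile_eY.decay profile_v.decay h,
    ← integral_add (integrable_mul_L2 e vy) (integrable_mul_L2 ey v)]
  refine integral_eq_zero_of_hasDerivAt_of_integrable (f := fun y => solEta c y * solV c y)
    (fun y => ?_) ((integrable_mul_L2 e vy).add (integrable_mul_L2 ey v)) (integrable_mul_L2 e v)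
  refine ((pd_eta h y).hasDerivAt_right.mul (pd_v h y).hasDerivAt_right).congr_deriv ?_
  ring

theorem profInner_eY_pos {c : ℝ} (h : AdmSpeed c) : 0 < profInner eY eY c + profInner vY vY c := by
  have hv : 0 ≤ profInner vY vY c := real_inner_self_nonneg
  suffices 0 < profInner eY eY c by linarith
  refine lt_of_le_of_ne real_inner_self_nonneg fun h0 => ?_
  have h1 : shiftL2 eY (c, 0) = 0 := inner_self_eq_zero.1 h0.symm
  have h2 : (fun y => eY c (y - 0)) =ᵐ[volume] fun _ => (0 : ℝ) := by
    refine (profile_eY.decay.shiftL2_ae (p := (c, 0)) h).symm.trans ?_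
    rw [h1]
    exact Lp.coeFn_zero ℝ 2 volume
  have h3 := congrFun (((profile_eY.decay.continuous h 0).ae_eq_iff_eq volume continuous_const).1 h2) 1
  have h4 := solTh_pos h one_pos
  have h5 := sc_pos h
  have h6 : 0 < solEta c 1 := by
    have := h.sq_lt
    have : 0 < 2 - c ^ 2 := by linarith
    have := Real.cosh_pos (Real.sqrt (2 - c ^ 2) * 1 / 2)
    unfold solEta; positivity
  simp only [sub_zero, eY, neg_eq_zero] at h3
  have : 0 < sc c * (solTh c 1 * solEta c 1) := by positivity
  linarith

/-- The matrix of the modulation equations for one soliton. -/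
def modBlock (c : ℝ) : ℝ × ℝ →L[ℝ] ℝ × ℝ :=
  (-((profInner eC eY c + profInner vC vY c) • ContinuousLinearMap.fst ℝ ℝ ℝ)
    + (profInner eY eY c + profInner vY vY c) • ContinuousLinearMap.snd ℝ ℝ ℝ).prod
  (-((2 * sc c) • ContinuousLinearMap.fst ℝ ℝ ℝ))

theorem modBlock_eq_zero {c : ℝ} (h : AdmSpeed c) {p : ℝ × ℝ} (hp : modBlock c p = 0) : p = 0 := by
  have h1 := congrArg Prod.fst hp
  have h2 := congrArg Prod.snd hp
  simp [modBlock] at h1 h2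
  have h3 : p.1 = 0 := by
    rcases h2 with h2 | h2
    · exact absurd h2 (sc_pos h).ne'
    · exact h2
  rw [h3] at h1
  have h4 := profInner_eY_pos h
  have h5 : p.2 = 0 := by
    simp at h1
    rcases h1 with h1 | h1
    · exact absurd h1 h4.ne'
    · exact h1
  exact Prod.ext h3 h5

/-- The matrix of the modulation equations. -/
def modMatrix {N : ℕ} (cs : Fin N → ℝ) : (Fin N → ℝ × ℝ) →L[ℝ] Fin N → ℝ × ℝ :=
  ContinuousLinearMap.pi fun k => (modBlock (cs k)).comp (ContinuousLinearMap.proj k)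

theorem modMatrix_isInvertible {N : ℕ} {cs : Fin N → ℝ} (h : cs ∈ Adm N) :
    ∃ M : (Fin N → ℝ × ℝ) ≃L[ℝ] Fin N → ℝ × ℝ,
      (M : (Fin N → ℝ × ℝ) →L[ℝ] Fin N → ℝ × ℝ) = modMatrix cs := by
  have hker : Function.Injective (modMatrix cs : (Fin N → ℝ × ℝ) →ₗ[ℝ] Fin N → ℝ × ℝ) := by
    rw [← LinearMap.ker_eq_bot, LinearMap.ker_eq_bot']
    intro x hx
    funext k
    exact modBlock_eq_zero (h k) (congrFun hx k)
  exact ⟨(LinearEquiv.ofInjectiveEndo _ hker).toContinuousLinearEquiv, ContinuousLinearMap.ext fun _ => rfl⟩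

section

open Metric

/-! ### The modulation equations -/

variable {N : ℕ}

/-- The scalar product of `w u - ∑ⱼ a(xⱼ)` with `f(xₖ)`. -/
def testRem (w : XSpace →L[ℝ] L2) (a f : ℝ → ℝ → ℝ) (z : XSpace × (Fin N → ℝ × ℝ)) (k : Fin N) : ℝ :=
  inner ℝ (w z.1 - ∑ j, shiftL2 a (z.2 j)) (shiftL2 f (z.2 k))

/-- Continuous linear maps of norm at most one which send solitons to translates of a profile. -/
structure Reads (w : XSpace →L[ℝ] L2) (a : ℝ → ℝ → ℝ) : Prop where
  norm_le : ∀ u, ‖w u‖ ≤ ‖u‖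
  soliton : ∀ p : ℝ × ℝ, AdmSpeed p.1 → w (soliton p.1 p.2) = shiftL2 a p

theorem reads_eta : Reads etaL solEta := ⟨norm_etaL_le, fun _ => etaL_soliton⟩
theorem reads_vel : Reads velL solV := ⟨norm_velL_le, fun _ => velL_soliton⟩

theorem Reads.chain {w : XSpace →L[ℝ] L2} {a : ℝ → ℝ → ℝ} (hw : Reads w a)
    {x : Fin N → ℝ × ℝ} (hx : ∀ k, AdmSpeed (x k).1) :
    w (chain (fun k => (x k).1) fun k => (x k).2) = ∑ k, shiftL2 a (x k) := by
  rw [GPChain.chain, map_sum]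
  exact Finset.sum_congr rfl fun k _ => hw.soliton (x k) (hx k)

theorem contDiffAt_testRem (w : XSpace →L[ℝ] L2) {a ac ay f fc fy : ℝ → ℝ → ℝ} (ha : Profile a ac ay)
    (hf : Profile f fc fy) {z : XSpace × (Fin N → ℝ × ℝ)} (hz : ∀ k, AdmSpeed (z.2 k).1)
    (k : Fin N) : ContDiffAt ℝ 1 (fun z : XSpace × (Fin N → ℝ × ℝ) => testRem w a f z k) z := by
  have hp : ∀ j : Fin N, ContDiffAt ℝ 1 (fun z : XSpace × (Fin N → ℝ × ℝ) => z.2 j) z := fun j =>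
    ((ContinuousLinearMap.proj (R := ℝ) (φ := fun _ : Fin N => ℝ × ℝ) j).comp
      (ContinuousLinearMap.snd ℝ XSpace (Fin N → ℝ × ℝ))).contDiff.contDiffAt
  have ha' : ∀ j : Fin N, ContDiffAt ℝ 1
      (fun z : XSpace × (Fin N → ℝ × ℝ) => shiftL2 a (z.2 j)) z := fun j =>
    ContDiffAt.comp (g := shiftL2 a) (f := fun z : XSpace × (Fin N → ℝ × ℝ) => z.2 j) z
      (ha.contDiffAt_shiftL2 (hz j)) (hp j)
  have hf' : ContDiffAt ℝ 1 (fun z : XSpace × (Fin N → ℝ × ℝ) => shiftL2 f (z.2 k)) z :=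
    ContDiffAt.comp (g := shiftL2 f) (f := fun z : XSpace × (Fin N → ℝ × ℝ) => z.2 k) z
      (hf.contDiffAt_shiftL2 (hz k)) (hp k)
  have hw : ContDiffAt ℝ 1 (fun z : XSpace × (Fin N → ℝ × ℝ) => w z.1) z :=
    (w.comp (ContinuousLinearMap.fst ℝ XSpace (Fin N → ℝ × ℝ))).contDiff.contDiffAt
  exact (hw.sub (ContDiffAt.sum fun j _ => ha' j)).inner ℝ hf'

theorem inner_shiftD (gc gy f : ℝ → ℝ → ℝ) (p q h : ℝ × ℝ) :
    inner ℝ (shiftD gc gy p h) (shiftL2 f q)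
      = h.1 * inner ℝ (shiftL2 gc p) (shiftL2 f q) - h.2 * inner ℝ (shiftL2 gy p) (shiftL2 f q) := by
  have e : shiftD gc gy p h = h.1 • shiftL2 gc p - h.2 • shiftL2 gy p := by simp [shiftD]
  rw [e, inner_sub_left, real_inner_smul_left, real_inner_smul_left]

theorem hasFDerivAt_testRem (w : XSpace →L[ℝ] L2) {a ac ay f fc fy : ℝ → ℝ → ℝ}
    (ha : Profile a ac ay) (hf : Profile f fc fy) (u : XSpace) {x : Fin N → ℝ × ℝ}
    (hx : ∀ k, AdmSpeed (x k).1) (k : Fin N) : ∃ D : (Fin N → ℝ × ℝ) →L[ℝ] ℝ,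
      HasFDerivAt (fun x => testRem w a f (u, x) k) D x ∧
      ∀ h, D h = inner ℝ (w u - ∑ j, shiftL2 a (x j)) (shiftD fc fy (x k) (h k))
        - ∑ j, inner ℝ (shiftD ac ay (x j) (h j)) (shiftL2 f (x k)) := by
  have hp : ∀ j : Fin N, HasFDerivAt (fun x : Fin N → ℝ × ℝ => x j)
      (ContinuousLinearMap.proj (R := ℝ) (φ := fun _ : Fin N => ℝ × ℝ) j) x := fun j =>
    (ContinuousLinearMap.proj (R := ℝ) (φ := fun _ : Fin N => ℝ × ℝ) j).hasFDerivAt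
  have h1 : HasFDerivAt (fun x : Fin N → ℝ × ℝ => w u - ∑ j, shiftL2 a (x j)) _ x :=
    (HasFDerivAt.fun_sum fun j _ => (ha.hasFDerivAt_shiftL2 (hx j)).comp x (hp j)).const_sub (w u)
  have h2 := (hf.hasFDerivAt_shiftL2 (hx k)).comp x (hp k)
  refine ⟨_, h1.inner ℝ h2, fun h => ?_⟩
  simp [fderivInnerCLM_apply, sum_inner]
  ring

theorem norm_sub_sum_le {w : XSpace →L[ℝ] L2} {a ac ay : ℝ → ℝ → ℝ} (ha : Profile a ac ay)
    (hw : Reads w a) {cs : Fin N → ℝ} {κ δ : ℝ} (hκ : 0 < κ)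
    (hδ : ∀ k b, |b - cs k| ≤ δ → b ∈ speeds κ) : ∃ C, 0 ≤ C ∧ ∀ (u : XSpace) (as : Fin N → ℝ)
      (r : ℝ), r ≤ δ → ∀ x ∈ closedBall (fun k => (cs k, as k)) r,
        ‖w u - ∑ j, shiftL2 a (x j)‖ ≤ ‖u - chain cs as‖ + C * r := by
  obtain ⟨C, hC, h1⟩ := ha.lipschitz_shiftL2 hκ
  refine ⟨N * C, by positivity, fun u as r hr x hx => ?_⟩
  have hr0 : 0 ≤ r := dist_nonneg.trans (mem_closedBall.1 hx)
  have hxk : ∀ k, ‖x k - (cs k, as k)‖ ≤ r := fun k => by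
    have := (dist_pi_le_iff hr0).1 (mem_closedBall.1 hx) k
    rwa [dist_eq_norm] at this
  have hadm : ∀ k, AdmSpeed (cs k) := fun k =>
    admSpeed_of_mem hκ (hδ k _ (by rw [sub_self, abs_zero]; linarith))
  have hterm : ∀ k, ‖shiftL2 a (cs k, as k) - shiftL2 a (x k)‖ ≤ C * r := fun k => by
    have hfst : |(x k).1 - cs k| ≤ r := (norm_fst_le (x k - (cs k, as k))).trans (hxk k)
    refine (h1 (closedBall (cs k) δ) (convex_closedBall _ _) (fun b hb => hδ k b hb) _ _
      (mem_closedBall_self (by linarith)) (mem_closedBall.2 (hfst.trans hr))).trans ?_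
    rw [norm_sub_rev]
    exact mul_le_mul_of_nonneg_left (hxk k) hC
  have e : w u - ∑ j, shiftL2 a (x j)
      = w (u - chain cs as) + ∑ j, (shiftL2 a (cs j, as j) - shiftL2 a (x j)) := by
    rw [map_sub, Finset.sum_sub_distrib,
      hw.chain (x := fun k => (cs k, as k)) hadm]
    abel
  rw [e]
  refine (norm_add_le _ _).trans (add_le_add (hw.norm_le _) ?_)
  refine (norm_sum_le_of_le _ fun k _ => hterm k).trans ?_
  simp [mul_assoc]

theorem exists_testRem_bound {w : XSpace →L[ℝ] L2} {a ac ay f fc fy : ℝ → ℝ → ℝ}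
    (ha : Profile a ac ay) (hf : Profile f fc fy) (hw : Reads w a) {cs : Fin N → ℝ}
    (hcs : cs ∈ Adm N) {ε : ℝ} (hε : 0 < ε) : ∃ δ > 0, ∃ L₀ > 0, ∀ as ∈ Pos N L₀, ∀ u : XSpace,
      ‖u - chain cs as‖ ≤ δ → ∀ x ∈ closedBall (fun k => (cs k, as k)) δ, ∀ k,
        ∃ D : (Fin N → ℝ × ℝ) →L[ℝ] ℝ, HasFDerivAt (fun x => testRem w a f (u, x) k) D x ∧
          ∀ h, |D h - (-(h k).1 * profInner ac f (cs k) + (h k).2 * profInner ay f (cs k))|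
            ≤ ε * ‖h‖ := by
  obtain ⟨κ, hκ, δ₁, hδ₁, hwin⟩ := exists_window hcs
  obtain ⟨C, hC, h1⟩ := norm_sub_sum_le ha hw hκ hwin
  obtain ⟨B, hB, h2⟩ := norm_shiftD_le hf.dc hf.dy hκ
  obtain ⟨K₁, hK₁, h3⟩ := abs_inner_shiftL2_le ha.dc hf.decay hκ
  obtain ⟨K₂, hK₂, h4⟩ := abs_inner_shiftL2_le ha.dy hf.decay hκ
  set η : ℝ := ε / (2 * (N + 1))
  have hη : 0 < η := by positivity
  have hmod : ∀ k, ∀ᶠ δ in 𝓝[>] (0 : ℝ), ∀ b, |b - cs k| ≤ δ →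
      |profInner ac f b - profInner ac f (cs k)| ≤ η / 2 ∧
      |profInner ay f b - profInner ay f (cs k)| ≤ η / 2 := by
    intro k
    have c1 := continuousAt_iff.1 (continuousAt_profInner ha.dc hf.decay (hcs k)) (η / 2)
      (by positivity)
    have c2 := continuousAt_iff.1 (continuousAt_profInner ha.dy hf.decay (hcs k)) (η / 2)
      (by positivity)
    obtain ⟨d₁, hd₁, c1⟩ := c1
    obtain ⟨d₂, hd₂, c2⟩ := c2
    filter_upwards [Ioo_mem_nhdsGT hd₁, Ioo_mem_nhdsGT hd₂] with δ e1 e2 b hb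
    exact ⟨(c1 (by rw [Real.dist_eq]; exact hb.trans_lt e1.2)).le,
      (c2 (by rw [Real.dist_eq]; exact hb.trans_lt e2.2)).le⟩
  have hsmall : ∀ᶠ δ in 𝓝[>] (0 : ℝ), (1 + C) * B * δ ≤ ε / 2 := by
    have : Tendsto (fun δ : ℝ => (1 + C) * B * δ) (𝓝 0) (𝓝 ((1 + C) * B * 0)) := by
      exact (continuous_const.mul continuous_id).tendsto 0
    rw [mul_zero] at this
    exact (this.eventually (ge_mem_nhds (by positivity))).filter_mono nhdsWithin_le_nhds
  obtain ⟨δ, ⟨⟨⟨hδm, hδs⟩, hδ1⟩, hδ2⟩⟩ := ((((eventually_all.2 hmod).and hsmall).and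
    (Ioo_mem_nhdsGT hδ₁)).and (Ioo_mem_nhdsGT one_pos)).exists
  have hom : ∀ᶠ d in atTop, (K₁ + K₂) * om d ≤ η := by
    have := tendsto_om.const_mul (K₁ + K₂)
    rw [mul_zero] at this
    exact this.eventually (ge_mem_nhds hη)
  obtain ⟨d, hd, hd0⟩ := (hom.and (eventually_ge_atTop 0)).exists
  refine ⟨δ, hδ1.1, d + 2, by positivity, fun as has u hu x hx k => ?_⟩
  have hxk : ∀ k, ‖x k - (cs k, as k)‖ ≤ δ := fun k => by
    have := (dist_pi_le_iff hδ1.1.le).1 (mem_closedBall.1 hx) k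
    rwa [dist_eq_norm] at this
  have hx1 : ∀ k, |(x k).1 - cs k| ≤ δ := fun k =>
    (norm_fst_le (x k - (cs k, as k))).trans (hxk k)
  have hx2 : ∀ k, |(x k).2 - as k| ≤ δ := fun k =>
    (norm_snd_le (x k - (cs k, as k))).trans (hxk k)
  have hxs : ∀ k, (x k).1 ∈ speeds κ := fun k => hwin k _ ((hx1 k).trans hδ1.2.le)
  have hadm : ∀ k, AdmSpeed (x k).1 := fun k => admSpeed_of_mem hκ (hxs k)
  obtain ⟨D, hD, hDh⟩ := hasFDerivAt_testRem w ha hf u hadm k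
  refine ⟨D, hD, fun h => ?_⟩
  rw [hDh]
  have hhk : ∀ j, ‖h j‖ ≤ ‖h‖ := norm_le_pi_norm h
  have hh1 : ∀ j, |(h j).1| ≤ ‖h‖ := fun j => (norm_fst_le (h j)).trans (hhk j)
  have hh2 : ∀ j, |(h j).2| ≤ ‖h‖ := fun j => (norm_snd_le (h j)).trans (hhk j)
  have hA : |inner ℝ (w u - ∑ j, shiftL2 a (x j)) (shiftD fc fy (x k) (h k))| ≤ ε / 2 * ‖h‖ := by
    refine (abs_real_inner_le_norm _ _).trans ?_
    have e1 := h1 u as δ hδ1.2.le x hx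
    have e2 := (h2 (x k) (hxs k) (h k)).trans (mul_le_mul_of_nonneg_left (hhk k) hB)
    calc _ ≤ ((1 + C) * δ) * (B * ‖h‖) := mul_le_mul (by linarith) e2 (norm_nonneg _)
          (mul_nonneg (by positivity) hδ1.1.le)
      _ = ((1 + C) * B * δ) * ‖h‖ := by ring
      _ ≤ _ := mul_le_mul_of_nonneg_right hδs (norm_nonneg _)
  set m : ℝ := (h k).1 * profInner ac f (cs k) - (h k).2 * profInner ay f (cs k)
  have hT : ∀ j, |inner ℝ (shiftD ac ay (x j) (h j)) (shiftL2 f (x k)) - if j = k then m else 0|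
      ≤ η * ‖h‖ := by
    intro j
    rw [inner_shiftD]
    by_cases hjk : j = k
    · subst hjk
      rw [if_pos rfl, inner_shiftL2_self ha.dc hf.decay (hadm j),
        inner_shiftL2_self ha.dy hf.decay (hadm j)]
      obtain ⟨e1, e2⟩ := hδm j _ (hx1 j)
      have e : (h j).1 * profInner ac f (x j).1 - (h j).2 * profInner ay f (x j).1 - m
          = (h j).1 * (profInner ac f (x j).1 - profInner ac f (cs j))
            - (h j).2 * (profInner ay f (x j).1 - profInner ay f (cs j)) := by simp only [m]; ring
      rw [e]
      refine (abs_sub _ _).trans ?_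
      rw [abs_mul, abs_mul]
      have b1 := mul_le_mul (hh1 j) e1 (abs_nonneg _) (norm_nonneg _)
      have b2 := mul_le_mul (hh2 j) e2 (abs_nonneg _) (norm_nonneg _)
      linarith
    · rw [if_neg hjk, sub_zero]
      have hgap : d ≤ |(x j).2 - (x k).2| := by
        have g1 := Pos.abs_gap (by linarith) has hjk
        have g2 := hx2 j
        have g3 := hx2 k
        have g4 : |as j - as k| ≤ |(x j).2 - (x k).2| + |(x j).2 - as j| + |(x k).2 - as k| := by
          have e : as j - as k = ((x j).2 - (x k).2) - ((x j).2 - as j) + ((x k).2 - as k) := by ring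
          rw [e]
          exact (abs_add_le _ _).trans (add_le_add_left (abs_sub _ _) _)
        linarith [hδ2.2]
      have ho := om_anti hgap hd0
      have e1 := (h3 (x j) (x k) (hxs j) (hxs k)).trans (mul_le_mul_of_nonneg_left ho hK₁)
      have e2 := (h4 (x j) (x k) (hxs j) (hxs k)).trans (mul_le_mul_of_nonneg_left ho hK₂)
      refine (abs_sub _ _).trans ?_
      rw [abs_mul, abs_mul]
      have b1 := mul_le_mul (hh1 j) e1 (abs_nonneg _) (norm_nonneg _)
      have b2 := mul_le_mul (hh2 j) e2 (abs_nonneg _) (norm_nonneg _)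
      have b3 := mul_le_mul_of_nonneg_left hd (norm_nonneg h)
      linarith
  have hS : |∑ j, inner ℝ (shiftD ac ay (x j) (h j)) (shiftL2 f (x k)) - m| ≤ ε / 2 * ‖h‖ := by
    have e : ∑ j, inner ℝ (shiftD ac ay (x j) (h j)) (shiftL2 f (x k)) - m
        = ∑ j, (inner ℝ (shiftD ac ay (x j) (h j)) (shiftL2 f (x k)) - if j = k then m else 0) := by
      rw [Finset.sum_sub_distrib, Finset.sum_ite_eq' Finset.univ k]; simp
    rw [e]
    refine (Finset.abs_sum_le_sum_abs _ _).trans ((Finset.sum_le_sum fun j _ => hT j).trans ?_)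
    rw [Finset.sum_const, Finset.card_univ, Fintype.card_fin, nsmul_eq_mul, ← mul_assoc]
    refine mul_le_mul_of_nonneg_right ?_ (norm_nonneg _)
    simp only [η]
    rw [mul_div_assoc', div_le_div_iff₀ (by positivity) two_pos]
    nlinarith
  have e : inner ℝ (w u - ∑ j, shiftL2 a (x j)) (shiftD fc fy (x k) (h k))
      - ∑ j, inner ℝ (shiftD ac ay (x j) (h j)) (shiftL2 f (x k))
      - (-(h k).1 * profInner ac f (cs k) + (h k).2 * profInner ay f (cs k))
      = inner ℝ (w u - ∑ j, shiftL2 a (x j)) (shiftD fc fy (x k) (h k))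
        - (∑ j, inner ℝ (shiftD ac ay (x j) (h j)) (shiftL2 f (x k)) - m) := by
    simp only [m]; ring
  rw [e]
  refine (abs_sub _ _).trans ?_
  linarith

end

section

variable {N : ℕ}

/-! ### Peaks of sums of solitons -/

theorem exists_tail_bound {cs : Fin N → ℝ} (hcs : cs ∈ Adm N) : ∃ C, 0 ≤ C ∧
    ∀ (S : Finset (Fin N)) (a : Fin N → ℝ) (x d : ℝ), 0 ≤ d → (∀ j ∈ S, d ≤ |x - a j|) →
      ∑ j ∈ S, solEta (cs j) (x - a j) ≤ C * wt d := by
  obtain ⟨κ, hκ, δ, hδ, hwin⟩ := exists_window hcs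
  obtain ⟨C, hC, h1⟩ := ud_eta κ hκ
  refine ⟨N * C, by positivity, fun S a x d hd hS => ?_⟩
  have h2 : ∀ j ∈ S, solEta (cs j) (x - a j) ≤ C * wt d := fun j hj => by
    refine (le_abs_self _).trans ((h1 _ (hwin j _ (by simpa using hδ.le)) _).trans ?_)
    have h3 : d ^ 2 ≤ (x - a j) ^ 2 := by
      rw [← sq_abs (x - a j)]; exact pow_le_pow_left₀ hd (hS j hj) 2
    unfold wt
    gcongr
  refine (Finset.sum_le_sum h2).trans ?_
  rw [Finset.sum_const, nsmul_eq_mul, mul_assoc]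
  have : (S.card : ℝ) ≤ N := by exact_mod_cast (Finset.card_le_univ S).trans_eq (Fintype.card_fin N)
  exact mul_le_mul_of_nonneg_right this (mul_nonneg hC (wt_pos d).le)

theorem eventually_mul_wt_le (C : ℝ) {ε : ℝ} (hε : 0 < ε) : ∀ᶠ d in atTop, C * wt d ≤ ε := by
  have := tendsto_wt.const_mul C
  rw [mul_zero] at this
  exact this.eventually (ge_mem_nhds hε)

theorem solEta_zero (c : ℝ) : solEta c 0 = 1 - c ^ 2 / 2 := by
  simp [solEta]; ring

theorem exists_chain_le {cs : Fin N → ℝ} (hcs : cs ∈ Adm N) : ∃ m < 1, ∃ L₀ > 0,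
    ∀ as ∈ Pos N L₀, ∀ x, etaC (chain cs as) x ≤ m := by
  obtain ⟨κ, hκ, δ, hδ, hwin⟩ := exists_window hcs
  have hsp : ∀ k, cs k ∈ speeds κ := fun k => hwin k _ (by simpa using hδ.le)
  obtain ⟨C, hC, hT⟩ := exists_tail_bound hcs
  obtain ⟨d, hd, hd0⟩ := ((eventually_mul_wt_le C (show 0 < min (κ / 4) (1 / 2) by positivity)).and
    (eventually_gt_atTop 0)).exists
  refine ⟨max (1 - κ / 4) (1 / 2), max_lt (by linarith) (by norm_num), 2 * d, by positivity,
    fun as has x => ?_⟩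
  rw [etaC_chain hcs]
  by_cases hx : ∃ k, |x - as k| < d
  · obtain ⟨k, hk⟩ := hx
    rw [← Finset.add_sum_erase _ _ (Finset.mem_univ k)]
    have h1 := hT (Finset.univ.erase k) as x d hd0.le fun j hj => by
      have h2 := Pos.abs_gap (by positivity) has (Finset.ne_of_mem_erase hj)
      have h3 : |as j - as k| ≤ |x - as k| + |x - as j| := by
        have e : as j - as k = (x - as k) - (x - as j) := by ring
        rw [e]; exact abs_sub _ _
      linarith
    have h2 := solEta_le (hcs k) (x - as k)
    have h3 := (hsp k).1
    refine le_trans ?_ (le_max_left _ _)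
    have := hd.trans (min_le_left _ _)
    linarith
  · push Not at hx
    have h1 := hT Finset.univ as x d hd0.le fun j _ => hx j
    exact (h1.trans (hd.trans (min_le_right _ _))).trans (le_max_right _ _)

theorem solEta_lt {c : ℝ} (h : AdmSpeed c) {ρ : ℝ} (hρ : 0 < ρ) : solEta c ρ < solEta c 0 := by
  have hs := sc_pos h
  have := solEta_eq h ρ
  have h0 := solEta_eq h 0
  have hT := solTh_pos h hρ
  have hT0 : solTh c 0 = 0 := by simp [solTh]
  rw [hT0] at h0
  rw [this, h0]
  have : 0 < sc c ^ 2 * solTh c ρ ^ 2 := by positivity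
  nlinarith

theorem solEta_anti {c : ℝ} (h : AdmSpeed c) {y z : ℝ} (hyz : |y| ≤ |z|) :
    solEta c z ≤ solEta c y := by
  have h1 : 0 ≤ 2 - c ^ 2 := by linarith [h.sq_lt]
  have h2 : Real.cosh (√(2 - c ^ 2) * y / 2) ≤ Real.cosh (√(2 - c ^ 2) * z / 2) := by
    rw [Real.cosh_le_cosh, abs_div, abs_div, abs_mul, abs_mul]
    gcongr
  have h3 := Real.cosh_pos (√(2 - c ^ 2) * y / 2)
  unfold solEta
  gcongr

theorem strictMono_eq_id {f : Fin N → Fin N} (hf : StrictMono f) : f = id := by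
  have hsurj : Function.Surjective f := Finite.surjective_of_injective hf.injective
  exact (StrictMono.range_inj hf strictMono_id).1 (by rw [hsurj.range_eq, range_id])

theorem exists_peak_bound {cs : Fin N → ℝ} (hcs : cs ∈ Adm N) {ρ : ℝ} (hρ : 0 < ρ) :
    ∃ ε > 0, ∃ L₀ > 0, ∀ a ∈ Pos N L₀, ∀ b ∈ Pos N L₀, ‖chain cs a - chain cs b‖ ≤ ε →
      ∀ k, |a k - b k| ≤ ρ := by
  obtain ⟨κ, hκ, δ, hδ, hwin⟩ := exists_window hcs
  have hsp : ∀ k, cs k ∈ speeds κ := fun k => hwin k _ (by simpa using hδ.le)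
  obtain ⟨C, hC, hT⟩ := exists_tail_bound hcs
  have hγ : ∀ k, ∀ᶠ γ in 𝓝[>] (0 : ℝ), solEta (cs k) ρ + γ < solEta (cs k) 0 := fun k => by
    filter_upwards [Ioo_mem_nhdsGT (sub_pos.2 (solEta_lt (hcs k) hρ))] with γ h
    linarith [h.2]
  obtain ⟨γ, ⟨hγ, hγκ⟩⟩ := ((eventually_all.2 hγ).and
    (Ioo_mem_nhdsGT (show 0 < κ / 2 by positivity))).exists
  obtain ⟨d, hd, hd0⟩ := ((eventually_mul_wt_le C (show 0 < γ / 2 by linarith [hγκ.1])).and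
    (eventually_gt_atTop 0)).exists
  refine ⟨γ / 4, by linarith [hγκ.1], 2 * d, by positivity, fun a ha b hb hab => ?_⟩
  have hpeak : ∀ k, solEta (cs k) 0 - γ / 2 ≤ ∑ j, solEta (cs j) (a k - b j) := by
    intro k
    have h1 := abs_etaC_sub_le (chain cs a) (chain cs b) (a k)
    rw [etaC_chain hcs, etaC_chain hcs] at h1
    have h2 := (le_abs_self _).trans h1
    have h3 := Finset.single_le_sum (f := fun j => solEta (cs j) (a k - a j))
      (fun j _ => solEta_nonneg (hcs j) _) (Finset.mem_univ k)
    simp only [sub_self] at h3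
    linarith
  have hnear : ∀ k, ∃ j, |a k - b j| < d := by
    intro k
    by_contra hno
    push Not at hno
    have h1 := hT Finset.univ b (a k) d hd0.le fun j _ => hno j
    have h2 := hpeak k
    have h3 := (hsp k).2
    rw [solEta_zero] at h2
    linarith [hγκ.2]
  choose f hf using hnear
  have hmono : StrictMono f := by
    intro k l hkl
    by_contra hle
    have h1 := Pos.gap (by positivity) ha hkl
    have h2 := abs_lt.1 (hf k)
    have h3 := abs_lt.1 (hf l)
    rcases (not_lt.1 hle).lt_or_eq with h | h
    · have h4 := Pos.gap (by positivity) hb h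
      linarith
    · rw [h] at h3; linarith
  intro k
  have hfk : |a k - b k| < d := by
    have := hf k
    rwa [strictMono_eq_id hmono] at this
  by_contra hlt
  have h1 := hpeak k
  rw [← Finset.add_sum_erase _ _ (Finset.mem_univ k)] at h1
  have h2 := hT (Finset.univ.erase k) b (a k) d hd0.le fun j hj => by
    have h3 := Pos.abs_gap (by positivity) hb (Finset.ne_of_mem_erase hj)
    have h4 : |b j - b k| ≤ |a k - b k| + |a k - b j| := by
      have e : b j - b k = (a k - b k) - (a k - b j) := by ring
      rw [e]; exact abs_sub _ _
    linarith
  have h3 : solEta (cs k) (a k - b k) ≤ solEta (cs k) ρ :=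
    solEta_anti (hcs k) (by rw [abs_of_pos hρ]; exact (not_le.1 hlt).le)
  have h4 := hγ k
  linarith

end

section

open Metric

variable {N : ℕ}

/-! ### Existence of modulation maps -/

/-- The left-hand sides of the orthogonality conditions for the state `z.1` and the parameters
`z.2`. -/
def modMap (z : XSpace × (Fin N → ℝ × ℝ)) : Fin N → ℝ × ℝ := fun k =>
  (testRem etaL solEta eY z k + testRem velL solV vY z k,
    testRem velL solV solEta z k + testRem etaL solEta solV z k)

theorem contDiffAt_modMap {z : XSpace × (Fin N → ℝ × ℝ)} (hz : ∀ k, AdmSpeed (z.2 k).1) :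
    ContDiffAt ℝ 1 (modMap (N := N)) z :=
  contDiffAt_pi.2 fun k =>
    ((contDiffAt_testRem etaL profile_eta profile_eY hz k).add
      (contDiffAt_testRem velL profile_v profile_vY hz k)).prodMk
    ((contDiffAt_testRem velL profile_v profile_eta hz k).add
      (contDiffAt_testRem etaL profile_eta profile_v hz k))

/-- The parameters with speeds `c` and positions `a`. -/
def params (c a : Fin N → ℝ) : Fin N → ℝ × ℝ := fun k => (c k, a k)

theorem exists_modMap_near {cs : Fin N → ℝ} (hcs : cs ∈ Adm N) {ε : ℝ} (hε : 0 < ε) :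
    ∃ δ > 0, ∃ L₀ > 0, ∀ as ∈ Pos N L₀, ∀ u : XSpace, ‖u - chain cs as‖ ≤ δ →
      ∀ x ∈ closedBall (params cs as) δ, ∃ D : (Fin N → ℝ × ℝ) →L[ℝ] Fin N → ℝ × ℝ,
        HasFDerivAt (fun x => modMap (u, x)) D x ∧ ‖D - modMatrix cs‖ ≤ ε := by
  have hε2 : 0 < ε / 2 := by positivity
  obtain ⟨δ₁, hδ₁, L₁, hL₁, h1⟩ := exists_testRem_bound profile_eta profile_eY reads_eta hcs hε2
  obtain ⟨δ₂, hδ₂, L₂, hL₂, h2⟩ := exists_testRem_bound profile_v profile_vY reads_vel hcs hε2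
  obtain ⟨δ₃, hδ₃, L₃, hL₃, h3⟩ := exists_testRem_bound profile_v profile_eta reads_vel hcs hε2
  obtain ⟨δ₄, hδ₄, L₄, hL₄, h4⟩ := exists_testRem_bound profile_eta profile_v reads_eta hcs hε2
  obtain ⟨δ, hδ, d1, d2, d3, d4⟩ : ∃ δ > 0, δ ≤ δ₁ ∧ δ ≤ δ₂ ∧ δ ≤ δ₃ ∧ δ ≤ δ₄ :=
    ⟨min (min δ₁ δ₂) (min δ₃ δ₄), by positivity, by simp⟩
  obtain ⟨L, l1, l2, l3, l4⟩ : ∃ L, L₁ ≤ L ∧ L₂ ≤ L ∧ L₃ ≤ L ∧ L₄ ≤ L :=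
    ⟨max (max L₁ L₂) (max L₃ L₄), by simp⟩
  refine ⟨δ, hδ, L, hL₁.trans_le l1, fun as has u hu x hx => ?_⟩
  choose D₁ hD₁ hb₁ using h1 as (Pos.mono l1 has) u (hu.trans d1) x (closedBall_subset_closedBall d1 hx)
  choose D₂ hD₂ hb₂ using h2 as (Pos.mono l2 has) u (hu.trans d2) x (closedBall_subset_closedBall d2 hx)
  choose D₃ hD₃ hb₃ using h3 as (Pos.mono l3 has) u (hu.trans d3) x (closedBall_subset_closedBall d3 hx)
  choose D₄ hD₄ hb₄ using h4 as (Pos.mono l4 has) u (hu.trans d4) x (closedBall_subset_closedBall d4 hx)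
  refine ⟨ContinuousLinearMap.pi fun k => (D₁ k + D₂ k).prod (D₃ k + D₄ k),
    hasFDerivAt_pi.2 fun k => ((hD₁ k).add (hD₂ k)).prodMk ((hD₃ k).add (hD₄ k)), ?_⟩
  refine ContinuousLinearMap.opNorm_le_bound _ hε.le fun h => ?_
  refine (pi_norm_le_iff_of_nonneg (by positivity)).2 fun k => ?_
  have e1 := deriv_momentum (hcs k)
  have e2 := deriv_momentum_translation (hcs k)
  have b1 := hb₁ k h
  have b2 := hb₂ k h
  have b3 := hb₃ k h
  have b4 := hb₄ k h
  rw [profInner_comm vC, profInner_comm vY] at b3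
  refine norm_prod_le_iff.2 ⟨?_, ?_⟩
  · have e : ((ContinuousLinearMap.pi (fun k => (D₁ k + D₂ k).prod (D₃ k + D₄ k)) - modMatrix cs) h k).1
        = (D₁ k h - (-(h k).1 * profInner eC eY (cs k) + (h k).2 * profInner eY eY (cs k)))
        + (D₂ k h - (-(h k).1 * profInner vC vY (cs k) + (h k).2 * profInner vY vY (cs k))) := by
      simp [modMatrix, modBlock]; ring
    rw [e, Real.norm_eq_abs]
    exact (abs_add_le _ _).trans (by linarith)
  · have e : ((ContinuousLinearMap.pi (fun k => (D₁ k + D₂ k).prod (D₃ k + D₄ k)) - modMatrix cs) h k).2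
        = (D₃ k h - (-(h k).1 * profInner solEta vC (cs k) + (h k).2 * profInner solEta vY (cs k)))
        + (D₄ k h - (-(h k).1 * profInner eC solV (cs k) + (h k).2 * profInner eY solV (cs k))) := by
      simp [modMatrix, modBlock]
      linear_combination (h k).2 * e2 - (h k).1 * e1
    rw [e, Real.norm_eq_abs]
    exact (abs_add_le _ _).trans (by linarith)

theorem exists_modMap_le {cs : Fin N → ℝ} (hcs : cs ∈ Adm N) : ∃ C > 0, ∀ (as : Fin N → ℝ)
    (u : XSpace), ‖modMap (u, params cs as)‖ ≤ C * ‖u - chain cs as‖ := by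
  obtain ⟨κ, hκ, δ, hδ, hwin⟩ := exists_window hcs
  have hsp : ∀ k, cs k ∈ speeds κ := fun k => hwin k _ (by simpa using hδ.le)
  have key : ∀ {w : XSpace →L[ℝ] L2} {a f : ℝ → ℝ → ℝ}, Reads w a → Decay f → ∃ C, 0 ≤ C ∧
      ∀ (as : Fin N → ℝ) (u : XSpace) (k : Fin N),
        |testRem w a f (u, params cs as) k| ≤ C * ‖u - chain cs as‖ := by
    intro w a f hw hf
    obtain ⟨C, hC, h1⟩ := norm_shiftL2_le hf hκ
    refine ⟨C, hC, fun as u k => ?_⟩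
    have e : w u - ∑ j, shiftL2 a (params cs as j) = w (u - chain cs as) := by
      rw [map_sub, ← hw.chain (x := params cs as) hcs]; rfl
    rw [testRem, e]
    refine (abs_real_inner_le_norm _ _).trans ?_
    rw [mul_comm C]
    exact mul_le_mul (hw.norm_le _) (h1 _ (hsp k)) (norm_nonneg _) (norm_nonneg _)
  obtain ⟨C₁, hC₁, h1⟩ := key reads_eta profile_eY.decay
  obtain ⟨C₂, hC₂, h2⟩ := key reads_vel profile_vY.decay
  obtain ⟨C₃, hC₃, h3⟩ := key reads_vel profile_eta.decay
  obtain ⟨C₄, hC₄, h4⟩ := key reads_eta profile_v.decay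
  refine ⟨C₁ + C₂ + C₃ + C₄ + 1, by positivity, fun as u => ?_⟩
  have hn := norm_nonneg (u - chain cs as)
  refine (pi_norm_le_iff_of_nonneg (by positivity)).2 fun k => norm_prod_le_iff.2 ⟨?_, ?_⟩
  · refine (abs_add_le _ _).trans ?_
    have := h1 as u k
    have := h2 as u k
    nlinarith
  · refine (abs_add_le _ _).trans ?_
    have := h3 as u k
    have := h4 as u k
    nlinarith

theorem modMap_eq_zero_iff {u : XSpace} {c a : Fin N → ℝ} (hc : c ∈ Adm N) :
    modMap (u, params c a) = 0 ↔ ∀ k, orthX (u - chain c a) (c k) (a k) = 0 ∧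
      dMomentum (u - chain c a) (c k) (a k) = 0 := by
  have key : ∀ {w : XSpace →L[ℝ] L2} {b f : ℝ → ℝ → ℝ}, Reads w b → Decay f → ∀ k,
      testRem w b f (u, params c a) k = ∫ x, w (u - chain c a) x * f (c k) (x - a k) := by
    intro w b f hw hf k
    have e : w u - ∑ j, shiftL2 b (params c a j) = w (u - chain c a) := by
      rw [map_sub, ← hw.chain (x := params c a) hc]; rfl
    rw [testRem, e, inner_L2]
    refine integral_congr_ae ?_
    filter_upwards [hf.shiftL2_ae (p := (c k, a k)) (hc k)] with x hx
    simp only [params, hx]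
  have hint : ∀ (w : L2) {f : ℝ → ℝ → ℝ}, Decay f → ∀ k,
      Integrable (fun x => w x * f (c k) (x - a k)) := fun w _ hf k =>
    integrable_mul_L2 (Lp.memLp w) (hf.memLp (hc k) _)
  rw [funext_iff]
  refine forall_congr' fun k => ?_
  rw [Prod.ext_iff]
  refine and_congr ?_ ?_
  · simp only [modMap, orthX, Pi.zero_apply, Prod.fst_zero]
    rw [key reads_eta profile_eY.decay, key reads_vel profile_vY.decay,
      ← integral_add (hint _ profile_eY.decay k) (hint _ profile_vY.decay k), deriv_solEta_eq (hc k),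
      deriv_solV_eq (hc k), coe_etaL, coe_velL]
  · simp only [modMap, dMomentum, Pi.zero_apply, Prod.snd_zero]
    rw [key reads_eta profile_v.decay, key reads_vel profile_eta.decay,
      ← integral_add (hint _ profile_eta.decay k) (hint _ profile_v.decay k), coe_etaL, coe_velL]
    simp only [mul_comm (solEta _ _), mul_comm (solV _ _)]
    rw [mul_eq_zero, or_iff_right (by norm_num)]

theorem exists_local_modulation {cs : Fin N → ℝ} (hcs : cs ∈ Adm N) : ∃ r > 0, ∃ L₀ > 0, ∃ α₀ > 0,
    ∃ K > 0, K * α₀ ≤ r / 2 ∧ (∀ k b, |b - cs k| ≤ r → AdmSpeed b) ∧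
    ∀ as ∈ Pos N L₀, ∀ u : XSpace, ‖u - chain cs as‖ ≤ α₀ →
      InjOn (fun x => modMap (u, x)) (closedBall (params cs as) r) ∧
      (∃ x ∈ closedBall (params cs as) (K * ‖u - chain cs as‖), modMap (u, x) = 0) ∧
      ∀ x ∈ closedBall (params cs as) r, ∃ D : (Fin N → ℝ × ℝ) →L[ℝ] Fin N → ℝ × ℝ,
        HasFDerivAt (fun x => modMap (u, x)) D x ∧ D.IsInvertible := by
  obtain ⟨M, hM⟩ := modMatrix_isInvertible hcs
  obtain ⟨C, hC, hle⟩ := exists_modMap_le hcs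
  set K₀ : ℝ := ‖(M.symm : (Fin N → ℝ × ℝ) →L[ℝ] Fin N → ℝ × ℝ)‖ + 1
  have hK₀ : 0 < K₀ := by positivity
  have hMK : ‖(M.symm : (Fin N → ℝ × ℝ) →L[ℝ] Fin N → ℝ × ℝ)‖ ≤ K₀ := by simp [K₀]
  obtain ⟨κ, hκ, δ₁, hδ₁, hwin⟩ := exists_window hcs
  obtain ⟨δ, hδ, L₀, hL₀, hD⟩ := exists_modMap_near hcs (show 0 < (2 * K₀)⁻¹ by positivity)
  set r := min δ δ₁
  have hr : 0 < r := lt_min hδ hδ₁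
  set K := 2 * K₀ * C
  have hK : 0 < K := by positivity
  refine ⟨r, hr, L₀, hL₀, min δ (r / (2 * K)), lt_min hδ (by positivity), K, hK, ?_,
    fun k b hb => admSpeed_of_mem hκ (hwin k b (hb.trans (min_le_right _ _))),
    fun as has u hu => ?_⟩
  · calc K * min δ (r / (2 * K)) ≤ K * (r / (2 * K)) :=
        mul_le_mul_of_nonneg_left (min_le_right _ _) hK.le
      _ = r / 2 := by field_simp
  · have hD' : ∀ x ∈ closedBall (params cs as) r,
        ∃ D : (Fin N → ℝ × ℝ) →L[ℝ] Fin N → ℝ × ℝ,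
        HasFDerivAt (fun x => modMap (u, x)) D x ∧ ‖D - M‖ ≤ (2 * K₀)⁻¹ := fun x hx => by
      rw [hM]
      exact hD as has u (hu.trans (min_le_left _ _)) x
        (closedBall_subset_closedBall (min_le_left _ _) hx)
    have hle' := hle as u
    have hKle : 2 * K₀ * ‖modMap (u, params cs as)‖ ≤ K * ‖u - chain cs as‖ := by
      calc _ ≤ 2 * K₀ * (C * ‖u - chain cs as‖) := by gcongr
        _ = _ := by simp only [K]; ring
    have hKr : K * ‖u - chain cs as‖ ≤ r := by
      calc _ ≤ K * (r / (2 * K)) := by gcongr; exact hu.trans (min_le_right _ _)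
        _ = r / 2 := by field_simp
        _ ≤ r := by linarith
    choose! D hD1 hD2 using hD'
    obtain ⟨hinj, x, hx, hx0⟩ := exists_zero_of_near_equiv M hK₀ hMK hD1 hD2 (hKle.trans hKr)
    exact ⟨hinj, ⟨x, closedBall_subset_closedBall hKle hx, hx0⟩,
      fun x hx => ⟨D x, hD1 x hx, isInvertible_of_near M hK₀ hMK (hD2 x hx)⟩⟩

end

section

open Metric

variable {N : ℕ}

theorem nbhd_mono (cs : Fin N → ℝ) {α α' L L' : ℝ} (hα : α ≤ α') (hL : L' ≤ L) :
    nbhd cs α L ⊆ nbhd cs α' L' := fun _ ⟨a, ha, h⟩ => ⟨a, Pos.mono hL ha, h.trans_le hα⟩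

/-- Near a family of sums of solitons, `η` is bounded by a constant less than one. -/
theorem exists_nbhd_le {cs : Fin N → ℝ} (hcs : cs ∈ Adm N) : ∃ m < 1, ∃ α₀ > 0, ∃ L₀ > 0,
    ∀ u ∈ nbhd cs α₀ L₀, ∀ x, etaC u x ≤ m := by
  obtain ⟨m, hm, L₀, hL₀, h⟩ := exists_chain_le hcs
  refine ⟨(1 + m) / 2, by linarith, (1 - m) / 4, by linarith, L₀, hL₀, ?_⟩
  rintro u ⟨a, ha, hu⟩ x
  have h1 := (le_abs_self _).trans (abs_etaC_sub_le u (chain cs a) x)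
  have h2 := h a ha x
  linarith

theorem chain_lipschitz {cs : Fin N → ℝ} (hcs : cs ∈ Adm N) : ∃ δ > 0, ∃ C, 0 ≤ C ∧
    ∀ (as c a : Fin N → ℝ) (r : ℝ), r ≤ δ → params c a ∈ closedBall (params cs as) r →
      ‖chain cs as - chain c a‖ ≤ C * r := by
  obtain ⟨κ, hκ, δ, hδ, hwin⟩ := exists_window hcs
  obtain ⟨C, hC, h1⟩ := lipschitz_soliton hκ
  refine ⟨δ, hδ, N * C, by positivity, fun as c a r hr hx => ?_⟩
  have hr0 : 0 ≤ r := dist_nonneg.trans (mem_closedBall.1 hx)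
  rw [chain, chain, ← Finset.sum_sub_distrib]
  have hterm : ∀ k ∈ Finset.univ, ‖soliton (cs k) (as k) - soliton (c k) (a k)‖ ≤ C * r := by
    intro k _
    have hk : ‖(c k, a k) - (cs k, as k)‖ ≤ r := by
      have := (dist_pi_le_iff hr0).1 (mem_closedBall.1 hx) k
      rwa [dist_eq_norm] at this
    have hfst : |c k - cs k| ≤ r := (norm_fst_le ((c k, a k) - (cs k, as k))).trans hk
    refine (h1 (closedBall (cs k) δ) (convex_closedBall _ _) (fun b hb => hwin k b hb)
      (cs k, as k) (c k, a k) (mem_closedBall_self hδ.le)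
      (mem_closedBall.2 (hfst.trans hr))).trans ?_
    rw [norm_sub_rev]
    exact mul_le_mul_of_nonneg_left hk hC
  refine (norm_sum_le_of_le _ hterm).trans ?_
  simp [mul_assoc]

theorem exists_isModulation {cs : Fin N → ℝ} (hcs : cs ∈ Adm N) : ∃ α₁ L₁ K₁ : ℝ, 0 < α₁ ∧ 0 < L₁ ∧
    0 < K₁ ∧ nbhd cs α₁ L₁ ⊆ NV ∧ ∃ C A : XSpace → Fin N → ℝ, IsModulation cs α₁ L₁ K₁ C A := by
  obtain ⟨r, hr, Lr, hLr, αr, hαr, K, hK, hKα, hadm, hloc⟩ := exists_local_modulation hcs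
  obtain ⟨m, hm, αm, hαm, Lm, hLm, hle⟩ := exists_nbhd_le hcs
  obtain ⟨εp, hεp, Lp, hLp, hpeak⟩ := exists_peak_bound hcs (show 0 < r / 2 by positivity)
  obtain ⟨δc, hδc, B, hB, hlip⟩ := chain_lipschitz hcs
  obtain ⟨α₁, hα₁, ha1, ha2, ha3, ha4⟩ : ∃ α₁ > 0, α₁ ≤ αr ∧ α₁ ≤ αm ∧ α₁ ≤ εp / 2 ∧ α₁ ≤ δc / K :=
    ⟨min (min αr αm) (min (εp / 2) (δc / K)), by positivity, by simp⟩
  obtain ⟨L₁, hl1, hl2, hl3⟩ : ∃ L₁, Lr ≤ L₁ ∧ Lm ≤ L₁ ∧ Lp ≤ L₁ := ⟨max Lr (max Lm Lp), by simp⟩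
  have hKα₁ : K * α₁ ≤ r / 2 := (mul_le_mul_of_nonneg_left ha1 hK.le).trans hKα
  classical
  have hex : ∀ u : XSpace, ∃ x : Fin N → ℝ × ℝ, u ∈ nbhd cs α₁ L₁ →
      ∃ b ∈ Pos N L₁, ‖u - chain cs b‖ < α₁ ∧ x ∈ closedBall (params cs b) (r / 2) ∧
        modMap (u, x) = 0 := by
    intro u
    by_cases hu : u ∈ nbhd cs α₁ L₁
    · obtain ⟨b, hb, hub⟩ := hu
      obtain ⟨-, ⟨x, hx, hx0⟩, -⟩ := hloc b (Pos.mono hl1 hb) u (hub.le.trans ha1)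
      refine ⟨x, fun _ => ⟨b, hb, hub, closedBall_subset_closedBall ?_ hx, hx0⟩⟩
      exact (mul_le_mul_of_nonneg_left hub.le hK.le).trans hKα₁
    · exact ⟨0, fun h => absurd h hu⟩
  choose X hX using hex
  have hclose : ∀ u ∈ nbhd cs α₁ L₁, ∀ as ∈ Pos N L₁, ‖u - chain cs as‖ ≤ α₁ →
      X u ∈ closedBall (params cs as) (K * ‖u - chain cs as‖) := by
    intro u hu as has hua
    obtain ⟨b, hb, hub, hXb, hX0⟩ := hX u hu
    obtain ⟨hinj, ⟨x, hx, hx0⟩, -⟩ := hloc as (Pos.mono hl1 has) u (hua.trans ha1)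
    have hKr : K * ‖u - chain cs as‖ ≤ r / 2 := (mul_le_mul_of_nonneg_left hua hK.le).trans hKα₁
    have hba : ∀ k, |b k - as k| ≤ r / 2 := by
      refine hpeak b (Pos.mono hl3 hb) as (Pos.mono hl3 has) ?_
      have e : chain cs b - chain cs as = (u - chain cs as) - (u - chain cs b) := by abel
      rw [e]
      exact (norm_sub_le _ _).trans (by linarith)
    have hdist : dist (params cs b) (params cs as) ≤ r / 2 := by
      refine (dist_pi_le_iff (by positivity)).2 fun k => ?_
      rw [Prod.dist_eq]
      refine max_le ?_ ?_
      · simp only [params, dist_self]; positivity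
      · exact hba k
    have hmem : X u ∈ closedBall (params cs as) r := by
      rw [mem_closedBall] at hXb ⊢
      have := dist_triangle (X u) (params cs b) (params cs as)
      linarith
    have : X u = x := hinj hmem (closedBall_subset_closedBall (by linarith) hx)
      (hX0.trans hx0.symm)
    rw [this]; exact hx
  have hzero : ∀ u ∈ nbhd cs α₁ L₁, modMap (u, X u) = 0 := fun u hu => by
    obtain ⟨b, -, -, -, h⟩ := hX u hu
    exact h
  have hadmX : ∀ u ∈ nbhd cs α₁ L₁, ∀ k, AdmSpeed (X u k).1 := by
    intro u hu k
    obtain ⟨b, -, -, hXb, -⟩ := hX u hu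
    have hk := (dist_pi_le_iff (by positivity)).1 (mem_closedBall.1 hXb) k
    refine hadm k _ ?_
    have : dist (X u k).1 (cs k) ≤ r / 2 := (le_max_left _ _).trans hk
    rw [Real.dist_eq] at this
    linarith
  have hsmooth : ContDiffOn ℝ 1 X (nbhd cs α₁ L₁) := by
    intro u hu
    obtain ⟨b, hb, hub⟩ := hu
    have hu' : u ∈ nbhd cs α₁ L₁ := ⟨b, hb, hub⟩
    have hXb := hclose u hu' b hb hub.le
    have hXr : dist (X u) (params cs b) < r := by
      have := (mul_le_mul_of_nonneg_left hub.le hK.le).trans hKα₁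
      have := mem_closedBall.1 hXb
      linarith
    obtain ⟨-, -, hder⟩ := hloc b (Pos.mono hl1 hb) u (hub.le.trans ha1)
    obtain ⟨D, hD, hDinv⟩ := hder (X u) hXr.le
    have hC := contDiffAt_modMap (z := (u, X u)) (hadmX u hu')
    have hcomp : HasFDerivAt (fun x => modMap (u, x))
        ((fderiv ℝ (modMap (N := N)) (u, X u)).comp (.inr ℝ XSpace (Fin N → ℝ × ℝ))) (X u) := by
      have h1 : HasFDerivAt (fun x : Fin N → ℝ × ℝ => (u, x)) (.inr ℝ XSpace (Fin N → ℝ × ℝ)) (X u) :=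
        hasFDerivAt_prodMk_right u (X u)
      exact (hC.differentiableAt one_ne_zero).hasFDerivAt.comp (X u) h1
    have hinv : ((fderiv ℝ (modMap (N := N)) (u, X u)).comp
        (.inr ℝ XSpace (Fin N → ℝ × ℝ))).IsInvertible := by rwa [← hD.unique hcomp]
    have : CompleteSpace H1 := isClosed_H1.completeSpace_coe
    have hψ := hC.contDiffAt_implicitFunction one_ne_zero hinv
    have hψ0 := hC.implicitFunction_apply_self one_ne_zero hinv
    have hψz := hC.eventually_apply_implicitFunction one_ne_zero hinv
    set ψ := hC.implicitFunction one_ne_zero hinv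
    refine ContDiffAt.contDiffWithinAt (hψ.congr_of_eventuallyEq ?_)
    have hcont : ∀ᶠ w in 𝓝 u, ψ w ∈ closedBall (params cs b) r := by
      refine hψ.continuousAt.eventually_mem ?_
      change closedBall (params cs b) r ∈ 𝓝 (ψ u)
      rw [show ψ u = X u from hψ0]
      exact Filter.mem_of_superset (isOpen_ball.mem_nhds hXr) ball_subset_closedBall
    have hnear : ∀ᶠ w in 𝓝 u, ‖w - chain cs b‖ < α₁ := by
      have : ContinuousAt (fun w => ‖w - chain cs b‖) u := by fun_prop
      exact this.eventually_lt continuousAt_const hub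
    filter_upwards [hcont, hnear, hψz] with w h1 h2 h3
    have hw : w ∈ nbhd cs α₁ L₁ := ⟨b, hb, h2⟩
    obtain ⟨hinj, -, -⟩ := hloc b (Pos.mono hl1 hb) w (h2.le.trans ha1)
    refine hinj (closedBall_subset_closedBall ?_ (hclose w hw b hb h2.le)) h1 ?_
    · have := (mul_le_mul_of_nonneg_left h2.le hK.le).trans hKα₁
      linarith
    · change modMap (w, X w) = modMap (w, ψ w)
      rw [hzero w hw, h3]
      exact (hzero u hu').symm
  have hcomp : ∀ k, ContDiffOn ℝ 1 (fun u => X u k) (nbhd cs α₁ L₁) := contDiffOn_pi.1 hsmooth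
  refine ⟨α₁, L₁, 1 + B * K + 2 * N * K, hα₁, hLr.trans_le hl1, by positivity, ?_,
    fun u k => (X u k).1, fun u k => (X u k).2, ?_⟩
  · intro u hu
    exact (mem_NV_iff u).2 ⟨m, hm, hle u (nbhd_mono cs ha2 hl2 hu)⟩
  · refine ⟨contDiffOn_pi.2 fun k => (hcomp k).fst, contDiffOn_pi.2 fun k => (hcomp k).snd, hadmX, ?_, ?_⟩
    · intro u hu
      exact (modMap_eq_zero_iff (hadmX u hu)).1 (hzero u hu)
    · intro u hu α L hα hL as has hua
      have h1 := hclose u hu as (Pos.mono hL has) (hua.trans hα)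
      have hα0 : 0 ≤ α := (norm_nonneg _).trans hua
      have h2 : X u ∈ closedBall (params cs as) (K * α) :=
        closedBall_subset_closedBall (mul_le_mul_of_nonneg_left hua hK.le) h1
      have hKδ : K * α ≤ δc := by
        calc K * α ≤ K * (δc / K) := mul_le_mul_of_nonneg_left (hα.trans ha4) hK.le
          _ = δc := by field_simp
      have h3 := hlip as (fun k => (X u k).1) (fun k => (X u k).2) (K * α) hKδ h2
      have h4 : ‖u - chain (fun k => (X u k).1) fun k => (X u k).2‖ ≤ α + B * (K * α) := by
        have e : u - chain (fun k => (X u k).1) (fun k => (X u k).2) = (u - chain cs as)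
          + (chain cs as - chain (fun k => (X u k).1) fun k => (X u k).2) := by abel
        rw [e]
        exact (norm_add_le _ _).trans (add_le_add hua h3)
      have h5 : ∀ k, dist (X u k) (params cs as k) ≤ K * α :=
        (dist_pi_le_iff (by positivity)).1 (mem_closedBall.1 h2)
      have h6 : ∑ k, |(X u k).1 - cs k| ≤ N * (K * α) := by
        refine (Finset.sum_le_sum fun k _ => (le_max_left _ _).trans (h5 k)).trans ?_
        simp
      have h7 : ∑ k, |(X u k).2 - as k| ≤ N * (K * α) := by
        refine (Finset.sum_le_sum fun k _ => (le_max_right _ _).trans (h5 k)).trans ?_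
        simp
      linarith

end

section

/-! ### Testing the equations with functions that are not compactly supported -/

theorem TL2.comp_tendsto {ι κ : Type*} {l : Filter ι} {k : Filter κ} {f : ι → ℝ → ℝ} {g : ℝ → ℝ}
    (h : TL2 l f g) {φ : κ → ι} (hφ : Tendsto φ k l) : TL2 k (fun i => f (φ i)) g :=
  ⟨hφ.eventually h.1, h.2, h.tendsto.comp hφ⟩

theorem exists_test_eq_one : ∃ χ : ℝ → ℝ, IsTest χ ∧ χ 0 = 1 := by
  let b : ContDiffBump (0 : ℝ) := ⟨1, 2, one_pos, one_lt_two⟩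
  exact ⟨b, ⟨b.contDiff, b.hasCompactSupport⟩, b.one_of_mem_closedBall (Metric.mem_closedBall_self b.rIn_pos.le)⟩

theorem exists_test_approx {ψ : ℝ → ℝ} (hψ : ContDiff ℝ ∞ ψ) (h0 : MemLp ψ 2)
    (h1 : MemLp (deriv ψ) 2) (h2 : MemLp (deriv (deriv ψ)) 2) :
    ∃ φ : ℝ → ℝ → ℝ, (∀ h > 0, IsTest (φ h)) ∧ TL2 (𝓝[>] 0) φ ψ ∧
      TL2 (𝓝[>] 0) (fun h => deriv (φ h)) (deriv ψ) ∧
      TL2 (𝓝[>] 0) (fun h => deriv (deriv (φ h))) (deriv (deriv ψ)) := by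
  obtain ⟨χ, hχ, hχ0⟩ := exists_test_eq_one
  have hψ1 := (contDiff_infty_iff_deriv (𝕜 := ℝ)).1 hψ
  have hψ2 := (contDiff_infty_iff_deriv (𝕜 := ℝ)).1 hψ1.2
  have b0 := hχ.sob.abs_le
  have b1 := hχ.deriv.sob.abs_le
  have b2 := hχ.deriv.deriv.sob.abs_le
  set B := max (N2 χ + N2 (deriv χ)) (max (N2 (deriv χ) + N2 (deriv (deriv χ)))
    (N2 (deriv (deriv χ)) + N2 (deriv (deriv (deriv χ)))))
  have c0 : ∀ x, |χ x| ≤ B := fun x => (b0 x).trans (le_max_left _ _)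
  have c1 : ∀ x, |deriv χ x| ≤ B := fun x => (b1 x).trans ((le_max_left _ _).trans (le_max_right _ _))
  have c2 : ∀ x, |deriv (deriv χ) x| ≤ B := fun x =>
    (b2 x).trans ((le_max_right _ _).trans (le_max_right _ _))
  have hB : 0 ≤ B := (abs_nonneg _).trans (c0 0)
  have hscale : ∀ (g : ℝ → ℝ), IsTest g → ∀ h x, HasDerivAt (fun x => g (h * x)) (h * deriv g (h * x)) x := by
    intro g hg h x
    have := (hg.hasDerivAt (h * x)).scomp x ((hasDerivAt_id x).const_mul h)
    simpa [Function.comp_def] using this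
  have d1 : ∀ h, deriv (fun x => ψ x * χ (h * x))
      = fun x => deriv ψ x * χ (h * x) + h * (ψ x * deriv χ (h * x)) := fun h => by
    funext x
    refine ((hψ1.1 x).hasDerivAt.mul (hscale χ hχ h x)).deriv.trans ?_
    ring
  have d2 : ∀ h, deriv (deriv fun x => ψ x * χ (h * x))
      = fun x => deriv (deriv ψ) x * χ (h * x) + 2 * h * (deriv ψ x * deriv χ (h * x))
        + h ^ 2 * (ψ x * deriv (deriv χ) (h * x)) := fun h => by
    rw [d1]
    funext x
    refine (((hψ2.1 x).hasDerivAt.mul (hscale χ hχ h x)).add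
      (((hψ1.1 x).hasDerivAt.mul (hscale _ hχ.deriv h x)).const_mul h)).deriv.trans ?_
    ring
  have hlim : ∀ g : ℝ → ℝ, Continuous g → ∀ x, Tendsto (fun h : ℝ => g (h * x)) (𝓝[>] 0) (𝓝 (g 0)) := by
    intro g hg x
    have : Tendsto (fun h : ℝ => g (h * x)) (𝓝 0) (𝓝 (g (0 * x))) :=
      (hg.comp (continuous_id.mul continuous_const)).tendsto 0
    rw [zero_mul] at this
    exact this.mono_left nhdsWithin_le_nhds
  have hh : Tendsto (fun h : ℝ => h) (𝓝[>] 0) (𝓝 0) := tendsto_id.mono_left nhdsWithin_le_nhds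
  have cχ := hχ.1.continuous
  have cχ1 := hχ.deriv.1.continuous
  have cχ2 := hχ.deriv.deriv.1.continuous
  have cψ := hψ.continuous
  have cψ1 := hψ1.2.continuous
  have cψ2 := hψ2.2.continuous
  have hpos : ∀ᶠ h in 𝓝[>] (0 : ℝ), h ∈ Ioo 0 1 := Ioo_mem_nhdsGT one_pos
  refine ⟨fun h x => ψ x * χ (h * x), fun h hpos => ⟨hψ.mul (hχ.1.comp (contDiff_const.mul contDiff_id)),
    ?_⟩, ?_, ?_, ?_⟩
  · have : HasCompactSupport fun x => χ (h * x) :=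
      hχ.2.comp_homeomorph (Homeomorph.mulLeft₀ h hpos.ne')
    exact this.mul_left
  · refine TL2.of_dominated (W := fun x => B * |ψ x|) (.of_forall fun h =>
      Continuous.aestronglyMeasurable (by fun_prop)) cψ.aestronglyMeasurable (h0.abs.const_mul B)
      (.of_forall fun h x => ?_) fun x => ?_
    · rw [abs_mul, mul_comm]; gcongr; exact c0 _
    · simpa [hχ0] using (hlim χ cχ x).const_mul (ψ x)
  · simp only [d1]
    refine TL2.of_dominated (W := fun x => B * |deriv ψ x| + B * |ψ x|) (.of_forall fun h =>
      Continuous.aestronglyMeasurable (by fun_prop)) cψ1.aestronglyMeasurable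
      (memLp_fadd (h1.abs.const_mul B) (h0.abs.const_mul B)) ?_ fun x => ?_
    · filter_upwards [hpos] with h hp x
      refine (abs_add_le _ _).trans (add_le_add ?_ ?_)
      · rw [abs_mul, mul_comm]; gcongr; exact c0 _
      · rw [abs_mul, abs_of_pos hp.1, abs_mul]
        calc h * (|ψ x| * |deriv χ (h * x)|) ≤ 1 * (|ψ x| * B) := by
              gcongr
              · exact hp.2.le
              · exact c1 _
          _ = _ := by ring
    · simpa [hχ0] using ((hlim χ cχ x).const_mul (deriv ψ x)).add
        (hh.mul ((hlim _ cχ1 x).const_mul (ψ x)))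
  · simp only [d2]
    refine TL2.of_dominated (W := fun x => B * |deriv (deriv ψ) x| + 2 * B * |deriv ψ x| + B * |ψ x|)
      (.of_forall fun h => Continuous.aestronglyMeasurable (by fun_prop))
      cψ2.aestronglyMeasurable (memLp_fadd (memLp_fadd (h2.abs.const_mul B) (h1.abs.const_mul (2 * B)))
        (h0.abs.const_mul B)) ?_ fun x => ?_
    · filter_upwards [hpos] with h hp x
      refine (abs_add_le _ _).trans (add_le_add ((abs_add_le _ _).trans (add_le_add ?_ ?_)) ?_)
      · rw [abs_mul, mul_comm]; gcongr; exact c0 _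
      · rw [abs_mul, abs_of_pos (by linarith [hp.1] : 0 < 2 * h), abs_mul]
        calc 2 * h * (|deriv ψ x| * |deriv χ (h * x)|) ≤ 2 * 1 * (|deriv ψ x| * B) := by
              gcongr
              · exact hp.2.le
              · exact c1 _
          _ = _ := by ring
      · have : h ^ 2 ≤ 1 := pow_le_one₀ hp.1.le hp.2.le
        rw [abs_mul, abs_of_nonneg (sq_nonneg h), abs_mul]
        calc h ^ 2 * (|ψ x| * |deriv (deriv χ) (h * x)|) ≤ 1 * (|ψ x| * B) := by
              gcongr
              exact c2 _
          _ = _ := by ring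
    · simpa [hχ0] using (((hlim χ cχ x).const_mul (deriv (deriv ψ) x)).add
        ((hh.const_mul 2).mul ((hlim _ cχ1 x).const_mul (deriv ψ x)))).add
        ((hh.pow 2).mul ((hlim _ cχ2 x).const_mul (ψ x)))

section
variable {T : ℝ} {u : ℝ → XSpace} (hu : IsHGPSolution T u)
include hu

theorem IsHGPSolution.hasDerivWithinAt_vel_of_memLp {ψ : ℝ → ℝ} (hψ : ContDiff ℝ ∞ ψ)
    (h0 : MemLp ψ 2) (h1 : MemLp (deriv ψ) 2) (h2 : MemLp (deriv (deriv ψ)) 2)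
    {t : ℝ} (ht : t ∈ Icc 0 T) : HasDerivWithinAt (fun s => ∫ x, vel (u s) x * ψ x)
      (-(∫ x, etaC (u t) x * deriv ψ x) - (∫ x, quadFlux (u t) x * deriv ψ x)
        - ∫ x, slope (u t) x * deriv (deriv ψ) x) (Icc 0 T) t := by
  obtain ⟨φ, hφ, t0, t1, t2⟩ := exists_test_approx hψ h0 h1 h2
  have hψ1 := (contDiff_infty_iff_deriv (𝕜 := ℝ)).1 hψ
  have hψ2 := (contDiff_infty_iff_deriv (𝕜 := ℝ)).1 hψ1.2
  have hsob : Sob (deriv ψ) (deriv (deriv ψ)) :=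
    Sob.of_hasDerivAt (fun x => (hψ2.1 x).hasDerivAt) h1 h2
  have hfst : Tendsto (Prod.fst : ℝ × ℝ → ℝ) (𝓝[>] 0 ×ˢ 𝓝[Icc 0 T] t) (𝓝[>] 0) := tendsto_fst
  have hsnd : Tendsto (fun i : ℝ × ℝ => u i.2) (𝓝[>] 0 ×ˢ 𝓝[Icc 0 T] t) (𝓝 (u t)) :=
    (hu.tendsto ht).comp tendsto_snd
  have hpos : ∀ᶠ i : ℝ × ℝ in 𝓝[>] 0 ×ˢ 𝓝[Icc 0 T] t, 0 < i.1 :=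
    hfst.eventually self_mem_nhdsWithin
  have hin : ∀ᶠ i : ℝ × ℝ in 𝓝[>] 0 ×ˢ 𝓝[Icc 0 T] t, i.2 ∈ Icc 0 T :=
    (tendsto_snd (f := 𝓝[>] (0 : ℝ)) (g := 𝓝[Icc 0 T] t)).eventually self_mem_nhdsWithin
  have hbdd : ∃ C, ∀ x, |deriv ψ x| ≤ C := ⟨_, hsob.abs_le⟩
  have hunif : ∀ ε > 0, ∀ᶠ h in 𝓝[>] (0 : ℝ), ∀ x, |deriv (φ h) x - deriv ψ x| ≤ ε := by
    intro ε hε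
    have h3 := t1.tendsto.add t2.tendsto
    rw [add_zero] at h3
    filter_upwards [h3.eventually (gt_mem_nhds hε), self_mem_nhdsWithin] with h hh hp x
    exact (((hφ h hp).deriv.sob.sub hsob).abs_le x).trans hh.le
  set b : ℝ × ℝ → ℝ → ℝ := fun i => if 0 < i.1 then deriv (φ i.1) else deriv ψ
  have hb : ∀ i : ℝ × ℝ, 0 < i.1 → b i = deriv (φ i.1) := fun i hi => if_pos hi
  have hTU : TU (𝓝[>] 0 ×ˢ 𝓝[Icc 0 T] t) b (deriv ψ) := by
    refine ⟨fun i => ?_, hψ1.2.continuous.aestronglyMeasurable, hbdd, fun ε hε => ?_⟩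
    · by_cases hi : 0 < i.1
      · rw [hb i hi]; exact (hφ _ hi).deriv.1.continuous.aestronglyMeasurable
      · simp only [b, if_neg hi]; exact hψ1.2.continuous.aestronglyMeasurable
    · filter_upwards [hfst.eventually (hunif ε hε), hpos] with i h1 h2
      rw [hb i h2]; exact h1
  have hquad : ∀ (w : XSpace), w ∈ NV → ∀ g : ℝ → ℝ, AEStronglyMeasurable g →
      (∃ C, ∀ x, |g x| ≤ C) → ∫ x, quadFlux w x * g x
        = (∫ x, slope w x * (g x * slope w x)) - ∫ x, vel w x * (g x * vel w x) := by
    rintro w hw g hg ⟨C, hC⟩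
    rw [← integral_sub (integrable_mul_L2 (memLp_slope hw) (memLp_bdd_mul (memLp_slope hw) hg C
      (.of_forall hC))) (integrable_mul_L2 (memLp_vel w) (memLp_bdd_mul (memLp_vel w) hg C
      (.of_forall hC)))]
    congr 1; funext x; simp only [quadFlux]; ring
  refine hasDerivWithinAt_of_tendsto (convex_Icc 0 T) ht
    (F := fun h s => ∫ x, vel (u s) x * φ h x)
    (fun h hh s hs => hu.hasDerivWithinAt_vel (hφ h hh) hs)
    (fun s _ => (TL2.const (memLp_vel (u s))).integral_mul t0) ?_
  refine Tendsto.sub (Tendsto.sub (Tendsto.neg ?_) ?_) ?_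
  · exact (tL2_etaC hsnd).integral_mul (t1.comp_tendsto hfst)
  · have hs := tL2_slope hsnd (hu.mem_NV t ht)
    have hv := tL2_vel hsnd
    rw [hquad _ (hu.mem_NV t ht) _ hψ1.2.continuous.aestronglyMeasurable hbdd]
    refine ((hs.integral_mul (hTU.mul_TL2 hs)).sub (hv.integral_mul (hTU.mul_TL2 hv))).congr' ?_
    filter_upwards [hpos, hin] with i h1 h2
    rw [hb i h1, hquad _ (hu.mem_NV _ h2) _ (hφ _ h1).deriv.1.continuous.aestronglyMeasurable
      ⟨_, (hφ _ h1).deriv.sob.abs_le⟩]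
  · exact (tL2_slope hsnd (hu.mem_NV t ht)).integral_mul (t2.comp_tendsto hfst)

theorem IsHGPSolution.hasDerivWithinAt_etaC_of_sob {p q : ℝ → ℝ} (h : Sob p q) {t : ℝ}
    (ht : t ∈ Icc 0 T) : HasDerivWithinAt (fun s => ∫ x, etaC (u s) x * p x)
      (∫ x, massFlux (u t) x * q x) (Icc 0 T) t := by
  rw [hasDerivWithinAt_iff_isLittleO, Asymptotics.isLittleO_iff]
  intro c hc
  set n := N2 p + N2 q + 1
  have hn : 0 < n := by have := N2_nonneg p; have := N2_nonneg q; positivity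
  filter_upwards [hu.dualDeriv_etaC ht (c / n) (by positivity)] with s hs
  have h1 := hs p q h
  have e : ∫ x, (etaC (u s) x - etaC (u t) x) * p x
      = (∫ x, etaC (u s) x * p x) - ∫ x, etaC (u t) x * p x := by
    rw [← integral_sub (integrable_mul_L2 (memLp_etaC _) h.memLp)
      (integrable_mul_L2 (memLp_etaC _) h.memLp)]
    congr 1; funext x; ring
  rw [e] at h1
  rw [smul_eq_mul, Real.norm_eq_abs, Real.norm_eq_abs]
  refine h1.trans ?_
  calc c / n * |s - t| * (N2 p + N2 q) ≤ c / n * |s - t| * n := by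
        gcongr; simp [n]
    _ = c * |s - t| := by field_simp

end

/-! ### Differentiability of implicitly defined curves -/

theorem hasDerivWithinAt_of_implicit {X E : Type*} [NormedAddCommGroup X] [NormedSpace ℝ X]
    [NormedAddCommGroup E] [NormedSpace ℝ E] {G : X × E → E} {G' : X × E →L[ℝ] E} {I : Set ℝ}
    {t₀ : ℝ} {u : ℝ → X} {x : ℝ → E} (ht₀ : t₀ ∈ I) (hG : HasStrictFDerivAt G G' (u t₀, x t₀))
    (D : E ≃L[ℝ] E) (hD : ∀ y, D y = G' (0, y)) (hu : ContinuousWithinAt u I t₀)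
    (hx : ContinuousWithinAt x I t₀) (h0 : ∀ t ∈ I, G (u t, x t) = 0) {g : E}
    (hg : HasDerivWithinAt (fun t => G (u t, x t₀)) g I t₀) :
    HasDerivWithinAt x (-D.symm g) I t₀ := by
  have h1 := hasStrictFDerivAt_iff_isLittleO.1 hG
  have hlim : Tendsto (fun t => ((u t, x t), (u t, x t₀))) (𝓝[I] t₀)
      (𝓝 ((u t₀, x t₀), (u t₀, x t₀))) :=
    (hu.prodMk_nhds hx).prodMk_nhds (hu.prodMk_nhds continuousWithinAt_const)
  have h2 := h1.comp_tendsto hlim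
  have h3 := hasDerivWithinAt_iff_isLittleO.1 hg
  have h4 : (fun t => D (x t - x t₀) + (t - t₀) • g) =o[𝓝[I] t₀]
      fun t => ‖x t - x t₀‖ + ‖t - t₀‖ := by
    have k2 : (fun t => G (u t, x t) - G (u t, x t₀) - D (x t - x t₀)) =o[𝓝[I] t₀]
        fun t => ‖x t - x t₀‖ + ‖t - t₀‖ := by
      refine (h2.congr_left fun t => ?_).trans_isBigO ?_
      · simp only [Function.comp, hD, Prod.mk_sub_mk, sub_self]
      · refine Asymptotics.IsBigO.of_bound 1 (.of_forall fun t => ?_)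
        simp only [Function.comp, Prod.mk_sub_mk, sub_self, Prod.norm_def, norm_zero, one_mul]
        rw [max_eq_right (norm_nonneg _), Real.norm_of_nonneg (by positivity)]
        linarith [norm_nonneg (t - t₀)]
    have k3 : (fun t => G (u t, x t₀) - G (u t₀, x t₀) - (t - t₀) • g) =o[𝓝[I] t₀]
        fun t => ‖x t - x t₀‖ + ‖t - t₀‖ := by
      refine h3.trans_isBigO (Asymptotics.IsBigO.of_bound 1 (.of_forall fun t => ?_))
      rw [one_mul, Real.norm_of_nonneg (by positivity : 0 ≤ ‖x t - x t₀‖ + ‖t - t₀‖)]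
      linarith [norm_nonneg (x t - x t₀)]
    refine (k2.add k3).neg_left.congr' ?_ .rfl
    filter_upwards [self_mem_nhdsWithin] with t ht
    rw [h0 t ht, h0 t₀ ht₀]
    abel
  have h5 : (fun t => x t - x t₀ - (t - t₀) • (-D.symm g)) =o[𝓝[I] t₀]
      fun t => ‖x t - x t₀‖ + ‖t - t₀‖ := by
    refine (((D.symm : E →L[ℝ] E).isBigO_comp _ _).trans_isLittleO h4).congr_left fun t => ?_
    simp
  have h6 : (fun t => ‖x t - x t₀‖ + ‖t - t₀‖) =O[𝓝[I] t₀] fun t => t - t₀ := by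
    refine Asymptotics.IsBigO.of_bound (2 * (‖D.symm g‖ + 1) + 1) ?_
    filter_upwards [h5.def (show (0 : ℝ) < 1 / 2 by norm_num)] with t ht
    rw [Real.norm_of_nonneg (by positivity : 0 ≤ ‖x t - x t₀‖ + ‖t - t₀‖)] at ht ⊢
    have k := norm_sub_norm_le (x t - x t₀) ((t - t₀) • (-D.symm g))
    rw [norm_smul, norm_neg] at k
    nlinarith [norm_nonneg (t - t₀), norm_nonneg (D.symm g)]
  exact hasDerivWithinAt_iff_isLittleO.2 (h5.trans_isBigO h6)

end

/-! ### Fluxes of a soliton -/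

/-- The function `∂_y η_c / (2 (1 - η_c))`. -/
def solSlope (c y : ℝ) : ℝ := 1 / 2 * solInv c y * eY c y

theorem ud_solSlope : UD solSlope := ((UB.const (1 / 2)).mul ub_inv).mul_UD ud_eY

theorem ca_solSlope : CA solSlope := ((CA.const (1 / 2)).mul ca_inv).mul ca_eY

theorem decay_solSlope : Decay solSlope := ⟨ud_solSlope, ca_solSlope⟩

theorem ca_eYYY : CA eYYY := ((((ca_sc.mul ca_sc).mul ca_eY)).add
  (((CA.const (-6)).mul ca_eta).mul ca_eY)).congr fun c y => by simp only [eYYY]; ring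

theorem ca_vYYY : CA vYYY := ca_vfac.mul ((ca_eYYY.add
  ((((CA.const 6).mul ca_inv).mul ca_eY).mul ca_eYY)).add
  ((((CA.const 6).mul (ca_inv.mul ca_inv)).mul (ca_eY.mul ca_eY)).mul ca_eY))

theorem decay_vYYY : Decay vYYY := ⟨ud_vYYY, ca_vYYY⟩

theorem hasDerivAt_solSlope {c : ℝ} (h : AdmSpeed c) (y : ℝ) : HasDerivAt (solSlope c)
    (solEta c y - solV c y ^ 2 + solSlope c y ^ 2 + c * solV c y) y := by
  have h1 := (pd_inv h y).hasDerivAt_right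
  have h2 := (pd_eY h y).hasDerivAt_right
  refine ((h1.const_mul (1 / 2)).mul h2).congr_deriv ?_
  have hs := sc_sq h
  have hp := solInv_pos h y
  have hE := solEta_eq h y
  have hI : solInv c y * (1 - solEta c y) = 1 := inv_mul_cancel₀ hp.ne'
  have hY : eY c y ^ 2 = (sc c ^ 2 - 2 * solEta c y) * solEta c y ^ 2 := by
    rw [eY]
    linear_combination (2 * solEta c y ^ 2) * hE
  rw [solV_eq h, solSlope, eYY, hs]
  rw [hs] at hY
  generalize solEta c y = E at *
  generalize eY c y = D at *
  generalize solInv c y = I at *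
  have hI2 : I = (1 - E)⁻¹ := by
    field_simp; linarith
  rw [hI2]
  field_simp
  linear_combination hY

/-- The flux of the state `u`, tested. -/
def fluxPair (u : XSpace) (q r s : ℝ → ℝ) : ℝ :=
  (∫ x, massFlux u x * q x) + (-(∫ x, etaC u x * r x) - (∫ x, quadFlux u x * r x)
    - ∫ x, slope u x * s x)

/-- The flux of the soliton of speed `c` and position `a`, tested. -/
def solFluxPair (c a : ℝ) (q r s : ℝ → ℝ) : ℝ :=
  (∫ x, c * solEta c (x - a) * q x) + (-(∫ x, solEta c (x - a) * r x)
    - (∫ x, (solSlope c (x - a) ^ 2 - solV c (x - a) ^ 2) * r x) - ∫ x, solSlope c (x - a) * s x)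

theorem Decay.bdd {g : ℝ → ℝ → ℝ} (hg : Decay g) {c : ℝ} (h : AdmSpeed c) (a : ℝ) :
    Bdd fun x => g c (x - a) := by
  obtain ⟨κ, hκ, hc⟩ := h.mem_speeds
  obtain ⟨C, -, hC⟩ := hg.ud.UB κ hκ
  exact ⟨(hg.continuous h a).aestronglyMeasurable, C, fun x => hC c hc _⟩

theorem solFluxPair_eq {c : ℝ} (h : AdmSpeed c) (a : ℝ) {f fy ψ ψy ψyy : ℝ → ℝ → ℝ}
    (hf : Decay f) (hfy : Decay fy) (hψ : Decay ψ) (hψy : Decay ψy) (hψyy : Decay ψyy)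
    (df : ∀ y, HasDerivAt (f c) (fy c y) y) (dψ : ∀ y, HasDerivAt (ψ c) (ψy c y) y)
    (dψy : ∀ y, HasDerivAt (ψy c) (ψyy c y) y) :
    solFluxPair c a (fun x => fy c (x - a)) (fun x => ψy c (x - a)) (fun x => ψyy c (x - a))
      = -(c * (profInner eY f c + profInner vY ψ c)) := by
  have e := profile_eta.decay
  have v := profile_v.decay
  have ey := profile_eY.decay
  have vy := profile_vY.decay
  have m : ∀ {g : ℝ → ℝ → ℝ}, Decay g → MemLp (g c) 2 := fun hg => by
    simpa using hg.memLp h 0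
  have i : ∀ {g k : ℝ → ℝ → ℝ}, Decay g → Decay k → Integrable (fun y => g c y * k c y) :=
    fun hg hk => integrable_mul_L2 (m hg) (m hk)
  have b : ∀ {g : ℝ → ℝ → ℝ}, Decay g → Bdd (g c) := fun hg => by simpa using hg.bdd h 0
  have i1 : Integrable (fun y => c * solEta c y * fy c y) := by
    simpa only [mul_assoc] using (i e hfy).const_mul c
  have i2 := i e hψy
  have i2n : Integrable (fun y => -(solEta c y * ψy c y)) := i2.neg
  have i3 : Integrable (fun y => (solSlope c y ^ 2 - solV c y ^ 2) * ψy c y) := by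
    have := integrable_fsub ((b decay_solSlope).integrable_mul (i decay_solSlope hψy))
      ((b v).integrable_mul (i v hψy))
    refine this.congr (.of_forall fun y => ?_)
    simp only; ring
  have i4 := i decay_solSlope hψyy
  have i5 := (i ey hf).const_mul c
  have i6 := (i vy hψ).const_mul c
  have key : ∫ y, (((c * solEta c y * fy c y + (-(solEta c y * ψy c y)
      - (solSlope c y ^ 2 - solV c y ^ 2) * ψy c y - solSlope c y * ψyy c y))
      + c * (eY c y * f c y)) + c * (vY c y * ψ c y)) = 0 := by
    refine integral_eq_zero_of_hasDerivAt_of_integrable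
      (f := fun y => c * (solEta c y * f c y) - solSlope c y * ψy c y + c * (solV c y * ψ c y))
      (fun y => ?_)
      (integrable_fadd (integrable_fadd (integrable_fadd i1
        (integrable_fsub (integrable_fsub i2n i3) i4)) i5) i6)
      (integrable_fadd (integrable_fsub ((i e hf).const_mul c) (i decay_solSlope hψy))
        ((i v hψ).const_mul c))
    refine ((((pd_eta h y).hasDerivAt_right.mul (df y)).const_mul c).sub
      ((hasDerivAt_solSlope h y).mul (dψy y)) |>.add
      (((pd_v h y).hasDerivAt_right.mul (dψ y)).const_mul c)).congr_deriv ?_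
    ring
  rw [integral_add (integrable_fadd (integrable_fadd i1
    (integrable_fsub (integrable_fsub i2n i3) i4)) i5) i6,
    integral_add (integrable_fadd i1 (integrable_fsub (integrable_fsub i2n i3) i4)) i5,
    integral_add i1 (integrable_fsub (integrable_fsub i2n i3) i4),
    integral_sub (integrable_fsub i2n i3) i4, integral_sub i2n i3, integral_neg,
    integral_const_mul, integral_const_mul] at key
  rw [solFluxPair, integral_sub_right_eq_self (fun y => c * solEta c y * fy c y),
    integral_sub_right_eq_self (fun y => solEta c y * ψy c y),
    integral_sub_right_eq_self (fun y => (solSlope c y ^ 2 - solV c y ^ 2) * ψy c y),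
    integral_sub_right_eq_self (fun y => solSlope c y * ψyy c y), profInner_eq ey hf h,
    profInner_eq vy hψ h]
  linarith

/-! ### Comparison with the fluxes of a soliton -/

theorem abs_integral_mul_sub_le {F G H W q : ℝ → ℝ} {C : ℝ} (hF : Integrable (fun x => F x * q x))
    (hG : Integrable (fun x => G x * q x)) (hFG : ∀ᵐ x, |F x - G x| ≤ H x)
    (hq : ∀ x, |q x| ≤ C * W x) (hHW : Integrable (fun x => H x * W x)) :
    |(∫ x, F x * q x) - ∫ x, G x * q x| ≤ C * ∫ x, H x * W x := by
  rw [← integral_sub hF hG, ← integral_const_mul]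
  refine abs_integral_le_integral_abs.trans (integral_mono_ae (hF.sub hG).abs (hHW.const_mul C) ?_)
  filter_upwards [hFG] with x hx
  rw [← sub_mul, abs_mul]
  have h1 := mul_le_mul hx (hq x) (abs_nonneg _) ((abs_nonneg _).trans hx)
  linarith

theorem abs_le_add_sq_div (d : ℝ) {l : ℝ} (hl : 0 < l) : |d| ≤ l + d ^ 2 / l := by
  rw [← sub_le_iff_le_add', le_div_iff₀ hl, ← sq_abs d]
  nlinarith [sq_nonneg (|d| - l), abs_nonneg d]

theorem slope_sub_le {B μ κ e e' y y' : ℝ} (hμ : 0 < μ) (hκ : 0 < κ) (he : κ ≤ 1 - e)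
    (he' : μ ≤ 1 - e') (hy : |y| ≤ B) :
    |y' / (2 * (1 - e')) - 1 / 2 * (1 - e)⁻¹ * y|
      ≤ (μ⁻¹ + B * (μ⁻¹ * κ⁻¹)) * (|e' - e| + |y' - y|) := by
  have p1 : 0 < 1 - e := by linarith
  have p2 : 0 < 1 - e' := by linarith
  have hB : 0 ≤ B := (abs_nonneg _).trans hy
  have hJ : (1 - e')⁻¹ ≤ μ⁻¹ := by gcongr
  have hI : (1 - e)⁻¹ ≤ κ⁻¹ := by gcongr
  have hJ0 : 0 < (1 - e')⁻¹ := by positivity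
  have hI0 : 0 < (1 - e)⁻¹ := by positivity
  have ee : y' / (2 * (1 - e')) - 1 / 2 * (1 - e)⁻¹ * y
      = 1 / 2 * ((1 - e')⁻¹ * (y' - y)) + 1 / 2 * (y * ((1 - e')⁻¹ * (1 - e)⁻¹ * (e' - e))) := by
    field_simp; ring
  rw [ee]
  refine (abs_add_le _ _).trans ?_
  rw [abs_mul, abs_mul, abs_mul, abs_mul, abs_mul, abs_mul, abs_of_pos hJ0, abs_of_pos hI0,
    abs_of_pos (show (0 : ℝ) < 1 / 2 by norm_num)]
  have k1 : (1 - e')⁻¹ * |y' - y| ≤ μ⁻¹ * |y' - y| := by gcongr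
  have k2 : |y| * ((1 - e')⁻¹ * (1 - e)⁻¹ * |e' - e|) ≤ B * (μ⁻¹ * κ⁻¹ * |e' - e|) := by gcongr
  have k3 : 0 ≤ μ⁻¹ * |e' - e| := by positivity
  have k4 : 0 ≤ B * (μ⁻¹ * κ⁻¹) * |y' - y| := by positivity
  have k5 : 0 ≤ μ⁻¹ * |y' - y| := by positivity
  have k6 : 0 ≤ B * (μ⁻¹ * κ⁻¹ * |e' - e|) := by positivity
  nlinarith

theorem abs_sq_sub_sq_le {B b s s' n t : ℝ} (hs : |s| ≤ B) (h : |s' - s| ≤ b * n) (ht : n ^ 2 ≤ t) :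
    |s' ^ 2 - s ^ 2| ≤ 2 * B * b * n + b ^ 2 * t := by
  have hB : 0 ≤ B := (abs_nonneg _).trans hs
  have e : s' ^ 2 - s ^ 2 = 2 * s * (s' - s) + (s' - s) ^ 2 := by ring
  rw [e]
  refine (abs_add_le _ _).trans ?_
  rw [abs_mul, abs_mul, abs_of_pos (show (0 : ℝ) < 2 by norm_num), abs_of_nonneg (sq_nonneg (s' - s))]
  have h1 : |s| * |s' - s| ≤ B * (b * n) := mul_le_mul hs h (abs_nonneg _) hB
  have h2 : (s' - s) ^ 2 ≤ (b * n) ^ 2 := by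
    rw [← sq_abs (s' - s)]; exact pow_le_pow_left₀ (abs_nonneg _) h 2
  have h3 : (b * n) ^ 2 ≤ b ^ 2 * t := by rw [mul_pow]; gcongr
  nlinarith

/-- The squared distance, at the point `x`, between a state and a soliton. -/
def sqDist (u : XSpace) (c a x : ℝ) : ℝ :=
  (etaC u x - solEta c (x - a)) ^ 2 + (etaX u x - eY c (x - a)) ^ 2 + (vel u x - solV c (x - a)) ^ 2

theorem exists_pointwise_bound {κ μ : ℝ} (hκ : 0 < κ) (hμ : 0 < μ) : ∃ B, 0 ≤ B ∧
    ∀ (u : XSpace) (c a x : ℝ), c ∈ speeds κ → μ ≤ 1 - etaC u x → ∀ l > 0,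
      |massFlux u x - c * solEta c (x - a)| ≤ B * (3 * l + (1 + l⁻¹) * sqDist u c a x) ∧
      |etaC u x - solEta c (x - a)| ≤ B * (3 * l + (1 + l⁻¹) * sqDist u c a x) ∧
      |quadFlux u x - (solSlope c (x - a) ^ 2 - solV c (x - a) ^ 2)|
        ≤ B * (3 * l + (1 + l⁻¹) * sqDist u c a x) ∧
      |slope u x - solSlope c (x - a)| ≤ B * (3 * l + (1 + l⁻¹) * sqDist u c a x) := by
  obtain ⟨B₁, hB₁, h1⟩ := ud_eY.UB κ hκ
  obtain ⟨B₂, hB₂, h2⟩ := ud_v.UB κ hκ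
  obtain ⟨B₃, hB₃, h3⟩ := ud_solSlope.UB κ hκ
  obtain ⟨b, hbd⟩ : ∃ b, b = μ⁻¹ + B₁ * (μ⁻¹ * (κ / 2)⁻¹) := ⟨_, rfl⟩
  have hb : 0 ≤ b := by rw [hbd]; positivity
  have q1 : 0 ≤ B₃ * b := mul_nonneg hB₃ hb
  have q2 : 0 ≤ b ^ 2 := sq_nonneg b
  obtain ⟨B, hBd⟩ : ∃ B, B = (2 + 2 * B₂) + 1 + (2 * (B₃ * b) + 2 * b ^ 2 + 2 * B₂ + 1) + b := ⟨_, rfl⟩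
  have hB0 : 0 ≤ B := by rw [hBd]; positivity
  refine ⟨B, hB0, fun u c a x hc hx l hl => ?_⟩
  have hadm := admSpeed_of_mem hκ hc
  have hE : κ / 2 ≤ 1 - solEta c (x - a) := by
    have := one_sub_solEta_pos hadm (x - a)
    have := hc.1
    linarith
  have hE0 : 0 ≤ solEta c (x - a) := solEta_nonneg hadm _
  have hY : |eY c (x - a)| ≤ B₁ := h1 c hc _
  have hV : |solV c (x - a)| ≤ B₂ := h2 c hc _
  have hS : |solSlope c (x - a)| ≤ B₃ := h3 c hc _
  have hsl : |slope u x - solSlope c (x - a)|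
      ≤ b * (|etaC u x - solEta c (x - a)| + |etaX u x - eY c (x - a)|) := by
    rw [hbd]
    exact slope_sub_le (B := B₁) (κ := κ / 2) hμ (by positivity) hE hx hY
  have hV' : solV c (x - a) * (2 * (1 - solEta c (x - a))) = -(c * solEta c (x - a)) := by
    have : 2 * (1 - solEta c (x - a)) ≠ 0 := by linarith
    rw [solV, div_mul_cancel₀ _ this]
  have ht : sqDist u c a x = (etaC u x - solEta c (x - a)) ^ 2 + (etaX u x - eY c (x - a)) ^ 2
    + (vel u x - solV c (x - a)) ^ 2 := rfl
  generalize solEta c (x - a) = E at *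
  generalize solV c (x - a) = V at *
  generalize eY c (x - a) = Y at *
  generalize solSlope c (x - a) = S at *
  generalize sqDist u c a x = t at *
  obtain ⟨n, hnd⟩ : ∃ n, n = |etaC u x - E| + |etaX u x - Y| + |vel u x - V| := ⟨_, rfl⟩
  have a1 := abs_le_add_sq_div (etaC u x - E) hl
  have a2 := abs_le_add_sq_div (etaX u x - Y) hl
  have a3 := abs_le_add_sq_div (vel u x - V) hl
  have hn : n + t ≤ 3 * l + (1 + l⁻¹) * t := by
    rw [div_eq_mul_inv] at a1 a2 a3; rw [hnd, ht]; linarith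
  have n1 := abs_nonneg (etaC u x - E)
  have n2 := abs_nonneg (etaX u x - Y)
  have n3 := abs_nonneg (vel u x - V)
  have s1 := sq_nonneg (etaC u x - E)
  have s2 := sq_nonneg (etaX u x - Y)
  have s3 := sq_nonneg (vel u x - V)
  have hn0 : 0 ≤ n := by rw [hnd]; positivity
  have ht0 : 0 ≤ t := by rw [ht]; positivity
  have hfin : ∀ {z b₁ b₂ : ℝ}, |z| ≤ b₁ * n + b₂ * t → b₁ ≤ B → b₂ ≤ B →
      |z| ≤ B * (3 * l + (1 + l⁻¹) * t) := by
    intro z b₁ b₂ hz hb₁ hb₂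
    calc |z| ≤ B * n + B * t := hz.trans (by gcongr)
      _ = B * (n + t) := by ring
      _ ≤ _ := by gcongr
  refine ⟨hfin (b₁ := 2 + 2 * B₂) (b₂ := 1) ?_ (by linarith) (by linarith),
    hfin (b₁ := 1) (b₂ := 0) ?_ (by linarith) hB0,
    hfin (b₁ := 2 * (B₃ * b) + 2 * B₂) (b₂ := 2 * b ^ 2 + 1) ?_ (by linarith) (by linarith),
    hfin (b₁ := b) (b₂ := 0) ?_ (by linarith) hB0⟩
  · have e : massFlux u x - c * E = -2 * ((1 - E) * (vel u x - V))
        + 2 * ((etaC u x - E) * V) + 2 * ((etaC u x - E) * (vel u x - V)) := by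
      simp only [massFlux]; linear_combination -hV'
    rw [e]
    refine (abs_add_le _ _).trans ((add_le_add_left (abs_add_le _ _) _).trans ?_)
    rw [abs_mul, abs_mul, abs_mul, abs_mul, abs_mul, abs_mul, abs_neg,
      abs_of_pos (show (0 : ℝ) < 2 by norm_num), abs_of_pos (show 0 < 1 - E by linarith)]
    have k1 : (1 - E) * |vel u x - V| ≤ 1 * |vel u x - V| := by gcongr; linarith
    have k2 : |etaC u x - E| * |V| ≤ |etaC u x - E| * B₂ := by gcongr
    have k3 : 2 * (|etaC u x - E| * |vel u x - V|) ≤ t := by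
      rw [ht, ← sq_abs (etaC u x - E), ← sq_abs (vel u x - V)]
      linarith [sq_nonneg (|etaC u x - E| - |vel u x - V|)]
    have k4 : 0 ≤ B₂ * |etaX u x - Y| := by positivity
    have k5 : 0 ≤ B₂ * |vel u x - V| := by positivity
    rw [hnd]
    linarith
  · rw [hnd]; linarith
  · have k1 : |slope u x ^ 2 - S ^ 2|
        ≤ 2 * B₃ * b * (|etaC u x - E| + |etaX u x - Y|) + b ^ 2 * (2 * t) := by
      refine abs_sq_sub_sq_le hS hsl ?_
      rw [ht, ← sq_abs (etaC u x - E), ← sq_abs (etaX u x - Y)]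
      linarith [sq_nonneg (|etaC u x - E| - |etaX u x - Y|)]
    have k2 : |vel u x ^ 2 - V ^ 2| ≤ 2 * B₂ * 1 * |vel u x - V| + 1 ^ 2 * t := by
      refine abs_sq_sub_sq_le hV (by rw [one_mul]) ?_
      rw [sq_abs, ht]; linarith
    have e : quadFlux u x - (S ^ 2 - V ^ 2) = (slope u x ^ 2 - S ^ 2) - (vel u x ^ 2 - V ^ 2) := by
      simp only [quadFlux]; ring
    rw [e]
    refine (abs_sub _ _).trans ?_
    have k3 : 0 ≤ B₃ * b * |vel u x - V| := by positivity
    have k4 : 0 ≤ B₂ * (|etaC u x - E| + |etaX u x - Y|) := by positivity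
    rw [hnd]
    linarith
  · have k1 : 0 ≤ b * |vel u x - V| := by positivity
    rw [hnd]; linarith

section

variable {N : ℕ}

theorem norm_etaXL_le (u : XSpace) : ‖etaXL u‖ ≤ ‖u‖ := by
  rw [← N2_coe, coe_etaXL]; exact N2_etaX_le u

theorem reads_etaX : Reads etaXL eY := ⟨norm_etaXL_le, fun _ => etaXL_soliton⟩

theorem sum_shiftL2_ae {g : ℝ → ℝ → ℝ} (hg : Decay g) {x : Fin N → ℝ × ℝ}
    (hx : ∀ k, AdmSpeed (x k).1) (s : Finset (Fin N)) :
    ((∑ j ∈ s, shiftL2 g (x j) : L2) : ℝ → ℝ) =ᵐ[volume] fun y => ∑ j ∈ s, g (x j).1 (y - (x j).2) := by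
  classical
  induction s using Finset.induction_on with
  | empty =>
    simp only [Finset.sum_empty]
    exact Lp.coeFn_zero ℝ 2 volume
  | insert i s hi ih =>
    rw [Finset.sum_insert hi]
    filter_upwards [Lp.coeFn_add (shiftL2 g (x i)) (∑ j ∈ s, shiftL2 g (x j)), ih,
      hg.shiftL2_ae (hx i)] with y h1 h2 h3
    rw [h1, Pi.add_apply, h2, h3, Finset.sum_insert hi]

theorem Reads.sub_profile_ae {w : XSpace →L[ℝ] L2} {g : ℝ → ℝ → ℝ} (hw : Reads w g) (hg : Decay g)
    {c a : Fin N → ℝ} (hc : ∀ k, AdmSpeed (c k)) (u : XSpace) (k : Fin N) :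
    ∀ᵐ x, w u x - g (c k) (x - a k)
      = w (u - GPChain.chain c a) x + ∑ j ∈ Finset.univ.erase k, g (c j) (x - a j) := by
  have e : w (u - GPChain.chain c a) = w u - ∑ j, shiftL2 g (c j, a j) := by
    rw [map_sub, hw.chain (x := fun k => (c k, a k)) hc]
  rw [e]
  filter_upwards [Lp.coeFn_sub (w u) (∑ j, shiftL2 g (c j, a j)),
    sum_shiftL2_ae hg (x := fun k => (c k, a k)) hc Finset.univ] with x h1 h2
  rw [h1, Pi.sub_apply, h2, ← Finset.add_sum_erase _ _ (Finset.mem_univ k)]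
  ring

theorem sq_add_sum_le {p C : ℝ} {f w : Fin N → ℝ} {S : Finset (Fin N)}
    (hw : ∀ j, 0 < w j) (hw1 : ∀ j, w j ≤ 1) (hf : ∀ j ∈ S, |f j| ≤ C * w j) :
    (p + ∑ j ∈ S, f j) ^ 2 ≤ 2 * p ^ 2 + 2 * N * C ^ 2 * ∑ j ∈ S, w j := by
  have h1 : (∑ j ∈ S, f j) ^ 2 ≤ N * ∑ j ∈ S, f j ^ 2 := by
    refine sq_sum_le_card_mul_sum_sq.trans ?_
    have : (S.card : ℝ) ≤ N := by exact_mod_cast (Finset.card_le_univ S).trans_eq (Fintype.card_fin N)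
    exact mul_le_mul_of_nonneg_right this (Finset.sum_nonneg fun _ _ => sq_nonneg _)
  have h2 : ∑ j ∈ S, f j ^ 2 ≤ C ^ 2 * ∑ j ∈ S, w j := by
    rw [Finset.mul_sum]
    refine Finset.sum_le_sum fun j hj => ?_
    rw [← sq_abs]
    calc |f j| ^ 2 ≤ (C * w j) ^ 2 := pow_le_pow_left₀ (abs_nonneg _) (hf j hj) 2
      _ = C ^ 2 * (w j * w j) := by ring
      _ ≤ C ^ 2 * (w j * 1) := by gcongr; exacts [(hw j).le, hw1 j]
      _ = _ := by ring
  have h3 := mul_le_mul_of_nonneg_left h2 (Nat.cast_nonneg (α := ℝ) N)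
  nlinarith [sq_nonneg (p - ∑ j ∈ S, f j)]

theorem integrable_sqDist (u : XSpace) {c : ℝ} (hc : AdmSpeed c) (a : ℝ) :
    Integrable (sqDist u c a) := by
  have h1 := memLp_fsub (memLp_etaC u) (profile_eta.decay.memLp hc a)
  have h2 := memLp_fsub (memLp_etaX u) (profile_eY.decay.memLp hc a)
  have h3 := memLp_fsub (memLp_vel u) (profile_v.decay.memLp hc a)
  exact (h1.integrable_sq.add h2.integrable_sq).add h3.integrable_sq

theorem exists_weighted_bound (N : ℕ) {κ : ℝ} (hκ : 0 < κ) : ∃ C, 0 ≤ C ∧ ∀ (c a : Fin N → ℝ),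
    (∀ k, c k ∈ speeds κ) → ∀ d, 0 ≤ d → (∀ j k, j ≠ k → d ≤ |a j - a k|) → ∀ (u : XSpace) k,
      ∫ x, sqDist u (c k) (a k) x * wt (x - a k) ≤ C * (‖u - chain c a‖ ^ 2 + om d) := by
  obtain ⟨C₁, hC₁, h1⟩ := ud_eta κ hκ
  obtain ⟨C₂, hC₂, h2⟩ := ud_eY κ hκ
  obtain ⟨C₃, hC₃, h3⟩ := ud_v κ hκ
  set D := 2 * N * (C₁ ^ 2 + C₂ ^ 2 + C₃ ^ 2)
  have hD : 0 ≤ D := by positivity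
  refine ⟨2 + D * (N * Real.pi), by positivity, fun c a hc d hd hgap u k => ?_⟩
  have hadm : ∀ j, AdmSpeed (c j) := fun j => admSpeed_of_mem hκ (hc j)
  set ε := u - chain c a
  have hint1 : Integrable (fun x => etaC ε x ^ 2 + etaX ε x ^ 2 + vel ε x ^ 2) :=
    integrable_fadd (integrable_fadd (memLp_etaC ε).integrable_sq (memLp_etaX ε).integrable_sq)
      (memLp_vel ε).integrable_sq
  have hint2 : Integrable (fun x => ∑ j ∈ Finset.univ.erase k, (wt (x - a j) + wt (x - a k))) :=
    integrable_finsetSum _ fun j _ => integrable_fadd (integrable_wt _) (integrable_wt _)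
  have hpt : ∀ᵐ x, sqDist u (c k) (a k) x * wt (x - a k)
      ≤ 2 * (etaC ε x ^ 2 + etaX ε x ^ 2 + vel ε x ^ 2)
        + D * om d * (1 / 2) * ∑ j ∈ Finset.univ.erase k, (wt (x - a j) + wt (x - a k)) := by
    filter_upwards [reads_eta.sub_profile_ae profile_eta.decay (a := a) hadm u k,
      reads_etaX.sub_profile_ae profile_eY.decay (a := a) hadm u k,
      reads_vel.sub_profile_ae profile_v.decay (a := a) hadm u k, etaC_ae u, etaC_ae ε]
      with x e1 e2 e3 e4 e5
    rw [coe_etaL, coe_etaL, ← e4, ← e5] at e1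
    rw [coe_etaXL, coe_etaXL] at e2
    rw [coe_velL, coe_velL] at e3
    have hw0 : ∀ j, 0 < wt (x - a j) := fun j => wt_pos _
    have hw1 : ∀ j, wt (x - a j) ≤ 1 := fun j => wt_le_one _
    have s1 := sq_add_sum_le (p := etaC ε x) (S := Finset.univ.erase k) hw0 hw1
      (f := fun j => solEta (c j) (x - a j)) fun j _ => h1 _ (hc j) _
    have s2 := sq_add_sum_le (p := etaX ε x) (S := Finset.univ.erase k) hw0 hw1
      (f := fun j => eY (c j) (x - a j)) fun j _ => h2 _ (hc j) _
    have s3 := sq_add_sum_le (p := vel ε x) (S := Finset.univ.erase k) hw0 hw1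
      (f := fun j => solV (c j) (x - a j)) fun j _ => h3 _ (hc j) _
    have hs : sqDist u (c k) (a k) x ≤ 2 * (etaC ε x ^ 2 + etaX ε x ^ 2 + vel ε x ^ 2)
        + D * ∑ j ∈ Finset.univ.erase k, wt (x - a j) := by
      rw [sqDist, e1, e2, e3]; simp only [D]; linarith
    have hE0 : 0 ≤ etaC ε x ^ 2 + etaX ε x ^ 2 + vel ε x ^ 2 := by positivity
    have hsum : (∑ j ∈ Finset.univ.erase k, wt (x - a j)) * wt (x - a k)
        ≤ om d * (1 / 2) * ∑ j ∈ Finset.univ.erase k, (wt (x - a j) + wt (x - a k)) := by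
      rw [Finset.sum_mul, Finset.mul_sum]
      refine Finset.sum_le_sum fun j hj => ?_
      have g1 := wt_mul_le (x - a j) (x - a k)
      have g2 : om (x - a j - (x - a k)) ≤ om d := by
        refine om_anti ?_ hd
        have := hgap j k (Finset.ne_of_mem_erase hj)
        rwa [show x - a j - (x - a k) = -(a j - a k) by ring, abs_neg]
      have g3 : 0 ≤ 1 / 2 * (wt (x - a j) + wt (x - a k)) := by
        have := hw0 j; have := hw0 k; positivity
      calc _ ≤ _ := g1
        _ ≤ om d * (1 / 2 * (wt (x - a j) + wt (x - a k))) := mul_le_mul_of_nonneg_right g2 g3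
        _ = _ := by ring
    calc sqDist u (c k) (a k) x * wt (x - a k)
        ≤ (2 * (etaC ε x ^ 2 + etaX ε x ^ 2 + vel ε x ^ 2)
          + D * ∑ j ∈ Finset.univ.erase k, wt (x - a j)) * wt (x - a k) :=
          mul_le_mul_of_nonneg_right hs (hw0 k).le
      _ = 2 * (etaC ε x ^ 2 + etaX ε x ^ 2 + vel ε x ^ 2) * wt (x - a k)
          + D * ((∑ j ∈ Finset.univ.erase k, wt (x - a j)) * wt (x - a k)) := by ring
      _ ≤ 2 * (etaC ε x ^ 2 + etaX ε x ^ 2 + vel ε x ^ 2) * 1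
          + D * (om d * (1 / 2) * ∑ j ∈ Finset.univ.erase k, (wt (x - a j) + wt (x - a k))) := by
          gcongr; exact hw1 k
      _ = _ := by ring
  have hnorm : ∫ x, (etaC ε x ^ 2 + etaX ε x ^ 2 + vel ε x ^ 2) = ‖ε‖ ^ 2 := by
    rw [norm_sq_eq, N2_sq (memLp_etaC ε), N2_sq (memLp_etaX ε), N2_sq (memLp_vel ε),
      ← integral_add (memLp_etaC ε).integrable_sq (memLp_etaX ε).integrable_sq, ← integral_add
      (integrable_fadd (memLp_etaC ε).integrable_sq (memLp_etaX ε).integrable_sq)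
      (memLp_vel ε).integrable_sq]
  have hI2 : ∫ x, ∑ j ∈ Finset.univ.erase k, (wt (x - a j) + wt (x - a k)) ≤ N * (2 * Real.pi) := by
    rw [integral_finsetSum _ fun j _ => integrable_fadd (integrable_wt (a j)) (integrable_wt (a k))]
    have : ∀ j, ∫ x, (wt (x - a j) + wt (x - a k)) = 2 * Real.pi := fun j => by
      rw [integral_add (integrable_wt _) (integrable_wt _), integral_wt, integral_wt]; ring
    simp only [this, Finset.sum_const, nsmul_eq_mul]
    have h4 : ((Finset.univ.erase k).card : ℝ) ≤ N := by
      exact_mod_cast (Finset.card_le_univ _).trans_eq (Fintype.card_fin N)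
    gcongr
  have hbw : Integrable (fun x => sqDist u (c k) (a k) x * wt (x - a k)) :=
    (integrable_sqDist u (hadm k) (a k)).mul_bdd (c := 1)
      (continuous_wt.comp (continuous_id.sub continuous_const)).aestronglyMeasurable
      (.of_forall fun x => by
        rw [Real.norm_eq_abs, abs_of_pos (wt_pos _)]; exact wt_le_one _)
  have hom := om_nonneg d
  calc _ ≤ ∫ x, (2 * (etaC ε x ^ 2 + etaX ε x ^ 2 + vel ε x ^ 2)
        + D * om d * (1 / 2) * ∑ j ∈ Finset.univ.erase k, (wt (x - a j) + wt (x - a k))) :=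
        integral_mono_ae hbw (integrable_fadd (hint1.const_mul 2) (hint2.const_mul _)) hpt
    _ = 2 * ‖ε‖ ^ 2 + D * om d * (1 / 2)
        * ∫ x, ∑ j ∈ Finset.univ.erase k, (wt (x - a j) + wt (x - a k)) := by
        rw [integral_add (hint1.const_mul 2) (hint2.const_mul _), integral_const_mul,
          integral_const_mul, hnorm]
    _ ≤ 2 * ‖ε‖ ^ 2 + D * om d * (1 / 2) * (N * (2 * Real.pi)) := by gcongr
    _ ≤ _ := by
        have : 0 ≤ D * (N * Real.pi) * ‖ε‖ ^ 2 := by positivity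
        linarith

theorem mem_NV_of_le {u : XSpace} {μ : ℝ} (hμ : 0 < μ) (h : ∀ x, μ ≤ 1 - etaC u x) : u ∈ NV :=
  (mem_NV_iff u).2 ⟨1 - μ, by linarith, fun x => by linarith [h x]⟩

theorem exists_flux_close (N : ℕ) {κ μ ε : ℝ} (hκ : 0 < κ) (hμ : 0 < μ) (hε : 0 < ε)
    {gq gr gs : ℝ → ℝ → ℝ} (hq : Decay gq) (hr : Decay gr) (hs : Decay gs) :
    ∃ δ > 0, ∃ d₀, 0 ≤ d₀ ∧ ∀ (u : XSpace) (c a : Fin N → ℝ), (∀ k, c k ∈ speeds κ) →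
      (∀ x, μ ≤ 1 - etaC u x) → ‖u - chain c a‖ ≤ δ → (∀ j k, j ≠ k → d₀ ≤ |a j - a k|) → ∀ k,
        |fluxPair u (fun x => gq (c k) (x - a k)) (fun x => gr (c k) (x - a k))
            (fun x => gs (c k) (x - a k))
          - solFluxPair (c k) (a k) (fun x => gq (c k) (x - a k)) (fun x => gr (c k) (x - a k))
            (fun x => gs (c k) (x - a k))| ≤ ε := by
  obtain ⟨B, hB, hpt⟩ := exists_pointwise_bound hκ hμ
  obtain ⟨C', hC', hwb⟩ := exists_weighted_bound N hκ
  obtain ⟨Cq, hCq, hq1⟩ := hq.ud κ hκ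
  obtain ⟨Cr, hCr, hr1⟩ := hr.ud κ hκ
  obtain ⟨Cs, hCs, hs1⟩ := hs.ud κ hκ
  set C := Cq + 2 * Cr + Cs
  have hC : 0 ≤ C := by positivity
  have hl0 : 0 < ε / (2 * (C * B * (3 * Real.pi) + 1)) := by positivity
  obtain ⟨l, hl, hld⟩ : ∃ l : ℝ, 0 < l ∧ l = ε / (2 * (C * B * (3 * Real.pi) + 1)) := ⟨_, hl0, rfl⟩
  have hl1 : C * B * (3 * Real.pi) * l ≤ ε / 2 := by
    rw [hld, mul_div_assoc', div_le_div_iff₀ (by positivity) two_pos]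
    nlinarith
  set D := C * B * (1 + l⁻¹) * C'
  have hD : 0 ≤ D := by positivity
  have hη : 0 < ε / (4 * (D + 1)) := by positivity
  have hDη : D * (ε / (4 * (D + 1))) ≤ ε / 4 := by
    rw [mul_div_assoc', div_le_div_iff₀ (by positivity) four_pos]
    nlinarith
  obtain ⟨d₀, hd₀, hd0⟩ := ((tendsto_om.eventually (ge_mem_nhds hη)).and (eventually_ge_atTop 0)).exists
  refine ⟨√(ε / (4 * (D + 1))), Real.sqrt_pos.2 hη, d₀, hd0, fun u c a hc hu hδ hgap k => ?_⟩
  have hadm := admSpeed_of_mem hκ (hc k)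
  have hNV := mem_NV_of_le hμ hu
  have hS := hwb c a hc d₀ hd0 hgap u k
  have hδ2 : ‖u - chain c a‖ ^ 2 ≤ ε / (4 * (D + 1)) := by
    calc _ ≤ √(ε / (4 * (D + 1))) ^ 2 := pow_le_pow_left₀ (norm_nonneg _) hδ 2
      _ = _ := Real.sq_sqrt hη.le
  set H : ℝ → ℝ := fun x => B * (3 * l + (1 + l⁻¹) * sqDist u (c k) (a k) x)
  have hbw : Integrable (fun x => sqDist u (c k) (a k) x * wt (x - a k)) :=
    (integrable_sqDist u hadm (a k)).mul_bdd (c := 1)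
      (continuous_wt.comp (continuous_id.sub continuous_const)).aestronglyMeasurable
      (.of_forall fun x => by
        rw [Real.norm_eq_abs, abs_of_pos (wt_pos _)]; exact wt_le_one _)
  have hHe : (fun x => H x * wt (x - a k)) = fun x => B * (3 * l) * wt (x - a k)
      + B * (1 + l⁻¹) * (sqDist u (c k) (a k) x * wt (x - a k)) := by
    funext x; simp only [H]; ring
  have hHW : Integrable (fun x => H x * wt (x - a k)) := by
    rw [hHe]; exact integrable_fadd ((integrable_wt _).const_mul _) (hbw.const_mul _)
  have hHI : ∫ x, H x * wt (x - a k) = B * (3 * l) * Real.pi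
      + B * (1 + l⁻¹) * ∫ x, sqDist u (c k) (a k) x * wt (x - a k) := by
    rw [hHe, integral_add ((integrable_wt _).const_mul _) (hbw.const_mul _), integral_const_mul,
      integral_const_mul, integral_wt]
  have mq := hq.memLp hadm (a k)
  have mr := hr.memLp hadm (a k)
  have ms := hs.memLp hadm (a k)
  have me := profile_eta.decay.memLp hadm (a k)
  have msl := decay_solSlope.memLp hadm (a k)
  have bsl := decay_solSlope.bdd hadm (a k)
  have bv := profile_v.decay.bdd hadm (a k)
  have mv := profile_v.decay.memLp hadm (a k)
  have i1 : Integrable (fun x => c k * solEta (c k) (x - a k) * gq (c k) (x - a k)) := by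
    simpa only [mul_assoc] using (integrable_mul_L2 me mq).const_mul (c k)
  have i3 : Integrable (fun x => (solSlope (c k) (x - a k) ^ 2 - solV (c k) (x - a k) ^ 2)
      * gr (c k) (x - a k)) := by
    have := integrable_fsub (bsl.integrable_mul (integrable_mul_L2 msl mr))
      (bv.integrable_mul (integrable_mul_L2 mv mr))
    refine this.congr (.of_forall fun y => ?_)
    simp only; ring
  have i3' : Integrable (fun x => quadFlux u x * gr (c k) (x - a k)) := by
    simpa only [mul_comm] using (hr.bdd hadm (a k)).integrable_mul (integrable_quadFlux hNV)
  have P := fun x => hpt u (c k) (a k) x (hc k) (hu x) l hl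
  have k1 := abs_integral_mul_sub_le (C := Cq) (W := fun x => wt (x - a k)) (H := H)
    (integrable_mul_L2 (memLp_massFlux u) mq) i1 (.of_forall fun x => (P x).1)
    (fun x => hq1 _ (hc k) _) hHW
  have k2 := abs_integral_mul_sub_le (C := Cr) (W := fun x => wt (x - a k)) (H := H)
    (integrable_mul_L2 (memLp_etaC u) mr) (integrable_mul_L2 me mr)
    (.of_forall fun x => (P x).2.1) (fun x => hr1 _ (hc k) _) hHW
  have k3 := abs_integral_mul_sub_le (C := Cr) (W := fun x => wt (x - a k)) (H := H)
    i3' i3 (.of_forall fun x => (P x).2.2.1) (fun x => hr1 _ (hc k) _) hHW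
  have k4 := abs_integral_mul_sub_le (C := Cs) (W := fun x => wt (x - a k)) (H := H)
    (integrable_mul_L2 (memLp_slope hNV) ms) (integrable_mul_L2 msl ms)
    (.of_forall fun x => (P x).2.2.2) (fun x => hs1 _ (hc k) _) hHW
  have htot : C * ∫ x, H x * wt (x - a k) ≤ ε := by
    rw [hHI]
    have j1 : C * B * (1 + l⁻¹) * ∫ x, sqDist u (c k) (a k) x * wt (x - a k)
        ≤ C * B * (1 + l⁻¹) * (C' * (‖u - chain c a‖ ^ 2 + om d₀)) :=
      mul_le_mul_of_nonneg_left hS (by positivity)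
    have j2 : D * (‖u - chain c a‖ ^ 2 + om d₀) ≤ D * (ε / (4 * (D + 1)) + ε / (4 * (D + 1))) := by
      gcongr
    have j3 : C * B * (1 + l⁻¹) * (C' * (‖u - chain c a‖ ^ 2 + om d₀))
        = D * (‖u - chain c a‖ ^ 2 + om d₀) := by simp only [D]; ring
    linarith
  rw [abs_le] at k1 k2 k3 k4
  rw [fluxPair, solFluxPair, abs_le]
  have hexp : C * ∫ x, H x * wt (x - a k) = Cq * (∫ x, H x * wt (x - a k))
    + 2 * (Cr * ∫ x, H x * wt (x - a k)) + Cs * ∫ x, H x * wt (x - a k) := by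
    simp only [C]; ring
  constructor <;> linarith

end

section

open Metric

variable {N : ℕ}

/-! ### Motion of the modulation parameters -/

theorem contDiff_solEta (c : ℝ) : ContDiff ℝ ∞ (solEta c) := by
  have h1 : ContDiff ℝ ∞ fun x : ℝ => Real.cosh (√(2 - c ^ 2) * x / 2) :=
    Real.contDiff_cosh.comp ((contDiff_const.mul contDiff_id).div_const 2)
  exact contDiff_const.div (contDiff_const.mul (h1.pow 2)) fun x =>
    mul_ne_zero two_ne_zero (pow_ne_zero 2 (Real.cosh_pos _).ne')

theorem contDiff_solV {c : ℝ} (h : AdmSpeed c) : ContDiff ℝ ∞ (solV c) :=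
  (contDiff_const.mul (contDiff_solEta c)).neg.div
    (contDiff_const.mul (contDiff_const.sub (contDiff_solEta c))) fun x =>
    mul_ne_zero two_ne_zero (solInv_pos h x).ne'

theorem contDiff_vY {c : ℝ} (h : AdmSpeed c) : ContDiff ℝ ∞ (vY c) := by
  rw [← deriv_solV_eq h]
  exact ((contDiff_infty_iff_deriv (𝕜 := ℝ)).1 (contDiff_solV h)).2

theorem decay_eYY : Decay eYY := profile_eY.dy
theorem decay_vYY : Decay vYY := profile_vY.dy

theorem deriv_comp_sub {f f' : ℝ → ℝ} (h : ∀ y, HasDerivAt f (f' y) y) (a : ℝ) :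
    deriv (fun x => f (x - a)) = fun x => f' (x - a) :=
  funext fun x => (deriv_comp_sub_const (f := f) a x).trans (h _).deriv

section
variable {T : ℝ} {u : ℝ → XSpace} (hu : IsHGPSolution T u)
include hu

theorem IsHGPSolution.hasDerivWithinAt_pair {c : ℝ} (h : AdmSpeed c) (a : ℝ)
    {f fy ψ ψy ψyy : ℝ → ℝ → ℝ} (hf : Decay f) (hfy : Decay fy) (hψ : Decay ψ) (hψy : Decay ψy)
    (hψyy : Decay ψyy) (df : ∀ y, HasDerivAt (f c) (fy c y) y)
    (dψ : ∀ y, HasDerivAt (ψ c) (ψy c y) y) (dψy : ∀ y, HasDerivAt (ψy c) (ψyy c y) y)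
    (hsm : ContDiff ℝ ∞ (ψ c)) {t : ℝ} (ht : t ∈ Icc 0 T) :
    HasDerivWithinAt (fun s => (∫ x, etaC (u s) x * f c (x - a)) + ∫ x, vel (u s) x * ψ c (x - a))
      (fluxPair (u t) (fun x => fy c (x - a)) (fun x => ψy c (x - a)) (fun x => ψyy c (x - a)))
      (Icc 0 T) t := by
  have hd1 := deriv_comp_sub dψ a
  have hd2 : deriv (deriv fun x => ψ c (x - a)) = fun x => ψyy c (x - a) := by
    rw [hd1, deriv_comp_sub dψy a]
  have h1 := hu.hasDerivWithinAt_etaC_of_sob (Sob.of_hasDerivAt (f := fun x => f c (x - a))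
    (fun x => (df (x - a)).comp_sub_const x a) (hf.memLp h a) (hfy.memLp h a)) ht
  have h2 := hu.hasDerivWithinAt_vel_of_memLp (ψ := fun x => ψ c (x - a))
    (hsm.comp (contDiff_id.sub contDiff_const)) (hψ.memLp h a) (by rw [hd1]; exact hψy.memLp h a)
    (by rw [hd2]; exact hψyy.memLp h a) ht
  rw [hd2, hd1] at h2
  exact h1.add h2

theorem IsHGPSolution.hasDerivWithinAt_modMap {x : Fin N → ℝ × ℝ} (hx : ∀ k, AdmSpeed (x k).1)
    {t : ℝ} (ht : t ∈ Icc 0 T) : HasDerivWithinAt (fun s => modMap (u s, x))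
      (fun k =>
        (fluxPair (u t) (fun y => eYY (x k).1 (y - (x k).2)) (fun y => vYY (x k).1 (y - (x k).2))
          (fun y => vYYY (x k).1 (y - (x k).2)),
        fluxPair (u t) (fun y => vY (x k).1 (y - (x k).2)) (fun y => eY (x k).1 (y - (x k).2))
          (fun y => eYY (x k).1 (y - (x k).2)))) (Icc 0 T) t := by
  have key : ∀ {w : XSpace →L[ℝ] L2} {b f : ℝ → ℝ → ℝ}, Decay f → ∀ k v,
      testRem w b f (v, x) k = (∫ y, w v y * f (x k).1 (y - (x k).2))
        - inner ℝ (∑ j, shiftL2 b (x j)) (shiftL2 f (x k)) := by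
    intro w b f hf k v
    rw [testRem, inner_sub_left, inner_L2 (w v)]
    congr 1
    refine integral_congr_ae ?_
    filter_upwards [hf.shiftL2_ae (hx k)] with y hy
    rw [hy]
  have hη : ∀ v (g : ℝ → ℝ), ∫ y, etaL v y * g y = ∫ y, etaC v y * g y := fun v g => by
    refine integral_congr_ae ?_
    filter_upwards [etaC_ae v] with y hy
    rw [hy]; rfl
  refine hasDerivWithinAt_pi.2 fun k => ?_
  have h := hx k
  have e := profile_eta.decay
  have v := profile_v.decay
  have h1 := hu.hasDerivWithinAt_pair h (x k).2 profile_eY.decay decay_eYY profile_vY.decay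
    decay_vYY decay_vYYY (fun y => (pd_eY h y).hasDerivAt_right)
    (fun y => (pd_vY h y).hasDerivAt_right) (hasDerivAt_vYY h) (contDiff_vY h) ht
  have h2 := hu.hasDerivWithinAt_pair h (x k).2 v profile_vY.decay e profile_eY.decay
    decay_eYY (fun y => (pd_v h y).hasDerivAt_right) (fun y => (pd_eta h y).hasDerivAt_right)
    (fun y => (pd_eY h y).hasDerivAt_right) (contDiff_solEta _) ht
  refine HasDerivWithinAt.prodMk ?_ ?_
  · refine (h1.sub_const (inner ℝ (∑ j, shiftL2 solEta (x j)) (shiftL2 eY (x k))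
      + inner ℝ (∑ j, shiftL2 solV (x j)) (shiftL2 vY (x k)))).congr_of_eventuallyEq
      (.of_forall fun s => ?_) ?_
    all_goals
      beta_reduce
      rw [key profile_eY.decay, key profile_vY.decay, hη]
      simp only [coe_velL]
      ring
  · refine (h2.sub_const (inner ℝ (∑ j, shiftL2 solV (x j)) (shiftL2 solEta (x k))
      + inner ℝ (∑ j, shiftL2 solEta (x j)) (shiftL2 solV (x k)))).congr_of_eventuallyEq
      (.of_forall fun s => ?_) ?_
    all_goals
      beta_reduce
      rw [key e, key v, hη]
      simp only [coe_velL]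
      ring

end

/-- The velocities of the positions of `N` solitons. -/
theorem modMatrix_speeds {cs : Fin N → ℝ} (k : Fin N) : modMatrix cs (params 0 cs) k
    = (cs k * (profInner eY eY (cs k) + profInner vY vY (cs k)), 0) := by
  ext <;> simp [modMatrix, modBlock, params]; ring

theorem exists_speed_eq {cs : Fin N → ℝ} (hcs : cs ∈ Adm N) {ε : ℝ} (hε : 0 < ε) : ∃ δ > 0,
    ∀ k b, |b - cs k| ≤ δ → |b * (profInner eY eY b + profInner vY vY b)
      - cs k * (profInner eY eY (cs k) + profInner vY vY (cs k))| ≤ ε := by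
  have h1 : ∀ k, ∀ᶠ δ in 𝓝[>] (0 : ℝ), ∀ b, |b - cs k| ≤ δ →
      |b * (profInner eY eY b + profInner vY vY b)
      - cs k * (profInner eY eY (cs k) + profInner vY vY (cs k))| ≤ ε := by
    intro k
    have hc : ContinuousAt (fun b => b * (profInner eY eY b + profInner vY vY b)) (cs k) :=
      continuousAt_id.mul ((continuousAt_profInner profile_eY.decay profile_eY.decay (hcs k)).add
        (continuousAt_profInner profile_vY.decay profile_vY.decay (hcs k)))
    obtain ⟨d, hd, h⟩ := continuousAt_iff.1 hc ε hε
    filter_upwards [Ioo_mem_nhdsGT hd] with δ hδ b hb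
    exact (h (by rw [Real.dist_eq]; exact hb.trans_lt hδ.2)).le
  obtain ⟨δ, hδ, hδ0⟩ := ((eventually_all.2 h1).and self_mem_nhdsWithin).exists
  exact ⟨δ, hδ0, hδ⟩

theorem IsModulation.params_mem {cs : Fin N → ℝ} {α₁ L₁ K₁ : ℝ} {C A : XSpace → Fin N → ℝ}
    (h : IsModulation cs α₁ L₁ K₁ C A) {α L : ℝ} (hα : α ≤ α₁) (hL : L₁ ≤ L) {u : XSpace}
    {as : Fin N → ℝ} (has : as ∈ Pos N L) (hu : ‖u - chain cs as‖ < α) :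
    ‖u - chain (C u) (A u)‖ ≤ K₁ * α ∧ (∀ k, |C u k - cs k| ≤ K₁ * α) ∧
      (∀ k, |A u k - as k| ≤ K₁ * α) ∧
      params (C u) (A u) ∈ closedBall (params cs as) (K₁ * α) := by
  have hest := h.estimate u ⟨as, Pos.mono hL has, hu.trans_le hα⟩ α L hα hL as has hu.le
  have n0 := norm_nonneg (u - chain (C u) (A u))
  have n1 : 0 ≤ ∑ k, |C u k - cs k| := Finset.sum_nonneg fun _ _ => abs_nonneg _
  have n2 : 0 ≤ ∑ k, |A u k - as k| := Finset.sum_nonneg fun _ _ => abs_nonneg _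
  have hC : ∀ k, |C u k - cs k| ≤ K₁ * α := fun k => by
    have := Finset.single_le_sum (f := fun k => |C u k - cs k|) (fun _ _ => abs_nonneg _)
      (Finset.mem_univ k)
    linarith
  have hA : ∀ k, |A u k - as k| ≤ K₁ * α := fun k => by
    have := Finset.single_le_sum (f := fun k => |A u k - as k|) (fun _ _ => abs_nonneg _)
      (Finset.mem_univ k)
    linarith
  exact ⟨by linarith, hC, hA, mem_closedBall.2 ((dist_pi_le_iff (by linarith)).2 fun k =>
    max_le (hC k) (hA k))⟩

theorem exists_position_ode {cs : Fin N → ℝ} (hcs : cs ∈ Adm N) {α₁ L₁ K₁ : ℝ} (hα₁ : 0 < α₁)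
    (hK₁ : 0 < K₁) {δ₀ : ℝ} (hδ₀ : 0 < δ₀) : ∃ α₄ > 0, α₄ ≤ α₁ ∧ ∃ L₄, L₁ ≤ L₄ ∧
      ∀ C A : XSpace → Fin N → ℝ, IsModulation cs α₁ L₁ K₁ C A → ∀ α L T : ℝ, α ≤ α₄ → L₄ ≤ L →
      ∀ u : ℝ → XSpace, IsHGPSolution T u → (∀ t ∈ Icc 0 T, u t ∈ nbhd cs α L) →
      ∀ t ∈ Icc 0 T, ∃ a' : Fin N → ℝ, ∀ k,
        HasDerivWithinAt (fun s => A (u s) k) (a' k) (Icc 0 T) t ∧ |a' k - cs k| ≤ δ₀ := by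
  obtain ⟨M, hM⟩ := modMatrix_isInvertible hcs
  obtain ⟨K, hK, hMK⟩ : ∃ K > 0, ‖(M.symm : (Fin N → ℝ × ℝ) →L[ℝ] Fin N → ℝ × ℝ)‖ ≤ K :=
    ⟨_ + 1, by positivity, le_add_of_nonneg_right zero_le_one⟩
  have hε : 0 < δ₀ / (8 * K) := by positivity
  have hεM : 0 < min (2 * K)⁻¹ (δ₀ / (8 * K)) := by positivity
  obtain ⟨δn, hδn, Ln, hLn, hnear⟩ := exists_modMap_near hcs hεM
  obtain ⟨κ, hκ, δw, hδw, hwin⟩ := exists_window hcs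
  obtain ⟨m, hm, αm, hαm, Lm, hLm, hle⟩ := exists_nbhd_le hcs
  obtain ⟨δv, hδv, hspeed⟩ := exists_speed_eq hcs (show 0 < δ₀ / (16 * K) by positivity)
  obtain ⟨δf, hδf, df, hdf, hflux1⟩ := exists_flux_close N hκ (sub_pos.2 hm)
    (show 0 < δ₀ / (16 * K) by positivity) decay_eYY decay_vYY decay_vYYY
  obtain ⟨δg, hδg, dg, hdg, hflux2⟩ := exists_flux_close N hκ (sub_pos.2 hm) hε
    profile_vY.decay profile_eY.decay decay_eYY
  have hsm : ∀ᶠ α in 𝓝[>] (0 : ℝ), α ≤ α₁ ∧ α ≤ αm ∧ α ≤ δn ∧ K₁ * α ≤ δn ∧ K₁ * α ≤ δw ∧ K₁ * α ≤ δv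
      ∧ K₁ * α ≤ δf ∧ K₁ * α ≤ δg ∧ K₁ * α ≤ 1 := by
    have h1 : ∀ r > 0, ∀ᶠ α in 𝓝[>] (0 : ℝ), α ≤ r := fun r hr => by
      filter_upwards [Ioo_mem_nhdsGT hr] with α h using h.2.le
    have h2 : ∀ r > 0, ∀ᶠ α in 𝓝[>] (0 : ℝ), K₁ * α ≤ r := fun r hr => by
      filter_upwards [h1 (r / K₁) (by positivity)] with α h
      rwa [le_div_iff₀' hK₁] at h
    filter_upwards [h1 _ hα₁, h1 _ hαm, h1 _ hδn, h2 _ hδn, h2 _ hδw, h2 _ hδv, h2 _ hδf, h2 _ hδg,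
      h2 1 one_pos] with α a1 a2 a3 a4 a5 a6 a7 a8 a9
    exact ⟨a1, a2, a3, a4, a5, a6, a7, a8, a9⟩
  obtain ⟨α₄, ⟨s1, s2, s3, s4, s5, s6, s7, s8, s9⟩, hα₄⟩ := (hsm.and self_mem_nhdsWithin).exists
  obtain ⟨L₄, l1, l2, l3, l4, l5⟩ : ∃ L₄, L₁ ≤ L₄ ∧ Ln ≤ L₄ ∧ Lm ≤ L₄ ∧ df + 2 ≤ L₄ ∧ dg + 2 ≤ L₄ :=
    ⟨max L₁ (max (max Ln Lm) (max (df + 2) (dg + 2))), by simp⟩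
  refine ⟨α₄, hα₄, s1, L₄, l1, fun C A hmod α L T hα hL u hu hnb t ht => ?_⟩
  have hsub : nbhd cs α L ⊆ nbhd cs α₁ L₁ := nbhd_mono cs (hα.trans s1) (l1.trans hL)
  have hK₁α : K₁ * α ≤ K₁ * α₄ := mul_le_mul_of_nonneg_left hα hK₁.le
  obtain ⟨as, has, hua⟩ := hnb t ht
  obtain ⟨b1, b2, b3, b4⟩ := hmod.params_mem (hα.trans s1) (l1.trans hL) has hua
  have hcont : ContinuousOn (fun s => params (C (u s)) (A (u s))) (Icc 0 T) := by
    have c1 := hmod.contDiffOn_speed.continuousOn.comp hu.continuousOn fun s hs => hsub (hnb s hs)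
    have c2 := hmod.contDiffOn_pos.continuousOn.comp hu.continuousOn fun s hs => hsub (hnb s hs)
    exact continuousOn_pi.2 fun k => (continuousOn_pi.1 c1 k).prodMk (continuousOn_pi.1 c2 k)
  set x := params (C (u t)) (A (u t))
  have hadm : ∀ k, AdmSpeed (x k).1 := hmod.adm _ (hsub (hnb t ht))
  have hzero : ∀ s ∈ Icc 0 T, modMap (u s, params (C (u s)) (A (u s))) = 0 := fun s hs =>
    (modMap_eq_zero_iff (hmod.adm _ (hsub (hnb s hs)))).2 (hmod.orth _ (hsub (hnb s hs)))
  obtain ⟨D, hD, hDM⟩ := hnear as (Pos.mono (l2.trans hL) has) (u t) (hua.le.trans (hα.trans s3)) x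
    (closedBall_subset_closedBall (hK₁α.trans s4) b4)
  have hstrict := (contDiffAt_modMap (z := (u t, x)) hadm).hasStrictFDerivAt one_ne_zero
  have hDeq : D = (fderiv ℝ (modMap (N := N)) (u t, x)).comp (.inr ℝ XSpace (Fin N → ℝ × ℝ)) :=
    hD.unique (hstrict.hasFDerivAt.comp x (hasFDerivAt_prodMk_right (u t) x))
  obtain ⟨De, hDe⟩ := isInvertible_of_near M hK hMK (D := D) (by
    rw [hM]; exact hDM.trans (min_le_left _ _))
  have hg := hu.hasDerivWithinAt_modMap hadm ht
  set g : Fin N → ℝ × ℝ := fun k =>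
    (fluxPair (u t) (fun y => eYY (x k).1 (y - (x k).2)) (fun y => vYY (x k).1 (y - (x k).2))
      (fun y => vYYY (x k).1 (y - (x k).2)),
    fluxPair (u t) (fun y => vY (x k).1 (y - (x k).2)) (fun y => eY (x k).1 (y - (x k).2))
      (fun y => eYY (x k).1 (y - (x k).2)))
  have hx' := hasDerivWithinAt_of_implicit (x := fun s => params (C (u s)) (A (u s))) ht hstrict De
    (fun y => by
      change (De : (Fin N → ℝ × ℝ) →L[ℝ] Fin N → ℝ × ℝ) y = _
      rw [hDe, hDeq]; rfl) (hu.continuousOn t ht) (hcont t ht) hzero hg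
  set x' := -De.symm g
  have hDx' : D x' = -g := by
    rw [← hDe]; simp [x']
  set y₀ : Fin N → ℝ × ℝ := params 0 cs
  have hy₀ : ‖y₀‖ ≤ 2 := by
    refine (pi_norm_le_iff_of_nonneg zero_le_two).2 fun k => norm_prod_le_iff.2 ⟨by simp [y₀, params], ?_⟩
    have h2 := (hcs k).sq_lt
    simp only [y₀, params, Real.norm_eq_abs]
    exact abs_le_of_sq_le_sq (by linarith) zero_le_two
  have hgap : ∀ {d}, d + 2 ≤ L₄ → 0 ≤ d → ∀ j k, j ≠ k → d ≤ |A (u t) j - A (u t) k| := by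
    intro d hd hd0 j k hjk
    have g1 := Pos.abs_gap (by linarith) has hjk
    have g2 := b3 j
    have g3 := b3 k
    have g4 : |as j - as k| ≤ |A (u t) j - A (u t) k| + |A (u t) j - as j| + |A (u t) k - as k| := by
      have e : as j - as k = (A (u t) j - A (u t) k) - (A (u t) j - as j) + (A (u t) k - as k) := by
        ring
      rw [e]
      exact (abs_add_le _ _).trans (add_le_add_left (abs_sub _ _) _)
    linarith
  have hsp : ∀ k, C (u t) k ∈ speeds κ := fun k => hwin k _ ((b2 k).trans (hK₁α.trans s5))
  have hμ : ∀ y, 1 - m ≤ 1 - etaC (u t) y := fun y => by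
    have := hle (u t) (nbhd_mono cs (hα.trans s2) (l3.trans hL) (hnb t ht)) y
    linarith
  have hgM : ‖g + modMatrix cs y₀‖ ≤ δ₀ / (8 * K) := by
    refine (pi_norm_le_iff_of_nonneg hε.le).2 fun k => ?_
    have hk : AdmSpeed (C (u t) k) := hadm k
    refine norm_prod_le_iff.2 ⟨?_, ?_⟩
    · have f1 := hflux1 (u t) (C (u t)) (A (u t)) hsp hμ (b1.trans (hK₁α.trans s7)) (hgap l4 hdf) k
      rw [solFluxPair_eq hk (A (u t) k) profile_eY.decay decay_eYY profile_vY.decay decay_vYY decay_vYYY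
        (fun y => (pd_eY hk y).hasDerivAt_right) (fun y => (pd_vY hk y).hasDerivAt_right)
        (hasDerivAt_vYY hk)] at f1
      have f2 := hspeed k (C (u t) k) ((b2 k).trans (hK₁α.trans s6))
      have e : (g + modMatrix cs y₀) k = g k + modMatrix cs (params 0 cs) k := rfl
      rw [e, modMatrix_speeds, Real.norm_eq_abs]
      rw [abs_le] at f1 f2 ⊢
      have e8 : δ₀ / (8 * K) = δ₀ / (16 * K) + δ₀ / (16 * K) := by field_simp; norm_num
      simp only [g, x, params, Prod.fst_add] at f1 ⊢
      rw [e8]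
      constructor <;> linarith
    · have f1 := hflux2 (u t) (C (u t)) (A (u t)) hsp hμ (b1.trans (hK₁α.trans s8)) (hgap l5 hdg) k
      rw [solFluxPair_eq hk (A (u t) k) profile_v.decay profile_vY.decay profile_eta.decay profile_eY.decay
        decay_eYY (fun y => (pd_v hk y).hasDerivAt_right)
        (fun y => (pd_eta hk y).hasDerivAt_right)
        (fun y => (pd_eY hk y).hasDerivAt_right)] at f1
      have f2 := deriv_momentum_translation hk
      rw [profInner_comm solEta vY] at f2
      rw [show profInner eY solV (C (u t) k) + profInner vY solEta (C (u t) k) = 0 by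
        linarith, mul_zero, neg_zero, sub_zero] at f1
      have e : (g + modMatrix cs y₀) k = g k + modMatrix cs (params 0 cs) k := rfl
      rw [e, modMatrix_speeds, Real.norm_eq_abs, Prod.snd_add, add_zero]
      exact f1
  have hfin : ‖x' - y₀‖ ≤ δ₀ := by
    have k1 : D (x' - y₀) = -(g + modMatrix cs y₀) - (D - modMatrix cs) y₀ := by
      rw [map_sub, hDx', sub_apply]; abel
    have k2 : M (x' - y₀) = D (x' - y₀) - (D - modMatrix cs) (x' - y₀) := by
      rw [sub_apply, ← hM]; simp
    have k3 : ‖x' - y₀‖ ≤ K * ‖M (x' - y₀)‖ := by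
      calc ‖x' - y₀‖ = ‖(M.symm : (Fin N → ℝ × ℝ) →L[ℝ] Fin N → ℝ × ℝ) (M (x' - y₀))‖ := by simp
        _ ≤ _ := (ContinuousLinearMap.le_opNorm _ _).trans (by gcongr)
    have k4 : ‖D (x' - y₀)‖ ≤ δ₀ / (8 * K) + δ₀ / (8 * K) * 2 := by
      rw [k1]
      refine (norm_sub_le _ _).trans ?_
      rw [norm_neg]
      refine add_le_add hgM ((ContinuousLinearMap.le_opNorm _ _).trans ?_)
      exact mul_le_mul (hDM.trans (min_le_right _ _)) hy₀ (norm_nonneg _) hε.le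
    have k5 : ‖M (x' - y₀)‖ ≤ δ₀ / (8 * K) + δ₀ / (8 * K) * 2 + (2 * K)⁻¹ * ‖x' - y₀‖ := by
      rw [k2]
      refine (norm_sub_le _ _).trans (add_le_add k4 ((ContinuousLinearMap.le_opNorm _ _).trans ?_))
      exact mul_le_mul_of_nonneg_right (hDM.trans (min_le_left _ _)) (norm_nonneg _)
    have k6 := k3.trans (mul_le_mul_of_nonneg_left k5 hK.le)
    have k7 : K * (δ₀ / (8 * K) + δ₀ / (8 * K) * 2 + (2 * K)⁻¹ * ‖x' - y₀‖)
        = 3 * δ₀ / 8 + ‖x' - y₀‖ / 2 := by field_simp; ring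
    linarith
  refine ⟨fun k => (x' k).2, fun k => ⟨?_, ?_⟩⟩
  · have := hasDerivWithinAt_pi.1 hx' k
    exact this.snd
  · have h1 := (norm_le_pi_norm (x' - y₀) k).trans hfin
    exact (norm_snd_le (x' k - y₀ k)).trans h1

end

/-! ### Localized momenta -/

/-- The transition `½(1 + tanh(l(x - y)))`. -/
def kink (l y x : ℝ) : ℝ := 1 / 2 * (1 + Real.tanh (l * (x - y)))

/-- The derivative of `kink l y`. -/
def kinkX (l y x : ℝ) : ℝ := l / 2 / Real.cosh (l * (x - y)) ^ 2

/-- The second derivative of `kink l y`. -/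
def kinkXX (l y x : ℝ) : ℝ := -2 * l * Real.tanh (l * (x - y)) * kinkX l y x

theorem hasDerivAt_kink (l y x : ℝ) : HasDerivAt (kink l y) (kinkX l y x) x := by
  have h := ((hasDerivAt_tanh _).comp x (((hasDerivAt_id x).sub_const y).const_mul l)).const_add 1
    |>.const_mul (1 / 2)
  refine h.congr_deriv ?_
  simp only [kinkX, id]
  ring

theorem hasDerivAt_kink_center (l y x : ℝ) : HasDerivAt (fun z => kink l z x) (-kinkX l y x) y := by
  have h := ((hasDerivAt_tanh _).comp y (((hasDerivAt_id y).const_sub x).const_mul l)).const_add 1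
    |>.const_mul (1 / 2)
  refine h.congr_deriv ?_
  simp only [kinkX, id]
  ring

theorem kinkX_symm (l y x : ℝ) : kinkX l y x = kinkX l x y := by
  rw [kinkX, kinkX, ← Real.cosh_neg, ← mul_neg, neg_sub]

theorem hasDerivAt_kinkX (l y x : ℝ) : HasDerivAt (kinkX l y) (kinkXX l y x) x := by
  have hp := Real.cosh_pos (l * (x - y))
  have h0 : HasDerivAt (fun x => l * (x - y)) l x := by
    simpa using ((hasDerivAt_id x).sub_const y).const_mul l
  have h := (hasDerivAt_const x (l / 2)).div (h0.cosh.pow 2) (pow_ne_zero 2 hp.ne')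
  refine h.congr_deriv ?_
  simp only [kinkXX, kinkX, Real.tanh_eq_sinh_div_cosh]
  field_simp
  simp
  ring

theorem kinkX_pos {l : ℝ} (hl : 0 < l) (y x : ℝ) : 0 < kinkX l y x := by
  have := Real.cosh_pos (l * (x - y))
  unfold kinkX; positivity

theorem kinkX_le {l : ℝ} (hl : 0 < l) (y x : ℝ) : kinkX l y x ≤ l / 2 :=
  div_le_self (by positivity) (one_le_pow₀ (Real.one_le_cosh _))

theorem abs_kink_le (l y x : ℝ) : |kink l y x| ≤ 1 := by
  have := abs_le.1 (Real.abs_tanh_lt_one (l * (x - y))).le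
  rw [abs_le, kink]
  constructor <;> linarith

theorem abs_kinkXX_le {l : ℝ} (hl : 0 < l) (y x : ℝ) :
    |kinkXX l y x| ≤ 2 * l * kinkX l y x := by
  have h := (Real.abs_tanh_lt_one (l * (x - y))).le
  have h2 := kinkX_pos hl y x
  rw [kinkXX, abs_mul, abs_mul, abs_mul, abs_of_pos h2, abs_of_pos hl, abs_neg, abs_two]
  nlinarith [mul_pos hl h2]

theorem kinkX_le_exp {l : ℝ} (hl : 0 < l) {y x ρ : ℝ} (h : ρ ≤ |x - y|) :
    kinkX l y x ≤ 2 * l * Real.exp (-(2 * l * ρ)) := by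
  have h1 : Real.exp (l * ρ) / 2 ≤ Real.cosh (l * (x - y)) := by
    rw [← Real.cosh_abs, abs_mul, abs_of_pos hl, Real.cosh_eq]
    have h2 : Real.exp (l * ρ) ≤ Real.exp (l * |x - y|) :=
      Real.exp_le_exp.2 (mul_le_mul_of_nonneg_left h hl.le)
    have := Real.exp_pos (-(l * |x - y|))
    linarith
  have h3 : (Real.exp (l * ρ) / 2) ^ 2 ≤ Real.cosh (l * (x - y)) ^ 2 :=
    pow_le_pow_left₀ (by positivity) h1 2
  have h4 : l / 2 / (Real.exp (l * ρ) / 2) ^ 2 = 2 * l * Real.exp (-(2 * l * ρ)) := by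
    rw [Real.exp_neg, show 2 * l * ρ = l * ρ + l * ρ by ring, Real.exp_add]
    field_simp
  rw [← h4]
  exact div_le_div_of_nonneg_left (by positivity) (by positivity) h3

theorem weight2_kink {l : ℝ} (hl : 0 < l) (y : ℝ) :
    Weight2 (kink l y) (kinkX l y) (kinkXX l y) := by
  have c1 : Continuous (kinkX l y) :=
    continuous_iff_continuousAt.2 fun x => (hasDerivAt_kinkX l y x).continuousAt
  have ct : Continuous Real.tanh :=
    continuous_iff_continuousAt.2 fun x => (hasDerivAt_tanh x).continuousAt
  have c2 : Continuous (kinkXX l y) := by unfold kinkXX; fun_prop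
  have b1 : ∀ x, |kinkX l y x| ≤ l / 2 := fun x => by
    rw [abs_of_pos (kinkX_pos hl y x)]; exact kinkX_le hl y x
  have b2 : ∀ x, |kinkXX l y x| ≤ 2 * l * (l / 2) := fun x =>
    (abs_kinkXX_le hl y x).trans (mul_le_mul_of_nonneg_left (kinkX_le hl y x) (by positivity))
  refine ⟨⟨hasDerivAt_kink l y, c1, ⟨1, abs_kink_le l y⟩, ⟨_, b1⟩⟩,
    ⟨hasDerivAt_kinkX l y, c2, ⟨_, b1⟩, ⟨_, b2⟩⟩, ?_, ?_⟩
  · refine memLp_of_bound c1 (C := l / 2) (k := l) (a := y) hl.ne' fun x => ?_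
    rw [abs_of_pos (kinkX_pos hl y x)]; rfl
  · refine memLp_of_bound c2 (C := 2 * l * (l / 2)) (k := l) (a := y) hl.ne' fun x => ?_
    rw [mul_div_assoc]
    exact abs_kinkXX_le hl y x

theorem abs_kink_taylor {l : ℝ} (hl : 0 < l) (y z x : ℝ) :
    |kink l z x - kink l y x + (z - y) * kinkX l y x| ≤ l ^ 2 * (z - y) ^ 2 := by
  have hlip : ∀ w, |kinkX l w x - kinkX l y x| ≤ l ^ 2 * |w - y| := by
    intro w
    have h := convex_univ.norm_image_sub_le_of_norm_hasDerivWithin_le (f := kinkX l x)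
      (f' := kinkXX l x) (C := l ^ 2) (fun v _ => (hasDerivAt_kinkX l x v).hasDerivWithinAt)
      (fun v _ => by
        rw [Real.norm_eq_abs]
        refine (abs_kinkXX_le hl x v).trans ?_
        have := mul_le_mul_of_nonneg_left (kinkX_le hl x v) (show 0 ≤ 2 * l by positivity)
        linarith) (mem_univ y) (mem_univ w)
    rw [kinkX_symm l w x, kinkX_symm l y x]
    exact h
  have h := (convex_uIcc y z).norm_image_sub_le_of_norm_hasDerivWithin_le
    (f := fun w => kink l w x + w * kinkX l y x)
    (f' := fun w => -kinkX l w x + 1 * kinkX l y x) (C := l ^ 2 * |z - y|)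
    (fun w _ => ((hasDerivAt_kink_center l w x).add
      ((hasDerivAt_id w).mul_const _)).hasDerivWithinAt)
    (fun w hw => by
      rw [Real.norm_eq_abs, one_mul, neg_add_eq_sub, abs_sub_comm]
      exact (hlip w).trans (mul_le_mul_of_nonneg_left (abs_sub_left_of_mem_uIcc hw) (sq_nonneg l)))
    left_mem_uIcc right_mem_uIcc
  have e : kink l z x - kink l y x + (z - y) * kinkX l y x
      = kink l z x + z * kinkX l y x - (kink l y x + y * kinkX l y x) := by ring
  rw [e]
  refine h.trans (le_of_eq ?_)
  rw [Real.norm_eq_abs, mul_assoc, ← sq, sq_abs]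

theorem IsHGPSolution.hasDerivWithinAt_moving {T : ℝ} {u : ℝ → XSpace} (hu : IsHGPSolution T u)
    {l : ℝ} (hl : 0 < l) {y : ℝ → ℝ} {y' t : ℝ} (ht : t ∈ Icc 0 T)
    (hy : HasDerivWithinAt y y' (Icc 0 T) t) :
    HasDerivWithinAt (fun s => ∫ x, kink l (y s) x * (etaC (u s) x * vel (u s) x))
      (momRate (kinkX l (y t)) (kinkXX l (y t)) (u t)
        - y' * ∫ x, kinkX l (y t) x * (etaC (u t) x * vel (u t) x)) (Icc 0 T) t := by
  have hfix := hu.hasDerivWithinAt_mom (weight2_kink hl (y t)) ht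
  have ck : ∀ z, Continuous (kink l z) := fun z => (weight2_kink hl z).weight.continuous
  have i0 : ∀ z v, Integrable (fun x => kink l z x * (etaC v x * vel v x)) := fun z v =>
    (weight2_kink hl z).weight.bdd.integrable_mul (integrable_mul_L2 (memLp_etaC v) (memLp_vel v))
  have hmov : HasDerivWithinAt
      (fun s => ∫ x, (kink l (y s) x - kink l (y t) x) * (etaC (u s) x * vel (u s) x))
      (-(y' * ∫ x, kinkX l (y t) x * (etaC (u t) x * vel (u t) x))) (Icc 0 T) t := by
    rw [hasDerivWithinAt_iff_tendsto_slope] at hy ⊢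
    have hsub : Tendsto (fun s => s) (𝓝[Icc 0 T \ {t}] t) (𝓝[Icc 0 T] t) :=
      tendsto_id.mono_right (nhdsWithin_mono _ sdiff_subset)
    have hut := (hu.tendsto ht).comp hsub
    have hyc : Tendsto (fun s => |y s - y t|) (𝓝[Icc 0 T \ {t}] t) (𝓝 0) := by
      have h1 : Tendsto (fun s => (s - t) * _root_.slope y t s) (𝓝[Icc 0 T \ {t}] t) (𝓝 (0 * y')) := by
        refine Tendsto.mul ?_ hy
        have : Tendsto (fun s => s - t) (𝓝 t) (𝓝 (t - t)) := tendsto_id.sub_const t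
        rw [sub_self] at this
        exact this.mono_left nhdsWithin_le_nhds
      rw [zero_mul] at h1
      have h2 := h1.abs
      rw [abs_zero] at h2
      refine h2.congr fun s => ?_
      rw [← smul_eq_mul, sub_smul_slope, vsub_eq_sub]
    have hb : TU (𝓝[Icc 0 T \ {t}] t) (fun s x => (s - t)⁻¹ * (kink l (y s) x - kink l (y t) x))
        (fun x => -(y' * kinkX l (y t) x)) := by
      refine TU.of_tendsto_zero (ε := fun s => |_root_.slope y t s - y'| * (l / 2)
        + l ^ 2 * (|_root_.slope y t s| * |y s - y t|))
        (fun s => continuous_const.mul ((ck _).sub (ck _)))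
        (continuous_const.mul (weight2_kink hl (y t)).weight'.continuous).neg
        ⟨|y'| * (l / 2), fun x => ?_⟩ ?_ ?_
      · rw [abs_neg, abs_mul, abs_of_pos (kinkX_pos hl _ x)]
        exact mul_le_mul_of_nonneg_left (kinkX_le hl _ _) (abs_nonneg _)
      · have h1 := ((hy.sub_const y').abs.mul_const (l / 2)).add ((hy.abs.mul hyc).const_mul (l ^ 2))
        simpa using h1
      · filter_upwards [self_mem_nhdsWithin] with s hs x
        have hst : s - t ≠ 0 := sub_ne_zero.2 hs.2
        have e : (s - t)⁻¹ * (kink l (y s) x - kink l (y t) x) - -(y' * kinkX l (y t) x)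
            = (s - t)⁻¹ * (kink l (y s) x - kink l (y t) x + (y s - y t) * kinkX l (y t) x)
              - (_root_.slope y t s - y') * kinkX l (y t) x := by
          rw [slope_def_field]; field_simp; ring
        have hT := abs_kink_taylor hl (y t) (y s) x
        rw [e]
        refine (abs_sub _ _).trans ?_
        rw [abs_mul, abs_mul, abs_of_pos (kinkX_pos hl _ x), add_comm]
        refine add_le_add (mul_le_mul_of_nonneg_left (kinkX_le hl _ _) (abs_nonneg _)) ?_
        refine (mul_le_mul_of_nonneg_left hT (abs_nonneg _)).trans (le_of_eq ?_)
        rw [slope_def_field, abs_div, ← sq_abs (y s - y t), abs_inv]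
        ring
    have hlim := (hb.mul_TL2 (tL2_etaC hut)).integral_mul (tL2_vel hut)
    have e : ∫ x, -(y' * kinkX l (y t) x) * etaC (u t) x * vel (u t) x
        = -(y' * ∫ x, kinkX l (y t) x * (etaC (u t) x * vel (u t) x)) := by
      rw [← integral_const_mul, ← integral_neg]
      congr 1; funext x; ring
    rw [e] at hlim
    refine hlim.congr fun s => ?_
    rw [slope_def_field, div_eq_inv_mul]
    simp only [sub_self, zero_mul, integral_zero, sub_zero]
    rw [← integral_const_mul]
    congr 1; funext x
    simp only [Function.comp]; ring
  have e : (fun s => ∫ x, kink l (y s) x * (etaC (u s) x * vel (u s) x)) = fun s =>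
      (∫ x, kink l (y t) x * (etaC (u s) x * vel (u s) x))
      + ∫ x, (kink l (y s) x - kink l (y t) x) * (etaC (u s) x * vel (u s) x) := by
    funext s
    have : (fun x => (kink l (y s) x - kink l (y t) x) * (etaC (u s) x * vel (u s) x))
        = fun x => kink l (y s) x * (etaC (u s) x * vel (u s) x)
          - kink l (y t) x * (etaC (u s) x * vel (u s) x) := by funext x; ring
    rw [this, integral_sub (i0 _ _) (i0 _ _)]
    ring
  rw [e]
  exact hfix.add hmov

theorem momentum_form_nonneg {ν e v s r c : ℝ} (hν : ν ^ 2 ≤ 2) (he : |e| ≤ ν ^ 2 / 16)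
    (hr : |r| ≤ ν / 8) (hc : c ^ 2 ≤ 2 - ν ^ 2 / 2) :
    0 ≤ (1 - 2 * e) * v ^ 2 + (3 - 2 * e) * s ^ 2 + 1 / 2 * e ^ 2 + c * (e * v) + r * (s * e) := by
  obtain ⟨h1, h2⟩ := abs_le.1 he
  have hr2 : r ^ 2 ≤ ν ^ 2 / 64 := by
    have := pow_le_pow_left₀ (abs_nonneg r) hr 2
    rw [sq_abs] at this; nlinarith
  have k1 : r * (s * e) ≥ -(s ^ 2 + r ^ 2 / 4 * e ^ 2) := by nlinarith [sq_nonneg (s + r / 2 * e)]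
  have k2 : r ^ 2 / 4 * e ^ 2 ≤ ν ^ 2 / 256 * e ^ 2 :=
    mul_le_mul_of_nonneg_right (by linarith) (sq_nonneg e)
  have k3 : 0 ≤ (2 - 2 * e) * s ^ 2 := mul_nonneg (by linarith) (sq_nonneg s)
  have k4 : (1 - ν ^ 2 / 8) * v ^ 2 ≤ (1 - 2 * e) * v ^ 2 :=
    mul_le_mul_of_nonneg_right (by linarith) (sq_nonneg v)
  have hw : 0 < 1 - ν ^ 2 / 8 := by linarith
  have k5 : 0 ≤ (1 - ν ^ 2 / 8) * v ^ 2 + c * (e * v) + (1 / 2 - ν ^ 2 / 256) * e ^ 2 := by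
    have h5 : 0 ≤ (2 * (1 - ν ^ 2 / 8) * v + c * e) ^ 2 := sq_nonneg _
    have h6 : c ^ 2 * e ^ 2 ≤ 4 * (1 - ν ^ 2 / 8) * (1 / 2 - ν ^ 2 / 256) * e ^ 2 := by
      refine mul_le_mul_of_nonneg_right ?_ (sq_nonneg e)
      nlinarith [sq_nonneg (ν ^ 2)]
    have h7 : 0 ≤ 4 * (1 - ν ^ 2 / 8)
        * ((1 - ν ^ 2 / 8) * v ^ 2 + c * (e * v) + (1 / 2 - ν ^ 2 / 256) * e ^ 2) := by
      nlinarith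
    exact (mul_nonneg_iff_of_pos_left (by linarith)).1 h7
  nlinarith

theorem momentum_form_ge {M e v s r c : ℝ} (he : |e| ≤ M) (hr : |r| ≤ 2) (hc : |c| ≤ 2) :
    -((2 * M + 2) * (e ^ 2 + s ^ 2 + v ^ 2)) ≤
      (1 - 2 * e) * v ^ 2 + (3 - 2 * e) * s ^ 2 + 1 / 2 * e ^ 2 + c * (e * v) + r * (s * e) := by
  obtain ⟨h1, h2⟩ := abs_le.1 he
  obtain ⟨r1, r2⟩ := abs_le.1 hr
  obtain ⟨c1, c2⟩ := abs_le.1 hc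
  have hM : 0 ≤ M := (abs_nonneg _).trans he
  have k1 : -(2 * |e * v|) ≤ c * (e * v) := by
    have := abs_mul c (e * v)
    nlinarith [neg_abs_le (c * (e * v)), abs_nonneg (e * v)]
  have k2 : -(2 * |s * e|) ≤ r * (s * e) := by
    have := abs_mul r (s * e)
    nlinarith [neg_abs_le (r * (s * e)), abs_nonneg (s * e)]
  have k3 : 2 * |e * v| ≤ e ^ 2 + v ^ 2 := by
    rw [abs_mul]; nlinarith [sq_nonneg (|e| - |v|), sq_abs e, sq_abs v]
  have k4 : 2 * |s * e| ≤ e ^ 2 + s ^ 2 := by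
    rw [abs_mul]; nlinarith [sq_nonneg (|s| - |e|), sq_abs e, sq_abs s]
  have k5 : -(2 * M * v ^ 2) ≤ -(2 * e) * v ^ 2 := by nlinarith [sq_nonneg v]
  have k6 : -(2 * M * s ^ 2) ≤ -(2 * e) * s ^ 2 := by nlinarith [sq_nonneg s]
  nlinarith [sq_nonneg e, sq_nonneg v, sq_nonneg s, mul_nonneg hM (sq_nonneg e)]

theorem momRate_kink_le {ν : ℝ} (hν : 0 < ν) (hν2 : ν ^ 2 ≤ 2) {u : XSpace} {μ : ℝ} (hμ : 0 < μ)
    (hu : ∀ x, μ ≤ 1 - etaC u x) {c y ρ : ℝ} (hc : c ^ 2 ≤ 2 - ν ^ 2 / 2)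
    (hsmall : ∀ x, |x - y| ≤ ρ → |etaC u x| ≤ ν ^ 2 / 16) :
    momRate (kinkX (ν / 16) y) (kinkXX (ν / 16) y) u
        - c * (∫ x, kinkX (ν / 16) y x * (etaC u x * vel u x))
      ≤ ν / 8 * Real.exp (-(ν / 8 * ρ)) * ((4 * ‖u‖ + 2) * ((1 + ((2 * μ)⁻¹) ^ 2) * ‖u‖ ^ 2)) := by
  have hl : 0 < ν / 16 := by positivity
  have hnv := mem_NV_of_le hμ hu
  have w := weight2_kink hl y
  have he := memLp_etaC u
  have hv := memLp_vel u
  have hs := memLp_slope hnv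
  set l := ν / 16
  have i1 : Integrable (fun x => etaC u x ^ 2 + slope u x ^ 2 + vel u x ^ 2) :=
    integrable_fadd (integrable_fadd he.integrable_sq hs.integrable_sq) hv.integrable_sq
  have bη : Bdd (etaC u) := ⟨(continuous_etaC u).aestronglyMeasurable, _, abs_etaC_le u⟩
  have B1 := w.weight.bdd'
  have B2 := w.weight'.bdd'
  have j1 : Integrable (fun x => kinkX l y x * ((1 - 2 * etaC u x) * vel u x ^ 2
      + (3 - 2 * etaC u x) * slope u x ^ 2 + 1 / 2 * etaC u x ^ 2)) :=
    B1.integrable_mul (integrable_fadd (integrable_fadd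
      (((Bdd.const 1).sub ((Bdd.const 2).mul bη)).integrable_mul hv.integrable_sq)
      (((Bdd.const 3).sub ((Bdd.const 2).mul bη)).integrable_mul hs.integrable_sq))
      (he.integrable_sq.const_mul _))
  have j2 : Integrable (fun x => kinkXX l y x * (slope u x * etaC u x)) :=
    B2.integrable_mul (integrable_mul_L2 hs he)
  have j3 : Integrable (fun x => c * (kinkX l y x * (etaC u x * vel u x))) :=
    (B1.integrable_mul (integrable_mul_L2 he hv)).const_mul c
  have hbound : -(∫ x, ν / 8 * Real.exp (-(ν / 8 * ρ)) * ((4 * ‖u‖ + 2)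
        * (etaC u x ^ 2 + slope u x ^ 2 + vel u x ^ 2)))
      ≤ ∫ x, (kinkX l y x * ((1 - 2 * etaC u x) * vel u x ^ 2
      + (3 - 2 * etaC u x) * slope u x ^ 2 + 1 / 2 * etaC u x ^ 2)
      + kinkXX l y x * (slope u x * etaC u x) + c * (kinkX l y x * (etaC u x * vel u x))) := by
    rw [← integral_neg]
    refine integral_mono ((i1.const_mul _).const_mul _).neg
      (integrable_fadd (integrable_fadd j1 j2) j3) fun x => ?_
    have hp := kinkX_pos hl y x
    have hr := (Real.abs_tanh_lt_one (l * (x - y))).le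
    have hr1 : |-2 * l * Real.tanh (l * (x - y))| ≤ ν / 8 := by
      rw [abs_mul, abs_mul, abs_of_pos hl, abs_neg, abs_two]
      have : l = ν / 16 := rfl
      nlinarith
    have e : kinkX l y x * ((1 - 2 * etaC u x) * vel u x ^ 2
      + (3 - 2 * etaC u x) * slope u x ^ 2 + 1 / 2 * etaC u x ^ 2)
      + kinkXX l y x * (slope u x * etaC u x) + c * (kinkX l y x * (etaC u x * vel u x))
      = kinkX l y x * ((1 - 2 * etaC u x) * vel u x ^ 2 + (3 - 2 * etaC u x) * slope u x ^ 2
      + 1 / 2 * etaC u x ^ 2 + c * (etaC u x * vel u x)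
      + (-2 * l * Real.tanh (l * (x - y))) * (slope u x * etaC u x)) := by
      rw [kinkXX]; ring
    beta_reduce
    rw [e]
    have hn : 0 ≤ (4 * ‖u‖ + 2) * (etaC u x ^ 2 + slope u x ^ 2 + vel u x ^ 2) := by positivity
    rcases le_or_gt |x - y| ρ with h | h
    · have h1 := mul_nonneg hp.le (momentum_form_nonneg (v := vel u x) (s := slope u x) hν2
        (hsmall x h) hr1 hc)
      refine le_trans ?_ h1
      rw [neg_nonpos]
      positivity
    · have hν' : ν ≤ 2 := by nlinarith
      have h1 := momentum_form_ge (v := vel u x) (s := slope u x) (c := c) (abs_etaC_le u x)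
        (hr1.trans (by linarith)) (abs_le_of_sq_le_sq (by nlinarith) zero_le_two)
      have h2 := kinkX_le_exp hl h.le
      have h3 : 2 * l * Real.exp (-(2 * l * ρ)) = ν / 8 * Real.exp (-(ν / 8 * ρ)) := by
        have : 2 * l = ν / 8 := by simp only [l]; ring
        rw [this]
      rw [h3] at h2
      have h4 := mul_le_mul_of_nonneg_right h2 hn
      have h5 := mul_le_mul_of_nonneg_left h1 hp.le
      have h6 : 2 * (2 * ‖u‖) + 2 = 4 * ‖u‖ + 2 := by ring
      rw [h6] at h5
      linarith
  rw [integral_add (integrable_fadd j1 j2) j3, integral_add j1 j2, integral_const_mul,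
    integral_const_mul, integral_const_mul] at hbound
  have hnorm : ∫ x, (etaC u x ^ 2 + slope u x ^ 2 + vel u x ^ 2)
      ≤ (1 + ((2 * μ)⁻¹) ^ 2) * ‖u‖ ^ 2 := by
    rw [integral_add (integrable_fadd he.integrable_sq hs.integrable_sq) hv.integrable_sq,
      integral_add he.integrable_sq hs.integrable_sq, ← N2_sq he, ← N2_sq hv]
    have hslope : ∫ x, slope u x ^ 2 ≤ ((2 * μ)⁻¹) ^ 2 * N2 (etaX u) ^ 2 := by
      rw [N2_sq (memLp_etaX u), ← integral_const_mul]
      refine integral_mono hs.integrable_sq ((memLp_etaX u).integrable_sq.const_mul _) fun x => ?_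
      have h1 := hu x
      beta_reduce
      rw [slope, div_eq_inv_mul, mul_pow]
      refine mul_le_mul_of_nonneg_right ?_ (sq_nonneg _)
      have h2 : (2 * (1 - etaC u x))⁻¹ ≤ (2 * μ)⁻¹ := inv_anti₀ (by positivity) (by linarith)
      exact pow_le_pow_left₀ (inv_nonneg.2 (by linarith)) h2 2
    have h0 := norm_sq_eq u
    have p1 := mul_nonneg (sq_nonneg (2 * μ)⁻¹) (sq_nonneg (N2 (etaC u)))
    have p2 := mul_nonneg (sq_nonneg (2 * μ)⁻¹) (sq_nonneg (N2 (vel u)))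
    have p3 := sq_nonneg (N2 (etaX u))
    rw [h0]
    linarith
  have hfin := mul_le_mul_of_nonneg_left (mul_le_mul_of_nonneg_left hnorm
    (show 0 ≤ 4 * ‖u‖ + 2 by positivity)) (show 0 ≤ ν / 8 * Real.exp (-(ν / 8 * ρ)) by positivity)
  unfold momRate
  linarith

section

variable {N : ℕ}

/-! ### Almost monotonicity -/

theorem exists_norm_chain_le {cs : Fin N → ℝ} (hcs : cs ∈ Adm N) :
    ∃ C, 0 ≤ C ∧ ∀ a : Fin N → ℝ, ‖chain cs a‖ ≤ C := by
  obtain ⟨κ, hκ, δ, hδ, hwin⟩ := exists_window hcs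
  obtain ⟨C₁, hC₁, h1⟩ := norm_shiftL2_le profile_eta.decay hκ
  obtain ⟨C₂, hC₂, h2⟩ := norm_shiftL2_le profile_eY.decay hκ
  obtain ⟨C₃, hC₃, h3⟩ := norm_shiftL2_le profile_v.decay hκ
  refine ⟨N * (C₁ + C₂ + C₃), by positivity, fun a => ?_⟩
  have hterm : ∀ k ∈ Finset.univ, ‖soliton (cs k) (a k)‖ ≤ C₁ + C₂ + C₃ := by
    intro k _
    have hk : (cs k, a k).1 ∈ speeds κ := hwin k _ (by simpa using hδ.le)
    have hadm : AdmSpeed (cs k, a k).1 := hcs k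
    have h := norm_le_components (soliton (cs k, a k).1 (cs k, a k).2)
    rw [etaL_soliton hadm, etaXL_soliton hadm, velL_soliton hadm] at h
    linarith [h1 _ hk, h2 _ hk, h3 _ hk]
  refine (norm_sum_le_of_le _ hterm).trans (le_of_eq ?_)
  rw [Finset.sum_const, Finset.card_univ, Fintype.card_fin, nsmul_eq_mul]

theorem AdmSpeed.abs_le {c : ℝ} (h : AdmSpeed c) : |c| ≤ 3 / 2 :=
  abs_le_of_sq_le_sq (by linarith [h.sq_lt]) (by norm_num)

theorem nuMin_le (cs : Fin N → ℝ) (k : Fin N) : nuMin cs ≤ √(2 - cs k ^ 2) :=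
  ciInf_le (Set.finite_range _).bddBelow k

theorem nuMin_pos [Nonempty (Fin N)] {cs : Fin N → ℝ} (hcs : cs ∈ Adm N) : 0 < nuMin cs := by
  obtain ⟨k, hk⟩ := exists_eq_ciInf_of_finite (f := fun k => √(2 - cs k ^ 2))
  rw [nuMin, ← hk]
  exact Real.sqrt_pos.2 (by linarith [(hcs k).sq_lt])

theorem nuMin_sq_le [Nonempty (Fin N)] {cs : Fin N → ℝ} (hcs : cs ∈ Adm N) (k : Fin N) :
    nuMin cs ^ 2 ≤ 2 - cs k ^ 2 := by
  have h := pow_le_pow_left₀ (nuMin_pos hcs).le (nuMin_le cs k) 2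
  rwa [Real.sq_sqrt (by linarith [(hcs k).sq_lt])] at h

theorem sigmaMin_le (cs : Fin N → ℝ) {j k : Fin N} (h : (k : ℕ) = j + 1) :
    sigmaMin cs ≤ (cs k - cs j) / 2 := by
  have := ciInf_le (Set.finite_range
    fun p : {p : Fin N × Fin N // (p.2 : ℕ) = p.1 + 1} => cs p.1.2 - cs p.1.1).bddBelow ⟨(j, k), h⟩
  unfold sigmaMin
  linarith

theorem exists_speed_margin [Nonempty (Fin N)] {cs : Fin N → ℝ} (hcs : cs ∈ Adm N)
    (hord : StrictMono cs) : ∃ δ > 0,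
      (∀ j k : Fin N, (k : ℕ) = j + 1 → sigmaMin cs ≤ cs k - cs j - 2 * δ) ∧
      ∀ k b, |b - cs k| ≤ δ → b ^ 2 ≤ 2 - nuMin cs ^ 2 / 2 := by
  have hν := nuMin_pos hcs
  have h1 : ∀ j k : Fin N, ∀ᶠ δ in 𝓝[>] (0 : ℝ), (k : ℕ) = j + 1 →
      sigmaMin cs ≤ cs k - cs j - 2 * δ := by
    intro j k
    by_cases h : (k : ℕ) = j + 1
    · have hlt : cs j < cs k := hord (Fin.lt_def.2 (by omega))
      filter_upwards [Ioo_mem_nhdsGT (show 0 < (cs k - cs j) / 4 by linarith)] with δ hδ _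
      have := sigmaMin_le cs h
      linarith [hδ.2]
    · exact .of_forall fun _ h' => absurd h' h
  have h2 : ∀ᶠ δ in 𝓝[>] (0 : ℝ), ∀ k b, |b - cs k| ≤ δ → b ^ 2 ≤ 2 - nuMin cs ^ 2 / 2 := by
    filter_upwards [Ioo_mem_nhdsGT (show 0 < min 1 (nuMin cs ^ 2 / 8) by positivity)] with δ hδ k b hb
    have d1 := hδ.2.trans_le (min_le_left _ _)
    have d2 := hδ.2.trans_le (min_le_right _ _)
    have hc := nuMin_sq_le hcs k
    have hc2 : |cs k| ≤ 3 / 2 := (hcs k).abs_le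
    have hb2 : |b| ≤ |cs k| + δ := by
      have := abs_add_le (cs k) (b - cs k)
      rw [add_sub_cancel] at this
      linarith
    have h3 := pow_le_pow_left₀ (abs_nonneg b) hb2 2
    rw [sq_abs, add_sq, sq_abs] at h3
    nlinarith [abs_nonneg (cs k), hδ.1]
  obtain ⟨δ, ⟨h1, h2⟩, h0⟩ := (((eventually_all.2 fun j => eventually_all.2 (h1 j)).and h2).and
    self_mem_nhdsWithin).exists
  exact ⟨δ, h0, h1, h2⟩

theorem sum_speed_mul_sub (f q : ℕ → ℝ) (n : ℕ) :
    ∑ k ∈ Finset.range (n + 1), f k * (q k - q (k + 1))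
      = f 0 * q 0 - f n * q (n + 1) + ∑ k ∈ Finset.range n, (f (k + 1) - f k) * q (k + 1) := by
  induction n with
  | zero => simp; ring
  | succ n ih => rw [Finset.sum_range_succ, ih, Finset.sum_range_succ]; ring

theorem sum_speed_mul_sub_le {cs : Fin N → ℝ} (hcs : cs ∈ Adm N) (hord : StrictMono cs)
    {q : ℕ → ℝ} {B : ℝ} (hB : 0 ≤ B) (h0 : q 0 = 0) (hN : q N = 0) (hq : ∀ k, q k ≤ B) :
    ∑ k : Fin N, cs k * (q k - q (k + 1)) ≤ 3 * N * B := by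
  obtain _ | n := N
  · simp
  set f : ℕ → ℝ := fun k => if h : k < n + 1 then cs ⟨k, h⟩ else 0
  have e : ∑ k : Fin (n + 1), cs k * (q k - q (k + 1))
      = ∑ k ∈ Finset.range (n + 1), f k * (q k - q (k + 1)) := by
    rw [Finset.sum_range]
    refine Finset.sum_congr rfl fun k _ => ?_
    simp only [f, dif_pos k.2]
  rw [e, sum_speed_mul_sub, h0, hN, mul_zero, mul_zero, sub_zero, zero_add]
  have hterm : ∀ k ∈ Finset.range n, (f (k + 1) - f k) * q (k + 1) ≤ 3 * B := by
    intro k hk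
    have hk' := Finset.mem_range.1 hk
    have e1 : f (k + 1) = cs ⟨k + 1, by omega⟩ := dif_pos _
    have e2 : f k = cs ⟨k, by omega⟩ := dif_pos _
    have hlt : cs ⟨k, by omega⟩ < cs ⟨k + 1, by omega⟩ := hord (Fin.lt_def.2 (Nat.lt_succ_self k))
    have b1 := abs_le.1 (hcs ⟨k, by omega⟩).abs_le
    have b2 := abs_le.1 (hcs ⟨k + 1, by omega⟩).abs_le
    rw [e1, e2]
    exact (mul_le_mul_of_nonneg_left (hq _) (by linarith)).trans
      (mul_le_mul_of_nonneg_right (by linarith [b1.1, b2.2]) hB)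
  refine (Finset.sum_le_sum hterm).trans ?_
  rw [Finset.sum_const, Finset.card_range, nsmul_eq_mul]
  push_cast
  nlinarith

theorem cutoff_of_lt (cs a : Fin N → ℝ) {k : ℕ} (h : k + 1 < N) : cutoff cs a (k + 1)
    = kink (nuMin cs / 16) ((a ⟨k, by omega⟩ + a ⟨k + 1, h⟩) / 2) := by
  funext x
  rw [cutoff, if_neg (Nat.succ_ne_zero k), dif_pos h]
  rfl

theorem cutoff_of_ge (cs a : Fin N → ℝ) {k : ℕ} (h0 : k ≠ 0) (h : N ≤ k) :
    cutoff cs a k = fun _ => 0 := by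
  funext x
  rw [cutoff, if_neg h0, dif_neg (not_lt.2 h)]

theorem bdd_cutoff [Nonempty (Fin N)] {cs : Fin N → ℝ} (hcs : cs ∈ Adm N) (a : Fin N → ℝ) (k : ℕ) :
    Bdd (cutoff cs a k) := by
  obtain _ | k := k
  · exact Bdd.const 1
  · rcases lt_or_ge (k + 1) N with h | h
    · rw [cutoff_of_lt cs a h]
      exact (weight2_kink (div_pos (nuMin_pos hcs) (by norm_num)) _).weight.bdd
    · rw [cutoff_of_ge cs a (Nat.succ_ne_zero k) h]
      exact Bdd.const 0

theorem locMomentum_eq (cs a : Fin N → ℝ) (k : ℕ) (u : XSpace) :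
    locMomentum cs a k u = 1 / 2 * ∫ x, cutoff cs a k x * (etaC u x * vel u x) := by
  rw [locMomentum, ← integral_const_mul]
  refine integral_congr_ae ?_
  filter_upwards [etaC_ae u] with x hx
  rw [momDensity, hx]; ring

theorem integrable_momDensity (u : XSpace) : Integrable (momDensity u) := by
  refine ((integrable_mul_L2 (memLp_etaC u) (memLp_vel u)).const_mul (1 / 2)).congr ?_
  filter_upwards [etaC_ae u] with x hx
  rw [momDensity, hx]

theorem functionalG_eq [Nonempty (Fin N)] {cs : Fin N → ℝ} (hcs : cs ∈ Adm N) (a : Fin N → ℝ)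
    (u : XSpace) : functionalG cs a u = energy u
      + ∑ k : Fin N, cs k * (locMomentum cs a k u - locMomentum cs a (k + 1) u) := by
  rw [functionalG]
  congr 1
  refine Finset.sum_congr rfl fun k _ => ?_
  rw [locMomentum, locMomentum, ← integral_sub
    ((bdd_cutoff hcs a k).integrable_mul (integrable_momDensity u))
    ((bdd_cutoff hcs a (k + 1)).integrable_mul (integrable_momDensity u))]
  congr 2; funext x; ring

theorem Pos.abs_sub_midpoint {L : ℝ} (hL : 2 ≤ L) {as a : Fin N → ℝ} (has : as ∈ Pos N L)
    (hclose : ∀ k, |a k - as k| ≤ 1) {k : ℕ} (hk : k + 1 < N) {x R : ℝ}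
    (hx : |x - (a ⟨k, by omega⟩ + a ⟨k + 1, hk⟩) / 2|
      ≤ (a ⟨k + 1, hk⟩ - a ⟨k, by omega⟩) / 2 - R) (j : Fin N) : R - 1 ≤ |x - as j| := by
  obtain ⟨x1, x2⟩ := abs_le.1 hx
  have hj := abs_le.1 (hclose j)
  have h0 := abs_le.1 (hclose ⟨k, by omega⟩)
  have h1 := abs_le.1 (hclose ⟨k + 1, hk⟩)
  rcases Nat.lt_or_ge (j : ℕ) (k + 1) with h | h
  · refine le_trans ?_ (le_abs_self _)
    rcases Nat.lt_or_ge (j : ℕ) k with h' | h'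
    · have := Pos.gap (by linarith) has (Fin.lt_def.2 h' : j < ⟨k, by omega⟩)
      linarith
    · rw [show j = ⟨k, by omega⟩ from Fin.ext (by simp only; omega)] at hj ⊢
      linarith
  · refine le_trans ?_ (neg_le_abs _)
    rcases Nat.lt_or_ge (k + 1) j with h' | h'
    · have := Pos.gap (by linarith) has (Fin.lt_def.2 h' : (⟨k + 1, hk⟩ : Fin N) < j)
      linarith
    · rw [show j = ⟨k + 1, hk⟩ from Fin.ext (by simp only; omega)] at hj ⊢
      linarith

theorem exists_small_between {cs : Fin N → ℝ} (hcs : cs ∈ Adm N) {ε : ℝ} (hε : 0 < ε) :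
    ∃ R > 0, ∀ (L : ℝ) (as a : Fin N → ℝ) (u : XSpace), 2 ≤ L → as ∈ Pos N L →
      (∀ k, |a k - as k| ≤ 1) → ‖u - chain cs as‖ ≤ ε / 4 → ∀ (k : ℕ) (hk : k + 1 < N) (x : ℝ),
      |x - (a ⟨k, by omega⟩ + a ⟨k + 1, hk⟩) / 2|
        ≤ (a ⟨k + 1, hk⟩ - a ⟨k, by omega⟩) / 2 - R → |etaC u x| ≤ ε := by
  obtain ⟨C, hC, htail⟩ := exists_tail_bound hcs
  obtain ⟨d, hd, hd0⟩ := ((eventually_mul_wt_le C (half_pos hε)).and (eventually_ge_atTop 0)).exists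
  refine ⟨d + 1, by linarith, fun L as a u hL has hclose hu k hk x hx => ?_⟩
  have h1 := htail Finset.univ as x d hd0 fun j _ => by
    have := Pos.abs_sub_midpoint hL has hclose hk hx j
    linarith
  have h2 := abs_etaC_sub_le u (chain cs as) x
  rw [etaC_chain hcs] at h2
  have h3 : 0 ≤ ∑ j, solEta (cs j) (x - as j) :=
    Finset.sum_nonneg fun j _ => solEta_nonneg (hcs j) _
  have h4 := abs_le.1 h2
  rw [abs_le]
  constructor <;> linarith

theorem le_of_hasDerivWithinAt_ge {T σ : ℝ} {f f' : ℝ → ℝ}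
    (hf : ∀ s ∈ Icc 0 T, HasDerivWithinAt f (f' s) (Icc 0 T) s) (h : ∀ s ∈ Icc 0 T, σ ≤ f' s)
    {t : ℝ} (ht : t ∈ Icc 0 T) : f 0 + σ * t ≤ f t := by
  have hT : (0 : ℝ) ∈ Icc 0 T := ⟨le_rfl, ht.1.trans ht.2⟩
  have hd : ∀ s ∈ interior (Icc 0 T), HasDerivAt f (f' s) s := fun s hs =>
    (hf s (interior_subset hs)).hasDerivAt (mem_interior_iff_mem_nhds.1 hs)
  have := (convex_Icc 0 T).mul_sub_le_image_sub_of_le_deriv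
    (fun s hs => (hf s hs).continuousWithinAt)
    (fun s hs => (hd s hs).differentiableAt.differentiableWithinAt)
    (fun s hs => by rw [(hd s hs).deriv]; exact h s (interior_subset hs)) 0 hT t ht ht.1
  rw [sub_zero] at this
  linarith

theorem exists_momentum_monotonicity [Nonempty (Fin N)] {cs : Fin N → ℝ} (hcs : cs ∈ Adm N)
    (hord : StrictMono cs) {α₁ L₁ K₁ : ℝ} (hα₁ : 0 < α₁) (hK₁ : 0 < K₁) :
    ∃ α₄ > 0, α₄ ≤ α₁ ∧ ∃ L₄, L₁ ≤ L₄ ∧ ∃ K > 0,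
      ∀ C A : XSpace → Fin N → ℝ, IsModulation cs α₁ L₁ K₁ C A → ∀ α L T : ℝ, α ≤ α₄ → L₄ ≤ L →
      ∀ u : ℝ → XSpace, IsHGPSolution T u → (∀ t ∈ Icc 0 T, u t ∈ nbhd cs α L) →
      ∀ t ∈ Icc 0 T, ∃ q : ℕ → ℝ, q 0 = 0 ∧ q N = 0 ∧ ∀ k,
        HasDerivWithinAt (fun s => locMomentum cs (A (u s)) k (u s)) (q k) (Icc 0 T) t ∧
        q k ≤ K * Real.exp (-(nuMin cs * (L + sigmaMin cs * t) / 16)) := by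
  have hN : 0 < N := Fin.pos_iff_nonempty.2 inferInstance
  have hν := nuMin_pos hcs
  obtain ⟨δ₀, hδ₀, hgapσ, hsq⟩ := exists_speed_margin hcs hord
  obtain ⟨m, hm, αm, hαm, Lm, hLm, hle⟩ := exists_nbhd_le hcs
  obtain ⟨α₀, hα₀, hα₀₁, L₀, hL₀, hode⟩ := exists_position_ode hcs (L₁ := L₁) hα₁ hK₁ hδ₀
  obtain ⟨R, hR, hsmall⟩ := exists_small_between hcs (show 0 < nuMin cs ^ 2 / 16 by positivity)
  obtain ⟨M, hM, hMchain⟩ := exists_norm_chain_le hcs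
  obtain ⟨ν, hνe⟩ : ∃ ν, ν = nuMin cs := ⟨_, rfl⟩
  obtain ⟨σ, hσe⟩ : ∃ σ, σ = sigmaMin cs := ⟨_, rfl⟩
  rw [← hνe] at hν hsmall hsq ⊢
  rw [← hσe] at hgapσ ⊢
  have hν2 : ν ^ 2 ≤ 2 := by
    have := nuMin_sq_le hcs ⟨0, hN⟩
    rw [← hνe] at this
    linarith [sq_nonneg (cs ⟨0, hN⟩)]
  have hμ : 0 < 1 - m := sub_pos.2 hm
  obtain ⟨α₄, hα₄, a1, a2, a3, a4⟩ : ∃ α₄ > 0, α₄ ≤ α₀ ∧ α₄ ≤ αm ∧ K₁ * α₄ ≤ 1 / 2 ∧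
      α₄ ≤ ν ^ 2 / 16 / 4 := by
    refine ⟨min (min α₀ αm) (min (1 / 2 / K₁) (ν ^ 2 / 16 / 4)), by positivity,
      (min_le_left _ _).trans (min_le_left _ _), (min_le_left _ _).trans (min_le_right _ _), ?_,
      (min_le_right _ _).trans (min_le_right _ _)⟩
    have h := (min_le_right (min α₀ αm) (min (1 / 2 / K₁) (ν ^ 2 / 16 / 4))).trans (min_le_left _ _)
    rwa [le_div_iff₀' hK₁] at h
  set D : ℝ := (4 * (M + α₄) + 2) * ((1 + ((2 * (1 - m))⁻¹) ^ 2) * (M + α₄) ^ 2)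
  have hD : 0 ≤ D := by positivity
  refine ⟨α₄, hα₄, a1.trans hα₀₁, max (max L₀ Lm) 2, hL₀.trans ((le_max_left _ _).trans
    (le_max_left _ _)), 1 / 2 * (ν / 8 * Real.exp (ν / 16 + ν / 8 * R)) * D + 1, by positivity,
    fun C A hmod α L T hα hL u hu hnb t ht => ?_⟩
  have l1 : L₀ ≤ L := ((le_max_left _ _).trans (le_max_left _ _)).trans hL
  have l2 : Lm ≤ L := ((le_max_right _ _).trans (le_max_left _ _)).trans hL
  have l3 : 2 ≤ L := (le_max_right _ _).trans hL
  have hKα : K₁ * α ≤ 1 / 2 := (mul_le_mul_of_nonneg_left hα hK₁.le).trans a3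
  have hode' := hode C A hmod α L T (hα.trans a1) l1 u hu hnb
  choose! A' hA' using hode'
  have hexp := Real.exp_pos (-(ν * (L + σ * t) / 16))
  have hbase : 0 ≤ (1 / 2 * (ν / 8 * Real.exp (ν / 16 + ν / 8 * R)) * D + 1)
      * Real.exp (-(ν * (L + σ * t) / 16)) := by positivity
  have hgap : ∀ (k : ℕ) (hk : k + 1 < N),
      L - 1 + σ * t ≤ A (u t) ⟨k + 1, hk⟩ - A (u t) ⟨k, by omega⟩ := by
    intro k hk
    have h0 : (0 : ℝ) ∈ Icc 0 T := ⟨le_rfl, ht.1.trans ht.2⟩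
    obtain ⟨as, has, hua⟩ := hnb 0 h0
    obtain ⟨-, -, b3, -⟩ := hmod.params_mem ((hα.trans a1).trans hα₀₁) (hL₀.trans l1) has hua
    have c1 := abs_le.1 (b3 ⟨k, by omega⟩)
    have c2 := abs_le.1 (b3 ⟨k + 1, hk⟩)
    have c3 := has ⟨k, by omega⟩ ⟨k + 1, hk⟩ rfl
    have c4 := le_of_hasDerivWithinAt_ge (σ := σ)
      (f := fun s => A (u s) ⟨k + 1, hk⟩ - A (u s) ⟨k, by omega⟩)
      (f' := fun s => A' s ⟨k + 1, hk⟩ - A' s ⟨k, by omega⟩)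
      (fun s hs => (hA' s hs _).1.sub (hA' s hs _).1) (fun s hs => by
        have e1 := abs_le.1 (hA' s hs ⟨k + 1, hk⟩).2
        have e2 := abs_le.1 (hA' s hs ⟨k, by omega⟩).2
        have e3 := hgapσ ⟨k, by omega⟩ ⟨k + 1, hk⟩ rfl
        linarith) ht
    beta_reduce at c4
    linarith
  have main : ∀ (k : ℕ) (hk : k + 1 < N), ∃ q : ℝ,
      HasDerivWithinAt (fun s => locMomentum cs (A (u s)) (k + 1) (u s)) q (Icc 0 T) t ∧
      q ≤ (1 / 2 * (ν / 8 * Real.exp (ν / 16 + ν / 8 * R)) * D + 1)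
        * Real.exp (-(ν * (L + σ * t) / 16)) := by
    intro k hk
    have hy : HasDerivWithinAt (fun s => (A (u s) ⟨k, by omega⟩ + A (u s) ⟨k + 1, hk⟩) / 2)
        ((A' t ⟨k, by omega⟩ + A' t ⟨k + 1, hk⟩) / 2) (Icc 0 T) t :=
      ((hA' t ht _).1.add (hA' t ht _).1).div_const 2
    have hder := (hu.hasDerivWithinAt_moving (show 0 < ν / 16 by positivity) ht hy).const_mul (1 / 2)
    refine ⟨_, hder.congr_of_eventuallyEq (.of_forall fun s => ?_) ?_, ?_⟩
    · beta_reduce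
      rw [locMomentum_eq, cutoff_of_lt cs _ hk, ← hνe]
    · rw [locMomentum_eq, cutoff_of_lt cs _ hk, ← hνe]
    obtain ⟨as, has, hua⟩ := hnb t ht
    obtain ⟨-, -, b3, -⟩ := hmod.params_mem ((hα.trans a1).trans hα₀₁) (hL₀.trans l1) has hua
    have hunorm : ‖u t‖ ≤ M + α₄ := by
      have := norm_add_le (u t - chain cs as) (chain cs as)
      rw [sub_add_cancel] at this
      linarith [hMchain as]
    have hμu : ∀ x, 1 - m ≤ 1 - etaC (u t) x := fun x => by
      have := hle (u t) (nbhd_mono cs (hα.trans a2) l2 (hnb t ht)) x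
      linarith
    have hc : ((A' t ⟨k, by omega⟩ + A' t ⟨k + 1, hk⟩) / 2) ^ 2 ≤ 2 - ν ^ 2 / 2 := by
      have e1 := hsq _ _ (hA' t ht ⟨k, by omega⟩).2
      have e2 := hsq _ _ (hA' t ht ⟨k + 1, hk⟩).2
      nlinarith [sq_nonneg (A' t ⟨k, by omega⟩ - A' t ⟨k + 1, hk⟩)]
    have hrate := momRate_kink_le hν hν2 hμ hμu hc (hsmall L as (A (u t)) (u t) l3 has
      (fun j => (b3 j).trans (by linarith)) (hua.le.trans (hα.trans a4)) k hk)
    have hDu : (4 * ‖u t‖ + 2) * ((1 + ((2 * (1 - m))⁻¹) ^ 2) * ‖u t‖ ^ 2) ≤ D := by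
      simp only [D]
      gcongr
    have hexp2 : Real.exp (-(ν / 8 * ((A (u t) ⟨k + 1, hk⟩ - A (u t) ⟨k, by omega⟩) / 2 - R)))
        ≤ Real.exp (ν / 16 + ν / 8 * R) * Real.exp (-(ν * (L + σ * t) / 16)) := by
      rw [← Real.exp_add, Real.exp_le_exp]
      have := mul_le_mul_of_nonneg_left (hgap k hk) hν.le
      linarith
    have h1 := mul_le_mul_of_nonneg_left hexp2 (show 0 ≤ ν / 8 by positivity)
    have h2 := mul_le_mul h1 hDu (by positivity) (by positivity)
    linarith
  have hzero : HasDerivWithinAt (fun s => locMomentum cs (A (u s)) 0 (u s)) 0 (Icc 0 T) t := by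
    have w : Weight2 (fun _ => 1) (fun _ => 0) fun _ => 0 :=
      ⟨weight_one, ⟨fun x => hasDerivAt_const x 0, continuous_const, ⟨0, by simp⟩, ⟨0, by simp⟩⟩,
        MemLp.zero', MemLp.zero'⟩
    have h := (hu.hasDerivWithinAt_mom w ht).const_mul (1 / 2)
    have e : 1 / 2 * momRate (fun _ => 0) (fun _ => 0) (u t) = 0 := by simp [momRate]
    rw [e] at h
    exact h.congr_of_eventuallyEq (.of_forall fun s => locMomentum_eq _ _ _ _)
      (locMomentum_eq _ _ _ _)
  have hlast : ∀ k, N ≤ k →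
      HasDerivWithinAt (fun s => locMomentum cs (A (u s)) k (u s)) 0 (Icc 0 T) t := by
    intro k hk
    have e : (fun s => locMomentum cs (A (u s)) k (u s)) = fun _ => 0 := by
      funext s
      rw [locMomentum, cutoff_of_ge cs _ (by omega) hk]
      simp
    rw [e]
    exact hasDerivWithinAt_const t _ 0
  have hall : ∀ k : ℕ, ∃ q : ℝ, ((k = 0 ∨ k = N) → q = 0) ∧
      HasDerivWithinAt (fun s => locMomentum cs (A (u s)) k (u s)) q (Icc 0 T) t ∧
      q ≤ (1 / 2 * (ν / 8 * Real.exp (ν / 16 + ν / 8 * R)) * D + 1)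
        * Real.exp (-(ν * (L + σ * t) / 16)) := by
    intro k
    obtain _ | k := k
    · exact ⟨0, fun _ => rfl, hzero, hbase⟩
    · rcases lt_or_ge (k + 1) N with h | h
      · obtain ⟨q, h1, h2⟩ := main k h
        exact ⟨q, fun h' => by omega, h1, h2⟩
      · exact ⟨0, fun _ => rfl, hlast _ h, hbase⟩
  choose q hq0 hq using hall
  exact ⟨q, hq0 0 (.inl rfl), hq0 N (.inr rfl), hq⟩

end

end GPChain

end

theorem proposition5 (N : ℕ) (hN : 1 ≤ N) (cs : Fin N → ℝ) (hcs : cs ∈ GPChain.Adm N)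
    (hord : StrictMono cs) :
    ∃ α₁ L₁ K₁ : ℝ, 0 < α₁ ∧ 0 < L₁ ∧ 0 < K₁ ∧
      GPChain.nbhd cs α₁ L₁ ⊆ GPChain.NV ∧
      (∃ C A : GPChain.XSpace → Fin N → ℝ, GPChain.IsModulation cs α₁ L₁ K₁ C A) ∧
      ∃ α₄ L₄ K : ℝ, 0 < α₄ ∧ α₄ ≤ α₁ ∧ L₁ ≤ L₄ ∧ 0 < K ∧
        ∀ C A : GPChain.XSpace → Fin N → ℝ, GPChain.IsModulation cs α₁ L₁ K₁ C A →
        ∀ α L T : ℝ, α ≤ α₄ → L₄ ≤ L → 0 < T →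
        ∀ u : ℝ → GPChain.XSpace, GPChain.IsHGPSolution T u →
          (∀ t ∈ Set.Icc 0 T, u t ∈ GPChain.nbhd cs α L) →
          ∀ t ∈ Set.Icc 0 T,
            (∀ k : Fin N, ∃ q : ℝ,
              HasDerivWithinAt (fun s => GPChain.locMomentum cs (A (u s)) k (u s)) q
                (Set.Icc 0 T) t ∧
              q ≤ K * Real.exp (-(GPChain.nuMin cs * (L + GPChain.sigmaMin cs * t) / 16))) ∧
            ∃ g : ℝ,
              HasDerivWithinAt (fun s => GPChain.functionalG cs (A (u s)) (u s)) g
                (Set.Icc 0 T) t ∧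
              g ≤ K * Real.exp (-(GPChain.nuMin cs * (L + GPChain.sigmaMin cs * t) / 16)) := by
  have : Nonempty (Fin N) := ⟨⟨0, hN⟩⟩
  obtain ⟨α₁, L₁, K₁, hα₁, hL₁, hK₁, hnv, hmod⟩ := GPChain.exists_isModulation hcs
  obtain ⟨α₄, hα₄, hα₄₁, L₄, hL₄, K, hK, h⟩ :=
    GPChain.exists_momentum_monotonicity hcs hord (L₁ := L₁) hα₁ hK₁
  have hN' : (1 : ℝ) ≤ N := by exact_mod_cast hN
  have hK3 : K ≤ 3 * N * K := by nlinarith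
  refine ⟨α₁, L₁, K₁, hα₁, hL₁, hK₁, hnv, hmod, α₄, L₄, 3 * N * K, hα₄, hα₄₁, hL₄, by positivity,
    fun C A hCA α L T hα hL _ u hu hnb t ht => ?_⟩
  obtain ⟨q, q0, qN, hq⟩ := h C A hCA α L T hα hL u hu hnb t ht
  refine ⟨fun k => ⟨q k, (hq k).1, (hq k).2.trans
    (mul_le_mul_of_nonneg_right hK3 (Real.exp_pos _).le)⟩,
    ∑ k : Fin N, cs k * (q k - q (k + 1)), ?_, ?_⟩
  · have hd := (hu.hasDerivWithinAt_energy ht).add (HasDerivWithinAt.fun_sum (u := Finset.univ)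
      fun (k : Fin N) _ => ((hq k).1.sub (hq (k + 1)).1).const_mul (cs k))
    rw [zero_add] at hd
    exact hd.congr_of_eventuallyEq
      (Filter.Eventually.of_forall fun s => GPChain.functionalG_eq hcs _ _)
      (GPChain.functionalG_eq hcs _ _)
  · rw [mul_assoc (3 * (N : ℝ))]
    exact GPChain.sum_speed_mul_sub_le hcs hord
      (mul_nonneg hK.le (Real.exp_pos _).le) q0 qN fun k => (hq k).2
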